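/- For a connected graph $G$ and a graph $H$ (finite, simple, undirected, unweighted) with $|V(G)|=|V(H)|=n$ and an integer $d\ge 1$, a bijection $F:V(G)\to V(H)$ is called a \emph{bijective non-contracting distortion-$d$ embedding} of $G$ into $H$ if $$D_G(u,v)\;\le\; D_H(F(u),F(v))\;\le\; d\cdot D_G(u,v)\qquad\text{for all }u,v\in V(G),$$ where $D_G$ and $D_H$ are the shortest-path distances (equal to $\infty$ between different components). \textbf{Theorem.} There are absolute constants $C,c\in\mathbb{N}$ and a single algorithm (a fixed program of a unit-cost random access machine with registers, indirectly addressed memory, addition, truncated subtraction and tests for zero) with the following property. Let $n\ge 1$, $d\ge 1$ and $\alpha\ge 0$ be integers, let $G$ be a connected graph and $H$ a graph, both with vertex set $\{0,\dots,n-1\}$, and suppose that $H$ has treewidth at most $\alpha$. On input $(G,H,d,\alpha)$, the graphs being given by their adjacency matrices, the algorithm halts, and it either outputs a bijective non-contracting distortion-$d$ embedding of $G$ into $H$, or correctly reports that no such embedding exists. If moreover the maximum degree $\Delta$ of $H$ is at least $1$ (that is, $H$ has an edge), it does so in at most $$C\,\alpha^{2}\,n^{\alpha+3}\cdot\Delta^{d+1}\cdot\bigl(\alpha\,\Delta^{d+1}\bigr)^{\Delta^{\,c\,\alpha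 d^{2}}}$$ steps; that is, the running time is $O(\alpha^{2}n^{\alpha+3})\cdot\Delta^{d+1}\cdot(\alpha\Delta^{d+1})^{\Delta^{O(\alpha d^{2})}}$. -/

import Mathlib

/-! ## Graph metrics and non-contracting embeddings -/

/-- `F` is a non-contracting distortion-`d` embedding of the graph metric of `G` into the graph
metric of `H`: `D_G(u,v) ≤ D_H(F u, F v) ≤ d * D_G(u,v)` for all `u, v`. The distances are the
shortest-path distances with values in `ℕ∞`, so vertices in different components are at
distance `⊤`. -/
def IsNonContractingEmbedding {V W : Type*} (G : SimpleGraph V) (H : SimpleGraph W) (d : ℕ)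
    (F : V → W) : Prop :=
  ∀ u v : V, G.edist u v ≤ H.edist (F u) (F v) ∧ H.edist (F u) (F v) ≤ (d : ℕ∞) * G.edist u v

/-! ## Tree decompositions and treewidth -/

/-- A tree decomposition of `G`, indexed by the nodes of a finite tree. -/
structure TreeDecomposition {V : Type*} (G : SimpleGraph V) where
  node : Type
  nodeFintype : Fintype node
  tree : SimpleGraph node
  isTree : tree.IsTree
  bag : node → Finset V
  cover : ∀ x : V, ∃ u : node, x ∈ bag u
  edge_cover : ∀ x y : V, G.Adj x y → ∃ u : node, x ∈ bag u ∧ y ∈ bag u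
  path_closed : ∀ (u v w : node) (p : tree.Walk u v), p.IsPath → w ∈ p.support →
    ∀ x : V, x ∈ bag u → x ∈ bag v → x ∈ bag w

/-- The width of a tree decomposition: the size of the largest bag, minus one
(and `0` if all bags are empty, which happens only for the graph without vertices). -/
def TreeDecomposition.width {V : Type*} {G : SimpleGraph V} (T : TreeDecomposition G) : ℕ :=
  (@Finset.univ T.node T.nodeFintype).sup (fun u => (T.bag u).card) - 1

/-- The treewidth: the minimum of the widths of all tree decompositions. -/
noncomputable def treewidth {V : Type*} (G : SimpleGraph V) : ℕ :=
  sInf {k : ℕ | ∃ T : TreeDecomposition G, T.width = k}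

/-- A finite graph has a tree decomposition, so that `treewidth` is a minimum over a nonempty
set. -/
theorem treeDecomposition_nonempty {V : Type*} [Fintype V] (G : SimpleGraph V) :
    Nonempty (TreeDecomposition G) :=
  ⟨{ node := Unit
     nodeFintype := inferInstance
     tree := ⊥
     isTree := SimpleGraph.IsTree.of_subsingleton
     bag := fun _ => Finset.univ
     cover := fun _ => ⟨(), Finset.mem_univ _⟩
     edge_cover := fun _ _ _ => ⟨(), Finset.mem_univ _, Finset.mem_univ _⟩
     path_closed := fun _ _ _ _ _ _ _ _ _ => Finset.mem_univ _ }⟩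

/-! ## Random access machines with unit cost

The machine has registers `0, 1, 2, …` (a program mentions only finitely many of them) and a
memory of cells `0, 1, 2, …` that is accessed by indirect addressing; both hold natural numbers.
The only arithmetic operations are addition and (truncated) subtraction. A program is a finite
piece of syntax that does not depend on the input. -/

/-- The contents of the registers and of the memory. -/
structure RAMState where
  reg : ℕ → ℕ
  mem : ℕ → ℕ

/-- Overwrite register `i`. -/
def RAMState.setReg (s : RAMState) (i v : ℕ) : RAMState :=
  ⟨Function.update s.reg i v, s.mem⟩

/-- Overwrite memory cell `a`. -/
def RAMState.setMem (s : RAMState) (a v : ℕ) : RAMState :=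
  ⟨s.reg, Function.update s.mem a v⟩

/-- Programs of the machine. Register names and constants are fixed numbers in the program. -/
inductive RAMProg : Type
  /-- `r_i := c` -/
  | const (i c : ℕ)
  /-- `r_i := r_j + r_k` -/
  | add (i j k : ℕ)
  /-- `r_i := r_j - r_k`, which is `0` if `r_j < r_k` -/
  | sub (i j k : ℕ)
  /-- `r_i := mem[r_j]` -/
  | load (i j : ℕ)
  /-- `mem[r_i] := r_j` -/
  | store (i j : ℕ)
  /-- first `p`, then `q` -/
  | seq (p q : RAMProg)
  /-- if `r_i > 0` then `p` else `q` -/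
  | branch (i : ℕ) (p q : RAMProg)
  /-- while `r_i > 0` do `p` -/
  | loop (i : ℕ) (p : RAMProg)

/-- `RAMExec p s s' t`: the program `p`, started in state `s`, halts in state `s'` after exactly
`t` steps. Every elementary instruction and every evaluation of a test counts as one step. -/
inductive RAMExec : RAMProg → RAMState → RAMState → ℕ → Prop
  | const (i c : ℕ) (s : RAMState) : RAMExec (.const i c) s (s.setReg i c) 1
  | add (i j k : ℕ) (s : RAMState) :
      RAMExec (.add i j k) s (s.setReg i (s.reg j + s.reg k)) 1
  | sub (i j k : ℕ) (s : RAMState) :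
      RAMExec (.sub i j k) s (s.setReg i (s.reg j - s.reg k)) 1
  | load (i j : ℕ) (s : RAMState) : RAMExec (.load i j) s (s.setReg i (s.mem (s.reg j))) 1
  | store (i j : ℕ) (s : RAMState) : RAMExec (.store i j) s (s.setMem (s.reg i) (s.reg j)) 1
  | seq {p q : RAMProg} {s s' s'' : RAMState} {t t' : ℕ} :
      RAMExec p s s' t → RAMExec q s' s'' t' → RAMExec (.seq p q) s s'' (t + t')
  | branch_pos {i : ℕ} {p q : RAMProg} {s s' : RAMState} {t : ℕ} :
      0 < s.reg i → RAMExec p s s' t → RAMExec (.branch i p q) s s' (t + 1)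
  | branch_zero {i : ℕ} {p q : RAMProg} {s s' : RAMState} {t : ℕ} :
      s.reg i = 0 → RAMExec q s s' t → RAMExec (.branch i p q) s s' (t + 1)
  | loop_pos {i : ℕ} {p : RAMProg} {s s' s'' : RAMState} {t t' : ℕ} :
      0 < s.reg i → RAMExec p s s' t → RAMExec (.loop i p) s' s'' t' →
        RAMExec (.loop i p) s s'' (t + t' + 1)
  | loop_zero {i : ℕ} {p : RAMProg} {s : RAMState} :
      s.reg i = 0 → RAMExec (.loop i p) s s 1

/-! ## Input and output of the embedding problem -/

/-- The adjacency matrix of a graph on `{0, …, n-1}` as a function of natural numbers, with value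
`0` outside the matrix. -/
def adjEntry {n : ℕ} (G : SimpleGraph (Fin n)) [DecidableRel G.Adj] (i j : ℕ) : ℕ :=
  if h : i < n ∧ j < n then (if G.Adj ⟨i, h.1⟩ ⟨j, h.2⟩ then 1 else 0) else 0

/-- The initial state on input `(G, H, d, α)`, for graphs `G`, `H` on `{0, …, n-1}`.
Registers `0, 1, 2` hold `n`, `d`, `α`, and the others hold `0`. The memory holds the two adjacency
matrices row by row: cell `n * i + j` holds the `(i, j)` entry for `G`, and cell
`n * n + (n * i + j)` holds the `(i, j)` entry for `H`; all later cells hold `0`. -/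
def embeddingInput {n : ℕ} (G H : SimpleGraph (Fin n)) [DecidableRel G.Adj] [DecidableRel H.Adj]
    (d α : ℕ) : RAMState where
  reg := fun r => if r = 0 then n else if r = 1 then d else if r = 2 then α else 0
  mem := fun a =>
    if a < n * n then adjEntry G (a / n) (a % n) else adjEntry H ((a - n * n) / n) (a % n)

/-- The final state `s` answers the instance `(G, H, d)` of the bijective problem correctly:
either register `0` holds `1` and cells `0, …, n-1` of the memory hold the values of a bijective
non-contracting distortion-`d` embedding of `G` into `H`, or register `0` holds `0` and no such
embedding exists. -/
def IsCorrectAnswer {n : ℕ} (G H : SimpleGraph (Fin n)) (d : ℕ) (s : RAMState) : Prop :=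
  (s.reg 0 = 1 ∧ ∃ F : Fin n → Fin n, Function.Bijective F ∧ IsNonContractingEmbedding G H d F ∧
      ∀ i : Fin n, s.mem (i : ℕ) = (F i : ℕ)) ∨
  (s.reg 0 = 0 ∧ ¬ ∃ F : Fin n → Fin n, Function.Bijective F ∧ IsNonContractingEmbedding G H d F)

/-! An embedding F is handled through its inverse φ from V(H) to V(G). Non-contraction says that φ
maps edges of H to edges of G. The upper bound need only be checked on edges of G, where it says
that every neighbor of φ x is the image of a vertex within distance d of x in H. This is `LocalOk`,
a condition at x that depends only on φ on the d-ball around x. Bijectivity comes for free: the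
image of φ is closed under adjacency in the connected graph G, so φ is onto, and hence one-to-one
because both graphs have n vertices. `embedding_of_localOk` and `localOk_of_embedding` give this
equivalence. What remains is a constraint problem of bounded range on H, solved by dynamic
programming over small separators.

Separators. A region is a connected vertex set of H whose boundary lies in one bag of a tree
decomposition. By `exists_bag_meets` some bag contains the boundary of a region C together with a
vertex v of C, so the boundary has at most α vertices and the components of C \ {v} are regions
again (`IsRegion.split`). The algorithm never computes a tree decomposition. It tries all α-tuples
of vertices as boundaries and tabulates splitting vertices for sets of growing size (`splits_spec`);
regions serve only to prove that every entry that is needed gets filled. Following the table from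
the whole graph, the vertices are removed one by one, each from a component of what is left
(`order_spec`).

Dynamic programming. The interface of such a component C is the restriction of φ to the d-ball
around the boundary of C. A walk of length at most d that enters or leaves C meets the boundary of
C, so solutions for the components of C \ {v} that agree with one assignment near their boundaries
combine with it to a solution for C, provided the assignment is correct at v (`localOk_glue`). The
sets are processed in reverse order of removal. For each, all assignments on the d-ball around the
bag formed by v and the boundary of C are tried, and a solution is stored for each interface that is
found to be solvable (`enumerate_spec`, `record_spec`, `witnesses_spec`).

Number of assignments. The at most α + 1 vertices of the bag have n possible values each. Since φ
maps walks to walks, the value at any other vertex lies in the d-ball of G around the value at a bag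
vertex. Let M be the size of the largest d-ball of H, so M ≤ (Δ+1)^d. An embedding forces all
degrees of G below M (`count_lt_of_localOk`). The program tests this first, and then d-balls of G
have at most M^d elements. So there are at most n^(α+1) (M^d)^((α+1)M) assignments
(`prod_radix_le`). Each is handled in time O(n(Δ+1)), and there are n sets; this gives the exponent
α + 3 of n. `mainCost_le` turns the sum into the stated form. It needs Δ ≥ 2, which holds for
connected H with at least three vertices. If H is disconnected there is no embedding, and for at
most two vertices the identity is one.

Machine. The algorithm is written in a small language with a cost semantics, and `compCmd_spec`
shows that compilation preserves cost up to the factor 60. Sets and partial assignments are used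
directly as memory addresses through an injective numbering (`code_inj`, `witKey_inj`), so that a
table lookup is a single access. -/

set_option linter.constructorNameAsVariable false

/-! ## A small language with scoped variables, arrays and bounded loops -/

/-- Variable names. The first three hold the input parameters. -/
inductive Var
  | n | d | al | x | y | z | k | i | e | v | w | r | p | u | j | m | gm | q | key | key2
  | bx | bq | bk | bw | ip | t
deriving DecidableEq

/-- Array names. -/
inductive Arr
  | row | hd | hn | mk | qu | ln | s1 | s2 | t1 | t2 | eh | eg | gbl | wt | pw | pw2 | rx | cnt
  | dg | ca | gd | cc | fl | vt | cm | xx | bx | bg | an | chf | chc | chm | xd | chb | ph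
  | kt | res | out
deriving DecidableEq

/-- The bound 40 fixes the layout of the machine. Variables live in registers below 40, register 40
holds the base address of the arrays, and temporaries start at 41. The same number for arrays makes
40 a valid stride for interleaving them. -/
theorem Var.ctorIdx_lt (x : Var) : x.ctorIdx < 40 := by cases x <;> decide

theorem Arr.ctorIdx_lt (k : Arr) : k.ctorIdx < 40 := by cases k <;> decide

theorem Var.ctorIdx_inj {x y : Var} (h : x.ctorIdx = y.ctorIdx) : x = y := by
  revert h; cases x <;> cases y <;> simp [Var.ctorIdx]

theorem Arr.ctorIdx_inj {x y : Arr} (h : x.ctorIdx = y.ctorIdx) : x = y := by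
  revert h; cases x <;> cases y <;> simp [Arr.ctorIdx]

/-- Values of the variables. -/
abbrev Env := Var → ℕ

/-- Contents of the arrays. -/
abbrev Store := Arr → ℕ → ℕ

/-- Overwrite one entry of one array. -/
def Store.set (s : Store) (k : Arr) (a v : ℕ) : Store :=
  Function.update s k (Function.update (s k) a v)

/-- Bounded sums and maxima are expressions, so that counting, searching and existential tests need
no auxiliary arrays. There is no multiplication, as the machine has none; the products that are
needed are formed by repeated addition or kept in tables such as `row`. -/
inductive Expr
  | const (c : ℕ)
  | var (x : Var)
  | add (a b : Expr)
  | sub (a b : Expr)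
  | get (k : Arr) (a : Expr)
  | inp (a : Expr)
  | ite (c a b : Expr)
  | sum (y : Var) (N a : Expr)
  | sup (y : Var) (N a : Expr)

/-- The value of an expression, where `I` is the input memory. -/
def Expr.eval (I : ℕ → ℕ) : Expr → Env → Store → ℕ
  | .const c, _, _ => c
  | .var x, env, _ => env x
  | .add a b, env, s => a.eval I env s + b.eval I env s
  | .sub a b, env, s => a.eval I env s - b.eval I env s
  | .get k a, env, s => s k (a.eval I env s)
  | .inp a, env, s => I (a.eval I env s)
  | .ite c a b, env, s => if 0 < c.eval I env s then a.eval I env s else b.eval I env s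
  | .sum y N a, env, s =>
      ∑ i ∈ Finset.range (N.eval I env s), a.eval I (Function.update env y i) s
  | .sup y N a, env, s =>
      (Finset.range (N.eval I env s)).sup fun i => a.eval I (Function.update env y i) s

/-- The cost of evaluating an expression. -/
def Expr.cost (I : ℕ → ℕ) : Expr → Env → Store → ℕ
  | .const _, _, _ => 1
  | .var _, _, _ => 1
  | .add a b, env, s => 1 + a.cost I env s + b.cost I env s
  | .sub a b, env, s => 1 + a.cost I env s + b.cost I env s
  | .get _ a, env, s => 1 + a.cost I env s
  | .inp a, env, s => 1 + a.cost I env s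
  | .ite c a b, env, s =>
      1 + c.cost I env s + if 0 < c.eval I env s then a.cost I env s else b.cost I env s
  | .sum y N a, env, s => 1 + N.cost I env s +
      ∑ i ∈ Finset.range (N.eval I env s), (1 + a.cost I (Function.update env y i) s)
  | .sup y N a, env, s => 1 + N.cost I env s +
      ∑ i ∈ Finset.range (N.eval I env s), (1 + a.cost I (Function.update env y i) s)

/-- The number of rounds of a loop is evaluated once, before the first round. Hence effect and cost
are total functions defined by structural recursion, and termination needs no separate argument. -/
inductive Cmd
  | skip
  | set (k : Arr) (a b : Expr)
  | seq (c c' : Cmd)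
  | ite (b : Expr) (c c' : Cmd)
  | loop (x : Var) (N : Expr) (c : Cmd)
  | letE (x : Var) (a : Expr) (c : Cmd)

/-- Iterate an indexed step. -/
def iter {σ : Type*} (f : ℕ → σ → σ) : ℕ → σ → σ
  | 0, s => s
  | m + 1, s => f m (iter f m s)

/-- The effect of a command. -/
def Cmd.run (I : ℕ → ℕ) : Cmd → Env → Store → Store
  | .skip, _, s => s
  | .set k a b, env, s => s.set k (a.eval I env s) (b.eval I env s)
  | .seq c c', env, s => c'.run I env (c.run I env s)
  | .ite b c c', env, s => if 0 < b.eval I env s then c.run I env s else c'.run I env s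
  | .loop x N c, env, s =>
      iter (fun i s' => c.run I (Function.update env x i) s') (N.eval I env s) s
  | .letE x a c, env, s => c.run I (Function.update env x (a.eval I env s)) s

/-- The cost of a command. -/
def Cmd.cost (I : ℕ → ℕ) : Cmd → Env → Store → ℕ
  | .skip, _, _ => 1
  | .set _ a b, env, s => 1 + a.cost I env s + b.cost I env s
  | .seq c c', env, s => c.cost I env s + c'.cost I env (c.run I env s)
  | .ite b c c', env, s =>
      1 + b.cost I env s + if 0 < b.eval I env s then c.cost I env s else c'.cost I env s
  | .loop x N c, env, s => 1 + N.cost I env s +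
      ∑ i ∈ Finset.range (N.eval I env s), (1 + c.cost I (Function.update env x i)
        (iter (fun i s' => c.run I (Function.update env x i) s') i s))
  | .letE x a c, env, s =>
      1 + a.cost I env s + c.cost I (Function.update env x (a.eval I env s)) s

/-! ## Compilation to the random access machine -/

@[simp] theorem RAMState.setReg_reg (s : RAMState) (i v r : ℕ) :
    (s.setReg i v).reg r = if r = i then v else s.reg r := by
  simp [RAMState.setReg, Function.update_apply]

@[simp] theorem RAMState.setReg_mem (s : RAMState) (i v : ℕ) : (s.setReg i v).mem = s.mem := rfl

@[simp] theorem RAMState.setMem_reg (s : RAMState) (i v : ℕ) : (s.setMem i v).reg = s.reg := rfl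

@[simp] theorem RAMState.setMem_mem (s : RAMState) (i v a : ℕ) :
    (s.setMem i v).mem a = if a = i then v else s.mem a := by
  simp [RAMState.setMem, Function.update_apply]

/-- `p` started in `s` halts in `s'` within `T` steps. -/
def RAMWithin (p : RAMProg) (s s' : RAMState) (T : ℕ) : Prop := ∃ t ≤ T, RAMExec p s s' t

namespace RAMWithin

theorem mono {p s s' T T'} (h : RAMWithin p s s' T) (hT : T ≤ T') : RAMWithin p s s' T' := by
  obtain ⟨t, ht, h⟩ := h
  exact ⟨t, ht.trans hT, h⟩

theorem mono' {p s s' s'' T} (h : RAMWithin p s s' T) (hs : s' = s'') : RAMWithin p s s'' T :=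
  hs ▸ h

theorem const (i c s) : RAMWithin (.const i c) s (s.setReg i c) 1 := ⟨1, le_rfl, .const ..⟩

theorem add (i j k s) : RAMWithin (.add i j k) s (s.setReg i (s.reg j + s.reg k)) 1 :=
  ⟨1, le_rfl, .add ..⟩

theorem sub (i j k s) : RAMWithin (.sub i j k) s (s.setReg i (s.reg j - s.reg k)) 1 :=
  ⟨1, le_rfl, .sub ..⟩

theorem load (i j s) : RAMWithin (.load i j) s (s.setReg i (s.mem (s.reg j))) 1 :=
  ⟨1, le_rfl, .load ..⟩

theorem store (i j s) : RAMWithin (.store i j) s (s.setMem (s.reg i) (s.reg j)) 1 :=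
  ⟨1, le_rfl, .store ..⟩

theorem seq {p q s s' s'' T T'} (h : RAMWithin p s s' T) (h' : RAMWithin q s' s'' T') :
    RAMWithin (.seq p q) s s'' (T + T') := by
  obtain ⟨t, ht, h⟩ := h
  obtain ⟨t', ht', h'⟩ := h'
  exact ⟨t + t', by omega, .seq h h'⟩

theorem assoc {p q r s s' s'' T T'} (h : RAMWithin (.seq p q) s s' T)
    (h' : RAMWithin r s' s'' T') : RAMWithin (.seq p (.seq q r)) s s'' (T + T') := by
  obtain ⟨t, ht, h⟩ := h
  obtain ⟨t', ht', h'⟩ := h'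
  cases h with
  | seq h1 h2 => exact ⟨_, by omega, .seq h1 (.seq h2 h')⟩

theorem branch_pos {i p q s s' T} (hi : 0 < s.reg i) (h : RAMWithin p s s' T) :
    RAMWithin (.branch i p q) s s' (T + 1) := by
  obtain ⟨t, ht, h⟩ := h
  exact ⟨t + 1, by omega, .branch_pos hi h⟩

theorem branch_zero {i p q s s' T} (hi : s.reg i = 0) (h : RAMWithin q s s' T) :
    RAMWithin (.branch i p q) s s' (T + 1) := by
  obtain ⟨t, ht, h⟩ := h
  exact ⟨t + 1, by omega, .branch_zero hi h⟩

theorem loop_zero {i p s} (hi : s.reg i = 0) : RAMWithin (.loop i p) s s 1 :=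
  ⟨1, le_rfl, .loop_zero hi⟩

theorem loop_pos {i p s s' s'' T T'} (hi : 0 < s.reg i) (h : RAMWithin p s s' T)
    (h' : RAMWithin (.loop i p) s' s'' T') : RAMWithin (.loop i p) s s'' (T + T' + 1) := by
  obtain ⟨t, ht, h⟩ := h
  obtain ⟨t', ht', h'⟩ := h'
  exact ⟨t + t' + 1, by omega, .loop_pos hi h h'⟩

end RAMWithin

/-- The register with the address of the first array cell; registers above it hold temporaries. -/
def baseReg : ℕ := 40

/-- Add register `τ` to register `τ + 1`, `m` times. -/
def repAdd (τ : ℕ) : ℕ → RAMProg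
  | 0 => .const (τ + 2) 0
  | m + 1 => .seq (.add (τ + 1) (τ + 1) τ) (repAdd τ m)

/-- Put the address of entry `reg τ` of array `k` into register `τ + 1`. -/
def compAddr (τ : ℕ) (k : Arr) : RAMProg :=
  .seq (.const (τ + 1) k.ctorIdx) (.seq (.add (τ + 1) (τ + 1) baseReg) (repAdd τ 40))

/-- Run `body`, which updates the accumulator `τ`, while variable `x` runs below register
`τ + 1`. -/
def compAgg (τ : ℕ) (x : Var) (body : RAMProg) : RAMProg :=
  -- Register τ accumulates, τ + 1 counts the remaining rounds, τ + 2 is the index of the round, τ +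
  -- 3 saves the outer value of the loop variable, τ + 4 holds the constant 1, and the body may use
  -- everything from τ + 5 on.
  .seq (.const τ 0) <| .seq (.const (τ + 2) 0) <|
  .seq (.const (τ + 4) 1) <| .seq (.add (τ + 3) x.ctorIdx (τ + 2)) <|
  .seq (.loop (τ + 1) <|
    .seq (.const (τ + 5) 0) <| .seq (.add x.ctorIdx (τ + 2) (τ + 5)) <| .seq body <|
    .seq (.add (τ + 2) (τ + 2) (τ + 4)) (.sub (τ + 1) (τ + 1) (τ + 4))) <|
  .seq (.const (τ + 5) 0) (.add x.ctorIdx (τ + 3) (τ + 5))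

/-- Code that puts the value of an expression into register `τ`. -/
def compExpr : ℕ → Expr → RAMProg
  | τ, .const c => .const τ c
  | τ, .var x => .seq (.const τ 0) (.add τ x.ctorIdx τ)
  | τ, .add a b => .seq (compExpr τ a) (.seq (compExpr (τ + 1) b) (.add τ τ (τ + 1)))
  | τ, .sub a b => .seq (compExpr τ a) (.seq (compExpr (τ + 1) b) (.sub τ τ (τ + 1)))
  | τ, .get k a => .seq (compExpr τ a) (.seq (compAddr τ k) (.load τ (τ + 1)))
  -- Cells from the base address on belong to the arrays, so an input address has to be tested;
  -- beyond the input the value is 0, as it was in the initial memory.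
  | τ, .inp a => .seq (compExpr τ a) (.seq (.sub (τ + 1) baseReg τ)
      (.branch (τ + 1) (.load τ τ) (.const τ 0)))
  | τ, .ite c a b => .seq (compExpr τ c) (.branch τ (compExpr τ a) (compExpr τ b))
  | τ, .sum x N a => .seq (compExpr (τ + 1) N) <|
      compAgg τ x (.seq (compExpr (τ + 5) a) (.seq (.const (τ + 6) 0) (.add τ τ (τ + 5))))
  -- With truncated subtraction, accumulator + (value - accumulator) is the maximum of the two.
  | τ, .sup x N a => .seq (compExpr (τ + 1) N) <|
      compAgg τ x (.seq (compExpr (τ + 5) a) (.seq (.sub (τ + 5) (τ + 5) τ) (.add τ τ (τ + 5))))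

/-- Code for a command, with temporaries from register `τ` on. -/
def compCmd : ℕ → Cmd → RAMProg
  | τ, .skip => .const τ 0
  | τ, .set k a b => .seq (compExpr τ a) (.seq (compAddr τ k)
      (.seq (compExpr (τ + 2) b) (.store (τ + 1) (τ + 2))))
  | τ, .seq c c' => .seq (compCmd τ c) (compCmd τ c')
  | τ, .ite b c c' => .seq (compExpr τ b) (.branch τ (compCmd τ c) (compCmd τ c'))
  | τ, .loop x N c => .seq (compExpr (τ + 1) N) <|
      compAgg τ x (.seq (compCmd (τ + 5) c) (.const (τ + 5) 0))
  | τ, .letE x a c => .seq (compExpr τ a) <| .seq (.const (τ + 1) 0) <|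
      .seq (.add (τ + 1) x.ctorIdx (τ + 1)) <| .seq (.const (τ + 2) 0) <|
      .seq (.add x.ctorIdx τ (τ + 2)) <| .seq (compCmd (τ + 2) c) <|
      .seq (.const τ 0) (.add x.ctorIdx (τ + 1) τ)

/-- The machine state `rs` represents the variables `env` and the arrays `s`. -/
structure Represents (I : ℕ → ℕ) (B : ℕ) (env : Env) (s : Store) (rs : RAMState) : Prop where
  var : ∀ x : Var, rs.reg x.ctorIdx = env x
  base : rs.reg baseReg = B
  input : ∀ a < B, rs.mem a = I a
  arr : ∀ (k : Arr) (a : ℕ), rs.mem (B + k.ctorIdx + 40 * a) = s k a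

theorem Represents.of_agree {I B env s rs rs'} (h : Represents I B env s rs)
    (hr : ∀ r < 41, rs'.reg r = rs.reg r) (hm : rs'.mem = rs.mem) : Represents I B env s rs' where
  var x := by rw [hr _ (x.ctorIdx_lt.trans (by norm_num))]; exact h.var x
  base := by rw [hr _ (by simp [baseReg])]; exact h.base
  input := by rw [hm]; exact h.input
  arr := by rw [hm]; exact h.arr

/-! ### Correctness and cost of compiled code. -/

theorem repAdd_spec (τ m : ℕ) (rs : RAMState) :
    ∃ rs', RAMWithin (repAdd τ m) rs rs' (m + 1) ∧ rs'.reg (τ + 1) = rs.reg (τ + 1) + m * rs.reg τ ∧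
      (∀ r ≤ τ, rs'.reg r = rs.reg r) ∧ rs'.mem = rs.mem := by
  induction m generalizing rs with
  | zero => exact ⟨_, .const .., by simp, fun r hr => by simp; omega, rfl⟩
  | succ m ih =>
    obtain ⟨rs', h1, h2, h3, h4⟩ := ih (rs.setReg (τ + 1) (rs.reg (τ + 1) + rs.reg τ))
    refine ⟨rs', ((RAMWithin.add ..).seq h1).mono (by omega), ?_, fun r hr => ?_, by simp [h4]⟩
    · rw [h2]; simp; ring
    · rw [h3 r hr]; simp; omega

theorem compAddr_spec (τ : ℕ) (hτ : 41 ≤ τ) (k : Arr) (rs : RAMState) :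
    ∃ rs', RAMWithin (compAddr τ k) rs rs' 43 ∧
      rs'.reg (τ + 1) = rs.reg baseReg + k.ctorIdx + 40 * rs.reg τ ∧
      (∀ r ≤ τ, rs'.reg r = rs.reg r) ∧ rs'.mem = rs.mem := by
  obtain ⟨rs', h1, h2, h3, h4⟩ := repAdd_spec τ 40
    ((rs.setReg (τ + 1) k.ctorIdx).setReg (τ + 1) (k.ctorIdx + rs.reg baseReg))
  have hb : baseReg ≠ τ + 1 := by simp [baseReg]; omega
  refine ⟨rs', ((RAMWithin.const ..).seq (((RAMWithin.add ..).seq (T' := 41) ?_))).mono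
    (by norm_num), ?_, fun r hr => ?_, by simp [h4]⟩
  · simpa [hb] using h1
  · rw [h2]; simp; ring
  · rw [h3 r hr]; simp; split_ifs <;> omega

theorem Represents.setReg {I B env s rs} (h : Represents I B env s rs) {r : ℕ} (hr : 41 ≤ r)
    (v : ℕ) : Represents I B env s (rs.setReg r v) :=
  h.of_agree (fun r' hr' => by simp; omega) rfl

theorem Represents.setVar {I B env s rs} (h : Represents I B env s rs) (x : Var) (v : ℕ) :
    Represents I B (Function.update env x v) s (rs.setReg x.ctorIdx v) where
  var y := by
    by_cases hy : y = x
    · subst hy; simp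
    · have : y.ctorIdx ≠ x.ctorIdx := fun h => hy (Var.ctorIdx_inj h)
      simp [hy, this, h.var]
  base := by
    have := x.ctorIdx_lt
    have h2 := h.base
    simp only [baseReg] at *
    rw [RAMState.setReg_reg, if_neg (by omega), h2]
  input := h.input
  arr := h.arr

/-- Array numbers are below the stride 40, so the offset of a cell from the base determines array
and entry by its residue and quotient. A write therefore disturbs no other entry, and no input cell,
since those lie below the base. -/
theorem Represents.setMem {I B env s rs} (h : Represents I B env s rs) (k : Arr) (a v : ℕ) :
    Represents I B env (s.set k a v) (rs.setMem (B + k.ctorIdx + 40 * a) v) where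
  var := h.var
  base := h.base
  input a ha := by rw [RAMState.setMem_mem, if_neg (by omega)]; exact h.input a ha
  arr k' a' := by
    have h1 := k.ctorIdx_lt
    have h2 := k'.ctorIdx_lt
    rw [RAMState.setMem_mem, h.arr, Store.set]
    by_cases hk : k' = k
    · subst hk
      by_cases ha : a' = a
      · subst ha; simp
      · rw [if_neg (by omega)]; simp [ha]
    · have : k'.ctorIdx ≠ k.ctorIdx := fun h => hk (Arr.ctorIdx_inj h)
      rw [if_neg (by omega)]; simp [hk]

/-- The effect of the loop on accumulator and arrays, when round `i` acts by `f i`. -/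
theorem compAgg_spec {I : ℕ → ℕ} {B : ℕ} {env : Env} {τ : ℕ} (hτ : 41 ≤ τ) (x : Var)
    (body : RAMProg) (f : ℕ → ℕ × Store → ℕ × Store) (T : ℕ → ℕ) (N : ℕ) (s : Store)
    (rs : RAMState) (hrep : Represents I B env s rs) (hN : rs.reg (τ + 1) = N)
    (hstep : ∀ i < N, ∀ rs1 : RAMState,
      Represents I B (Function.update env x i) (iter f i (0, s)).2 rs1 →
      rs1.reg τ = (iter f i (0, s)).1 →
      ∃ rs2, RAMWithin body rs1 rs2 (T i) ∧
        Represents I B (Function.update env x i) (iter f (i + 1) (0, s)).2 rs2 ∧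
        rs2.reg τ = (iter f (i + 1) (0, s)).1 ∧
        (∀ r < τ + 5, r ≠ τ → rs2.reg r = rs1.reg r)) :
    ∃ rs', RAMWithin (compAgg τ x body) rs rs' (7 + ∑ i ∈ Finset.range N, (T i + 5)) ∧
      Represents I B env (iter f N (0, s)).2 rs' ∧ rs'.reg τ = (iter f N (0, s)).1 ∧
      (∀ r < τ, rs'.reg r = rs.reg r) := by
  have hx := x.ctorIdx_lt
  -- Induction on the number m of remaining rounds. Between rounds the register of the loop variable
  -- holds some value v that does not matter; the saved value is restored at the end.
  have key : ∀ m i (rs1 : RAMState) (v : ℕ), i + m = N → rs1.reg (τ + 1) = m →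
      rs1.reg (τ + 2) = i → rs1.reg (τ + 4) = 1 → rs1.reg τ = (iter f i (0, s)).1 →
      Represents I B (Function.update env x v) (iter f i (0, s)).2 rs1 →
      ∃ rs2, RAMWithin (.loop (τ + 1) <|
          .seq (.const (τ + 5) 0) <| .seq (.add x.ctorIdx (τ + 2) (τ + 5)) <| .seq body <|
          .seq (.add (τ + 2) (τ + 2) (τ + 4)) (.sub (τ + 1) (τ + 1) (τ + 4))) rs1 rs2
          (1 + ∑ j ∈ Finset.range m, (T (i + j) + 5)) ∧
        rs2.reg τ = (iter f N (0, s)).1 ∧ rs2.reg (τ + 3) = rs1.reg (τ + 3) ∧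
        (∃ v, Represents I B (Function.update env x v) (iter f N (0, s)).2 rs2) ∧
        (∀ r < τ, r ≠ x.ctorIdx → rs2.reg r = rs1.reg r) := by
    intro m
    induction m with
    | zero =>
      intro i rs1 v hi h1 h2 h4 h0 hr
      obtain rfl : i = N := by omega
      exact ⟨rs1, by simpa using RAMWithin.loop_zero h1, h0, rfl, ⟨v, hr⟩, fun _ _ _ => rfl⟩
    | succ m ih =>
      intro i rs1 v hi h1 h2 h4 h0 hr
      have hrA := (hr.setReg (r := τ + 5) (by omega) 0).setVar x i
      rw [Function.update_idem] at hrA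
      set rsA := (rs1.setReg (τ + 5) 0).setReg x.ctorIdx i with hA
      have eA : ∀ r, r ≠ τ + 5 → r ≠ x.ctorIdx → rsA.reg r = rs1.reg r := by
        intro r hr1 hr2; simp [hA, hr1, hr2]
      obtain ⟨rsB, hB1, hB2, hB3, hB4⟩ := hstep i (by omega) rsA hrA
        (by rw [eA _ (by omega) (by omega), h0])
      set rsC := (rsB.setReg (τ + 2) (i + 1)).setReg (τ + 1) m with hC
      have hrC : Represents I B (Function.update env x i) (iter f (i + 1) (0, s)).2 rsC :=
        (hB2.setReg (by omega) _).setReg (by omega) _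
      have eC : ∀ r, r < τ + 5 → r ≠ τ → r ≠ τ + 1 → r ≠ τ + 2 → r ≠ x.ctorIdx →
          rsC.reg r = rs1.reg r := by
        intro r q1 q2 q3 q4 q5
        simp only [hC, RAMState.setReg_reg, if_neg q3, if_neg q4]
        rw [hB4 r q1 q2, eA _ (by omega) q5]
      obtain ⟨rs2, g1, g2, g3, g4, g5⟩ := ih (i + 1) rsC i (by omega) (by simp [hC])
        (by simp [hC]) (by rw [eC _ (by omega) (by omega) (by omega) (by omega) (by omega), h4])
        (by simp only [hC, RAMState.setReg_reg]; rw [if_neg (by omega), if_neg (by omega), hB3])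
        hrC
      refine ⟨rs2, ?_, g2, ?_, g4, fun r hr1 hr2 => ?_⟩
      · have e1 : rsB.reg (τ + 2) + rsB.reg (τ + 4) = i + 1 := by
          rw [hB4 _ (by omega) (by omega), hB4 _ (by omega) (by omega),
            eA _ (by omega) (by omega), eA _ (by omega) (by omega), h2, h4]
        have e2 : (rsB.setReg (τ + 2) (i + 1)).reg (τ + 1) -
            (rsB.setReg (τ + 2) (i + 1)).reg (τ + 4) = m := by
          simp only [RAMState.setReg_reg]
          rw [if_neg (by omega), if_neg (by omega), hB4 _ (by omega) (by omega),
            hB4 _ (by omega) (by omega), eA _ (by omega) (by omega),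
            eA _ (by omega) (by omega), h1, h4]
          omega
        have wA : RAMWithin (.add x.ctorIdx (τ + 2) (τ + 5)) (rs1.setReg (τ + 5) 0) rsA 1 := by
          have := RAMWithin.add x.ctorIdx (τ + 2) (τ + 5) (rs1.setReg (τ + 5) 0)
          simpa [h2, hA] using this
        have wC : RAMWithin (.seq (.add (τ + 2) (τ + 2) (τ + 4)) (.sub (τ + 1) (τ + 1) (τ + 4)))
            rsB rsC 2 := by
          refine (RAMWithin.seq (RAMWithin.add ..) (RAMWithin.sub ..)).mono' ?_ |>.mono le_rfl
          rw [e1, e2]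
        rw [Finset.sum_range_succ']
        refine (RAMWithin.loop_pos (by omega) ((RAMWithin.const ..).seq (wA.seq (hB1.seq wC)))
          g1).mono ?_
        have : ∀ j, T (i + 1 + j) = T (i + (j + 1)) := fun j => by congr 1; omega
        simp only [this]
        simp; omega
      · rw [g3, eC _ (by omega) (by omega) (by omega) (by omega) (by omega)]
      · rw [g5 r hr1 hr2, eC _ (by omega) (by omega) (by omega) (by omega) hr2]
  set rsA := (((rs.setReg τ 0).setReg (τ + 2) 0).setReg (τ + 4) 1).setReg (τ + 3) (env x) with hA
  have hrA : Represents I B (Function.update env x (env x)) (iter f 0 (0, s)).2 rsA := by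
    rw [Function.update_eq_self]
    exact (((hrep.setReg (by omega) _).setReg (by omega) _).setReg (by omega) _).setReg
      (by omega) _
  obtain ⟨rs2, g1, g2, g3, ⟨v, g4⟩, g5⟩ := key N 0 rsA (env x) (by omega) (by simp [hA, hN])
    (by simp [hA]) (by simp [hA]) (by simp [hA, iter]) hrA
  have g3' : rs2.reg (τ + 3) = env x := by rw [g3]; simp [hA]
  have hfin := (g4.setReg (r := τ + 5) (by omega) 0).setVar x (env x)
  rw [Function.update_idem, Function.update_eq_self] at hfin
  refine ⟨_, ?_, hfin, ?_, fun r hr => ?_⟩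
  · have w1 : RAMWithin (.add (τ + 3) x.ctorIdx (τ + 2))
        (((rs.setReg τ 0).setReg (τ + 2) 0).setReg (τ + 4) 1) rsA 1 := by
      refine (RAMWithin.add ..).mono' ?_
      have h := hrep.var x
      simp only [RAMState.setReg_reg]
      rw [if_neg (by omega), if_neg (by omega), if_neg (by omega), h, hA]; simp
    have w2 : RAMWithin (.add x.ctorIdx (τ + 3) (τ + 5)) (rs2.setReg (τ + 5) 0)
        ((rs2.setReg (τ + 5) 0).setReg x.ctorIdx (env x)) 1 := by
      refine (RAMWithin.add ..).mono' ?_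
      simp [g3']
    refine ((RAMWithin.const ..).seq ((RAMWithin.const ..).seq ((RAMWithin.const ..).seq
      (w1.seq (g1.seq ((RAMWithin.const ..).seq w2)))))).mono ?_
    simp; omega
  · simp only [RAMState.setReg_reg]
    rw [if_neg (by omega), if_neg (by omega), g2]
  · by_cases hrx : r = x.ctorIdx
    · subst hrx; simp [hrep.var]
    · simp only [RAMState.setReg_reg]
      rw [if_neg hrx, if_neg (by omega), g5 r hr hrx]
      simp only [hA, RAMState.setReg_reg]
      rw [if_neg (by omega), if_neg (by omega), if_neg (by omega), if_neg (by omega)]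

/-- The factor 60 covers the dearest single construct, an array access with its 43 steps of address
computation, as well as the set-up and bookkeeping of loops. Registers below τ are preserved, so
that operands evaluated earlier survive. -/
theorem compExpr_spec {I : ℕ → ℕ} {B : ℕ} (hI : ∀ a, B ≤ a → I a = 0) (e : Expr) :
    ∀ {τ : ℕ} (_ : 41 ≤ τ) {env : Env} {s : Store} {rs : RAMState}
      (_ : Represents I B env s rs),
      ∃ rs', RAMWithin (compExpr τ e) rs rs' (60 * e.cost I env s) ∧
        Represents I B env s rs' ∧ rs'.reg τ = e.eval I env s ∧
        (∀ r < τ, rs'.reg r = rs.reg r) := by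
  induction e with
  | const c =>
    intro τ hτ env s rs h
    exact ⟨_, (RAMWithin.const ..).mono (by simp [Expr.cost]), h.setReg hτ _, by simp [Expr.eval],
      fun r hr => by simp; omega⟩
  | var x =>
    intro τ hτ env s rs h
    have hx := x.ctorIdx_lt
    refine ⟨_, ((RAMWithin.const ..).seq (RAMWithin.add ..)).mono (by simp [Expr.cost]),
      (h.setReg hτ _).setReg hτ _, ?_, fun r hr => ?_⟩
    · simp [Expr.eval, show x.ctorIdx ≠ τ by omega, h.var]
    · simp only [RAMState.setReg_reg]
      rw [if_neg (by omega), if_neg (by omega)]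
  | add a b iha ihb =>
    intro τ hτ env s rs h
    obtain ⟨r1, a1, a2, a3, a4⟩ := iha hτ h
    obtain ⟨r2, b1, b2, b3, b4⟩ := ihb (τ := τ + 1) (by omega) a2
    refine ⟨_, (a1.seq (b1.seq (RAMWithin.add ..))).mono (by simp [Expr.cost]; omega),
      b2.setReg hτ _, ?_, fun r hr => ?_⟩
    · simp [Expr.eval, b3, b4, a3]
    · simp only [RAMState.setReg_reg]
      rw [if_neg (by omega), b4 _ (by omega), a4 _ hr]
  | sub a b iha ihb =>
    intro τ hτ env s rs h
    obtain ⟨r1, a1, a2, a3, a4⟩ := iha hτ h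
    obtain ⟨r2, b1, b2, b3, b4⟩ := ihb (τ := τ + 1) (by omega) a2
    refine ⟨_, (a1.seq (b1.seq (RAMWithin.sub ..))).mono (by simp [Expr.cost]; omega),
      b2.setReg hτ _, ?_, fun r hr => ?_⟩
    · simp [Expr.eval, b3, b4, a3]
    · simp only [RAMState.setReg_reg]
      rw [if_neg (by omega), b4 _ (by omega), a4 _ hr]
  | get k a iha =>
    intro τ hτ env s rs h
    obtain ⟨r1, a1, a2, a3, a4⟩ := iha hτ h
    obtain ⟨r2, b1, b2, b3, b4⟩ := compAddr_spec τ hτ k r1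
    have hr2 : Represents I B env s r2 := a2.of_agree (fun r hr => b3 r (by omega)) b4
    refine ⟨_, (a1.seq (b1.seq (RAMWithin.load ..))).mono (by simp [Expr.cost]; omega),
      hr2.setReg hτ _, ?_, fun r hr => ?_⟩
    · simp [Expr.eval, b2, a2.base, a3, hr2.arr]
    · simp only [RAMState.setReg_reg]
      rw [if_neg (by omega), b3 _ (by omega), a4 _ hr]
  | inp a iha =>
    intro τ hτ env s rs h
    obtain ⟨r1, a1, a2, a3, a4⟩ := iha hτ h
    have hb : baseReg < 41 := by simp [baseReg]
    have hs := RAMWithin.sub (τ + 1) baseReg τ r1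
    have hr2 := a2.setReg (r := τ + 1) (by omega) (r1.reg baseReg - r1.reg τ)
    by_cases hlt : a.eval I env s < B
    · refine ⟨_, (a1.seq (hs.seq (RAMWithin.branch_pos ?_ (RAMWithin.load ..)))).mono
        (by simp [Expr.cost]; omega), hr2.setReg hτ _, ?_, fun r hr => ?_⟩
      · simp [a2.base, a3]; omega
      · simp [Expr.eval, a3, a2.input _ hlt]
      · simp only [RAMState.setReg_reg]
        rw [if_neg (by omega), if_neg (by omega), a4 _ hr]
    · refine ⟨_, (a1.seq (hs.seq (RAMWithin.branch_zero ?_ (RAMWithin.const ..)))).mono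
        (by simp [Expr.cost]; omega), hr2.setReg hτ _, ?_, fun r hr => ?_⟩
      · simp [a2.base, a3]; omega
      · simp [Expr.eval, hI _ (not_lt.mp hlt)]
      · simp only [RAMState.setReg_reg]
        rw [if_neg (by omega), if_neg (by omega), a4 _ hr]
  | ite c a b ihc iha ihb =>
    intro τ hτ env s rs h
    obtain ⟨r1, a1, a2, a3, a4⟩ := ihc hτ h
    by_cases hc : 0 < c.eval I env s
    · obtain ⟨r2, b1, b2, b3, b4⟩ := iha hτ a2
      refine ⟨r2, (a1.seq (RAMWithin.branch_pos (by omega) b1)).mono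
        (by simp [Expr.cost, hc]; omega), b2, by simp [Expr.eval, hc, b3], fun r hr => ?_⟩
      rw [b4 _ hr, a4 _ hr]
    · obtain ⟨r2, b1, b2, b3, b4⟩ := ihb hτ a2
      refine ⟨r2, (a1.seq (RAMWithin.branch_zero (by omega) b1)).mono
        (by simp [Expr.cost, hc]; omega), b2, by simp [Expr.eval, hc, b3], fun r hr => ?_⟩
      rw [b4 _ hr, a4 _ hr]
  | sum x N a ihN iha =>
    intro τ hτ env s rs h
    obtain ⟨r1, a1, a2, a3, a4⟩ := ihN (τ := τ + 1) (by omega) h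
    have hit : ∀ i, iter (fun i (p : ℕ × Store) =>
        (p.1 + a.eval I (Function.update env x i) s, p.2)) i (0, s) =
        (∑ j ∈ Finset.range i, a.eval I (Function.update env x j) s, s) := by
      intro i
      induction i with
      | zero => rfl
      | succ i ih => simp [iter, ih, Finset.sum_range_succ]
    obtain ⟨r2, b1, b2, b3, b4⟩ := compAgg_spec hτ x
      (.seq (compExpr (τ + 5) a) (.seq (.const (τ + 6) 0) (.add τ τ (τ + 5))))
      (fun i p => (p.1 + a.eval I (Function.update env x i) s, p.2))
      (fun i => 60 * a.cost I (Function.update env x i) s + 2) _ s r1 a2 a3 (by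
        intro i hi q hq hq0
        rw [hit] at hq hq0
        rw [hit, Finset.sum_range_succ]
        obtain ⟨q1, c1, c2, c3, c4⟩ := iha (τ := τ + 5) (by omega) hq
        refine ⟨_, c1.seq ((RAMWithin.const ..).seq (RAMWithin.add ..)),
          (c2.setReg (by omega) _).setReg hτ _, ?_, fun r hr hr' => ?_⟩
        · simp [c3, c4, hq0]
        · simp only [RAMState.setReg_reg]
          rw [if_neg hr', if_neg (by omega), c4 _ hr])
    rw [hit] at b2 b3
    refine ⟨r2, (a1.seq b1).mono ?_, b2, by simp [Expr.eval, b3], fun r hr => ?_⟩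
    · simp only [Expr.cost, mul_add, Finset.mul_sum]
      have : ∀ i ∈ Finset.range (N.eval I env s),
        60 * a.cost I (Function.update env x i) s + 2 + 5 ≤
          60 * 1 + 60 * a.cost I (Function.update env x i) s := fun i _ => by omega
      have := Finset.sum_le_sum this
      omega
    · rw [b4 _ hr, a4 _ (by omega)]
  | sup x N a ihN iha =>
    intro τ hτ env s rs h
    obtain ⟨r1, a1, a2, a3, a4⟩ := ihN (τ := τ + 1) (by omega) h
    have hit : ∀ i, iter (fun i (p : ℕ × Store) =>
        (p.1 + (a.eval I (Function.update env x i) s - p.1), p.2)) i (0, s) =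
        ((Finset.range i).sup fun j => a.eval I (Function.update env x j) s, s) := by
      intro i
      induction i with
      | zero => rfl
      | succ i ih =>
        simp only [iter, ih, Finset.range_add_one, Finset.sup_insert, Prod.mk.injEq, and_true]
        generalize ((Finset.range i).sup fun j => a.eval I (Function.update env x j) s) = b
        change b + (a.eval I (Function.update env x i) s - b) =
          max (a.eval I (Function.update env x i) s) b
        omega
    obtain ⟨r2, b1, b2, b3, b4⟩ := compAgg_spec hτ x
      (.seq (compExpr (τ + 5) a) (.seq (.sub (τ + 5) (τ + 5) τ) (.add τ τ (τ + 5))))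
      (fun i p => (p.1 + (a.eval I (Function.update env x i) s - p.1), p.2))
      (fun i => 60 * a.cost I (Function.update env x i) s + 2) _ s r1 a2 a3 (by
        intro i hi q hq hq0
        obtain ⟨q1, c1, c2, c3, c4⟩ := iha (τ := τ + 5) (by omega) hq
        rw [iter]
        rw [hit] at c1 c2 c3 hq0 ⊢
        refine ⟨_, c1.seq ((RAMWithin.sub ..).seq (RAMWithin.add ..)),
          (c2.setReg (r := τ + 5) (by omega) _).setReg hτ _, ?_, fun r hr hr' => ?_⟩
        · simp [c3, c4, hq0]
        · simp only [RAMState.setReg_reg]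
          rw [if_neg hr', if_neg (by omega), c4 _ hr])
    rw [hit] at b2 b3
    refine ⟨r2, (a1.seq b1).mono ?_, b2, by simp [Expr.eval, b3], fun r hr => ?_⟩
    · simp only [Expr.cost, mul_add, Finset.mul_sum]
      have : ∀ i ∈ Finset.range (N.eval I env s),
        60 * a.cost I (Function.update env x i) s + 2 + 5 ≤
          60 * 1 + 60 * a.cost I (Function.update env x i) s := fun i _ => by omega
      have := Finset.sum_le_sum this
      omega
    · rw [b4 _ hr, a4 _ (by omega)]

theorem compCmd_spec {I : ℕ → ℕ} {B : ℕ} (hI : ∀ a, B ≤ a → I a = 0) (c : Cmd) :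
    ∀ {τ : ℕ} (_ : 41 ≤ τ) {env : Env} {s : Store} {rs : RAMState}
      (_ : Represents I B env s rs),
      ∃ rs', RAMWithin (compCmd τ c) rs rs' (60 * c.cost I env s) ∧
        Represents I B env (c.run I env s) rs' ∧ (∀ r < τ, rs'.reg r = rs.reg r) := by
  induction c with
  | skip =>
    intro τ hτ env s rs h
    exact ⟨_, (RAMWithin.const ..).mono (by simp [Cmd.cost]), h.setReg hτ _,
      fun r hr => by simp; omega⟩
  | set k a b =>
    intro τ hτ env s rs h
    obtain ⟨r1, a1, a2, a3, a4⟩ := compExpr_spec hI a hτ h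
    obtain ⟨r2, b1, b2, b3, b4⟩ := compAddr_spec τ hτ k r1
    have hr2 : Represents I B env s r2 := a2.of_agree (fun r hr => b3 r (by omega)) b4
    obtain ⟨r3, c1, c2, c3, c4⟩ := compExpr_spec hI b (τ := τ + 2) (by omega) hr2
    have hadr : r3.reg (τ + 1) = B + k.ctorIdx + 40 * a.eval I env s := by
      rw [c4 _ (by omega), b2, a2.base, a3]
    refine ⟨_, (a1.seq (b1.seq (c1.seq (RAMWithin.store ..)))).mono (by simp [Cmd.cost]; omega),
      ?_, fun r hr => ?_⟩
    · rw [hadr, c3]; exact c2.setMem k _ _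
    · rw [RAMState.setMem_reg, c4 _ (by omega), b3 _ (by omega), a4 _ hr]
  | seq c c' ih ih' =>
    intro τ hτ env s rs h
    obtain ⟨r1, a1, a2, a3⟩ := ih hτ h
    obtain ⟨r2, b1, b2, b3⟩ := ih' hτ a2
    exact ⟨r2, (a1.seq b1).mono (by simp [Cmd.cost]; omega), b2,
      fun r hr => by rw [b3 _ hr, a3 _ hr]⟩
  | ite b c c' ih ih' =>
    intro τ hτ env s rs h
    obtain ⟨r1, a1, a2, a3, a4⟩ := compExpr_spec hI b hτ h
    by_cases hc : 0 < b.eval I env s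
    · obtain ⟨r2, b1, b2, b4⟩ := ih hτ a2
      refine ⟨r2, (a1.seq (RAMWithin.branch_pos (by omega) b1)).mono
        (by simp [Cmd.cost, hc]; omega), by simpa [Cmd.run, hc] using b2, fun r hr => ?_⟩
      rw [b4 _ hr, a4 _ hr]
    · obtain ⟨r2, b1, b2, b4⟩ := ih' hτ a2
      refine ⟨r2, (a1.seq (RAMWithin.branch_zero (by omega) b1)).mono
        (by simp [Cmd.cost, hc]; omega), by simpa [Cmd.run, hc] using b2, fun r hr => ?_⟩
      rw [b4 _ hr, a4 _ hr]
  | loop x N c ih =>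
    intro τ hτ env s rs h
    obtain ⟨r1, a1, a2, a3, a4⟩ := compExpr_spec hI N (τ := τ + 1) (by omega) h
    set g : ℕ → Store → Store := fun i s' => c.run I (Function.update env x i) s' with hg
    have hit : ∀ i, iter (fun i (p : ℕ × Store) => (0, g i p.2)) i (0, s) = (0, iter g i s) := by
      intro i
      induction i with
      | zero => rfl
      | succ i ih => simp [iter, ih]
    obtain ⟨r2, b1, b2, b3, b4⟩ := compAgg_spec hτ x
      (.seq (compCmd (τ + 5) c) (.const (τ + 5) 0)) (fun i p => (0, g i p.2))
      (fun i => 60 * c.cost I (Function.update env x i) (iter g i s) + 1) _ s r1 a2 a3 (by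
        intro i hi q hq hq0
        rw [hit] at hq hq0
        rw [hit]
        obtain ⟨q1, c1, c2, c4⟩ := ih (τ := τ + 5) (by omega) hq
        refine ⟨_, c1.seq (RAMWithin.const ..), c2.setReg (by omega) _, ?_, fun r hr hr' => ?_⟩
        · simp [c4, hq0]
        · simp only [RAMState.setReg_reg]
          rw [if_neg (by omega), c4 _ hr])
    rw [hit] at b2
    refine ⟨r2, (a1.seq b1).mono ?_, b2, fun r hr => ?_⟩
    · simp only [Cmd.cost, ← hg, mul_add, Finset.mul_sum]
      have : ∀ i ∈ Finset.range (N.eval I env s),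
        60 * c.cost I (Function.update env x i) (iter g i s) + 1 + 5 ≤
          60 * 1 + 60 * c.cost I (Function.update env x i) (iter g i s) := fun i _ => by omega
      have := Finset.sum_le_sum this
      omega
    · rw [b4 _ hr, a4 _ (by omega)]
  | letE x a c ih =>
    intro τ hτ env s rs h
    have hx := x.ctorIdx_lt
    obtain ⟨r1, a1, a2, a3, a4⟩ := compExpr_spec hI a hτ h
    set v := a.eval I env s with hv
    set r2 := ((r1.setReg (τ + 1) (env x)).setReg (τ + 2) 0).setReg x.ctorIdx v with hr2
    have h2 : Represents I B (Function.update env x v) s r2 :=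
      ((a2.setReg (by omega) _).setReg (by omega) _).setVar x v
    obtain ⟨r3, b1, b2, b3⟩ := ih (τ := τ + 2) (by omega) h2
    have hfin := (b2.setReg (r := τ) hτ 0).setVar x (env x)
    rw [Function.update_idem, Function.update_eq_self] at hfin
    have w1 : RAMWithin (.seq (.const (τ + 1) 0) (.add (τ + 1) x.ctorIdx (τ + 1))) r1
        (r1.setReg (τ + 1) (env x)) 2 := by
      refine ((RAMWithin.const ..).seq (RAMWithin.add ..)).mono' ?_
      simp only [RAMState.setReg_reg]
      rw [if_neg (by omega), a2.var]
      simp [RAMState.setReg]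
    have w2 : RAMWithin (.seq (.const (τ + 2) 0) (.add x.ctorIdx τ (τ + 2)))
        (r1.setReg (τ + 1) (env x)) r2 2 := by
      refine ((RAMWithin.const ..).seq (RAMWithin.add ..)).mono' ?_
      simp only [RAMState.setReg_reg]
      rw [if_neg (by omega), if_neg (by omega), a3]
      simp [hr2]
    have w3 : RAMWithin (.seq (.const τ 0) (.add x.ctorIdx (τ + 1) τ)) r3
        ((r3.setReg τ 0).setReg x.ctorIdx (env x)) 2 := by
      refine ((RAMWithin.const ..).seq (RAMWithin.add ..)).mono' ?_
      have : r3.reg (τ + 1) = env x := by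
        rw [b3 _ (by omega), hr2]
        simp [show τ + 1 ≠ x.ctorIdx by omega]
      simp [this]
    refine ⟨_, (a1.seq (w1.assoc (w2.assoc (b1.seq w3)))).mono
      (by simp only [Cmd.cost, ← hv]; omega), hfin, fun r hr => ?_⟩
    by_cases hrx : r = x.ctorIdx
    · subst hrx; simp [h.var]
    · simp only [RAMState.setReg_reg]
      rw [if_neg hrx, if_neg (by omega), b3 _ (by omega), hr2]
      simp only [RAMState.setReg_reg]
      rw [if_neg hrx, if_neg (by omega), if_neg (by omega), a4 _ hr]

/-! ### Setting up the memory and delivering the output. -/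

/-- The initial values of the variables. -/
def initEnv (n d α : ℕ) : Env
  | .n => n
  | .d => d
  | .al => α
  | _ => 0

/-- Store the address of the array cells, which follow the two input matrices. -/
def prologue : RAMProg :=
  .seq (.const 40 0) <| .seq (.const 42 1) <| .seq (.const 43 0) <| .seq (.add 41 0 43) <|
  .loop 41 (.seq (.add 40 40 0) (.seq (.add 40 40 0) (.sub 41 41 42)))

theorem prologue_spec (n : ℕ) (rs : RAMState) (hn : rs.reg 0 = n) :
    ∃ rs', RAMWithin prologue rs rs' (5 + 4 * n) ∧ rs'.reg 40 = 2 * n * n ∧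
      (∀ r < 40, rs'.reg r = rs.reg r) ∧ rs'.mem = rs.mem := by
  have key : ∀ m (q : RAMState), q.reg 41 = m → q.reg 42 = 1 → q.reg 0 = n →
      ∃ q', RAMWithin (.loop 41 (.seq (.add 40 40 0) (.seq (.add 40 40 0) (.sub 41 41 42)))) q q'
          (1 + 4 * m) ∧ q'.reg 40 = q.reg 40 + 2 * n * m ∧ (∀ r < 40, q'.reg r = q.reg r) ∧
          q'.mem = q.mem := by
    intro m
    induction m with
    | zero =>
      intro q h1 h2 h3
      exact ⟨q, .loop_zero h1, by simp, fun _ _ => rfl, rfl⟩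
    | succ m ih =>
      intro q h1 h2 h3
      obtain ⟨q', a1, a2, a3, a4⟩ := ih
        ((((q.setReg 40 (q.reg 40 + n)).setReg 40 (q.reg 40 + n + n))).setReg 41 m)
        (by simp) (by simp [h2]) (by simp [h3])
      refine ⟨q', (RAMWithin.loop_pos (by omega) (((RAMWithin.add ..).seq
        ((RAMWithin.add ..).seq (RAMWithin.sub ..))).mono' ?_) a1).mono (by omega), ?_,
        fun r hr => ?_, by simp [a4]⟩
      · simp [h1, h2, h3]
      · rw [a2]; simp; ring
      · rw [a3 r hr]; simp only [RAMState.setReg_reg]; split_ifs <;> omega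
  obtain ⟨q', a1, a2, a3, a4⟩ := key n
    ((((rs.setReg 40 0).setReg 42 1).setReg 43 0).setReg 41 n) (by simp) (by simp) (by simp [hn])
  refine ⟨q', ((RAMWithin.const ..).seq ((RAMWithin.const ..).seq ((RAMWithin.const ..).seq
    (((RAMWithin.add ..).mono' ?_).seq a1)))).mono (by omega), ?_, fun r hr => ?_, by simp [a4]⟩
  · simp [hn]
  · rw [a2]; simp
  · rw [a3 r hr]; simp only [RAMState.setReg_reg]; split_ifs <;> omega

/-- Copy array `out` to the first cells of the memory and the result to register `0`. -/
def epilogue : RAMProg :=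
  .seq (.const 42 0) <| .seq (.const 43 1) <| .seq (.add 41 0 42) <|
  .seq (.loop 41 (.seq (.const 45 0) <| .seq (.add 44 42 45) <| .seq (compAddr 44 .out) <|
    .seq (.load 46 45) <| .seq (.store 42 46) <| .seq (.add 42 42 43) (.sub 41 41 43))) <|
  .seq (.const 44 0) <| .seq (compAddr 44 .res) (.load 0 45)

/-- The output overwrites input cells only: n ≤ B keeps the writes below the arrays, which are still
being read. -/
theorem epilogue_spec {B n : ℕ} (hnB : n ≤ B) (s : Store) (rs : RAMState) (hn : rs.reg 0 = n)
    (hB : rs.reg baseReg = B)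
    (harr : ∀ (k : Arr) (a : ℕ), rs.mem (B + k.ctorIdx + 40 * a) = s k a) :
    ∃ rs', RAMWithin epilogue rs rs' (60 + 60 * n) ∧ rs'.reg 0 = s .res 0 ∧
      ∀ i < n, rs'.mem i = s .out i := by
  have key : ∀ m i (q : RAMState), i + m = n → q.reg 41 = m → q.reg 42 = i → q.reg 43 = 1 →
      q.reg baseReg = B → (∀ (k : Arr) (a : ℕ), q.mem (B + k.ctorIdx + 40 * a) = s k a) →
      (∀ j < i, q.mem j = s .out j) →
      ∃ q', RAMWithin (.loop 41 (.seq (.const 45 0) <| .seq (.add 44 42 45) <|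
        .seq (compAddr 44 .out) <| .seq (.load 46 45) <| .seq (.store 42 46) <|
        .seq (.add 42 42 43) (.sub 41 41 43))) q q' (1 + 50 * m) ∧ q'.reg baseReg = B ∧
        (∀ (k : Arr) (a : ℕ), q'.mem (B + k.ctorIdx + 40 * a) = s k a) ∧
        (∀ j < n, q'.mem j = s .out j) := by
    intro m
    induction m with
    | zero =>
      intro i q hi h1 h2 h3 h4 h5 h6
      exact ⟨q, .loop_zero h1, h4, h5, fun j hj => h6 j (by omega)⟩
    | succ m ih =>
      intro i q hi h1 h2 h3 h4 h5 h6
      set qA := (q.setReg 45 0).setReg 44 i with hqA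
      obtain ⟨qB, b1, b2, b3, b4⟩ := compAddr_spec 44 (by norm_num) .out qA
      have hmB : qB.mem = q.mem := by rw [b4]; rfl
      have e45 : qB.mem (qB.reg 45) = s .out i := by
        rw [b2, hmB, ← h5]; simp [hqA, baseReg] at h4 ⊢; rw [h4]
      have eB : ∀ r ≤ 44, r ≠ 44 → qB.reg r = q.reg r := by
        intro r hr hr'
        rw [b3 r hr]; simp only [hqA, RAMState.setReg_reg]; split_ifs <;> omega
      set qC := (((qB.setReg 46 (s .out i)).setMem i (s .out i)).setReg 42 (i + 1)).setReg 41 m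
        with hqC
      have hbase : qC.reg baseReg = B := by
        have := eB baseReg (by simp [baseReg]) (by simp [baseReg])
        simp [hqC, baseReg] at this h4 ⊢; rw [this, h4]
      obtain ⟨q', a1, a2, a3, a4⟩ := ih (i + 1) qC (by omega) (by simp [hqC]) (by simp [hqC])
        (by simp [hqC, eB, h3]) hbase
        (fun k a => by
          simp only [hqC, RAMState.setReg_mem, RAMState.setMem_mem]
          rw [if_neg (by omega), hmB, h5])
        (fun j hj => by
          simp only [hqC, RAMState.setReg_mem, RAMState.setMem_mem]
          split_ifs with hji
          · rw [hji]
          · rw [hmB, h6 j (by omega)])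
      refine ⟨q', (RAMWithin.loop_pos (s' := qC) (T := 49) (by omega) ?_ a1).mono (by omega), a2,
        a3, a4⟩
      have wA : RAMWithin (.add 44 42 45) (q.setReg 45 0) qA 1 :=
        (RAMWithin.add ..).mono' (by simp [hqA, h2])
      have wL : RAMWithin (.load 46 45) qB (qB.setReg 46 (s .out i)) 1 :=
        (RAMWithin.load ..).mono' (by rw [e45])
      have wS : RAMWithin (.store 42 46) (qB.setReg 46 (s .out i))
          ((qB.setReg 46 (s .out i)).setMem i (s .out i)) 1 :=
        (RAMWithin.store ..).mono' (by simp [eB, h2])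
      have wE : RAMWithin (.seq (.add 42 42 43) (.sub 41 41 43))
          ((qB.setReg 46 (s .out i)).setMem i (s .out i)) qC 2 :=
        ((RAMWithin.add ..).seq (RAMWithin.sub ..)).mono' (by simp [hqC, eB, h1, h2, h3])
      exact ((RAMWithin.const ..).seq (wA.seq (b1.seq (wL.seq (wS.seq wE))))).mono (by norm_num)
  obtain ⟨q', a1, a2, a3, a4⟩ := key n 0
    (((rs.setReg 42 0).setReg 43 1).setReg 41 n) (by omega) (by simp) (by simp) (by simp)
    (by simp [baseReg] at hB ⊢; exact hB) (by simpa using harr) (by simp)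
  obtain ⟨qB, b1, b2, b3, b4⟩ := compAddr_spec 44 (by norm_num) .res (q'.setReg 44 0)
  have hbase : (q'.setReg 44 0).reg baseReg = B := by simp [baseReg] at a2 ⊢; exact a2
  refine ⟨_, ((RAMWithin.const ..).seq ((RAMWithin.const ..).seq
    (((RAMWithin.add ..).mono' ?_).seq (a1.seq ((RAMWithin.const ..).seq
      (b1.seq (RAMWithin.load ..))))))).mono (by omega), ?_, fun j hj => ?_⟩
  · simp [hn]
  · rw [hbase] at b2
    simp only [RAMState.setReg_reg, if_pos, b4, RAMState.setReg_mem]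
    rw [b2, ← a3]; simp
  · simp [b4, a4 j hj]

/-- The machine program of a command. -/
def compProg (c : Cmd) : RAMProg := .seq prologue (.seq (compCmd 41 c) epilogue)

theorem compProg_spec (c : Cmd) {n d α : ℕ} {rs : RAMState} (hn : 1 ≤ n)
    (hreg : rs.reg = fun r => if r = 0 then n else if r = 1 then d else if r = 2 then α else 0)
    (hmem : ∀ a, 2 * n * n ≤ a → rs.mem a = 0) :
    ∃ rs' t, RAMExec (compProg c) rs rs' t ∧
      rs'.reg 0 = c.run rs.mem (initEnv n d α) (fun _ _ => 0) .res 0 ∧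
      (∀ i < n, rs'.mem i = c.run rs.mem (initEnv n d α) (fun _ _ => 0) .out i) ∧
      t ≤ 65 + 64 * n + 60 * c.cost rs.mem (initEnv n d α) (fun _ _ => 0) := by
  obtain ⟨r1, a1, a2, a3, a4⟩ := prologue_spec n rs (by simp [hreg])
  have hrep : Represents rs.mem (2 * n * n) (initEnv n d α) (fun _ _ => 0) r1 :=
    { var := fun x => by
        rw [a3 _ x.ctorIdx_lt, hreg]; cases x <;> simp [initEnv, Var.ctorIdx]
      base := a2
      input := fun a _ => by rw [a4]
      arr := fun k a => by rw [a4, hmem _ (by omega)] }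
  obtain ⟨r2, b1, b2, b3⟩ := compCmd_spec hmem c le_rfl hrep
  obtain ⟨r3, c1, c2, c3⟩ := epilogue_spec (n := n) (by nlinarith) _ r2 (b2.var .n) b2.base b2.arr
  obtain ⟨t, ht, h⟩ := a1.seq (b1.seq c1)
  exact ⟨r3, t, h, c2, c3, by omega⟩

/-! ## Graphs on `{0, …, n-1}` as relations on natural numbers -/

/-- `h` is the adjacency relation of a graph on `{0, …, n-1}`, possibly with loops. -/
structure IsGraphOn (n : ℕ) (h : ℕ → ℕ → Prop) : Prop where
  symm : ∀ {x y}, h x y → h y x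
  lt : ∀ {x y}, h x y → x < n

theorem IsGraphOn.lt_right {n h} (H : IsGraphOn n h) {x y : ℕ} (hxy : h x y) : y < n :=
  H.lt (H.symm hxy)

/-- `Near h r x y`: there is a walk of length at most `r` from `x` to `y`. -/
def Near (h : ℕ → ℕ → Prop) : ℕ → ℕ → ℕ → Prop
  | 0, x, y => x = y
  | r + 1, x, y => Near h r x y ∨ ∃ z, Near h r x z ∧ h z y

theorem Near.mono {h : ℕ → ℕ → Prop} {r r' x y : ℕ} (hn : Near h r x y) (hr : r ≤ r') :
    Near h r' x y := by
  induction r', hr using Nat.le_induction with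
  | base => exact hn
  | succ m _ ih => exact Or.inl ih

theorem Near.refl (h : ℕ → ℕ → Prop) (r x : ℕ) : Near h r x x :=
  Near.mono (r := 0) rfl (Nat.zero_le r)

theorem Near.of_adj {h : ℕ → ℕ → Prop} {r x y : ℕ} (hr : 1 ≤ r) (hxy : h x y) : Near h r x y :=
  Near.mono (r := 1) (Or.inr ⟨x, rfl, hxy⟩) hr

theorem Near.lt {n h} (H : IsGraphOn n h) {r x y : ℕ} (hn : Near h r x y) (hx : x < n) :
    y < n := by
  cases r with
  | zero => exact hn ▸ hx
  | succ r =>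
    induction r generalizing y with
    | zero =>
      rcases hn with hn | ⟨z, _, hz⟩
      · exact hn ▸ hx
      · exact H.lt_right hz
    | succ r ih =>
      rcases hn with hn | ⟨z, _, hz⟩
      · exact ih hn
      · exact H.lt_right hz

/-- The condition at `x` for `φ` to be the inverse of an embedding: edges at `x` are mapped to
edges, and the neighbors of the image of `x` are images of vertices at distance at most `d`. -/
def LocalOk (n d : ℕ) (g h : ℕ → ℕ → Prop) (φ : ℕ → ℕ) (x : ℕ) : Prop :=
  φ x < n ∧ (∀ y, h x y → g (φ x) (φ y)) ∧ ∀ w, g (φ x) w → ∃ y, Near h d x y ∧ φ y = w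

/-- Locality: the condition at x inspects φ only on the d-ball around x. For the first half this
uses that neighbors of x lie in the ball, hence d ≥ 1. -/
theorem LocalOk.congr {n d : ℕ} {g h : ℕ → ℕ → Prop} {φ φ' : ℕ → ℕ} {x : ℕ} (hd : 1 ≤ d)
    (hφ : LocalOk n d g h φ x) (he : ∀ y, Near h d x y → φ' y = φ y) : LocalOk n d g h φ' x := by
  obtain ⟨h1, h2, h3⟩ := hφ
  have hx := he x (Near.refl h d x)
  refine ⟨hx ▸ h1, fun y hy => ?_, fun w hw => ?_⟩
  · rw [hx, he y (Near.of_adj hd hy)]; exact h2 y hy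
  · obtain ⟨y, hy, rfl⟩ := h3 w (hx ▸ hw)
    exact ⟨y, hy, he y hy⟩

open Classical in
/-- The vertices that can be reached from `x` inside `S`. -/
noncomputable def comp (h : ℕ → ℕ → Prop) (S : Finset ℕ) (x : ℕ) : Finset ℕ :=
  S.filter (Relation.ReflTransGen (fun a b => h a b ∧ b ∈ S) x)

/-- `D` is a connected component of the subgraph induced on `S`. -/
def IsComp (h : ℕ → ℕ → Prop) (S D : Finset ℕ) : Prop := ∃ x ∈ S, comp h S x = D

open Classical in
/-- The vertices outside `C` with a neighbor in `C`. -/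
noncomputable def bdry (n : ℕ) (h : ℕ → ℕ → Prop) (C : Finset ℕ) : Finset ℕ :=
  (Finset.range n).filter fun x => x ∉ C ∧ ∃ y ∈ C, h x y

open Classical in
/-- The vertices at distance at most `d` from `X`. -/
noncomputable def ball (n : ℕ) (h : ℕ → ℕ → Prop) (d : ℕ) (X : Finset ℕ) : Finset ℕ :=
  (Finset.range n).filter fun y => ∃ x ∈ X, Near h d x y

/-! ### Components, boundaries, and gluing of local solutions. -/

section Components

variable {n : ℕ} {h : ℕ → ℕ → Prop} {S C D : Finset ℕ} {x y z v : ℕ}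

theorem mem_comp : y ∈ comp h S x ↔
    y ∈ S ∧ Relation.ReflTransGen (fun a b => h a b ∧ b ∈ S) x y := by
  simp [comp]

theorem mem_bdry : x ∈ bdry n h C ↔ x < n ∧ x ∉ C ∧ ∃ y ∈ C, h x y := by
  simp [bdry]

theorem mem_ball {d : ℕ} {X : Finset ℕ} :
    y ∈ ball n h d X ↔ y < n ∧ ∃ x ∈ X, Near h d x y := by
  simp [ball]

theorem comp_subset : comp h S x ⊆ S := fun _ hy => (mem_comp.mp hy).1

theorem IsComp.subset (hD : IsComp h S D) : D ⊆ S := by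
  obtain ⟨x, -, rfl⟩ := hD
  exact comp_subset

theorem mem_comp_self (hx : x ∈ S) : x ∈ comp h S x := mem_comp.mpr ⟨hx, .refl⟩

theorem IsComp.nonempty (hD : IsComp h S D) : D.Nonempty := by
  obtain ⟨x, hx, rfl⟩ := hD
  exact ⟨x, mem_comp_self hx⟩

theorem comp_closed (hy : y ∈ comp h S x) (hyz : h y z) (hz : z ∈ S) : z ∈ comp h S x :=
  mem_comp.mpr ⟨hz, (mem_comp.mp hy).2.tail ⟨hyz, hz⟩⟩

theorem comp_subset_of_closed {T : Finset ℕ} (hx : x ∈ T)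
    (hT : ∀ a ∈ T, ∀ b ∈ S, h a b → b ∈ T) : comp h S x ⊆ T := by
  intro y hy
  have := (mem_comp.mp hy).2
  clear hy
  induction this with
  | refl => exact hx
  | tail _ hbc ih => exact hT _ ih _ hbc.2 hbc.1

theorem comp_mem_symm (H : IsGraphOn n h) (hx : x ∈ S) (hy : y ∈ comp h S x) :
    x ∈ comp h S y := by
  have := (mem_comp.mp hy).2
  clear hy
  induction this with
  | refl => exact mem_comp_self hx
  | @tail b c hab hbc ih =>
    have hb : b ∈ comp h S c := by
      have hbS : b ∈ S := by
        rcases Relation.ReflTransGen.cases_tail hab with h1 | ⟨_, _, h2⟩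
        · exact h1 ▸ hx
        · exact h2.2
      exact comp_closed (mem_comp_self hbc.2) (H.symm hbc.1) hbS
    exact mem_comp.mpr ⟨hx, (mem_comp.mp hb).2.trans (mem_comp.mp ih).2⟩

theorem comp_eq_of_mem (H : IsGraphOn n h) (hx : x ∈ S) (hy : y ∈ comp h S x) :
    comp h S y = comp h S x := by
  have hx' := comp_mem_symm H hx hy
  ext z
  exact ⟨fun hz => mem_comp.mpr ⟨(mem_comp.mp hz).1, (mem_comp.mp hy).2.trans (mem_comp.mp hz).2⟩,
    fun hz => mem_comp.mpr ⟨(mem_comp.mp hz).1, (mem_comp.mp hx').2.trans (mem_comp.mp hz).2⟩⟩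

theorem IsComp.eq_comp (H : IsGraphOn n h) (hD : IsComp h S D) (hy : y ∈ D) :
    D = comp h S y := by
  obtain ⟨x, hx, rfl⟩ := hD
  exact (comp_eq_of_mem H hx hy).symm

theorem isComp_comp (hx : x ∈ S) : IsComp h S (comp h S x) := ⟨x, hx, rfl⟩

theorem IsComp.closed (hD : IsComp h S D) (hy : y ∈ D) (hyz : h y z) (hz : z ∈ S) : z ∈ D := by
  obtain ⟨x, hx, rfl⟩ := hD
  exact comp_closed hy hyz hz

/-- A set that is closed under adjacency inside `S` and connected is a component of `S`. -/
theorem comp_eq_of_closed (hC : C ⊆ S) (hconn : comp h C x = C) (hx : x ∈ C)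
    (hcl : ∀ a ∈ C, ∀ b ∈ S, h a b → b ∈ C) : comp h S x = C := by
  apply Finset.Subset.antisymm (comp_subset_of_closed hx hcl)
  rw [← hconn]
  intro y hy
  exact mem_comp.mpr ⟨hC (mem_comp.mp hy).1,
    Relation.ReflTransGen.mono (fun a b hab => ⟨hab.1, hC hab.2⟩) _ _ (mem_comp.mp hy).2⟩

theorem comp_comp (hx : x ∈ S) : comp h (comp h S x) x = comp h S x := by
  apply Finset.Subset.antisymm comp_subset
  have : comp h S x ⊆ comp h (comp h S x) x := by
    apply comp_subset_of_closed (mem_comp_self (mem_comp_self hx))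
    intro a ha b hb hab
    exact comp_closed ha hab (comp_closed (comp_subset ha) hab hb)
  exact this

theorem IsComp.connected (H : IsGraphOn n h) (hD : IsComp h S D) (hy : y ∈ D) :
    comp h D y = D := by
  obtain rfl := hD.eq_comp H hy
  exact comp_comp (hD.subset hy)

/-- A component of a larger induced subgraph, seen inside a closed connected piece. -/
theorem isComp_mono (H : IsGraphOn n h) {S' : Finset ℕ} (hS : S' ⊆ S) (hD : IsComp h S' D)
    (hcl : ∀ a ∈ D, ∀ b ∈ S, h a b → b ∈ S') : IsComp h S D := by
  obtain ⟨x, hx⟩ := hD.nonempty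
  refine ⟨x, hS (hD.subset hx), comp_eq_of_closed (hD.subset.trans hS) (hD.connected H hx) hx ?_⟩
  intro a ha b hb hab
  exact hD.closed ha hab (hcl a ha b hb hab)

/-- A neighbor of D inside C \ {v} would belong to D. So a boundary vertex of D is v, or lies
outside C and is then a boundary vertex of C. -/
theorem bdry_comp_subset (H : IsGraphOn n h) (hD : IsComp h (C.erase v) D) :
    bdry n h D ⊆ insert v (bdry n h C) := by
  intro x hx
  obtain ⟨h1, h2, y, hy, hxy⟩ := mem_bdry.mp hx
  rw [Finset.mem_insert]
  by_contra! hcon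
  apply h2
  refine hD.closed hy (H.symm hxy) (Finset.mem_erase.mpr ⟨hcon.1, ?_⟩)
  by_contra hxC
  exact hcon.2 (mem_bdry.mpr ⟨h1, hxC, y, Finset.erase_subset _ _ (hD.subset hy), hxy⟩)

/-- A walk that enters `D` passes through its boundary. -/
theorem near_enter (H : IsGraphOn n h) {r : ℕ} (hn : Near h r x y) (hx : x ∉ D) (hy : y ∈ D) :
    ∃ b ∈ bdry n h D, Near h r b y := by
  induction r generalizing y with
  | zero => exact absurd (hn ▸ hy) hx
  | succ r ih =>
    rcases hn with hn | ⟨z, hz, hzy⟩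
    · obtain ⟨b, hb, hb'⟩ := ih hn hy
      exact ⟨b, hb, Or.inl hb'⟩
    · by_cases hzD : z ∈ D
      · obtain ⟨b, hb, hb'⟩ := ih hz hzD
        exact ⟨b, hb, Or.inr ⟨z, hb', hzy⟩⟩
      · exact ⟨z, mem_bdry.mpr ⟨H.lt hzy, hzD, y, hy, hzy⟩, Or.inr ⟨z, Near.refl h r z, hzy⟩⟩

/-- A walk that leaves `D` passes through its boundary. -/
theorem near_exit (H : IsGraphOn n h) {r : ℕ} (hn : Near h r x y) (hx : x ∈ D) (hy : y ∉ D) :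
    ∃ b ∈ bdry n h D, Near h r b y := by
  induction r generalizing y with
  | zero => exact absurd (hn ▸ hx) hy
  | succ r ih =>
    rcases hn with hn | ⟨z, hz, hzy⟩
    · obtain ⟨b, hb, hb'⟩ := ih hn hy
      exact ⟨b, hb, Or.inl hb'⟩
    · by_cases hzD : z ∈ D
      · exact ⟨y, mem_bdry.mpr ⟨H.lt_right hzy, hy, z, hzD, H.symm hzy⟩, Near.refl h _ y⟩
      · obtain ⟨b, hb, hb'⟩ := ih hz hzD
        exact ⟨b, hb, Or.inr ⟨z, hb', hzy⟩⟩

/-- Solutions for the components of `C \ {v}` that agree with `φ` near their boundaries combine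
with `φ` to a solution for `C`. -/
theorem localOk_glue {d : ℕ} {g : ℕ → ℕ → Prop} (H : IsGraphOn n h) (hd : 1 ≤ d) (hv : v ∈ C)
    {φ ψ : ℕ → ℕ} (hφ : LocalOk n d g h φ v)
    (hψ : ∀ x, x ∉ C.erase v → ψ x = φ x)
    (hsol : ∀ D, IsComp h (C.erase v) D → ∃ ω : ℕ → ℕ, (∀ x ∈ D, ψ x = ω x) ∧
      (∀ y ∈ ball n h d (bdry n h D), ω y = φ y) ∧ ∀ x ∈ D, LocalOk n d g h ω x) :
    (∀ y ∈ ball n h d (bdry n h C), ψ y = φ y) ∧ ∀ x ∈ C, LocalOk n d g h ψ x := by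
  -- A short walk into D crosses the boundary of D, so its endpoint lies in the ball on which the
  -- solution for D agrees with φ.
  have key : ∀ D, IsComp h (C.erase v) D → ∀ x y, y ∈ D → x ∉ D → Near h d x y →
      ψ y = φ y := by
    intro D hD x y hy hx hxy
    obtain ⟨ω, h1, h2, -⟩ := hsol D hD
    obtain ⟨b, hb, hby⟩ := near_enter H hxy hx hy
    rw [h1 y hy, h2 y (mem_ball.mpr ⟨hby.lt H (mem_bdry.mp hb).1, b, hb, hby⟩)]
  -- Seen from v or from outside C, the combined map cannot be told from φ within distance d. This
  -- settles both the agreement near the boundary of C and the condition at v.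
  have key2 : ∀ x y, x ∉ C.erase v → Near h d x y → ψ y = φ y := by
    intro x y hx hxy
    by_cases hy : y ∈ C.erase v
    · exact key _ (isComp_comp hy) x y (mem_comp_self hy) (fun hx' => hx (comp_subset hx')) hxy
    · exact hψ y hy
  refine ⟨fun y hy => ?_, fun x hx => ?_⟩
  · obtain ⟨-, b, hb, hby⟩ := mem_ball.mp hy
    exact key2 b y (fun hb' => (mem_bdry.mp hb).2.1 (Finset.erase_subset _ _ hb')) hby
  · by_cases hxv : x = v
    · subst hxv
      exact hφ.congr hd fun y hy => key2 x y (by simp) hy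
    · have hxe : x ∈ C.erase v := Finset.mem_erase.mpr ⟨hxv, hx⟩
      have hD := isComp_comp (h := h) hxe
      have hxD := mem_comp_self (h := h) hxe
      obtain ⟨ω, h1, h2, h3⟩ := hsol _ hD
      refine (h3 x hxD).congr hd fun y hy => ?_
      by_cases hyD : y ∈ comp h (C.erase v) x
      · exact h1 y hyD
      -- Here y lies outside the component of x. The walk leaves that component, so ω y = φ y. Also
      -- ψ y = φ y, either because y is outside C \ {v} or because the same walk enters the
      -- component of y.
      · obtain ⟨b, hb, hby⟩ := near_exit H hy hxD hyD
        rw [h2 y (mem_ball.mpr ⟨hby.lt H (mem_bdry.mp hb).1, b, hb, hby⟩)]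
        by_cases hyC : y ∈ C.erase v
        · refine key _ (isComp_comp hyC) x y (mem_comp_self hyC) (fun hx' => hyD ?_) hy
          exact comp_mem_symm H hyC hx'
        · exact hψ y hyC

end Components

/-! ## Regions of a tree decomposition -/

section TreeDecompositions

variable {ι : Type*} {T : SimpleGraph ι}

/-- Paths in a tree are unique, so the path from a to c arises from the walk via b by cutting out
detours. -/
theorem SimpleGraph.IsTree.mem_support_or (hT : T.IsTree) {a b c t : ι} {p : T.Walk a c}
    (hp : p.IsPath) {p₁ : T.Walk a b} {p₂ : T.Walk b c} (ht : t ∈ p.support) :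
    t ∈ p₁.support ∨ t ∈ p₂.support := by
  classical
  have := (hT.2.subsingleton_path a c).elim ⟨p, hp⟩ (p₁.append p₂).toPath
  have hpe : p = (p₁.append p₂).bypass := congrArg Subtype.val this
  rw [hpe] at ht
  exact SimpleGraph.Walk.mem_support_append_iff _ _ |>.mp
    (SimpleGraph.Walk.support_bypass_subset_support _ ht)

theorem SimpleGraph.IsTree.exists_isPath (hT : T.IsTree) (a b : ι) :
    ∃ p : T.Walk a b, p.IsPath := by
  classical
  obtain ⟨p⟩ := hT.1.preconnected a b
  exact ⟨p.bypass, p.bypass_isPath⟩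

variable {n : ℕ} {h : ℕ → ℕ → Prop} {bag : ι → Finset ℕ} {C : Finset ℕ}

/-- Connectedness carries over to the tree. Along a walk in C from y to z, consecutive vertices
share a bag, and each vertex fills the tree path between two of its bags. These paths together cover
the path from w to u. -/
theorem bag_meets_of_path (hT : T.IsTree)
    (hedge : ∀ x y, h x y → ∃ u, x ∈ bag u ∧ y ∈ bag u)
    (hpath : ∀ (u v w : ι) (p : T.Walk u v), p.IsPath → w ∈ p.support →
      ∀ x, x ∈ bag u → x ∈ bag v → x ∈ bag w) {y z : ℕ} (hy : y ∈ C)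
    (hz : Relation.ReflTransGen (fun a b => h a b ∧ b ∈ C) y z) :
    ∀ (w u : ι) (p : T.Walk w u), p.IsPath → y ∈ bag w → z ∈ bag u →
      ∀ t ∈ p.support, ∃ c ∈ C, c ∈ bag t := by
  induction hz with
  | refl => exact fun w u p hp h1 h2 t ht => ⟨y, hy, hpath w u t p hp ht y h1 h2⟩
  | @tail b c _ hbc ih =>
    intro w u p hp h1 h2 t ht
    obtain ⟨e, he1, he2⟩ := hedge _ _ hbc.1
    obtain ⟨p1, hp1⟩ := hT.exists_isPath w e
    obtain ⟨p2, hp2⟩ := hT.exists_isPath e u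
    rcases hT.mem_support_or hp (p₁ := p1) (p₂ := p2) ht with h3 | h3
    · exact ih w e p1 hp1 h1 he1 t h3
    · exact ⟨c, hbc.2, hpath e u t p2 hp2 h3 c he2 h2⟩

/-- Move along the tree path from a bag that contains the boundary to one that meets C, and stop at
the first bag that meets C. As long as the current bag misses C, the boundary is carried along to
the next bag. -/
theorem exists_bag_meets (hT : T.IsTree)
    (hedge : ∀ x y, h x y → ∃ u, x ∈ bag u ∧ y ∈ bag u)
    (hpath : ∀ (u v w : ι) (p : T.Walk u v), p.IsPath → w ∈ p.support →
      ∀ x, x ∈ bag u → x ∈ bag v → x ∈ bag w)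
    (hconn : ∀ x ∈ C, comp h C x = C) {u u' : ι} (p : T.Walk u u') (hp : p.IsPath)
    (hu : bdry n h C ⊆ bag u) (hu' : ∃ v ∈ C, v ∈ bag u') :
    ∃ u, bdry n h C ⊆ bag u ∧ ∃ v ∈ C, v ∈ bag u := by
  induction p with
  | nil => exact ⟨_, hu, hu'⟩
  | @cons u t u' hut q ih =>
    by_cases hm : ∃ v ∈ C, v ∈ bag u
    · exact ⟨u, hu, hm⟩
    rw [SimpleGraph.Walk.cons_isPath_iff] at hp
    refine ih hp.1 (fun x hx => ?_) hu'
    obtain ⟨-, -, y, hy, hxy⟩ := mem_bdry.mp hx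
    obtain ⟨w, hw1, hw2⟩ := hedge _ _ hxy
    obtain ⟨r, hr⟩ := hT.exists_isPath u w
    by_cases htr : t ∈ r.support
    · exact hpath u w t r hr htr x (hu hx) hw1
    -- The edge from x into C lies in a bag w on the other side of u, away from t. As C meets bags
    -- on both sides of u and is connected, it would meet the bag of u.
    · exfalso
      obtain ⟨z, hz, hzu⟩ := hu'
      obtain ⟨s, hs⟩ := hT.exists_isPath u' w
      have hcons : (SimpleGraph.Walk.cons hut.symm r).IsPath := by
        rw [SimpleGraph.Walk.cons_isPath_iff]; exact ⟨hr, htr⟩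
      have hmem : u ∈ (SimpleGraph.Walk.cons hut.symm r).support := by simp
      rcases hT.mem_support_or hcons (p₁ := q) (p₂ := s) hmem with h1 | h1
      · exact hp.2 h1
      · have hyz : y ∈ comp h C z := by rw [hconn z hz]; exact hy
        exact hm (bag_meets_of_path hT hedge hpath hz (mem_comp.mp hyz).2 u' w s hs hzu hw2 u h1)

/-- A connected set of vertices whose boundary lies in one bag. -/
structure IsRegion (n : ℕ) (h : ℕ → ℕ → Prop) (bag : ι → Finset ℕ) (C : Finset ℕ) : Prop where
  nonempty : C.Nonempty
  subset : C ⊆ Finset.range n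
  connected : ∀ x ∈ C, comp h C x = C
  exists_bag : ∃ u, bdry n h C ⊆ bag u

/-- Take a bag that contains the boundary and some v in C. As v is not in the boundary, the boundary
has at most α of the α + 1 places. The same bag contains the boundaries of all components of C \
{v}, because these gain at most v. -/
theorem IsRegion.split (H : IsGraphOn n h) (hT : T.IsTree)
    (hcover : ∀ x < n, ∃ u, x ∈ bag u)
    (hedge : ∀ x y, h x y → ∃ u, x ∈ bag u ∧ y ∈ bag u)
    (hpath : ∀ (u v w : ι) (p : T.Walk u v), p.IsPath → w ∈ p.support →
      ∀ x, x ∈ bag u → x ∈ bag v → x ∈ bag w) {α : ℕ} (hα : ∀ u, (bag u).card ≤ α + 1)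
    (hC : IsRegion n h bag C) :
    (bdry n h C).card ≤ α ∧ ∃ v ∈ C, ∀ D, IsComp h (C.erase v) D → IsRegion n h bag D := by
  have meet : ∀ C, IsRegion n h bag C → ∃ u, bdry n h C ⊆ bag u ∧ ∃ v ∈ C, v ∈ bag u := by
    intro C hC
    obtain ⟨u, hu⟩ := hC.exists_bag
    obtain ⟨v, hv⟩ := hC.nonempty
    obtain ⟨u', hu'⟩ := hcover v (Finset.mem_range.mp (hC.subset hv))
    obtain ⟨p, hp⟩ := hT.exists_isPath u u'
    exact exists_bag_meets hT hedge hpath hC.connected p hp hu ⟨v, hv, hu'⟩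
  obtain ⟨u, hu, v, hv, hvu⟩ := meet C hC
  constructor
  · have : insert v (bdry n h C) ⊆ bag u := Finset.insert_subset hvu hu
    have hc := (Finset.card_le_card this).trans (hα u)
    rw [Finset.card_insert_of_notMem fun hb => (mem_bdry.mp hb).2.1 hv] at hc
    omega
  · refine ⟨v, hv, fun D hD => ⟨hD.nonempty, ?_, fun x hx => hD.connected H hx, u, ?_⟩⟩
    · exact hD.subset.trans ((Finset.erase_subset _ _).trans hC.subset)
    · exact (bdry_comp_subset H hD).trans (Finset.insert_subset hvu hu)

end TreeDecompositions

/-! ## Embeddings as local solutions -/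

/-- The adjacency relation of a graph on `Fin n`, on natural numbers. -/
def natAdj {n : ℕ} (G : SimpleGraph (Fin n)) (x y : ℕ) : Prop :=
  ∃ (hx : x < n) (hy : y < n), G.Adj ⟨x, hx⟩ ⟨y, hy⟩

theorem natAdj_isGraphOn {n : ℕ} (G : SimpleGraph (Fin n)) : IsGraphOn n (natAdj G) where
  symm := fun ⟨hx, hy, h⟩ => ⟨hy, hx, h.symm⟩
  lt := fun ⟨hx, _, _⟩ => hx

@[simp] theorem natAdj_val {n : ℕ} (G : SimpleGraph (Fin n)) (x y : Fin n) :
    natAdj G x y ↔ G.Adj x y := by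
  simp [natAdj]

theorem near_natAdj_iff {n : ℕ} (G : SimpleGraph (Fin n)) (r : ℕ) (x y : Fin n) :
    Near (natAdj G) r x y ↔ G.edist x y ≤ r := by
  constructor
  · induction r generalizing y with
    | zero =>
      intro h
      have : x = y := Fin.ext h
      simp [this]
    | succ r ih =>
      rintro (h | ⟨z, h, hz, hy, hzy⟩)
      · exact (ih y h).trans (by exact_mod_cast Nat.le_succ r)
      · have h1 := ih ⟨z, hz⟩ h
        calc G.edist x y ≤ G.edist x ⟨z, hz⟩ + G.edist ⟨z, hz⟩ y := G.edist_triangle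
          _ ≤ r + 1 := add_le_add h1 (SimpleGraph.edist_eq_one_iff_adj.mpr hzy).le
          _ = ((r + 1 : ℕ) : ℕ∞) := by push_cast; rfl
  · intro h
    have hr : G.Reachable x y := by
      apply SimpleGraph.reachable_of_edist_ne_top
      exact ne_top_of_le_ne_top (by simp) h
    obtain ⟨p, hp⟩ := hr.exists_walk_length_eq_edist
    rw [← hp] at h
    have h' : p.length ≤ r := by exact_mod_cast h
    -- `Near` grows at its end and walks grow at their head, so the induction runs on the reversed
    -- statement.
    have key : ∀ {x y : Fin n} (p : G.Walk x y), Near (natAdj G) p.length y x := by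
      intro x y p
      induction p with
      | nil => exact Near.refl _ _ _
      | @cons a b c hab q ih => exact Or.inr ⟨b, ih, (natAdj_val G b a).mpr hab.symm⟩
    have := key p.reverse
    rw [SimpleGraph.Walk.length_reverse] at this
    exact this.mono h'

/-- The bijective non-contracting embeddings of `G` into `H` are the inverses of the maps that
satisfy the local conditions everywhere. -/
theorem embedding_of_localOk {n d : ℕ} {G H : SimpleGraph (Fin n)} (hG : G.Connected) {φ : ℕ → ℕ}
    (hφ : ∀ x < n, LocalOk n d (natAdj G) (natAdj H) φ x) :
    ∃ F : Fin n → Fin n, Function.Bijective F ∧ IsNonContractingEmbedding G H d F ∧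
      ∀ x, (hx : x < n) → F ⟨φ x, (hφ x hx).1⟩ = ⟨x, hx⟩ := by
  set f : Fin n → Fin n := fun x => ⟨φ x, (hφ x x.2).1⟩ with hf
  have hadj : ∀ x y, H.Adj x y → G.Adj (f x) (f y) := by
    intro x y hxy
    exact (natAdj_val G (f x) (f y)).mp ((hφ x x.2).2.1 y ((natAdj_val H x y).mpr hxy))
  have hnb : ∀ x w, G.Adj (f x) w → ∃ y, H.edist x y ≤ d ∧ f y = w := by
    intro x w hw
    obtain ⟨y, hy, hyw⟩ := (hφ x x.2).2.2 w ((natAdj_val G (f x) w).mpr hw)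
    have hyn := hy.lt (natAdj_isGraphOn H) x.2
    exact ⟨⟨y, hyn⟩, (near_natAdj_iff H d x ⟨y, hyn⟩).mp hy, Fin.ext hyw⟩
  have hsurj : Function.Surjective f := by
    intro w
    obtain ⟨v0⟩ := hG.nonempty
    obtain ⟨p⟩ := hG.preconnected (f v0) w
    -- The image of f is closed under adjacency in G; as G is connected, it is everything.
    have key : ∀ {a b : Fin n} (p : G.Walk a b), (∃ x, f x = a) → ∃ x, f x = b := by
      intro a b p
      induction p with
      | nil => exact id
      | cons hab _ ih =>
        rintro ⟨x, rfl⟩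
        obtain ⟨y, -, hy⟩ := hnb x _ hab
        exact ih ⟨y, hy⟩
    exact key p ⟨v0, rfl⟩
  have hbij : Function.Bijective f := Finite.surjective_iff_bijective.mp hsurj
  let e := Equiv.ofBijective f hbij
  refine ⟨e.symm, e.symm.bijective, fun u v => ⟨?_, ?_⟩, fun x hx => ?_⟩
  · by_cases htop : H.edist (e.symm u) (e.symm v) = ⊤
    · rw [htop]; exact le_top
    obtain ⟨p, hp⟩ :=
      (SimpleGraph.reachable_of_edist_ne_top htop).exists_walk_length_eq_edist
    rw [← hp]
    let F : H →g G := ⟨f, fun {a b} hab => hadj a b hab⟩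
    have h1 := G.edist_le (p.map F)
    rw [SimpleGraph.Walk.length_map] at h1
    have h2 : ∀ a, F (e.symm a) = a := fun a => e.apply_symm_apply a
    rwa [h2, h2] at h1
  · obtain ⟨p, hp⟩ := hG.exists_walk_length_eq_edist u v
    rw [← hp]
    clear hp
    induction p with
    | nil => simp
    | @cons a b c hab q ih =>
      have h1 : H.edist (e.symm a) (e.symm b) ≤ d := by
        have : G.Adj (f (e.symm a)) b := by
          rw [show f (e.symm a) = a from e.apply_symm_apply a]; exact hab
        obtain ⟨y, hy, hyb⟩ := hnb _ _ this
        rwa [show y = e.symm b from (e.symm_apply_eq.mpr hyb.symm).symm] at hy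
      calc H.edist (e.symm a) (e.symm c) ≤ H.edist (e.symm a) (e.symm b) +
            H.edist (e.symm b) (e.symm c) := H.edist_triangle
        _ ≤ d + d * q.length := add_le_add h1 ih
        _ = d * (q.length + 1 : ℕ) := by push_cast; ring
  · exact e.symm_apply_eq.mpr rfl

/-- Both inequalities are applied to adjacent pairs only. For an edge of H, non-contraction leaves
distance at most 1 in G, and distance 0 is excluded by injectivity. For an edge of G, the upper
bound places the preimage under φ within distance d. -/
theorem localOk_of_embedding {n d : ℕ} {G H : SimpleGraph (Fin n)} {F : Fin n → Fin n}
    (hF : Function.Bijective F) (hd : IsNonContractingEmbedding G H d F) :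
    ∃ φ : ℕ → ℕ, ∀ x < n, LocalOk n d (natAdj G) (natAdj H) φ x := by
  let e := Equiv.ofBijective F hF
  refine ⟨fun x => if hx : x < n then e.symm ⟨x, hx⟩ else 0, fun x hx => ⟨?_, ?_, ?_⟩⟩
  · simp [hx]
  · rintro y ⟨_, hy, hxy⟩
    simp only [hx, hy, dif_pos, natAdj_val]
    have h1 := (hd (e.symm ⟨x, hx⟩) (e.symm ⟨y, hy⟩)).1
    have h2 : ∀ a, F (e.symm a) = a := fun a => e.apply_symm_apply a
    rw [h2, h2, SimpleGraph.edist_eq_one_iff_adj.mpr hxy] at h1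
    rw [← SimpleGraph.edist_eq_one_iff_adj]
    apply le_antisymm h1
    rw [Order.one_le_iff_ne_zero, Ne, SimpleGraph.edist_eq_zero_iff]
    intro h3
    exact hxy.ne (e.symm.injective h3)
  · rintro w ⟨_, hw, hxw⟩
    refine ⟨F ⟨w, hw⟩, ?_, ?_⟩
    · have := (near_natAdj_iff H d ⟨x, hx⟩ (F ⟨w, hw⟩)).mpr ?_
      · exact this
      · have h1 := (hd (e.symm ⟨x, hx⟩) ⟨w, hw⟩).2
        have h2 : ∀ a, F (e.symm a) = a := fun a => e.apply_symm_apply a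
        rw [h2] at h1
        have h3 : G.Adj (e.symm ⟨x, hx⟩) ⟨w, hw⟩ := by simpa [hx] using hxw
        rwa [SimpleGraph.edist_eq_one_iff_adj.mpr h3, mul_one] at h1
    · have : e.symm (F ⟨w, hw⟩) = ⟨w, hw⟩ := e.symm_apply_apply _
      simp [this]

/-! ## Reasoning about commands -/

section Framework

variable {I : ℕ → ℕ} {env : Env} {s : Store}

/-- Command `c` started in `s` reaches a store with property `Q` at cost at most `b`. -/
def Reaches (I : ℕ → ℕ) (env : Env) (c : Cmd) (s : Store) (Q : Store → Prop) (b : ℕ) : Prop :=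
  Q (c.run I env s) ∧ c.cost I env s ≤ b

theorem Reaches.mono {c : Cmd} {Q Q' : Store → Prop} {b b' : ℕ} (h : Reaches I env c s Q b)
    (hQ : ∀ s', Q s' → Q' s') (hb : b ≤ b') : Reaches I env c s Q' b' :=
  ⟨hQ _ h.1, h.2.trans hb⟩

theorem Reaches.skip {Q : Store → Prop} (h : Q s) : Reaches I env .skip s Q 1 := ⟨h, le_rfl⟩

theorem Reaches.set {k : Arr} {a b : Expr} {Q : Store → Prop} {ca cb : ℕ}
    (h : Q (s.set k (a.eval I env s) (b.eval I env s)))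
    (ha : a.cost I env s ≤ ca) (hb : b.cost I env s ≤ cb) :
    Reaches I env (.set k a b) s Q (1 + ca + cb) :=
  ⟨h, by simp only [Cmd.cost]; omega⟩

theorem Reaches.seq {c c' : Cmd} {R Q : Store → Prop} {b b' : ℕ} (h : Reaches I env c s R b)
    (h' : ∀ s', R s' → Reaches I env c' s' Q b') : Reaches I env (.seq c c') s Q (b + b') :=
  ⟨(h' _ h.1).1, by have h1 := (h' _ h.1).2; have h2 := h.2; simp only [Cmd.cost]; omega⟩

theorem Reaches.ite {e : Expr} {c c' : Cmd} {Q : Store → Prop} {be b : ℕ}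
    (he : e.cost I env s ≤ be) (h : 0 < e.eval I env s → Reaches I env c s Q b)
    (h' : ¬ 0 < e.eval I env s → Reaches I env c' s Q b) :
    Reaches I env (.ite e c c') s Q (1 + be + b) := by
  by_cases hc : 0 < e.eval I env s
  · have := h hc
    exact ⟨by simpa [Cmd.run, hc] using this.1, by
      have h2 := this.2; simp only [Cmd.cost, if_pos hc]; omega⟩
  · have := h' hc
    exact ⟨by simpa only [Cmd.run, hc, if_false] using this.1, by
      have h2 := this.2; simp only [Cmd.cost, if_neg hc]; omega⟩

theorem Reaches.letE {x : Var} {a : Expr} {c : Cmd} {Q : Store → Prop} {ca b v : ℕ}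
    (hv : a.eval I env s = v) (ha : a.cost I env s ≤ ca)
    (h : Reaches I (Function.update env x v) c s Q b) :
    Reaches I env (.letE x a c) s Q (1 + ca + b) := by
  subst hv
  exact ⟨h.1, by have h2 := h.2; simp only [Cmd.cost]; omega⟩

theorem Reaches.loop {x : Var} {N : Expr} {c : Cmd} (Inv : ℕ → Store → Prop) {m cN b : ℕ}
    (hN : N.eval I env s = m) (hcN : N.cost I env s ≤ cN) (h0 : Inv 0 s)
    (h : ∀ i < m, ∀ s', Inv i s' → Reaches I (Function.update env x i) c s' (Inv (i + 1)) b) :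
    Reaches I env (.loop x N c) s (Inv m) (1 + cN + m * (1 + b)) := by
  subst hN
  set f : ℕ → Store → Store := fun i s' => c.run I (Function.update env x i) s' with hf
  have hInv : ∀ i ≤ N.eval I env s, Inv i (iter f i s) := by
    intro i
    induction i with
    | zero => exact fun _ => h0
    | succ i ih => exact fun hi => (h i (by omega) _ (ih (by omega))).1
  refine ⟨hInv _ le_rfl, ?_⟩
  simp only [Cmd.cost, ← hf]
  have : ∑ i ∈ Finset.range (N.eval I env s),
      (1 + c.cost I (Function.update env x i) (iter f i s)) ≤ N.eval I env s * (1 + b) := by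
    calc _ ≤ ∑ i ∈ Finset.range (N.eval I env s), (1 + b) := by
          refine Finset.sum_le_sum fun i hi => ?_
          have hi' := Finset.mem_range.mp hi
          have := (h i hi' _ (hInv i hi'.le)).2
          omega
      _ = _ := by simp
  omega

/-! ### Syntactic bounds for the cost -/

/-- Every loop in the expression runs up to variable `n`, which is not rebound. -/
def Expr.isPlain : Expr → Bool
  | .const _ => true
  | .var _ => true
  | .add a b => a.isPlain && b.isPlain
  | .sub a b => a.isPlain && b.isPlain
  | .get _ a => a.isPlain
  | .inp a => a.isPlain
  | .ite c a b => c.isPlain && a.isPlain && b.isPlain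
  | .sum y N a => (match N with | .var .n => true | _ => false) && y ≠ .n && a.isPlain
  | .sup y N a => (match N with | .var .n => true | _ => false) && y ≠ .n && a.isPlain

/-- The cost of a plain expression when `n = L`. -/
def Expr.bound (L : ℕ) : Expr → ℕ
  | .const _ => 1
  | .var _ => 1
  | .add a b => 1 + a.bound L + b.bound L
  | .sub a b => 1 + a.bound L + b.bound L
  | .get _ a => 1 + a.bound L
  | .inp a => 1 + a.bound L
  | .ite c a b => 1 + c.bound L + (a.bound L + b.bound L)
  | .sum _ _ a => 2 + L * (1 + a.bound L)
  | .sup _ _ a => 2 + L * (1 + a.bound L)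

theorem Expr.sum_cost_le {y : Var} {N a : Expr} {m cN b : ℕ} (hN : N.eval I env s = m)
    (hcN : N.cost I env s ≤ cN) (h : ∀ i < m, a.cost I (Function.update env y i) s ≤ b) :
    (Expr.sum y N a).cost I env s ≤ 1 + cN + m * (1 + b) := by
  subst hN
  simp only [Expr.cost]
  have : ∑ i ∈ Finset.range (N.eval I env s), (1 + a.cost I (Function.update env y i) s) ≤
      N.eval I env s * (1 + b) := by
    calc _ ≤ ∑ i ∈ Finset.range (N.eval I env s), (1 + b) := by
          refine Finset.sum_le_sum fun i hi => ?_
          have := h i (Finset.mem_range.mp hi)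
          omega
      _ = _ := by simp
  omega

/-- All loops of a plain expression have n rounds and never rebind n, so its cost is bounded
independently of the store by a polynomial in n that can be read off the syntax. -/
theorem Expr.cost_le_bound (e : Expr) (he : e.isPlain = true) (env : Env) (s : Store) :
    e.cost I env s ≤ e.bound (env .n) := by
  induction e generalizing env with
  | const => exact le_rfl
  | var => exact le_rfl
  | add a b iha ihb | sub a b iha ihb =>
    simp only [isPlain, Bool.and_eq_true] at he
    have := iha he.1 env
    have := ihb he.2 env
    simp only [cost, bound]; omega
  | get k a iha =>
    have := iha he env
    simp only [cost, bound]; omega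
  | inp a iha =>
    have := iha he env
    simp only [cost, bound]; omega
  | ite c a b ihc iha ihb =>
    simp only [isPlain, Bool.and_eq_true] at he
    have := ihc he.1.1 env
    have := iha he.1.2 env
    have := ihb he.2 env
    simp only [cost, bound]; split_ifs <;> omega
  | sum y N a ihN iha =>
    simp only [isPlain, Bool.and_eq_true, decide_eq_true_eq] at he
    obtain ⟨⟨h1, h2⟩, h3⟩ := he
    split at h1
    · refine (sum_cost_le (m := env .n) (cN := 1) rfl le_rfl (b := a.bound (env .n))
        fun i _ => ?_).trans (by simp only [bound]; omega)
      have := iha h3 (Function.update env y i)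
      rwa [Function.update_of_ne (Ne.symm h2)] at this
    · simp at h1
  | sup y N a ihN iha =>
    simp only [isPlain, Bool.and_eq_true, decide_eq_true_eq] at he
    obtain ⟨⟨h1, h2⟩, h3⟩ := he
    split at h1
    · refine (sum_cost_le (y := y) (N := .var .n) (a := a) (m := env .n) (cN := 1) rfl le_rfl
        (b := a.bound (env .n)) fun i _ => ?_).trans (by simp only [bound]; omega)
      have := iha h3 (Function.update env y i)
      rwa [Function.update_of_ne (Ne.symm h2)] at this
    · simp at h1

theorem Expr.cost_le {e : Expr} {n b : ℕ} (hn : env .n = n) (he : e.isPlain = true)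
    (hb : e.bound n ≤ b) : e.cost I env s ≤ b := by
  subst hn
  exact (e.cost_le_bound he env s).trans hb

/-! ### Independence of arrays -/

/-- The expression reads array `k`. -/
def Expr.reads (k : Arr) : Expr → Bool
  | .const _ => false
  | .var _ => false
  | .add a b => a.reads k || b.reads k
  | .sub a b => a.reads k || b.reads k
  | .get k' a => k' = k || a.reads k
  | .inp a => a.reads k
  | .ite c a b => c.reads k || (a.reads k || b.reads k)
  | .sum _ N a => N.reads k || a.reads k
  | .sup _ N a => N.reads k || a.reads k

theorem Expr.eval_congr (e : Expr) {s s' : Store} (env : Env)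
    (h : ∀ k, e.reads k = true → s' k = s k) : e.eval I env s' = e.eval I env s := by
  induction e generalizing env with
  | const => rfl
  | var => rfl
  | add a b iha ihb | sub a b iha ihb =>
    simp only [eval]
    rw [iha env fun k hk => h k (by simp [reads, hk]), ihb env fun k hk => h k (by simp [reads, hk])]
  | get k a iha =>
    simp only [eval]
    rw [iha env fun k hk => h k (by simp [reads, hk]), h k (by simp [reads])]
  | inp a iha =>
    simp only [eval]
    rw [iha env fun k hk => h k (by simp [reads, hk])]
  | ite c a b ihc iha ihb =>
    simp only [eval]
    rw [ihc env fun k hk => h k (by simp [reads, hk]), iha env fun k hk => h k (by simp [reads, hk]),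
      ihb env fun k hk => h k (by simp [reads, hk])]
  | sum y N a ihN iha =>
    simp only [eval]
    rw [ihN env fun k hk => h k (by simp [reads, hk])]
    exact Finset.sum_congr rfl fun i _ => iha _ fun k hk => h k (by simp [reads, hk])
  | sup y N a ihN iha =>
    simp only [eval]
    rw [ihN env fun k hk => h k (by simp [reads, hk])]
    exact Finset.sup_congr rfl fun i _ => iha _ fun k hk => h k (by simp [reads, hk])

theorem Store.set_of_ne {k j : Arr} (h : j ≠ k) (a v : ℕ) : s.set k a v j = s j := by
  simp [Store.set, h]

theorem Store.set_self (k : Arr) (a v b : ℕ) : s.set k a v k b = if b = a then v else s k b := by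
  simp [Store.set, Function.update_apply]

/-- Filling an array: entry `f i` of array `k` gets the value of `a`. -/
theorem Reaches.tabulate {x : Var} {N idx a : Expr} {k : Arr} {m cN ci ca : ℕ} {f : ℕ → ℕ}
    (hN : N.eval I env s = m) (hcN : N.cost I env s ≤ cN)
    (hidx : idx.reads k = false) (ha : a.reads k = false)
    (hf : ∀ i < m, idx.eval I (Function.update env x i) s = f i)
    (hinj : ∀ i < m, ∀ j < m, f i = f j → i = j)
    (hci : ∀ i < m, ∀ s, idx.cost I (Function.update env x i) s ≤ ci)
    (hca : ∀ i < m, ∀ s', (∀ j, j ≠ k → s' j = s j) →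
      a.cost I (Function.update env x i) s' ≤ ca) :
    Reaches I env (.loop x N (.set k idx a)) s
      (fun s' => (∀ j, j ≠ k → s' j = s j) ∧
        (∀ i < m, s' k (f i) = a.eval I (Function.update env x i) s) ∧
        ∀ b, (∀ i < m, f i ≠ b) → s' k b = s k b)
      (1 + cN + m * (2 + ci + ca)) := by
  refine (Reaches.loop (fun m' s' => (∀ j, j ≠ k → s' j = s j) ∧
    (∀ i < m', s' k (f i) = a.eval I (Function.update env x i) s) ∧
    ∀ b, (∀ i < m', f i ≠ b) → s' k b = s k b) (b := 1 + ci + ca) hN hcN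
    ⟨fun _ _ => rfl, by simp, fun _ _ => rfl⟩ ?_).mono (fun _ h => h) (le_of_eq (by ring))
  rintro i hi s' ⟨h1, h2, h3⟩
  -- Neither expression reads the array that is being filled, so every round evaluates them as in
  -- the initial store.
  have e1 : idx.eval I (Function.update env x i) s' = f i := by
    rw [← hf i hi]
    exact Expr.eval_congr _ _ fun j hj => h1 j (by rintro rfl; simp [hidx] at hj)
  have e2 : a.eval I (Function.update env x i) s' = a.eval I (Function.update env x i) s :=
    Expr.eval_congr _ _ fun j hj => h1 j (by rintro rfl; simp [ha] at hj)
  refine Reaches.set ?_ (hci i hi _) (hca i hi _ h1)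
  rw [e1, e2]
  refine ⟨fun j hj => by rw [Store.set_of_ne hj, h1 j hj], fun j hj => ?_, fun b hb => ?_⟩
  · rw [Store.set_self]
    split_ifs with hji
    · rw [hinj j (by omega) i hi hji]
    · have : j ≠ i := fun h => hji (by rw [h])
      exact h2 j (by omega)
  · rw [Store.set_self, if_neg (fun h => hb i (by omega) h.symm)]
    exact h3 b fun j hj => hb j (by omega)

/-- Filling the first `n` entries of an array with the values of a plain expression. -/
theorem Reaches.fill {x : Var} {a : Expr} {k : Arr} {n ca : ℕ} (hn : env .n = n) (hx : x ≠ .n)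
    (ha : a.reads k = false) (hp : a.isPlain = true) (hb : a.bound n ≤ ca) :
    Reaches I env (.loop x (.var .n) (.set k (.var x) a)) s
      (fun s' => (∀ j, j ≠ k → s' j = s j) ∧
        ∀ i < n, s' k i = a.eval I (Function.update env x i) s)
      (2 + n * (3 + ca)) := by
  refine (Reaches.tabulate (m := n) (cN := 1) (ci := 1) (ca := ca) (f := id)
    (by simpa [Expr.eval] using hn) le_rfl rfl ha
    (fun i _ => by simp [Expr.eval]) (fun i _ j _ h => h) (fun i _ s => le_rfl)
    (fun i _ s' _ => Expr.cost_le ?_ hp hb)).mono (fun s' h => ⟨h.1, h.2.1⟩) le_rfl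
  rw [Function.update_of_ne (Ne.symm hx), hn]

end Framework

/-! ### Derived expressions -/

namespace Expr

/-- Truth is positivity, and truncated subtraction provides negation and comparison. Disjunction and
existential quantification are then plain sums. -/
def not (e : Expr) : Expr := .sub (.const 1) e

def and (a b : Expr) : Expr := .ite a b (.const 0)

def or (a b : Expr) : Expr := .add a b

def lt (a b : Expr) : Expr := .sub b a

def eq (a b : Expr) : Expr := not (.add (.sub a b) (.sub b a))

variable {I : ℕ → ℕ} {env : Env} {s : Store} {a b c : Expr}

@[simp] theorem not_pos : 0 < (not a).eval I env s ↔ ¬ 0 < a.eval I env s := by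
  simp only [not, eval]; omega

@[simp] theorem and_pos :
    0 < (and a b).eval I env s ↔ 0 < a.eval I env s ∧ 0 < b.eval I env s := by
  simp only [and, eval]; split_ifs with h <;> simp [h]

@[simp] theorem or_pos :
    0 < (or a b).eval I env s ↔ 0 < a.eval I env s ∨ 0 < b.eval I env s := by
  simp only [or, eval]; omega

@[simp] theorem lt_pos : 0 < (lt a b).eval I env s ↔ a.eval I env s < b.eval I env s := by
  simp only [lt, eval]; omega

@[simp] theorem eq_pos : 0 < (eq a b).eval I env s ↔ a.eval I env s = b.eval I env s := by
  simp only [eq, not_pos, eval]; omega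

@[simp] theorem sum_pos {y : Var} {N : Expr} : 0 < (sum y N a).eval I env s ↔
    ∃ i < N.eval I env s, 0 < a.eval I (Function.update env y i) s := by
  simp [eval, Finset.sum_pos_iff]

@[simp] theorem eval_const (c : ℕ) : (const c).eval I env s = c := rfl

@[simp] theorem eval_var (x : Var) : (var x).eval I env s = env x := rfl

@[simp] theorem eval_add : (add a b).eval I env s = a.eval I env s + b.eval I env s := rfl

@[simp] theorem eval_sub : (sub a b).eval I env s = a.eval I env s - b.eval I env s := rfl

@[simp] theorem eval_get (k : Arr) : (get k a).eval I env s = s k (a.eval I env s) := rfl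

@[simp] theorem eval_inp : (inp a).eval I env s = I (a.eval I env s) := rfl

@[simp] theorem eval_ite : (ite c a b).eval I env s =
    if 0 < c.eval I env s then a.eval I env s else b.eval I env s := rfl

/-- The index of entry `(a, b)` of a square matrix. -/
def ix (a b : Expr) : Expr := .add (.get .row a) b

@[simp] theorem eval_ix : (ix a b).eval I env s = s .row (a.eval I env s) + b.eval I env s := rfl

/-- Adjacency in the first input graph. -/
def gadj (a b : Expr) : Expr := .inp (ix a b)

/-- Adjacency in the second input graph. -/
def hadj (a b : Expr) : Expr := .inp (.add (.get .row (.var .n)) (ix a b))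

end Expr

/-! ## Components by breadth-first search -/

/-- The input memory holds the adjacency matrices of `g` and `h`. -/
structure Ctx (I : ℕ → ℕ) (n : ℕ) (g h : ℕ → ℕ → Prop) : Prop where
  gG : IsGraphOn n g
  hG : IsGraphOn n h
  inpG : ∀ x < n, ∀ y < n, 0 < I (n * x + y) ↔ g x y
  inpH : ∀ x < n, ∀ y < n, 0 < I (n * n + (n * x + y)) ↔ h x y

/-- Row addresses, degrees (at most `Δ`) and adjacency lists of `h`. -/
structure AdjLists (n Δ : ℕ) (h : ℕ → ℕ → Prop) (row hd hn : ℕ → ℕ) : Prop where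
  row : ∀ x ≤ n, row x = n * x
  adj : ∀ x < n, ∀ k < hd x, h x (hn (n * x + k))
  ex : ∀ x < n, ∀ y, h x y → ∃ k < hd x, hn (n * x + k) = y
  le : ∀ x < n, hd x ≤ Δ
  le_n : ∀ x < n, hd x ≤ n

/-- Array `a` is the indicator of `S` on `{0, …, n-1}`. -/
def Ind (n : ℕ) (a : ℕ → ℕ) (S : Finset ℕ) : Prop := ∀ x < n, 0 < a x ↔ x ∈ S

open Expr in
/-- Mark the vertices reachable from `u` inside the set `S` in array `mk`. -/
def bfs (S : Arr) (u : Var) : Cmd :=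
  .seq (.loop .bx (.var .n) (.set .mk (.var .bx) (.const 0))) <|
  .seq (.set .mk (.var u) (.const 1)) <|
  .seq (.set .qu (.const 0) (.var u)) <|
  .seq (.set .ln (.const 0) (.const 1)) <|
  -- The queue grows while it is worked off, so its final length is unknown here. The loop has n
  -- rounds, the largest possible length, and rounds beyond the current end do nothing.
  .loop .bq (.var .n) <| .ite (lt (.var .bq) (.get .ln (.const 0)))
    (.loop .bk (.get .hd (.get .qu (.var .bq))) <|
      .letE .bw (.get .hn (ix (.get .qu (.var .bq)) (.var .bk))) <|
      .ite (and (.get S (.var .bw)) (not (.get .mk (.var .bw))))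
        (.seq (.set .mk (.var .bw) (.const 1)) <|
          .seq (.set .qu (.get .ln (.const 0)) (.var .bw)) <|
          .set .ln (.const 0) (.add (.get .ln (.const 0)) (.const 1)))
        .skip)
    .skip

/-- The queue `qu` of length `len` lists the marked vertices, all reachable from `u` in `S`. -/
structure BfsInv (n : ℕ) (h : ℕ → ℕ → Prop) (S : Finset ℕ) (u : ℕ) (mk qu : ℕ → ℕ)
    (len : ℕ) : Prop where
  marked : ∀ j < len, qu j < n ∧ 0 < mk (qu j)
  inj : ∀ i < len, ∀ j < len, qu i = qu j → i = j
  queued : ∀ x < n, 0 < mk x → ∃ j < len, qu j = x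
  reach : ∀ x < n, 0 < mk x → x ∈ comp h S u
  start : 0 < mk u

theorem BfsInv.push {n h S u mk qu len} (H : BfsInv n h S u mk qu len) {w : ℕ} (hw : w < n)
    (hwc : w ∈ comp h S u) (hm : ¬ 0 < mk w) :
    BfsInv n h S u (Function.update mk w 1) (Function.update qu len w) (len + 1) := by
  have hne : ∀ j < len, qu j ≠ w := fun j hj he => hm (he ▸ (H.marked j hj).2)
  refine ⟨fun j hj => ?_, fun i hi j hj hij => ?_, fun x hx hxm => ?_, fun x hx hxm => ?_, ?_⟩
  · rcases Nat.lt_succ_iff_lt_or_eq.mp hj with h1 | rfl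
    · have := H.marked j h1
      simp [h1.ne, hne j h1, this]
    · simp [hw]
  · rcases Nat.lt_succ_iff_lt_or_eq.mp hi with h1 | rfl <;>
    rcases Nat.lt_succ_iff_lt_or_eq.mp hj with h2 | rfl
    · exact H.inj i h1 j h2 (by simpa [Function.update_apply, h1.ne, h2.ne] using hij)
    · exact absurd (by simpa [Function.update_apply, h1.ne] using hij) (hne i h1)
    · exact absurd (by simpa [Function.update_apply, h2.ne] using hij.symm) (hne j h2)
    · rfl
  · by_cases hxw : x = w
    · exact ⟨len, by omega, by simp [hxw]⟩
    · obtain ⟨j, hj, rfl⟩ := H.queued x hx (by simpa [hxw] using hxm)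
      exact ⟨j, by omega, by simp [hj.ne]⟩
  · by_cases hxw : x = w
    · exact hxw ▸ hwc
    · exact H.reach x hx (by simpa [hxw] using hxm)
  · rw [Function.update_apply]; split_ifs <;> simp [H.start]

theorem BfsInv.len_le {n h S u mk qu len} (H : BfsInv n h S u mk qu len) : len ≤ n := by
  have := Finset.card_le_card_of_injOn (s := Finset.range len) (t := Finset.range n) qu
    (fun j hj => by simpa using (H.marked j (by simpa using hj)).1)
    (fun i hi j hj => H.inj i (by simpa using hi) j (by simpa using hj))
  simpa using this

/-- Once all queued vertices are processed, the marked part of S is closed under adjacency within S,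
so it contains the component of u. -/
theorem BfsInv.done {n h S u mk qu len} (H : BfsInv n h S u mk qu len)
    (hS : S ⊆ Finset.range n) (hu : u ∈ S)
    (hcl : ∀ j < len, ∀ y ∈ S, h (qu j) y → 0 < mk y) : Ind n mk (comp h S u) := by
  intro x hx
  refine ⟨H.reach x hx, fun hxc => ?_⟩
  have : comp h S u ⊆ S.filter (fun x => 0 < mk x) := by
    refine comp_subset_of_closed (by simp [hu, H.start]) fun a ha b hb hab => ?_
    obtain ⟨h1, h2⟩ := Finset.mem_filter.mp ha
    obtain ⟨j, hj, rfl⟩ := H.queued a (by simpa using hS h1) h2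
    exact Finset.mem_filter.mpr ⟨hb, hcl j hj b hb hab⟩
  exact (Finset.mem_filter.mp (this hxc)).2

/-- Every vertex is queued at most once, and processing it scans at most Δ list entries. This is
where adjacency lists replace the matrix, so that a search costs n(Δ+1) and not n². -/
theorem bfs_spec {I : ℕ → ℕ} {n Δ : ℕ} {g h : ℕ → ℕ → Prop} (hI : Ctx I n g h) {env : Env}
    {s : Store} (hn : env .n = n) (hL : AdjLists n Δ h (s .row) (s .hd) (s .hn)) {S : Arr}
    (hS1 : S ≠ .mk) (hS2 : S ≠ .qu) (hS3 : S ≠ .ln) {A : Finset ℕ} (hA : A ⊆ Finset.range n)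
    (hSA : Ind n (s S) A) {x : Var} {u : ℕ} (hx : env x = u) (hu : u ∈ A) :
    Reaches I env (bfs S x) s (fun s' => (∀ j, j ≠ .mk → j ≠ .qu → j ≠ .ln → s' j = s j) ∧
      Ind n (s' .mk) (comp h A u)) (50 * (n * (Δ + 1))) := by
  have hun : u < n := by simpa using hA hu
  let Fr : Store → Prop := fun s' => ∀ j, j ≠ .mk → j ≠ .qu → j ≠ .ln → s' j = s j
  let Inv : ℕ → Store → Prop := fun q s' => Fr s' ∧
    BfsInv n h A u (s' .mk) (s' .qu) (s' .ln 0) ∧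
    ∀ j < s' .ln 0, j < q → ∀ y ∈ A, h (s' .qu j) y → 0 < s' .mk y
  refine (Reaches.seq (R := fun s' => (∀ j, j ≠ .mk → s' j = s j) ∧ ∀ i < n, s' .mk i = 0)
    (b := 2 + n * 4) ?_ fun s1 h1 => ?_).mono (b := 2 + n * 4 + (3 + (3 + (3 + (2 + n * (1 + (5 + (4 + Δ * 30))))))))
    (fun _ h => h) ?_
  · refine (Reaches.fill hn (by simp) rfl rfl le_rfl).mono (fun s' h' => ⟨h'.1, fun i hi => ?_⟩) ?_
    · simpa using h'.2 i hi
    · simp [Expr.bound]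
  · refine Reaches.seq (R := fun s' => s' = s1.set .mk u 1) (b := 3)
      (Reaches.set (by simp [hx]) le_rfl le_rfl) ?_
    rintro _ rfl
    refine Reaches.seq (R := fun s' => s' = (s1.set .mk u 1).set .qu 0 u) (b := 3)
      (Reaches.set (by simp [hx]) le_rfl le_rfl) ?_
    rintro _ rfl
    refine Reaches.seq (R := Inv 0) (b := 3) (Reaches.set ?_ le_rfl le_rfl) ?_
    · simp only [Expr.eval_const]
      refine ⟨fun j j1 j2 j3 => ?_, ?_, by simp⟩
      · rw [Store.set_of_ne j3, Store.set_of_ne j2, Store.set_of_ne j1, h1.1 j j1]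
      · have e1 : ((s1.set .mk u 1).set .qu 0 u).set .ln 0 1 .mk = Function.update (s1 .mk) u 1 := by
          simp [Store.set]
        have e2 : ((s1.set .mk u 1).set .qu 0 u).set .ln 0 1 .qu = Function.update (s1 .qu) 0 u := by
          simp [Store.set]
        have e3 : ((s1.set .mk u 1).set .qu 0 u).set .ln 0 1 .ln 0 = 1 := by simp [Store.set]
        rw [e1, e2, e3]
        refine ⟨fun j hj => ?_, fun i hi j hj _ => by omega, fun y hy hym => ⟨0, by omega, ?_⟩,
          fun y hy hym => ?_, by simp⟩
        · obtain rfl : j = 0 := by omega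
          simp [hun]
        all_goals
          by_cases hyu : y = u
          · subst hyu; first | exact mem_comp_self hu | simp
          · rw [Function.update_of_ne hyu, h1.2 y hy] at hym; omega
    intro s2 h2
    refine (Reaches.loop Inv (m := n) (cN := 1) (by simpa using hn) le_rfl h2
      (b := 5 + (4 + Δ * 30)) ?_).mono ?_ (by omega)
    · rintro q hq s3 ⟨f3, b3, c3⟩
      refine (Reaches.ite (be := 4) (b := 4 + Δ * 30) ?_ (fun hlt => ?_) (fun hlt => ?_)).mono
        (fun _ h => h) (by omega)
      · exact le_rfl
      · have hql : q < s3 .ln 0 := by simpa using hlt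
        set p := s3 .qu q with hp
        have hpn : p < n := (b3.marked q hql).1
        have hpA : p ∈ comp h A u := b3.reach p hpn (b3.marked q hql).2
        have r3 := f3 .row (by simp) (by simp) (by simp)
        have d3 := f3 .hd (by simp) (by simp) (by simp)
        have n3 := f3 .hn (by simp) (by simp) (by simp)
        -- Pushing appends behind position q, so the current vertex p stays in place. Earlier queue
        -- entries are finished, and of the neighbors of p the first k have been dealt with.
        let Inv2 : ℕ → Store → Prop := fun k s' => Fr s' ∧
          BfsInv n h A u (s' .mk) (s' .qu) (s' .ln 0) ∧ q < s' .ln 0 ∧ s' .qu q = p ∧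
          (∀ j < s' .ln 0, j < q → ∀ y ∈ A, h (s' .qu j) y → 0 < s' .mk y) ∧
          ∀ j < k, s .hn (n * p + j) ∈ A → 0 < s' .mk (s .hn (n * p + j))
        refine (Reaches.loop Inv2 (m := s .hd p) (cN := 3) (b := 29) (by simp [← hp, d3]) le_rfl
          ⟨f3, b3, hql, rfl, c3, by simp⟩ ?_).mono ?_ ?_
        · rintro k hk s4 ⟨f4, b4, l4, q4, c4, m4⟩
          have r4 := f4 .row (by simp) (by simp) (by simp)
          have n4 := f4 .hn (by simp) (by simp) (by simp)
          have S4 := f4 S hS1 hS2 hS3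
          set w := s .hn (n * p + k) with hw
          have hpw : h p w := hL.adj p hpn k hk
          have hwn : w < n := hI.hG.lt_right hpw
          refine (Reaches.letE (v := w) (ca := 6) (b := 22) ?_ le_rfl ?_).mono (fun _ h => h)
            (by omega)
          · simp [q4, r4, n4, hL.row p hpn.le, hw]
          · refine (Reaches.ite (be := 8) (b := 13) ?_ (fun hc => ?_) (fun hc => ?_)).mono
              (fun _ h => h) (by omega)
            · exact (Expr.cost_le rfl rfl le_rfl).trans (by
                simp [Expr.and, Expr.not, Expr.bound])
            · have hc' : w ∈ A ∧ s4 .mk w = 0 := by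
                simpa [S4, hSA w hwn] using hc
              have hB := b4.push hwn (comp_closed hpA hpw hc'.1) (by omega)
              refine ⟨?_, by simp [Cmd.cost, Expr.cost]⟩
              have e1 : ∀ a b c d e f g, (((s4.set .mk a b).set .qu c d).set .ln e f : Store) g =
                  if g = .ln then Function.update (s4 .ln) e f else if g = .qu then
                  Function.update (s4 .qu) c d else if g = .mk then Function.update (s4 .mk) a b
                  else s4 g := by
                intro a b c d e f g
                cases g <;> simp [Store.set]
              have hmk : ∀ v, 0 < s4 .mk v → 0 < Function.update (s4 .mk) w 1 v := by
                intro v hv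
                rw [Function.update_apply]; split_ifs <;> omega
              have hqu : ∀ j, j < s4 .ln 0 →
                  Function.update (s4 .qu) (s4 .ln 0) w j = s4 .qu j := by
                intro j hj
                rw [Function.update_of_ne hj.ne]
              have hln1 : s4.set .mk w 1 .ln = s4 .ln := by simp [Store.set]
              have hln2 : ∀ a b, (s4.set .mk w 1).set .qu a b .ln = s4 .ln := by
                simp [Store.set]
              simp only [Cmd.run, Expr.eval_const, Expr.eval_var, Expr.eval_get, Expr.eval_add,
                Function.update_self, hln1, hln2]
              refine ⟨fun j j1 j2 j3 => ?_, ?_, ?_, ?_, fun j hj hjq y hy hjy => ?_,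
                fun j hj hjA => ?_⟩
              · rw [e1, if_neg j3, if_neg j2, if_neg j1]; exact f4 j j1 j2 j3
              · simpa [e1] using hB
              · simp [e1]; omega
              · simpa [e1, l4.ne] using q4
              · simp only [e1] at hjy ⊢
                simp [hqu j (by omega)] at hjy
                simpa using hmk y (c4 j (by omega) hjq y hy hjy)
              · simp only [e1]
                rcases Nat.lt_succ_iff_lt_or_eq.mp hj with h1 | rfl
                · simpa using hmk _ (m4 j h1 hjA)
                · simp [← hw]
            · refine (Reaches.skip ⟨f4, b4, l4, q4, c4, fun j hj hjA => ?_⟩).mono (fun _ h => h)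
                (by omega)
              rcases Nat.lt_succ_iff_lt_or_eq.mp hj with h1 | rfl
              · exact m4 j h1 hjA
              · have hc' : w ∈ A → 0 < s4 .mk w := by
                  intro hA
                  by_contra h0
                  exact hc (by simp [S4, hSA w hwn, hA]; omega)
                exact hc' hjA
        · rintro s4 ⟨f4, b4, l4, q4, c4, m4⟩
          refine ⟨f4, b4, fun j hj hjq y hy hjy => ?_⟩
          rcases Nat.lt_succ_iff_lt_or_eq.mp hjq with h1 | rfl
          · exact c4 j hj h1 y hy hjy
          · obtain ⟨k, hk, rfl⟩ := hL.ex p hpn y (q4 ▸ hjy)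
            exact m4 k hk hy
        · have := hL.le p hpn
          nlinarith
      · have hql : s3 .ln 0 ≤ q := by simpa using hlt
        exact (Reaches.skip ⟨f3, b3, fun j hj _ => c3 j hj (by omega)⟩).mono (fun _ h => h)
          (by omega)
    · rintro s3 ⟨f3, b3, c3⟩
      exact ⟨f3, b3.done hA hu fun j hj => c3 j hj (lt_of_lt_of_le hj b3.len_le)⟩
  · have : 1 ≤ n := by omega
    nlinarith

/-! ## Enumeration of all vectors in a box -/

/-- Digit `y` of `e` in the mixed radix system with radices `r`. -/
def dig (r : ℕ → ℕ) (e y : ℕ) : ℕ := e / (∏ z ∈ Finset.range y, r z) % r y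

theorem dig_lt {r : ℕ → ℕ} {e y : ℕ} (hr : 0 < r y) : dig r e y < r y := Nat.mod_lt _ hr

/-- Digit y moves exactly when all lower digits overflow, that is, when the product of the lower
radices divides e + 1. -/
theorem dig_succ {r : ℕ → ℕ} {e y : ℕ} (hr : 0 < r y) :
    dig r (e + 1) y = if ∏ z ∈ Finset.range y, r z ∣ e + 1 then
      (if dig r e y + 1 < r y then dig r e y + 1 else 0) else dig r e y := by
  unfold dig
  set P := ∏ z ∈ Finset.range y, r z
  rw [Nat.succ_div]
  split_ifs with h1 h2
  · rw [Nat.add_mod, Nat.mod_eq_of_lt (a := _ + _)]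
    · rcases Nat.lt_or_ge 1 (r y) with h | h
      · rw [Nat.mod_eq_of_lt h]
      · omega
    · rcases Nat.lt_or_ge 1 (r y) with h | h
      · rwa [Nat.mod_eq_of_lt h]
      · omega
  · have : e / P % r y + 1 = r y := by have := Nat.mod_lt (e / P) hr; omega
    have h3 := Nat.div_add_mod (e / P) (r y)
    rw [show e / P + 1 = r y * (e / P / r y + 1) by rw [mul_add]; omega]
    simp
  · simp

/-- The carry passes digit y if and only if it reaches digit y and that digit is maximal. With the
carry expressed as a divisibility, this is the invariant behind `next_spec`. -/
theorem dig_carry {r : ℕ → ℕ} {e y : ℕ} (hP : 0 < ∏ z ∈ Finset.range y, r z) (hr : 0 < r y) :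
    ∏ z ∈ Finset.range (y + 1), r z ∣ e + 1 ↔
      ∏ z ∈ Finset.range y, r z ∣ e + 1 ∧ ¬ dig r e y + 1 < r y := by
  rw [Finset.prod_range_succ]
  constructor
  · rintro ⟨q, hq⟩
    have h1 : ∏ z ∈ Finset.range y, r z ∣ e + 1 := ⟨r y * q, by rw [hq]; ring⟩
    refine ⟨h1, fun hlt => ?_⟩
    have h2 := dig_succ (e := e) hr
    rw [if_pos h1, if_pos hlt, dig, hq, mul_assoc, Nat.mul_div_cancel_left _ hP,
      Nat.mul_mod_right] at h2
    omega
  · rintro ⟨h1, h2⟩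
    have h3 := dig_succ (e := e) hr
    rw [if_pos h1, if_neg h2, dig] at h3
    obtain ⟨q, hq⟩ := h1
    rw [hq, Nat.mul_div_cancel_left _ hP] at h3
    rw [hq]
    exact mul_dvd_mul_left _ (Nat.dvd_of_mod_eq_zero h3)

/-- Counting through all e visits every vector of the box. A new top digit is adjoined by adding a
multiple of the product of the lower radices. -/
theorem exists_dig_eq (r τ : ℕ → ℕ) (m : ℕ) (h : ∀ y < m, τ y < r y) :
    ∃ e < ∏ y ∈ Finset.range m, r y, ∀ y < m, dig r e y = τ y := by
  induction m with
  | zero => exact ⟨0, by simp, by simp⟩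
  | succ m ih =>
    obtain ⟨e, he, hd⟩ := ih fun y hy => h y (by omega)
    have hm := h m (by omega)
    set P := ∏ y ∈ Finset.range m, r y with hP
    refine ⟨e + P * τ m, ?_, fun y hy => ?_⟩
    · rw [Finset.prod_range_succ]
      nlinarith
    · rcases Nat.lt_succ_iff_lt_or_eq.mp hy with h1 | rfl
      · rw [← hd y h1]
        unfold dig
        -- The added multiple of P is divisible by the radices up to and including r y, so digit y
        -- does not change.
        have hPy : P = (∏ z ∈ Finset.range y, r z) * (r y *
            ∏ z ∈ Finset.Ico (y + 1) m, r z) := by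
          rw [← mul_assoc, ← Finset.prod_range_succ, hP, Finset.prod_range_mul_prod_Ico _ h1]
        have hpos : 0 < ∏ z ∈ Finset.range y, r z :=
          Finset.prod_pos fun z hz => by
            have := h z (by have := Finset.mem_range.mp hz; omega)
            omega
        rw [hPy, mul_assoc, Nat.add_mul_div_left _ _ hpos, mul_assoc, Nat.add_mul_mod_self_left]
      · unfold dig
        rw [← hP, Nat.add_mul_div_left _ _ (by omega), Nat.div_eq_of_lt he, zero_add,
          Nat.mod_eq_of_lt hm]

open Expr in
/-- Advance the vector `dg` of length `L` to the next one in the box with sides `rx`. -/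
def next (L : Var) : Cmd :=
  .seq (.set .ca (.const 0) (.const 1)) <|
  .loop .ip (.var L) <| .ite (.get .ca (.const 0))
    (.ite (lt (.add (.get .dg (.var .ip)) (.const 1)) (.get .rx (.var .ip)))
      (.seq (.set .dg (.var .ip) (.add (.get .dg (.var .ip)) (.const 1)))
        (.set .ca (.const 0) (.const 0)))
      (.set .dg (.var .ip) (.const 0)))
    .skip

theorem next_spec {I : ℕ → ℕ} {env : Env} {s : Store} {L : Var} {m e : ℕ} {r : ℕ → ℕ}
    (hm : env L = m) (hr : ∀ y < m, 0 < r y) (hrx : ∀ y < m, s .rx y = r y)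
    (hdg : ∀ y < m, s .dg y = dig r e y) :
    Reaches I env (next L) s (fun s' => (∀ j, j ≠ .dg → j ≠ .ca → s' j = s j) ∧
      ∀ y < m, s' .dg y = dig r (e + 1) y) (5 + m * 25) := by
  have hP : ∀ y ≤ m, 0 < ∏ z ∈ Finset.range y, r z := fun y hy =>
    Finset.prod_pos fun z hz => hr z (by have := Finset.mem_range.mp hz; omega)
  refine (Reaches.seq (R := fun s' => s' = s.set .ca 0 1) (b := 3) (b' := 2 + m * 25)
    (Reaches.set (by simp) le_rfl le_rfl) ?_).mono (fun _ h => h) (by omega)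
  rintro _ rfl
  refine (Reaches.loop (fun y s' => (∀ j, j ≠ .dg → j ≠ .ca → s' j = s j) ∧
      (0 < s' .ca 0 ↔ ∏ z ∈ Finset.range y, r z ∣ e + 1) ∧
      (∀ z < y, s' .dg z = dig r (e + 1) z) ∧ ∀ z < m, y ≤ z → s' .dg z = dig r e z)
    (m := m) (cN := 1) (b := 24) (by simpa using hm) le_rfl
    ⟨fun j h1 h2 => by simp [Store.set, h2], by simp [Store.set], by simp,
      fun z hz _ => by simp [Store.set, hdg z hz]⟩ ?_).mono ?_ (by omega)
  · rintro y hy s1 ⟨f1, c1, d1, d2⟩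
    have hs := dig_succ (e := e) (hr y hy)
    have hc := dig_carry (e := e) (hP y hy.le) (hr y hy)
    have e1 : s1 .rx y = r y := by rw [f1 .rx (by simp) (by simp), hrx y hy]
    have e2 := d2 y hy le_rfl
    refine (Reaches.ite (be := 2) (b := 21) le_rfl (fun h1 => ?_) (fun h1 => ?_)).mono
      (fun _ h => h) le_rfl
    · have hdvd := c1.mp (by simpa using h1)
      rw [if_pos hdvd] at hs
      refine (Reaches.ite (be := 9) (b := 11) (by simp [Expr.cost, Expr.lt]) (fun h2 => ?_)
        (fun h2 => ?_)).mono (fun _ h => h) le_rfl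
      · have h2' : dig r e y + 1 < r y := by simpa [e1, e2] using h2
        rw [if_pos h2'] at hs
        refine ⟨?_, by simp [Cmd.cost, Expr.cost]⟩
        simp only [Cmd.run, Expr.eval_const, Expr.eval_var, Expr.eval_get, Expr.eval_add,
          Function.update_self]
        refine ⟨fun j j1 j2 => ?_, ?_, fun z hz => ?_, fun z hz hz' => ?_⟩
        · rw [Store.set_of_ne j2, Store.set_of_ne j1, f1 j j1 j2]
        · rw [Store.set_self, if_pos rfl, hc]; simp [h2']
        · rw [Store.set_of_ne (by simp), Store.set_self]
          split_ifs with hzy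
          · rw [hzy, hs, e2]
          · exact d1 z (by omega)
        · rw [Store.set_of_ne (by simp), Store.set_self, if_neg (by omega)]
          exact d2 z hz (by omega)
      · have h2' : ¬ dig r e y + 1 < r y := by
          simpa only [Expr.lt_pos, Expr.eval_const, Expr.eval_var, Expr.eval_get, Expr.eval_add,
            Function.update_self, e1, e2] using h2
        rw [if_neg h2'] at hs
        refine ⟨?_, by simp [Cmd.cost, Expr.cost]⟩
        simp only [Cmd.run, Expr.eval_const, Expr.eval_var, Function.update_self]
        refine ⟨fun j j1 j2 => ?_, ?_, fun z hz => ?_, fun z hz hz' => ?_⟩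
        · rw [Store.set_of_ne j1, f1 j j1 j2]
        · rw [Store.set_of_ne (by simp), hc, c1]; simp [h2']
        · rw [Store.set_self]
          split_ifs with hzy
          · rw [hzy, hs]
          · exact d1 z (by omega)
        · rw [Store.set_self, if_neg (by omega)]
          exact d2 z hz (by omega)
    · have hdvd : ¬ ∏ z ∈ Finset.range y, r z ∣ e + 1 := fun h => h1 (by simpa using c1.mpr h)
      rw [if_neg hdvd] at hs
      refine (Reaches.skip ⟨f1, ?_, fun z hz => ?_, fun z hz hz' => d2 z hz (by omega)⟩).mono
        (fun _ h => h) (by omega)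
      · rw [hc, c1]; simp [hdvd]
      · rcases Nat.lt_succ_iff_lt_or_eq.mp hz with h3 | rfl
        · exact d1 z h3
        · rw [hs, e2]
  · rintro s1 ⟨f1, -, d1, -⟩
    exact ⟨f1, d1⟩

open Expr in
/-- Compute the number of vectors in the box and set `dg` to the first one. -/
def initBox (L : Var) : Cmd :=
  .seq (.set .cnt (.const 0) (.const 1)) <|
  -- The product of the sides is built up by summing the current value as many times as the next
  -- side says.
  .seq (.loop .ip (.var L) (.set .cnt (.const 0)
    (.sum .t (.get .rx (.var .ip)) (.get .cnt (.const 0))))) <|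
  .loop .ip (.var L) (.set .dg (.var .ip) (.const 0))

theorem initBox_spec {I : ℕ → ℕ} {env : Env} {s : Store} {L : Var} {m R : ℕ} {r : ℕ → ℕ}
    (hm : env L = m) (hrx : ∀ y < m, s .rx y = r y) (hR : ∀ y < m, r y ≤ R) :
    Reaches I env (initBox L) s (fun s' => (∀ j, j ≠ .dg → j ≠ .cnt → s' j = s j) ∧
      s' .cnt 0 = ∏ y ∈ Finset.range m, r y ∧ ∀ y < m, s' .dg y = dig r 0 y)
      (7 + m * (10 + 3 * R)) := by
  refine (Reaches.seq (R := fun s' => s' = s.set .cnt 0 1) (b := 3)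
    (b' := (2 + m * (6 + 3 * R)) + (2 + m * 4))
    (Reaches.set (by simp) le_rfl le_rfl) ?_).mono (fun _ h => h) ?_
  · rintro _ rfl
    refine (Reaches.seq (R := fun s' => (∀ j, j ≠ .dg → j ≠ .cnt → s' j = s j) ∧
      s' .cnt 0 = ∏ y ∈ Finset.range m, r y) (b := 2 + m * (6 + 3 * R)) ?_ fun s1 h1 => ?_)
    · refine (Reaches.loop (fun y s' => (∀ j, j ≠ .dg → j ≠ .cnt → s' j = s j) ∧
        s' .cnt 0 = ∏ y ∈ Finset.range y, r y) (m := m) (cN := 1) (b := 5 + 3 * R)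
        (by simpa using hm) le_rfl
        ⟨fun j h1 h2 => by simp [Store.set, h2], by simp [Store.set]⟩ ?_).mono (fun _ h => h)
        (le_of_eq (by ring))
      rintro y hy s1 ⟨f1, c1⟩
      have e1 : s1 .rx y = r y := by rw [f1 .rx (by simp) (by simp), hrx y hy]
      refine (Reaches.set (ca := 1) (cb := 3 + 3 * R) ?_ le_rfl ?_).mono (fun _ h => h) (by omega)
      · refine ⟨fun j j1 j2 => by rw [Store.set_of_ne j2, f1 j j1 j2], ?_⟩
        simp [Store.set, Expr.eval, e1, c1, Finset.prod_range_succ, mul_comm]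
      · refine (Expr.sum_cost_le (m := r y) (cN := 2) (b := 2) (by simp [e1]) le_rfl
          fun i _ => le_rfl).trans ?_
        have := hR y hy
        omega
    · refine (Reaches.tabulate (m := m) (cN := 1) (ci := 1) (ca := 1) (f := id)
        (by simpa [Expr.eval] using hm) le_rfl rfl rfl (fun i _ => by simp)
        (fun i _ j _ h => h) (fun i _ s => le_rfl) (fun i _ s' _ => le_rfl)).mono ?_ (by omega)
      rintro s' ⟨h2, h3, -⟩
      refine ⟨fun j j1 j2 => by rw [h2 j j1, h1.1 j j1 j2], by rw [h2 _ (by simp), h1.2],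
        fun y hy => ?_⟩
      have := h3 y hy
      simpa [dig] using this
  · nlinarith

/-! ## Counting and listing -/

section Counting

variable {P : ℕ → Prop} [DecidablePred P] {n k y : ℕ}

/-- The `k`-th number below `n` with property `P`, or `0`. -/
def nthVal (P : ℕ → Prop) [DecidablePred P] (n k : ℕ) : ℕ :=
  ∑ y ∈ Finset.range n, if P y ∧ Nat.count P y = k then y else 0

/-- Among the numbers with property P, the one preceded by k others is unique, so the sum has a
single summand. -/
theorem nthVal_count (hy : y < n) (hP : P y) : nthVal P n (Nat.count P y) = y := by
  unfold nthVal
  rw [Finset.sum_eq_single y]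
  · simp [hP]
  · intro z _ hzy
    rw [if_neg]
    rintro ⟨h1, h2⟩
    exact hzy (Nat.count_injective h1 hP h2)
  · intro h; exact absurd (Finset.mem_range.mpr hy) h

theorem exists_count_eq (hk : k < Nat.count P n) : ∃ y < n, P y ∧ Nat.count P y = k := by
  induction n with
  | zero => simp at hk
  | succ n ih =>
    rw [Nat.count_succ] at hk
    by_cases h : k < Nat.count P n
    · obtain ⟨y, h1, h2⟩ := ih h
      exact ⟨y, by omega, h2⟩
    · split_ifs at hk with hP
      · exact ⟨n, by omega, hP, by omega⟩
      · omega

theorem nthVal_lt (hn : 0 < n) : nthVal P n k < n := by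
  by_cases h : ∃ y < n, P y ∧ Nat.count P y = k
  · obtain ⟨y, h1, h2, rfl⟩ := h
    rwa [nthVal_count h1 h2]
  · have : nthVal P n k = 0 := Finset.sum_eq_zero fun y hy =>
      if_neg fun hc => h ⟨y, Finset.mem_range.mp hy, hc⟩
    omega

theorem count_eq_sum_lt (hy : y ≤ n) :
    Nat.count P y = ∑ z ∈ Finset.range n, if z < y ∧ P z then 1 else 0 := by
  rw [Nat.count_eq_card_filter_range, ← Finset.card_filter]
  congr 1
  ext z
  simp only [Finset.mem_filter, Finset.mem_range]
  constructor
  · rintro ⟨h1, h2⟩; exact ⟨by omega, h1, h2⟩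
  · rintro ⟨_, h1, h2⟩; exact ⟨h1, h2⟩

end Counting

namespace Expr

variable {I : ℕ → ℕ} {env : Env} {s : Store}

/-- The number of `y < n` with property `p`. -/
def count (y : Var) (p : Expr) : Expr := .sum y (.var .n) (.ite p (.const 1) (.const 0))

theorem eval_count {y : Var} {p : Expr} {n : ℕ} (hn : env .n = n) {P : ℕ → Prop}
    [DecidablePred P] (h : ∀ i < n, 0 < p.eval I (Function.update env y i) s ↔ P i) :
    (count y p).eval I env s = Nat.count P n := by
  rw [Nat.count_eq_card_filter_range, Finset.card_filter]
  simp only [count, eval, hn]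
  refine Finset.sum_congr rfl fun i hi => ?_
  simp [h i (Finset.mem_range.mp hi)]

/-- The `k`-th `y < n` with property `p`; here `p'` is `p` with `z` in place of `y`. -/
def nth (p p' k : Expr) : Expr :=
  .sum .y (.var .n) (.ite (and p (eq (count .z (and (lt (.var .z) (.var .y)) p')) k))
    (.var .y) (.const 0))

theorem eval_nth {p p' k : Expr} {n k0 : ℕ} (hn : env .n = n) {P : ℕ → Prop}
    [DecidablePred P] (h : ∀ i < n, 0 < p.eval I (Function.update env .y i) s ↔ P i)
    (h' : ∀ i < n, ∀ j < n,
      0 < p'.eval I (Function.update (Function.update env .y i) .z j) s ↔ P j)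
    (hk : ∀ i, k.eval I (Function.update env .y i) s = k0) :
    (nth p p' k).eval I env s = nthVal P n k0 := by
  simp only [nth, eval, hn, nthVal]
  refine Finset.sum_congr rfl fun i hi => ?_
  have hi' := Finset.mem_range.mp hi
  have hc := eval_count (I := I) (env := Function.update env .y i) (s := s) (y := .z)
    (p := and (lt (.var .z) (.var .y)) p') (n := n) (by simpa using hn) (P := fun z => z < i ∧ P z)
    (fun j hj => by simp [h' i hi' j hj])
  rw [Nat.count_eq_card_filter_range, Finset.card_filter, ← count_eq_sum_lt hi'.le] at hc
  simp [h i hi', hc, hk]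

end Expr

theorem index_inj {n x y x' y' : ℕ} (hy : y < n) (hy' : y' < n)
    (h : n * x + y = n * x' + y') : x = x' ∧ y = y' := by
  have h1 := congrArg (· / n) h
  have h2 := congrArg (· % n) h
  simp only [Nat.mul_add_mod, Nat.mod_eq_of_lt hy, Nat.mod_eq_of_lt hy'] at h2
  subst h2
  have : n * x = n * x' := by omega
  exact ⟨Nat.eq_of_mul_eq_mul_left (by omega) this, rfl⟩

section Fill

variable {I : ℕ → ℕ} {env : Env} {s : Store}

/-- Filling row `i` of a matrix. -/
theorem Reaches.fillRow {x y : Var} {a : Expr} {k : Arr} {n i ca : ℕ} (hn : env .n = n)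
    (hx : env x = i) (hi : i < n)
    (hyn : y ≠ .n) (hxy : y ≠ x) (hk : k ≠ .row) (hrow : ∀ x ≤ n, s .row x = n * x)
    (ha : a.reads k = false) (hp : a.isPlain = true) (hb : a.bound n ≤ ca) :
    Reaches I env (.loop y (.var .n) (.set k (Expr.ix (.var x) (.var y)) a)) s
      (fun s' => (∀ j, j ≠ k → s' j = s j) ∧
        (∀ j < n, s' k (n * i + j) = a.eval I (Function.update env y j) s) ∧
        ∀ b, (∀ j < n, n * i + j ≠ b) → s' k b = s k b)
      (2 + n * (6 + ca)) := by
  refine (Reaches.tabulate (m := n) (cN := 1) (ci := 4) (ca := ca) (f := fun j => n * i + j)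
    (by simpa [Expr.eval] using hn) le_rfl ?_ ha
    (fun j _ => ?_) (fun j hj j' hj' h => by omega) (fun j _ s => le_rfl)
    (fun j _ s' _ => Expr.cost_le ?_ hp hb)).mono (fun s' h => h) (by nlinarith)
  · simp [Expr.ix, Expr.reads, hk.symm]
  · simp [Function.update_of_ne hxy.symm, hx, hrow i hi.le]
  · rw [Function.update_of_ne hyn.symm, hn]

/-- Filling a square matrix. -/
theorem Reaches.fill2 {x y : Var} {a : Expr} {k : Arr} {n ca : ℕ} (hn : env .n = n)
    (hxn : x ≠ .n) (hyn : y ≠ .n) (hxy : y ≠ x) (hk : k ≠ .row)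
    (hrow : ∀ x ≤ n, s .row x = n * x)
    (ha : a.reads k = false) (hp : a.isPlain = true) (hb : a.bound n ≤ ca) :
    Reaches I env (.loop x (.var .n)
      (.loop y (.var .n) (.set k (Expr.ix (.var x) (.var y)) a))) s
      (fun s' => (∀ j, j ≠ k → s' j = s j) ∧ ∀ i < n, ∀ j < n, s' k (n * i + j) =
        a.eval I (Function.update (Function.update env x i) y j) s)
      (2 + n * (3 + n * (6 + ca))) := by
  refine (Reaches.loop (fun m s' => (∀ j, j ≠ k → s' j = s j) ∧
    ∀ i < m, ∀ j < n, s' k (n * i + j) =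
        a.eval I (Function.update (Function.update env x i) y j) s) (m := n) (cN := 1)
    (by simpa using hn) le_rfl ⟨fun _ _ => rfl, by simp⟩ (b := 2 + n * (6 + ca)) ?_).mono
    (fun _ h => h) (by nlinarith)
  rintro i hi s1 ⟨f1, h1⟩
  refine (Reaches.fillRow (n := n) (i := i) (by rw [Function.update_of_ne hxn.symm, hn])
    (by simp) hi hyn hxy hk (by rw [f1 .row hk.symm]; exact hrow) ha hp hb).mono ?_ le_rfl
  rintro s2 ⟨f2, h2, h3⟩
  refine ⟨fun j hj => by rw [f2 j hj, f1 j hj], fun i' hi' j hj => ?_⟩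
  rcases Nat.lt_succ_iff_lt_or_eq.mp hi' with h4 | rfl
  · rw [h3 _ fun j' hj' h => by have := (index_inj hj' hj h).1; omega, h1 i' h4 j hj]
  · rw [h2 j hj]
    exact Expr.eval_congr _ _ fun j hj => f1 j (by rintro rfl; simp [ha] at hj)

end Fill

/-! ## Preprocessing -/

open Expr in
/-- Row addresses, degrees and adjacency lists. -/
def buildLists : Cmd :=
  .seq (.loop .x (.add (.var .n) (.const 1)) (.set .row (.var .x) (.sum .y (.var .x) (.var .n)))) <|
  .seq (.loop .x (.var .n) (.set .hd (.var .x) (count .y (hadj (.var .x) (.var .y))))) <|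
  .loop .x (.var .n) <| .loop .k (.var .n) <| .set .hn (ix (.var .x) (.var .k))
    (nth (hadj (.var .x) (.var .y)) (hadj (.var .x) (.var .z)) (.var .k))

theorem hadj_pos {I : ℕ → ℕ} {n : ℕ} {g h : ℕ → ℕ → Prop} (hI : Ctx I n g h) {env : Env}
    {s : Store} (hn : env .n = n) (hrow : ∀ x ≤ n, s .row x = n * x) {a b : Expr} {x y : ℕ}
    (ha : a.eval I env s = x) (hb : b.eval I env s = y) (hx : x < n) (hy : y < n) :
    0 < (Expr.hadj a b).eval I env s ↔ h x y := by
  simp [Expr.hadj, hn, ha, hb, hrow n le_rfl, hrow x hx.le, hI.inpH x hx y hy]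

theorem gadj_pos {I : ℕ → ℕ} {n : ℕ} {g h : ℕ → ℕ → Prop} (hI : Ctx I n g h) {env : Env}
    {s : Store} (hrow : ∀ x ≤ n, s .row x = n * x) {a b : Expr} {x y : ℕ}
    (ha : a.eval I env s = x) (hb : b.eval I env s = y) (hx : x < n) (hy : y < n) :
    0 < (Expr.gadj a b).eval I env s ↔ g x y := by
  simp [Expr.gadj, ha, hb, hrow x hx.le, hI.inpG x hx y hy]

open Classical in
-- Searching for each k-th neighbor by counting costs n^4 in total. This is affordable, since
-- n^(α+3) is at least n^4 as soon as H has an edge.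
theorem buildLists_spec {I : ℕ → ℕ} {n Δ : ℕ} {g h : ℕ → ℕ → Prop} (hI : Ctx I n g h)
    {env : Env} {s : Store} (hn : env .n = n) (hn1 : 1 ≤ n)
    (hΔ : ∀ x < n, Nat.count (h x) n ≤ Δ) :
    Reaches I env buildLists s (fun s' => (∀ j, j ≠ .row → j ≠ .hd → j ≠ .hn → s' j = s j) ∧
      AdjLists n Δ h (s' .row) (s' .hd) (s' .hn)) (300 * n ^ 4) := by
  refine (Reaches.seq (R := fun s' => (∀ j, j ≠ .row → s' j = s j) ∧
    ∀ x ≤ n, s' .row x = n * x) (b := 4 + (n + 1) * (6 + 2 * n)) ?_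
    (b' := 2 + n * 100 * n + (2 + n * (3 + n * (6 + (2 + n * (30 + (2 + n * 40))))))) fun s1 h1 => ?_).mono (fun _ h => h) ?_
  · refine (Reaches.tabulate (m := n + 1) (cN := 3) (ci := 1) (ca := 2 + 2 * n) (f := id)
      (by simp [hn]) le_rfl rfl rfl (fun i _ => by simp)
        (fun i _ j _ h => h) (fun i _ s => le_rfl) (fun i hi s' _ => ?_)).mono ?_ (by nlinarith)
    · refine (Expr.sum_cost_le (m := i) (cN := 1) (b := 1) (by simp) le_rfl
          fun i _ => le_rfl).trans ?_
      omega
    · rintro s' ⟨h2, h3, -⟩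
      refine ⟨h2, fun x hx => ?_⟩
      have := h3 x (by omega)
      simpa [Expr.eval, hn, mul_comm] using this
  · obtain ⟨f1, r1⟩ := h1
    refine Reaches.seq (R := fun s' => (∀ j, j ≠ .hd → s' j = s1 j) ∧
      ∀ x < n, s' .hd x = Nat.count (h x) n) (b := 2 + n * 100 * n) ?_ fun s2 h2 => ?_
    · refine (Reaches.fill (ca := 2 + n * 12) hn (by simp) rfl rfl ?_).mono ?_ ?_
      · simp [Expr.bound, Expr.count, Expr.hadj, Expr.ix]
      · rintro s' ⟨h2, h3⟩
        refine ⟨h2, fun x hx => ?_⟩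
        rw [h3 x hx]
        exact Expr.eval_count (by simpa using hn) fun y hy =>
          hadj_pos hI (by simpa using hn) r1 (by simp) (by simp) hx hy
      · nlinarith
    · obtain ⟨f2, d2⟩ := h2
      have r2 : ∀ x ≤ n, s2 .row x = n * x := by rw [f2 _ (by simp)]; exact r1
      refine (Reaches.fill2 (ca := 2 + n * (30 + (2 + n * 40))) hn (by simp) (by simp) (by simp)
        (by simp) r2 rfl rfl ?_).mono ?_ le_rfl
      · simp [Expr.bound, Expr.nth, Expr.count, Expr.hadj, Expr.ix, Expr.lt, Expr.and, Expr.eq,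
          Expr.not]
        nlinarith
      · rintro s3 ⟨f3, h3⟩
        have hv : ∀ x < n, ∀ k < n, s3 .hn (n * x + k) = nthVal (h x) n k := by
          intro x hx k hk
          rw [h3 x hx k hk]
          exact Expr.eval_nth (by simpa using hn)
            (fun i hi => hadj_pos hI (by simpa using hn) r2 (by simp) (by simp) hx hi)
            (fun i _ j hj => hadj_pos hI (by simpa using hn) r2 (by simp) (by simp) hx hj)
            (fun i => by simp)
        have hcn : ∀ x, Nat.count (h x) n ≤ n := fun x => Nat.count_le _
        have e3 : s3 .hd = s2 .hd := f3 _ (by simp)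
        have e3r : s3 .row = s2 .row := f3 _ (by simp)
        refine ⟨fun j j1 j2 j3 => by rw [f3 j j3, f2 j j2, f1 j j1], ?_⟩
        rw [e3, e3r]
        refine ⟨r2, fun x hx k hk => ?_, fun x hx y hxy => ?_, fun x hx => ?_, fun x hx => ?_⟩
        · rw [d2 x hx] at hk
          obtain ⟨y, hy, hP, rfl⟩ := exists_count_eq hk
          rw [hv x hx _ (hk.trans_le (hcn x)), nthVal_count hy hP]
          exact hP
        · have hy := hI.hG.lt_right hxy
          have hlt : Nat.count (h x) y < Nat.count (h x) n := Nat.count_strict_mono hxy hy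
          exact ⟨_, by rwa [d2 x hx], by
            rw [hv x hx _ (hlt.trans_le (hcn x)), nthVal_count hy hxy]⟩
        · rw [d2 x hx]; exact hΔ x hx
        · rw [d2 x hx]; exact hcn x
  · have h1 : 1 ≤ n ^ 4 := Nat.one_le_pow _ _ hn1
    have h2 : n ≤ n ^ 4 := Nat.le_self_pow (by norm_num) n
    have h3 : n ^ 2 ≤ n ^ 4 := Nat.pow_le_pow_right hn1 (by norm_num)
    have h4 : n ^ 3 ≤ n ^ 4 := Nat.pow_le_pow_right hn1 (by norm_num)
    nlinarith

/-! ## Distances -/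

open Expr in
/-- Mark the pairs at distance at most `d` in matrix `A`; `e` is adjacency of `z` and `y`. -/
def dists (A : Arr) (e : Expr) : Cmd :=
  .loop .x (.var .n) <|
  .seq (.loop .y (.var .n) (.set .t1 (.var .y) (eq (.var .x) (.var .y)))) <|
  .seq (.loop .r (.var .d) <|
    .seq (.loop .y (.var .n) (.set .t2 (.var .y)
      (or (.get .t1 (.var .y)) (.sum .z (.var .n) (and (.get .t1 (.var .z)) e))))) <|
    .loop .y (.var .n) (.set .t1 (.var .y) (.get .t2 (.var .y)))) <|
  .loop .y (.var .n) (.set A (ix (.var .x) (.var .y)) (.get .t1 (.var .y)))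

/-- Matrix `a` marks the pairs at distance at most `d`. -/
def NearMat (n d : ℕ) (h : ℕ → ℕ → Prop) (a : ℕ → ℕ) : Prop :=
  ∀ x < n, ∀ y < n, 0 < a (n * x + y) ↔ Near h d x y

/-- For each source the reached set is extended by one step d times, each time by a matrix scan. The
cost does not involve degrees, so the same code serves G, whose degrees are not yet under control.
-/
theorem dists_spec {I : ℕ → ℕ} {n d : ℕ} {h : ℕ → ℕ → Prop} (H : IsGraphOn n h)
    {env : Env} {s : Store} (hn : env .n = n) (hd : env .d = d) (hn1 : 1 ≤ n)
    (hrow : ∀ x ≤ n, s .row x = n * x) {A : Arr} (hA : A ≠ .row) (hA1 : A ≠ .t1) (hA2 : A ≠ .t2)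
    {e : Expr} (he : e.isPlain = true) (heb : e.bound n ≤ 12)
    (he2 : e.reads .t2 = false)
    (hadj : ∀ (env' : Env) (s' : Store), env' .n = n → (∀ x ≤ n, s' .row x = n * x) →
      env' .y < n → env' .z < n → (0 < e.eval I env' s' ↔ h (env' .z) (env' .y))) :
    Reaches I env (dists A e) s (fun s' => (∀ j, j ≠ .t1 → j ≠ .t2 → j ≠ A → s' j = s j) ∧
      NearMat n d h (s' A)) (100 * (n ^ 3 * (d + 1))) := by
  have hb : 2 + n * (1 + ((2 + n * 13) + (2 + d * (1 + ((2 + n * (3 + (5 + n * 20))) + (2 + n * 5))) +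
      (2 + n * 8)))) ≤ 100 * (n ^ 3 * (d + 1)) := by
    obtain ⟨m, rfl⟩ : ∃ m, n = m + 1 := ⟨n - 1, by omega⟩
    ring_nf
    nlinarith [Nat.zero_le (m * d), Nat.zero_le (m ^ 2 * d), Nat.zero_le (m ^ 3 * d),
      Nat.zero_le (m ^ 2), Nat.zero_le (m ^ 3)]
  refine (Reaches.loop (fun m s' => (∀ j, j ≠ .t1 → j ≠ .t2 → j ≠ A → s' j = s j) ∧
    ∀ x < m, ∀ y < n, 0 < s' A (n * x + y) ↔ Near h d x y) (m := n) (cN := 1)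
    (by simpa using hn) le_rfl ⟨fun _ _ _ _ => rfl, by simp⟩ ?_).mono (fun _ h => h) hb
  rintro x hx s1 ⟨f1, h1⟩
  refine Reaches.seq (b := 2 + n * 13) (R := fun s' => (∀ j, j ≠ .t1 → s' j = s1 j) ∧
    ∀ y < n, 0 < s' .t1 y ↔ x = y) ?_ fun s2 ⟨f2, h2⟩ => ?_
  · refine (Reaches.fill (n := n) (ca := 10) (by simpa using hn) (by simp) rfl rfl
      (by simp [Expr.bound, Expr.eq, Expr.not])).mono ?_ le_rfl
    rintro s' ⟨f, hv⟩
    refine ⟨f, fun y hy => ?_⟩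
    rw [hv y hy]
    simp
  refine Reaches.seq (b := 2 + d * (1 + ((2 + n * (3 + (5 + n * 20))) + (2 + n * 5)))) (b' := 2 + n * 8)
    (R := fun s' => (∀ j, j ≠ .t1 → j ≠ .t2 → s' j = s1 j) ∧
    ∀ y < n, 0 < s' .t1 y ↔ Near h d x y) ?_ fun s3 ⟨f3, h3⟩ => ?_
  · refine (Reaches.loop (fun r s' => (∀ j, j ≠ .t1 → j ≠ .t2 → s' j = s1 j) ∧
      ∀ y < n, 0 < s' .t1 y ↔ Near h r x y) (m := d) (cN := 1) (by simpa using hd) le_rfl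
      ⟨fun j j1 _ => f2 j j1, h2⟩ ?_).mono (fun _ h => h) le_rfl
    rintro r hr s3 ⟨f3, h3⟩
    have hrow3 : ∀ x ≤ n, s3 .row x = n * x := by
      rw [f3 _ (by simp) (by simp)]
      by_cases hAr : A = .row
      · exact absurd hAr hA
      · rw [f1 _ (by simp) (by simp) hA.symm]; exact hrow
    refine Reaches.seq (R := fun s' => (∀ j, j ≠ .t2 → s' j = s3 j) ∧
      ∀ y < n, 0 < s' .t2 y ↔ Near h (r + 1) x y) ?_ fun s4 ⟨f4, h4⟩ => ?_
    · refine (Reaches.fill (n := n) (ca := 5 + n * 20) (by simpa using hn) (by simp) ?_ ?_ ?_).mono ?_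
        le_rfl
      · simp [Expr.reads, Expr.or, Expr.and, he2]
      · simp [Expr.isPlain, Expr.or, Expr.and, he]
      · simp only [Expr.bound, Expr.or, Expr.and]
        nlinarith
      · rintro s' ⟨f, hv⟩
        refine ⟨f, fun y hy => ?_⟩
        rw [hv y hy]
        simp only [Expr.or_pos, Expr.eval_get, Expr.eval_var, Function.update_self, Expr.sum_pos,
          Expr.and_pos, h3 y hy]
        refine or_congr Iff.rfl ⟨?_, ?_⟩
        · rintro ⟨z, hz, hz1, hz2⟩
          have hz' : z < n := by simpa [hn] using hz
          exact ⟨z, (h3 z hz').mp hz1, by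
            simpa using (hadj _ _ (by simpa using hn) hrow3 (by simpa using hy)
              (by simpa using hz')).mp hz2⟩
        · rintro ⟨z, hz1, hz2⟩
          have hz' : z < n := H.lt hz2
          exact ⟨z, by simpa [hn] using hz', (h3 z hz').mpr hz1,
            (hadj _ _ (by simpa using hn) hrow3 (by simpa using hy)
              (by simpa using hz')).mpr (by simpa using hz2)⟩
    · refine (Reaches.fill (n := n) (ca := 2) (by simpa using hn) (by simp) rfl rfl le_rfl).mono ?_ le_rfl
      rintro s' ⟨f, hv⟩
      refine ⟨fun j j1 j2 => by rw [f j j1, f4 j j2, f3 j j1 j2], fun y hy => ?_⟩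
      rw [hv y hy, ← h4 y hy]
      simp
  · have hrow3 : ∀ x ≤ n, s3 .row x = n * x := by
      rw [f3 _ (by simp) (by simp), f1 _ (by simp) (by simp) hA.symm]; exact hrow
    refine (Reaches.fillRow (n := n) (i := x) (ca := 2) (by simpa using hn) (by simp) hx (by simp)
      (by simp) hA hrow3 ?_ rfl le_rfl).mono ?_ le_rfl
    · simp [Expr.reads, hA1.symm]
    · rintro s4 ⟨f4, h4, h5⟩
      refine ⟨fun j j1 j2 j3 => by rw [f4 j j3, f3 j j1 j2, f1 j j1 j2 j3], fun x' hx' y hy => ?_⟩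
      rcases Nat.lt_succ_iff_lt_or_eq.mp hx' with h6 | rfl
      · rw [h5 _ fun j' hj' h => by have := (index_inj hj' hy h).1; omega]
        rw [f3 A hA1 hA2]; exact h1 x' h6 y hy
      · rw [h4 y hy]
        simpa using h3 y hy

/-! ## Codes of vertex sets -/

/-- The code of a set of vertices. -/
def code (n : ℕ) (S : Finset ℕ) : ℕ := ∑ x ∈ S, 2 ^ x * (n + 1) ^ (n + 1)

/-- Binary expansions are unique. The factor (n+1)^(n+1) leaves room below the code for n + 1 digits
in base n + 1, which witness addresses use for values and an offset. -/
theorem code_inj {n : ℕ} {S T : Finset ℕ} (h : code n S = code n T) : S = T := by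
  unfold code at h
  rw [← Finset.sum_mul, ← Finset.sum_mul] at h
  exact Finset.geomSum_injective le_rfl (Nat.eq_of_mul_eq_mul_right (by positivity) h)

/-- The address of the witness for the set `S` and the values `φ` on `B`. -/
def witKey (n : ℕ) (S B : Finset ℕ) (φ : ℕ → ℕ) : ℕ :=
  code n S + ∑ y ∈ B, (φ y + 1) * (n + 1) ^ (y + 1)

/-! ### Uniqueness of expansions in base n + 1. -/

theorem digits_lt {n m : ℕ} {c : ℕ → ℕ} (hc : ∀ y < m, c y ≤ n) :
    ∑ y ∈ Finset.range m, c y * (n + 1) ^ y < (n + 1) ^ m := by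
  induction m with
  | zero => simp
  | succ m ih =>
    rw [Finset.sum_range_succ, pow_succ]
    have h1 := ih fun y hy => hc y (by omega)
    have h2 := Nat.mul_le_mul_right ((n + 1) ^ m) (hc m (by omega))
    nlinarith

theorem digits_inj {n m : ℕ} {c c' : ℕ → ℕ} (hc : ∀ y < m, c y ≤ n) (hc' : ∀ y < m, c' y ≤ n)
    (h : ∑ y ∈ Finset.range m, c y * (n + 1) ^ y = ∑ y ∈ Finset.range m, c' y * (n + 1) ^ y) :
    ∀ y < m, c y = c' y := by
  induction m with
  | zero => simp
  | succ m ih =>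
    rw [Finset.sum_range_succ, Finset.sum_range_succ] at h
    have h1 := digits_lt (c := c) fun y (hy : y < m) => hc y (by omega)
    have h2 := digits_lt (c := c') fun y (hy : y < m) => hc' y (by omega)
    have hm : c m = c' m := by
      have e := congrArg (· / (n + 1) ^ m) h
      simpa [Nat.add_mul_div_right, Nat.div_eq_of_lt h1, Nat.div_eq_of_lt h2] using e
    intro y hy
    rcases Nat.lt_succ_iff_lt_or_eq.mp hy with h3 | rfl
    · refine ih (fun y hy => hc y (by omega)) (fun y hy => hc' y (by omega)) ?_ y h3
      rw [hm] at h; omega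
    · exact hm

/-- Addresses in the table of witnesses determine the set, the values, and the offset. -/
theorem witKey_inj {n : ℕ} {S S' B B' : Finset ℕ} {φ φ' : ℕ → ℕ} {z z' : ℕ}
    (hB : B ⊆ Finset.range n) (hB' : B' ⊆ Finset.range n) (hφ : ∀ y ∈ B, φ y < n)
    (hφ' : ∀ y ∈ B', φ' y < n) (hz : z < n) (hz' : z' < n)
    (h : witKey n S B φ + z = witKey n S' B' φ' + z') :
    S = S' ∧ (B = B' → ∀ y ∈ B, φ y = φ' y) ∧ z = z' := by
  -- Digit 0 is the offset within a row. Digit y + 1 is φ y + 1 on B and 0 off B; it is at most n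
  -- because values are below n.
  let c : Finset ℕ → (ℕ → ℕ) → ℕ → ℕ → ℕ := fun B φ z y =>
    match y with
    | 0 => z
    | y + 1 => if y ∈ B then φ y + 1 else 0
  have hc : ∀ (B : Finset ℕ) (φ : ℕ → ℕ) (z : ℕ), (∀ y ∈ B, φ y < n) → z < n →
      ∀ y < n + 1, c B φ z y ≤ n := by
    intro B φ z h1 h2 y _
    cases y with
    | zero => exact h2.le
    | succ y =>
      simp only [c]
      split_ifs with hy
      · exact h1 y hy
      · omega
  have key : ∀ (S B : Finset ℕ) (φ : ℕ → ℕ) (z : ℕ), B ⊆ Finset.range n →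
      witKey n S B φ + z = (∑ x ∈ S, 2 ^ x) * (n + 1) ^ (n + 1) +
        ∑ y ∈ Finset.range (n + 1), c B φ z y * (n + 1) ^ y := by
    intro S B φ z hB
    rw [Finset.sum_range_succ', witKey, code, Finset.sum_mul]
    have : ∑ y ∈ Finset.range n, c B φ z (y + 1) * (n + 1) ^ (y + 1) =
        ∑ y ∈ B, (φ y + 1) * (n + 1) ^ (y + 1) := by
      rw [← Finset.sum_subset hB]
      · exact Finset.sum_congr rfl fun y hy => by simp [c, hy]
      · intro y _ hy; simp [c, hy]
    rw [this]
    simp [c]; ring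
  rw [key S B φ z hB, key S' B' φ' z' hB'] at h
  have l1 := digits_lt (m := n + 1) (hc B φ z hφ hz)
  have l2 := digits_lt (m := n + 1) (hc B' φ' z' hφ' hz')
  have hS : ∑ x ∈ S, 2 ^ x = ∑ x ∈ S', 2 ^ x := by
    have e := congrArg (· / (n + 1) ^ (n + 1)) h
    rw [Nat.mul_comm (∑ x ∈ S, 2 ^ x), Nat.mul_comm (∑ x ∈ S', 2 ^ x),
      Nat.mul_add_div (by positivity), Nat.mul_add_div (by positivity), Nat.div_eq_of_lt l1,
      Nat.div_eq_of_lt l2] at e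
    simpa using e
  rw [hS] at h
  have hd := digits_inj (hc B φ z hφ hz) (hc B' φ' z' hφ' hz') (by omega)
  refine ⟨Finset.geomSum_injective le_rfl hS, fun hBB y hy => ?_, ?_⟩
  · have h1 := hd (y + 1) (by have := Finset.mem_range.mp (hB hy); omega)
    simpa [c, hy, ← hBB] using h1
  · simpa [c] using hd 0 (by omega)

open Expr in
/-- Powers of `n + 1` and the weights of the vertices in codes. -/
def weights : Cmd :=
  .seq (.set .pw (.const 0) (.add (.var .n) (.const 1))) <|
  .seq (.loop .y (.var .n) (.set .pw (.add (.var .y) (.const 1))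
    (.sum .t (.add (.var .n) (.const 1)) (.get .pw (.var .y))))) <|
  .seq (.set .pw2 (.const 0) (.get .pw (.var .n))) <|
  .loop .y (.var .n) (.set .pw2 (.add (.var .y) (.const 1))
    (.add (.get .pw2 (.var .y)) (.get .pw2 (.var .y))))

theorem weights_spec {I : ℕ → ℕ} {n : ℕ} {env : Env} {s : Store} (hn : env .n = n)
    (hn1 : 1 ≤ n) :
    Reaches I env weights s (fun s' => (∀ j, j ≠ .pw → j ≠ .pw2 → s' j = s j) ∧
      (∀ y ≤ n, s' .pw y = (n + 1) ^ (y + 1)) ∧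
      ∀ y ≤ n, s' .pw2 y = 2 ^ y * (n + 1) ^ (n + 1)) (100 * n ^ 4) := by
  refine (Reaches.seq (R := fun s' => (∀ j, j ≠ .pw → s' j = s j) ∧ s' .pw 0 = n + 1) (b := 5)
    (b' := (2 + n * (12 + 3 * n)) + (4 + (2 + n * 10))) ?_ fun s1 ⟨f1, h1⟩ => ?_).mono
    (fun _ h => h) ?_
  · refine Reaches.set ⟨fun j hj => by simp [Store.set, hj], by simp [Store.set, hn]⟩ le_rfl le_rfl
  · refine Reaches.seq (R := fun s' => (∀ j, j ≠ .pw → s' j = s j) ∧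
      ∀ y ≤ n, s' .pw y = (n + 1) ^ (y + 1)) (b := 2 + n * (12 + 3 * n)) ?_ fun s2 ⟨f2, h2⟩ => ?_
    · refine (Reaches.loop (fun m s' => (∀ j, j ≠ .pw → s' j = s j) ∧
        ∀ y ≤ m, s' .pw y = (n + 1) ^ (y + 1)) (m := n) (cN := 1) (b := 11 + 3 * n)
        (by simpa using hn) le_rfl
        ⟨f1, fun y hy => by obtain rfl : y = 0 := by omega
                            simpa using h1⟩ ?_).mono (fun _ h => h) (by nlinarith)
      rintro m hm s3 ⟨f3, h3⟩
      refine (Reaches.set (ca := 3) (cb := 7 + 3 * n) ?_ le_rfl ?_).mono (fun _ h => h) (by omega)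
      · refine ⟨fun j hj => by rw [Store.set_of_ne hj, f3 j hj], fun y hy => ?_⟩
        simp only [Expr.eval_add, Expr.eval_var, Expr.eval_const, Function.update_self]
        rw [Store.set_self]
        split_ifs with hym
        · simp [Expr.eval, hn, h3 m le_rfl, hym, pow_succ]; ring
        · exact h3 y (by omega)
      · refine (Expr.sum_cost_le (m := n + 1) (cN := 3) (b := 2) (by simp [hn]) le_rfl
          fun i _ => le_rfl).trans ?_
        omega
    · refine Reaches.seq (R := fun s' => (∀ j, j ≠ .pw2 → s' j = s2 j) ∧
        s' .pw2 0 = (n + 1) ^ (n + 1)) (b := 4) ?_ fun s3 ⟨f3, h3⟩ => ?_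
      · exact Reaches.set ⟨fun j hj => by simp [Store.set, hj],
          by simp [Store.set, hn, h2 n le_rfl]⟩ le_rfl le_rfl
      · refine (Reaches.loop (fun m s' => (∀ j, j ≠ .pw2 → s' j = s2 j) ∧
          ∀ y ≤ m, s' .pw2 y = 2 ^ y * (n + 1) ^ (n + 1)) (m := n) (cN := 1) (b := 9)
          (by simpa using hn) le_rfl
          ⟨f3, fun y hy => by obtain rfl : y = 0 := by omega
                              simpa using h3⟩ ?_).mono ?_ (by omega)
        · rintro m hm s4 ⟨f4, h4⟩
          refine Reaches.set (ca := 3) (cb := 5) ?_ le_rfl le_rfl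
          refine ⟨fun j hj => by rw [Store.set_of_ne hj, f4 j hj], fun y hy => ?_⟩
          simp only [Expr.eval_add, Expr.eval_var, Expr.eval_const, Function.update_self]
          rw [Store.set_self]
          split_ifs with hym
          · simp [h4 m le_rfl, hym, pow_succ]; ring
          · exact h4 y (by omega)
        · rintro s4 ⟨f4, h4⟩
          exact ⟨fun j j1 j2 => by rw [f4 j j2, f2 j j1], by rw [f4 .pw (by simp)]; exact h2, h4⟩
  · have h1 : 1 ≤ n ^ 4 := Nat.one_le_pow _ _ hn1
    have h2 : n ≤ n ^ 4 := Nat.le_self_pow (by norm_num) n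
    have h3 : n ^ 2 ≤ n ^ 4 := Nat.pow_le_pow_right hn1 (by norm_num)
    nlinarith

/-- The code of the set whose indicator is array `A`. -/
def Expr.codeOf (A : Arr) : Expr :=
  .sum .t (.var .n) (.ite (.get A (.var .t)) (.get .pw2 (.var .t)) (.const 0))

theorem eval_codeOf {I : ℕ → ℕ} {n : ℕ} {env : Env} {s : Store} (hn : env .n = n)
    (hp : ∀ y ≤ n, s .pw2 y = 2 ^ y * (n + 1) ^ (n + 1)) {A : Arr} {S : Finset ℕ}
    (hS : S ⊆ Finset.range n) (hA : Ind n (s A) S) :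
    (Expr.codeOf A).eval I env s = code n S := by
  simp only [Expr.codeOf, Expr.eval, hn, code, Function.update_self]
  rw [← Finset.sum_subset hS]
  · refine Finset.sum_congr rfl fun x hx => ?_
    have hxn := Finset.mem_range.mp (hS hx)
    rw [if_pos ((hA x hxn).mpr hx), hp x hxn.le]
  · intro x hx hxS
    rw [if_neg fun h => hxS ((hA x (Finset.mem_range.mp hx)).mp h)]

/-! ## Lists of vertices near a vertex -/

open Expr in
/-- Row `x` of `gbl` lists the vertices near `x` according to matrix `eg`. -/
def nearLists : Cmd :=
  .loop .x (.var .n) <| .loop .k (.var .n) <| .set .gbl (ix (.var .x) (.var .k))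
    (nth (.get .eg (ix (.var .x) (.var .y))) (.get .eg (ix (.var .x) (.var .z))) (.var .k))

open Classical in
-- Positions behind the end of a list hold 0. So every position names a vertex, and an assignment
-- read from the lists always takes values below n.
theorem nearLists_spec {I : ℕ → ℕ} {n d : ℕ} {g : ℕ → ℕ → Prop}
    {env : Env} {s : Store} (hn : env .n = n) (hn1 : 1 ≤ n)
    (hrow : ∀ x ≤ n, s .row x = n * x) (hE : NearMat n d g (s .eg)) :
    Reaches I env nearLists s (fun s' => (∀ j, j ≠ .gbl → s' j = s j) ∧
      (∀ x < n, ∀ k < n, s' .gbl (n * x + k) < n) ∧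
      ∀ x < n, ∀ y < n, Near g d x y → ∃ k < Nat.count (Near g d x) n, s' .gbl (n * x + k) = y)
      (100 * n ^ 4) := by
  refine (Reaches.fill2 (ca := 2 + n * (30 + (2 + n * 40))) hn (by simp) (by simp) (by simp)
        (by simp) hrow rfl rfl ?_).mono ?_ ?_
  · simp [Expr.bound, Expr.nth, Expr.count, Expr.ix, Expr.lt, Expr.and, Expr.eq, Expr.not]
    nlinarith
  · rintro s3 ⟨f3, h3⟩
    have hv : ∀ x < n, ∀ k < n, s3 .gbl (n * x + k) = nthVal (Near g d x) n k := by
      intro x hx k hk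
      rw [h3 x hx k hk]
      exact Expr.eval_nth (by simpa using hn)
        (fun i hi => by simp [hrow x hx.le, hE x hx i hi])
        (fun i _ j hj => by simp [hrow x hx.le, hE x hx j hj])
        (fun i => by simp)
    refine ⟨f3, fun x hx k hk => ?_, fun x hx y hy hxy => ?_⟩
    · rw [hv x hx k hk]; exact nthVal_lt hn1
    · have hlt : Nat.count (Near g d x) y < Nat.count (Near g d x) n :=
        Nat.count_strict_mono hxy hy
      exact ⟨_, hlt, by rw [hv x hx _ (hlt.trans_le (Nat.count_le _)), nthVal_count hy hxy]⟩
  · have h1 : 1 ≤ n ^ 4 := Nat.one_le_pow _ _ hn1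
    have h2 : n ≤ n ^ 4 := Nat.le_self_pow (by norm_num) n
    have h3 : n ^ 2 ≤ n ^ 4 := Nat.pow_le_pow_right hn1 (by norm_num)
    have h4 : n ^ 3 ≤ n ^ 4 := Nat.pow_le_pow_right hn1 (by norm_num)
    nlinarith

/-! ## Splitting vertices -/

/-- Each component of a connected set minus a vertex has a neighbor of that vertex. -/
theorem exists_adj_of_isComp {n : ℕ} {h : ℕ → ℕ → Prop} (H : IsGraphOn n h) {C D : Finset ℕ}
    {v : ℕ} (hC : ∀ x ∈ C, comp h C x = C) (hv : v ∈ C) (hD : IsComp h (C.erase v) D) :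
    ∃ w ∈ D, h v w := by
  by_contra! hcon
  obtain ⟨x, hx⟩ := hD.nonempty
  have hxC : x ∈ C := Finset.erase_subset _ _ (hD.subset hx)
  -- If D had no neighbor of v, it would be closed under adjacency in C and hence equal C, although
  -- v is in C and not in D.
  have hsub : comp h C x ⊆ D := comp_subset_of_closed hx fun a ha b hb hab =>
    hD.closed ha hab (Finset.mem_erase.mpr ⟨fun hbv => hcon a ha (H.symm (hbv ▸ hab)), hb⟩)
  rw [hC x hxC] at hsub
  exact (Finset.mem_erase.mp (hD.subset (hsub hv))).1 rfl

/-- Entry `code n C` of the table is `0` or names a vertex `v` of `C`, such that the components of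
`C \ {v}` have nonzero entries. -/
def SplitTable (n α : ℕ) (h : ℕ → ℕ → Prop) (gd : ℕ → ℕ) : Prop :=
  ∀ C ⊆ Finset.range n, gd (code n C) ≠ 0 → ∃ v ∈ C, gd (code n C) = v + 1 ∧
    (bdry n h C).card ≤ α ∧ ∀ D, IsComp h (C.erase v) D → gd (code n D) ≠ 0

/-- Entries are set or replaced but never cleared, so a justification that refers to nonzero entries
of smaller sets stays valid. -/
theorem SplitTable.update {n α : ℕ} {h : ℕ → ℕ → Prop} {gd : ℕ → ℕ} (hT : SplitTable n α h gd)
    {C : Finset ℕ} {v : ℕ} (hv : v ∈ C) (hα : (bdry n h C).card ≤ α)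
    (hD : ∀ D, IsComp h (C.erase v) D → gd (code n D) ≠ 0) :
    SplitTable n α h (Function.update gd (code n C) (v + 1)) := by
  have mono : ∀ a, gd a ≠ 0 → Function.update gd (code n C) (v + 1) a ≠ 0 := by
    intro a ha
    rw [Function.update_apply]; split_ifs <;> simp [ha]
  intro C' hC' h0
  by_cases he : C' = C
  · subst he
    exact ⟨v, hv, by simp, hα, fun D h1 => mono _ (hD D h1)⟩
  · have hne : code n C' ≠ code n C := fun h => he (code_inj h)
    rw [Function.update_of_ne hne] at h0 ⊢
    obtain ⟨v', h1, h2, h3, h4⟩ := hT C' hC' h0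
    exact ⟨v', h1, h2, h3, fun D h5 => mono _ (h4 D h5)⟩

open Expr in
/-- Look for a vertex that splits the set in `cc` into sets that have been split. -/
def trySplit : Cmd :=
  .loop .v (.var .n) <| .ite (.get .cc (.var .v))
    (.seq (.loop .y (.var .n) (.set .s2 (.var .y)
      (and (.get .cc (.var .y)) (not (eq (.var .y) (.var .v)))))) <|
    .seq (.set .fl (.const 0) (.const 1)) <|
    -- As C is connected, every component of C \ {v} contains a neighbor of v, so searches from the
    -- neighbors of v find all of them. Finding one twice does no harm.
    .seq (.loop .k (.get .hd (.var .v)) <| .letE .w (.get .hn (ix (.var .v) (.var .k))) <|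
      .ite (.get .s2 (.var .w))
        (.seq (bfs .s2 .w) <|
          .ite (.get .gd (codeOf .mk)) .skip (.set .fl (.const 0) (.const 0)))
        .skip) <|
    .ite (.get .fl (.const 0)) (.set .gd (codeOf .cc) (.add (.var .v) (.const 1))) .skip)
    .skip

/-- Progress is measured against the table at the start. The table may change during the loop over
v, but nonzero entries remain nonzero, so a vertex that splits C at the start still passes the test
when its turn comes. -/
theorem trySplit_spec {I : ℕ → ℕ} {n Δ α : ℕ} {g h : ℕ → ℕ → Prop} (hI : Ctx I n g h) {env : Env}
    {s : Store} (hn : env .n = n) (hL : AdjLists n Δ h (s .row) (s .hd) (s .hn))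
    (hp : ∀ y ≤ n, s .pw2 y = 2 ^ y * (n + 1) ^ (n + 1)) {C : Finset ℕ}
    (hC : C ⊆ Finset.range n) (hCc : Ind n (s .cc) C) (hconn : ∀ x ∈ C, comp h C x = C)
    (hα : (bdry n h C).card ≤ α) (hT : SplitTable n α h (s .gd)) :
    Reaches I env trySplit s (fun s' =>
      (∀ j, j ≠ .mk → j ≠ .qu → j ≠ .ln → j ≠ .s2 → j ≠ .fl → j ≠ .gd → s' j = s j) ∧
      SplitTable n α h (s' .gd) ∧ (∀ a, s .gd a ≠ 0 → s' .gd a ≠ 0) ∧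
      ((∃ v ∈ C, ∀ D, IsComp h (C.erase v) D → s .gd (code n D) ≠ 0) →
        s' .gd (code n C) ≠ 0)) (200 * (n ^ 2 * (Δ + 1) ^ 2) + 2) := by
  let b := 50 * (n * (Δ + 1))
  have hb : 2 + n * (1 + (3 + ((2 + n * 18) + (3 + ((3 + Δ * (1 + (6 + (3 + (b + (8 + n * 7)))))) +
      (10 + n * 7)))))) ≤ 200 * (n ^ 2 * (Δ + 1) ^ 2) + 2 := by
    rcases Nat.eq_zero_or_pos n with rfl | hn0
    · simp
    obtain ⟨m, rfl⟩ : ∃ m, n = m + 1 := ⟨n - 1, by omega⟩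
    simp only [b]
    ring_nf
    omega
  refine (Reaches.loop (fun v s' =>
    (∀ j, j ≠ .mk → j ≠ .qu → j ≠ .ln → j ≠ .s2 → j ≠ .fl → j ≠ .gd → s' j = s j) ∧
      SplitTable n α h (s' .gd) ∧ (∀ a, s .gd a ≠ 0 → s' .gd a ≠ 0) ∧
      ((∃ v' < v, v' ∈ C ∧ ∀ D, IsComp h (C.erase v') D → s .gd (code n D) ≠ 0) →
        s' .gd (code n C) ≠ 0)) (m := n) (cN := 1) (by simpa using hn) le_rfl
    ⟨fun _ _ _ _ _ _ _ => rfl, hT, fun _ h => h, by rintro ⟨_, h0, _⟩; omega⟩ ?_).mono ?_ hb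
  · rintro v hv s1 ⟨f1, T1, m1, c1⟩
    have k1 : ∀ j, j ∈ [Arr.row, .hd, .hn, .cc, .pw2] → s1 j = s j := by
      intro j hj
      apply f1 <;> (rintro rfl; simp at hj)
    refine (Reaches.ite (be := 2) le_rfl (fun hc => ?_) (fun hc => ?_)).mono (fun _ h => h) le_rfl
    swap
    · refine (Reaches.skip ⟨f1, T1, m1, ?_⟩).mono (fun _ h => h) (by omega)
      rintro ⟨v', h1, h2, h3⟩
      rcases Nat.lt_succ_iff_lt_or_eq.mp h1 with h4 | rfl
      · exact c1 ⟨v', h4, h2, h3⟩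
      · exact absurd ((hCc v' hv).mpr h2) (by simpa [k1] using hc)
    have hvC : v ∈ C := (hCc v hv).mp (by simpa [k1] using hc)
    refine Reaches.seq (b := 2 + n * 18) (R := fun s' => (∀ j, j ≠ .s2 → s' j = s1 j) ∧
      Ind n (s' .s2) (C.erase v)) ?_ fun s2 ⟨f2, h2⟩ => ?_
    · refine (Reaches.fill (n := n) (ca := 15) (by simpa using hn) (by simp) rfl rfl
        (by simp [Expr.bound, Expr.eq, Expr.not, Expr.and])).mono ?_ le_rfl
      rintro s' ⟨f, hs⟩
      refine ⟨f, fun x hx => ?_⟩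
      rw [hs x hx]
      simp [k1, hCc x hx, and_comm]
    refine Reaches.seq (b := 3) (R := fun s' => s' = s2.set .fl 0 1)
      (Reaches.set (by simp) le_rfl le_rfl) ?_
    rintro _ rfl
    refine Reaches.seq (b := 3 + Δ * (1 + (6 + (3 + (b + (8 + n * 7)))))) (R := fun s' =>
      (∀ j, j ≠ .mk → j ≠ .qu → j ≠ .ln → j ≠ .fl → s' j = s2 j) ∧
      (0 < s' .fl 0 ↔ ∀ D, IsComp h (C.erase v) D → s1 .gd (code n D) ≠ 0)) ?_
      fun s3 ⟨f3, h3⟩ => ?_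
    · refine (Reaches.loop (fun k s' => (∀ j, j ≠ .mk → j ≠ .qu → j ≠ .ln → j ≠ .fl → s' j = s2 j) ∧
        (0 < s' .fl 0 ↔ ∀ j < k, s .hn (n * v + j) ∈ C.erase v →
          s1 .gd (code n (comp h (C.erase v) (s .hn (n * v + j)))) ≠ 0)) (m := s .hd v) (cN := 2)
        (b := 6 + (3 + (b + (8 + n * 7)))) ?_ le_rfl ?_ ?_).mono ?_ ?_
      · simp [Store.set, f2, k1]
      · exact ⟨fun j _ _ _ h4 => by rw [Store.set_of_ne h4], by simp [Store.set]⟩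
      · rintro k hk s3 ⟨f3, h3⟩
        have hvw := hL.adj v hv k hk
        set w := s .hn (n * v + k) with hw
        have hwn := hI.hG.lt_right hvw
        have k3 : ∀ j, j ∈ [Arr.row, .hd, .hn, .cc, .pw2] → s3 j = s j := by
          intro j hj
          rw [f3 j, f2 j, k1 j hj] <;> (rintro rfl; simp at hj)
        have g3 : s3 .gd = s1 .gd := by rw [f3 _ (by simp) (by simp) (by simp) (by simp), f2 _ (by simp)]
        have e3 : s3 .s2 = s2 .s2 := f3 _ (by simp) (by simp) (by simp) (by simp)
        refine (Reaches.letE (v := w) (ca := 5) (b := 3 + (b + (8 + n * 7))) ?_ le_rfl ?_).mono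
          (fun _ h => h) (by omega)
        · simp [k3, hL.row v hv.le, hw]
        refine (Reaches.ite (be := 2) (b := b + (8 + n * 7)) le_rfl (fun hc2 => ?_)
          (fun hc2 => ?_)).mono (fun _ h => h) le_rfl
        · have hwC : w ∈ C.erase v := (h2 w hwn).mp (by simpa [e3] using hc2)
          refine Reaches.seq (bfs_spec hI (by simpa using hn) (by simpa [k3] using hL)
            (by simp) (by simp) (by simp) ((Finset.erase_subset v C).trans hC) (by rw [e3]; exact h2)
            (by simp) hwC) fun s4 ⟨f4, h4⟩ => ?_
          have hcode : ∀ env : Env, env .n = n → (Expr.codeOf .mk).eval I env s4 =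
              code n (comp h (C.erase v) w) := fun env he => eval_codeOf he
            (by rw [f4 _ (by simp) (by simp) (by simp)]; simpa [k3] using hp)
            (comp_subset.trans ((Finset.erase_subset v C).trans hC)) h4
          have g4 : s4 .gd = s1 .gd := by rw [f4 _ (by simp) (by simp) (by simp), g3]
          have l4 : s4 .fl = s3 .fl := f4 _ (by simp) (by simp) (by simp)
          refine (Reaches.ite (be := 3 + n * 7) (b := 3) ?_ (fun hc3 => ?_) (fun hc3 => ?_)).mono
            (fun _ h => h) (by omega)
          · exact Expr.cost_le (n := n) (by simpa using hn) rfl (by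
              simp [Expr.codeOf, Expr.bound]; omega)
          · refine (Reaches.skip ⟨fun j j1 j2 j3 j4 => by rw [f4 j j1 j2 j3, f3 j j1 j2 j3 j4],
              ?_⟩).mono (fun _ h => h) (by omega)
            rw [Expr.eval_get, hcode _ (by simpa using hn), g4] at hc3
            rw [l4, h3]
            refine ⟨fun h5 j hj => ?_, fun h5 j hj => h5 j (by omega)⟩
            rcases Nat.lt_succ_iff_lt_or_eq.mp hj with h6 | rfl
            · exact h5 j h6
            · intro _; exact hc3.ne'
          · rw [Expr.eval_get, hcode _ (by simpa using hn), g4] at hc3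
            refine Reaches.set ⟨fun j j1 j2 j3 j4 => by
              rw [Store.set_of_ne j4, f4 j j1 j2 j3, f3 j j1 j2 j3 j4], ?_⟩ le_rfl le_rfl
            simp only [Expr.eval_const]
            rw [Store.set_self, if_pos rfl]
            refine ⟨fun h5 => absurd h5 (by simp), fun h5 => absurd (h5 k (by omega) hwC) (by
              rw [← hw]; omega)⟩
        · have hwC : w ∉ C.erase v := fun h5 => hc2 (by simpa [e3] using (h2 w hwn).mpr h5)
          refine (Reaches.skip ⟨f3, ?_⟩).mono (fun _ h => h) (by omega)
          rw [h3]
          refine ⟨fun h5 j hj => ?_, fun h5 j hj => h5 j (by omega)⟩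
          rcases Nat.lt_succ_iff_lt_or_eq.mp hj with h6 | rfl
          · exact h5 j h6
          · intro h6; exact absurd h6 hwC
      · rintro s3 ⟨f3, h3⟩
        refine ⟨f3, h3.trans ⟨fun h4 D hD => ?_, fun h4 j hj h5 => h4 _ (isComp_comp h5)⟩⟩
        obtain ⟨w, hw, hvw⟩ := exists_adj_of_isComp hI.hG hconn hvC hD
        obtain ⟨k, hk, rfl⟩ := hL.ex v hv w hvw
        rw [hD.eq_comp hI.hG hw]
        exact h4 k hk (hD.subset hw)
      · have := Nat.mul_le_mul_right (1 + (6 + (3 + (b + (8 + n * 7))))) (hL.le v hv)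
        omega
    · have g3 : s3 .gd = s1 .gd := by rw [f3 _ (by simp) (by simp) (by simp) (by simp), f2 _ (by simp)]
      have fr : ∀ j, j ≠ .mk → j ≠ .qu → j ≠ .ln → j ≠ .s2 → j ≠ .fl → j ≠ .gd → s3 j = s j :=
        fun j j1 j2 j3 j4 j5 j6 => by rw [f3 j j1 j2 j3 j5, f2 j j4, f1 j j1 j2 j3 j4 j5 j6]
      refine (Reaches.ite (be := 2) (b := 6 + n * 7) le_rfl (fun hc3 => ?_) (fun hc3 => ?_)).mono
        (fun _ h => h) (by omega)
      · have hD := h3.mp (by simpa using hc3)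
        refine (Reaches.set (ca := 2 + n * 7) (cb := 3) ?_ ?_ le_rfl).mono (fun _ h => h) (by omega)
        · rw [eval_codeOf (n := n) (by simpa using hn)
            (by rw [fr _ (by simp) (by simp) (by simp) (by simp) (by simp) (by simp)]; exact hp) hC
            (by rw [fr _ (by simp) (by simp) (by simp) (by simp) (by simp) (by simp)]; exact hCc)]
          have hu := T1.update hvC hα hD
          have e : (s3.set .gd (code n C) (v + 1)) .gd =
            Function.update (s1 .gd) (code n C) (v + 1) := by simp [Store.set, g3]
          simp only [Expr.eval_add, Expr.eval_var, Function.update_self, Expr.eval_const]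
          rw [e]
          refine ⟨fun j j1 j2 j3 j4 j5 j6 => by rw [Store.set_of_ne j6, fr j j1 j2 j3 j4 j5 j6], hu,
            fun a ha => ?_, fun _ => by simp⟩
          rw [Function.update_apply]; split_ifs
          · simp
          · exact m1 a ha
        · exact Expr.cost_le (n := n) (by simpa using hn) rfl (by
              simp [Expr.codeOf, Expr.bound])
      · refine (Reaches.skip ⟨fr, by rw [g3]; exact T1, by rw [g3]; exact m1, ?_⟩).mono
          (fun _ h => h) (by omega)
        rw [g3]
        rintro ⟨v', h4, h5, h6⟩
        rcases Nat.lt_succ_iff_lt_or_eq.mp h4 with h7 | rfl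
        · exact c1 ⟨v', h7, h5, h6⟩
        · exact absurd (h3.mpr fun D hD => m1 _ (h6 D hD)) (by simpa using hc3)
  · rintro s' ⟨f, T, m, c⟩
    exact ⟨f, T, m, fun ⟨v, h1, h2⟩ => c ⟨v, by simpa using hC h1, h1, h2⟩⟩

open Expr in
/-- Try to split the components next to the vertices in `dg` that arise when those vertices are
removed. -/
def tupleStep : Cmd :=
  .seq (.loop .x (.var .n) (.set .s1 (.var .x)
    (not (.sum .p (.var .al) (eq (.get .dg (.var .p)) (.var .x)))))) <|
  .loop .p (.var .al) <| .loop .k (.get .hd (.get .dg (.var .p))) <|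
    .letE .u (.get .hn (ix (.get .dg (.var .p)) (.var .k))) <|
    .ite (.get .s1 (.var .u))
      (.seq (bfs .s1 .u) <|
        .seq (.loop .y (.var .n) (.set .cc (.var .y) (.get .mk (.var .y)))) trySplit)
      .skip

/-- What the components of the complement of `X` gain when the step for `X` is carried out. -/
def SplitProgress (n : ℕ) (h : ℕ → ℕ → Prop) (X : Finset ℕ) (gd gd' : ℕ → ℕ) : Prop :=
  ∀ u, u ∈ Finset.range n \ X → (∃ x ∈ X, h x u) →
    (∃ v ∈ comp h (Finset.range n \ X) u,
      ∀ D, IsComp h ((comp h (Finset.range n \ X) u).erase v) D → gd (code n D) ≠ 0) →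
    gd' (code n (comp h (Finset.range n \ X) u)) ≠ 0

/-- A neighbor outside X would belong to the component. As X is the image of an α-tuple, every set
considered by `tupleStep` has a boundary of at most α vertices, whatever the structure of the graph.
-/
theorem bdry_comp_compl_subset {n : ℕ} {h : ℕ → ℕ → Prop} (H : IsGraphOn n h) {X : Finset ℕ}
    {u : ℕ} : bdry n h (comp h (Finset.range n \ X) u) ⊆ X := by
  intro x hx
  obtain ⟨h1, h2, y, hy, hxy⟩ := mem_bdry.mp hx
  by_contra hxX
  exact h2 (comp_closed hy (H.symm hxy) (by simp [h1, hxX]))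

/-- There are at most αΔ starting vertices next to the tuple. For each of them, up to n splitting
vertices with Δ searches of cost n(Δ+1) each are tried; this accounts for α n² (Δ+1)³. -/
theorem tupleStep_spec {I : ℕ → ℕ} {n Δ α : ℕ} {g h : ℕ → ℕ → Prop} (hI : Ctx I n g h) {env : Env}
    {s : Store} (hn : env .n = n) (hal : env .al = α) (hα1 : 1 ≤ α) (hn1 : 1 ≤ n)
    (hL : AdjLists n Δ h (s .row) (s .hd) (s .hn))
    (hp : ∀ y ≤ n, s .pw2 y = 2 ^ y * (n + 1) ^ (n + 1)) (hT : SplitTable n α h (s .gd))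
    {τ : ℕ → ℕ} (hτ : ∀ p < α, τ p < n) (hdg : ∀ p < α, s .dg p = τ p) :
    Reaches I env tupleStep s (fun s' =>
      (∀ j, j ≠ .mk → j ≠ .qu → j ≠ .ln → j ≠ .s1 → j ≠ .s2 → j ≠ .fl → j ≠ .gd → j ≠ .cc →
        s' j = s j) ∧
      SplitTable n α h (s' .gd) ∧ (∀ a, s .gd a ≠ 0 → s' .gd a ≠ 0) ∧
      SplitProgress n h ((Finset.range α).image τ) (s .gd) (s' .gd))
      (400 * (α * n ^ 2 * (Δ + 1) ^ 3)) := by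
  set X := (Finset.range α).image τ with hX
  set A := Finset.range n \ X with hA
  have hAn : A ⊆ Finset.range n := Finset.sdiff_subset
  let b := 50 * (n * (Δ + 1))
  let b2 := 200 * (n ^ 2 * (Δ + 1) ^ 2) + 2
  have hb : (2 + n * (3 + (4 + α * 20))) + (2 + α * (1 + (4 + Δ * (1 + (8 + (3 +
      (b + ((2 + n * 5) + b2)))))))) ≤ 400 * (α * n ^ 2 * (Δ + 1) ^ 3) := by
    obtain ⟨m, rfl⟩ : ∃ m, n = m + 1 := ⟨n - 1, by omega⟩
    obtain ⟨a, rfl⟩ : ∃ m, α = m + 1 := ⟨α - 1, by omega⟩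
    simp only [b, b2]
    ring_nf
    omega
  refine (Reaches.seq (b := 2 + n * (3 + (4 + α * 20))) (R := fun s' => (∀ j, j ≠ .s1 → s' j = s j) ∧
    Ind n (s' .s1) A) ?_ fun s1 ⟨f1, h1⟩ => ?_).mono (fun _ h => h) hb
  · refine (Reaches.tabulate (m := n) (cN := 1) (ci := 1) (ca := 4 + α * 20) (f := id)
      (by simpa using hn) le_rfl rfl rfl (fun i _ => by simp)
      (fun i _ j _ h => h) (fun i _ s => le_rfl) (fun i hi s' _ => ?_)).mono ?_ (by
        apply le_of_eq; ring)
    · have := Expr.sum_cost_le (I := I) (env := Function.update env .x i) (s := s') (y := .p)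
        (N := .var .al) (a := Expr.eq (.get .dg (.var .p)) (.var .x)) (m := α) (cN := 1) (b := 15)
        (by simpa using hal) le_rfl (fun i _ => by simp [Expr.cost, Expr.eq, Expr.not])
      simp only [Expr.cost, Expr.not] at this ⊢
      omega
    · rintro s' ⟨f, h2, -⟩
      refine ⟨f, fun x hx => ?_⟩
      have := h2 x hx
      simp only [id] at this
      rw [this]
      simp only [Expr.not_pos, Expr.sum_pos, Expr.eq_pos, Expr.eval_get, Expr.eval_var, hA, hX]
      simp [hal, hx]
      exact forall₂_congr fun p hp => by rw [hdg p hp]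
  have frA : ∀ (s' : Store), (∀ j, j ≠ .mk → j ≠ .qu → j ≠ .ln → j ≠ .s2 → j ≠ .fl → j ≠ .gd →
      j ≠ .cc → s' j = s1 j) → ∀ j, j ∈ [Arr.row, .hd, .hn, .pw2, .dg] → s' j = s j := by
    intro s' f j hj
    rw [f j, f1 j] <;> (rintro rfl; simp at hj)
  let Fr : Store → Prop := fun s' => ∀ j, j ≠ .mk → j ≠ .qu → j ≠ .ln → j ≠ .s2 → j ≠ .fl →
      j ≠ .gd → j ≠ .cc → s' j = s1 j
  let Base : Store → Prop := fun s' => Fr s' ∧ SplitTable n α h (s' .gd) ∧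
    ∀ a, s .gd a ≠ 0 → s' .gd a ≠ 0
  let Done : ℕ → Store → Prop := fun u s' => (∃ v ∈ comp h A u,
      ∀ D, IsComp h ((comp h A u).erase v) D → s .gd (code n D) ≠ 0) →
    s' .gd (code n (comp h A u)) ≠ 0
  have g1 : s1 .gd = s .gd := f1 _ (by simp)
  refine (Reaches.loop (fun p s' => Base s' ∧ ∀ p' < p, ∀ u ∈ A, h (τ p') u → Done u s')
      (m := α) (cN := 1) (by simpa using hal) le_rfl
      ⟨⟨fun _ _ _ _ _ _ _ _ => rfl, by rwa [g1], by rw [g1]; exact fun _ h => h⟩,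
        by simp⟩ ?_).mono ?_ le_rfl
  · rintro p hpα s2 ⟨B2, D2⟩
    have k2 := frA s2 B2.1
    have hτp := hτ p hpα
    refine (Reaches.loop (fun k s' => Base s' ∧ (∀ p' < p, ∀ u ∈ A, h (τ p') u → Done u s') ∧
      ∀ j < k, s .hn (n * τ p + j) ∈ A → Done (s .hn (n * τ p + j)) s') (m := s .hd (τ p)) (cN := 3)
      (b := 8 + (3 + (b + ((2 + n * 5) + b2)))) (by simp [k2, hdg p hpα]) le_rfl
      ⟨B2, D2, by simp⟩ ?_).mono ?_ ?_
    · rintro k hk s3 ⟨B3, D3, E3⟩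
      have k3 := frA s3 B3.1
      have hvw := hL.adj _ hτp k hk
      set u := s .hn (n * τ p + k) with hu
      have hun := hI.hG.lt_right hvw
      refine (Reaches.letE (v := u) (ca := 6) (b := 3 + (b + ((2 + n * 5) + b2))) ?_ le_rfl ?_).mono
          (fun _ h => h) (by omega)
      · simp [k3, hdg p hpα, hL.row _ hτp.le, hu]
      have es1 : s3 .s1 = s1 .s1 := B3.1 _ (by simp) (by simp) (by simp) (by simp) (by simp)
        (by simp) (by simp)
      refine (Reaches.ite (be := 2) (b := b + ((2 + n * 5) + b2)) le_rfl (fun hc2 => ?_)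
          (fun hc2 => ?_)).mono (fun _ h => h) le_rfl
      · have huA : u ∈ A := (h1 u hun).mp (by simpa [es1] using hc2)
        have hCn : comp h A u ⊆ Finset.range n := comp_subset.trans hAn
        refine Reaches.seq (bfs_spec hI (by simpa using hn) (by simpa [k3] using hL)
            (by simp) (by simp) (by simp) hAn (by rw [es1]; exact h1)
            (by simp) huA) fun s4 ⟨f4, h4⟩ => ?_
        refine Reaches.seq (R := fun s' => (∀ j, j ≠ .cc → s' j = s4 j) ∧
          Ind n (s' .cc) (comp h A u)) (b := 2 + n * 5) ?_ fun s5 ⟨f5, h5⟩ => ?_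
        · refine (Reaches.fill (n := n) (ca := 2) (by simpa using hn) (by simp) rfl rfl
            le_rfl).mono ?_ le_rfl
          rintro s' ⟨f, hs⟩
          refine ⟨f, fun x hx => ?_⟩
          rw [hs x hx, ← h4 x hx]
          simp
        have k5 : ∀ j, j ∈ [Arr.row, .hd, .hn, .pw2, .dg] → s5 j = s j := by
          intro j hj
          rw [f5 j, f4 j, k3 j hj] <;> (rintro rfl; simp at hj)
        have g5 : s5 .gd = s3 .gd := by rw [f5 _ (by simp), f4 _ (by simp) (by simp) (by simp)]
        have hcard : (bdry n h (comp h A u)).card ≤ α :=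
          (Finset.card_le_card (bdry_comp_compl_subset hI.hG)).trans
            (Finset.card_image_le.trans (by simp))
        refine (trySplit_spec hI (C := comp h A u) (α := α) (by simpa using hn)
          (by simpa [k5] using hL) (by simpa [k5] using hp) hCn h5
          (fun x hx => (isComp_comp huA).connected hI.hG hx) hcard (by rw [g5]; exact B3.2.1)).mono
          ?_ le_rfl
        rintro s6 ⟨f6, T6, m6, c6⟩
        rw [g5] at m6 c6
        have hmono : ∀ u, Done u s3 → Done u s6 := fun u hD hs => m6 _ (hD hs)
        refine ⟨⟨fun j j1 j2 j3 j4 j5 j6 j7 => by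
            rw [f6 j j1 j2 j3 j4 j5 j6, f5 j j7, f4 j j1 j2 j3, B3.1 j j1 j2 j3 j4 j5 j6 j7],
            T6, fun a ha => m6 a (B3.2.2 a ha)⟩,
          fun p' hp' u hu hpu => hmono u (D3 p' hp' u hu hpu), fun j hj hjA => ?_⟩
        rcases Nat.lt_succ_iff_lt_or_eq.mp hj with h7 | rfl
        · exact hmono _ (E3 j h7 hjA)
        · rintro ⟨v, hv, hD⟩
          exact c6 ⟨v, hv, fun D hD' => B3.2.2 _ (hD D hD')⟩
      · refine (Reaches.skip ⟨B3, D3, fun j hj hjA => ?_⟩).mono (fun _ h => h) (by omega)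
        rcases Nat.lt_succ_iff_lt_or_eq.mp hj with h7 | rfl
        · exact E3 j h7 hjA
        · exact absurd (by simpa [es1] using (h1 u hun).mpr hjA) hc2
    · rintro s3 ⟨B3, D3, E3⟩
      refine ⟨B3, fun p' hp' u hu hpu => ?_⟩
      rcases Nat.lt_succ_iff_lt_or_eq.mp hp' with h7 | rfl
      · exact D3 p' h7 u hu hpu
      · obtain ⟨k, hk, rfl⟩ := hL.ex _ hτp u hpu
        exact E3 k hk hu
    · have := Nat.mul_le_mul_right (1 + (8 + (3 + (b + ((2 + n * 5) + b2))))) (hL.le _ hτp)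
      omega
  · rintro s' ⟨B, D⟩
    refine ⟨fun j j1 j2 j3 j4 j5 j6 j7 j8 => by rw [B.1 j j1 j2 j3 j5 j6 j7 j8, f1 j j4],
      B.2.1, B.2.2, fun u hu hx => ?_⟩
    obtain ⟨x, hx, hxu⟩ := hx
    obtain ⟨p, hp, rfl⟩ := Finset.mem_image.mp hx
    exact D p (by simpa using hp) u hu hxu

open Expr in
/-- Fill the table `gd` of splitting vertices. -/
def splits : Cmd :=
  .seq (.loop .p (.var .al) (.set .rx (.var .p) (.var .n))) <|
  -- Each round goes through all n^α tuples and raises by one the size up to which all members with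
  -- nonempty boundary are settled.
  .loop .r (.var .n) <| .seq (initBox .al) <| .loop .e (.get .cnt (.const 0)) <|
    .seq tupleStep (next .al)

/-- A family of connected sets with boundaries of size at most `α`, in which every member has
a vertex that splits it into members. -/
structure SplitFamily (n α : ℕ) (h : ℕ → ℕ → Prop) (Reg : Finset ℕ → Prop) : Prop where
  subset : ∀ C, Reg C → C ⊆ Finset.range n
  nonempty : ∀ C, Reg C → C.Nonempty
  connected : ∀ C, Reg C → ∀ x ∈ C, comp h C x = C
  card_bdry : ∀ C, Reg C → (bdry n h C).card ≤ α
  split : ∀ C, Reg C → ∃ v ∈ C, ∀ D, IsComp h (C.erase v) D → Reg D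

/-- Positions beyond the size of X repeat one of its elements, so α-tuples also describe smaller
nonempty sets. -/
theorem exists_tuple {α : ℕ} {X : Finset ℕ} (hX : X.Nonempty) (hα : X.card ≤ α) :
    ∃ τ : ℕ → ℕ, (∀ p, τ p ∈ X) ∧ (Finset.range α).image τ = X := by
  obtain ⟨x0, hx0⟩ := hX
  let e := X.equivFin
  refine ⟨fun p => if hp : p < X.card then e.symm ⟨p, hp⟩ else x0, fun p => ?_, ?_⟩
  · dsimp only
    split_ifs
    · exact (e.symm _).2
    · exact hx0
  · ext x
    simp only [Finset.mem_image, Finset.mem_range]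
    constructor
    · rintro ⟨p, -, rfl⟩
      split_ifs
      · exact (e.symm _).2
      · exact hx0
    · intro hx
      refine ⟨e ⟨x, hx⟩, (e ⟨x, hx⟩).2.trans_le hα, ?_⟩
      simp

/-- Induction on the size of C. The pieces of C at its splitting vertex are smaller members with
nonempty boundary, so they have entries from earlier rounds. When the tuple lists the boundary of C,
the set C shows up as a component of the complement. A set with empty boundary is not next to any
tuple and must be treated separately. -/
theorem splits_spec {I : ℕ → ℕ} {n Δ α : ℕ} {g h : ℕ → ℕ → Prop} (hI : Ctx I n g h) {env : Env}
    {s : Store} (hn : env .n = n) (hal : env .al = α) (hα1 : 1 ≤ α) (hn1 : 1 ≤ n)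
    (hL : AdjLists n Δ h (s .row) (s .hd) (s .hn))
    (hp : ∀ y ≤ n, s .pw2 y = 2 ^ y * (n + 1) ^ (n + 1)) (h0 : ∀ a, s .gd a = 0)
    {Reg : Finset ℕ → Prop} (hR : SplitFamily n α h Reg) :
    Reaches I env splits s (fun s' =>
      (∀ j, j ≠ .mk → j ≠ .qu → j ≠ .ln → j ≠ .s1 → j ≠ .s2 → j ≠ .fl → j ≠ .gd → j ≠ .cc →
        j ≠ .rx → j ≠ .cnt → j ≠ .dg → j ≠ .ca → s' j = s j) ∧
      SplitTable n α h (s' .gd) ∧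
      ∀ C, Reg C → (bdry n h C).Nonempty → s' .gd (code n C) ≠ 0)
      (500 * (α * n ^ (α + 3) * (Δ + 1) ^ 3)) := by
  set T := 400 * (α * n ^ 2 * (Δ + 1) ^ 3) with hT
  have hb : (2 + α * 4) + (2 + n * (1 + ((7 + α * (10 + 3 * n)) + (3 + n ^ α *
      (1 + (T + (5 + α * 25))))))) ≤ 500 * (α * n ^ (α + 3) * (Δ + 1) ^ 3) := by
    obtain ⟨q, hq⟩ : ∃ q, n ^ α = q + 1 := ⟨n ^ α - 1, by have := Nat.one_le_pow α n hn1; omega⟩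
    rw [pow_add, hq, hT]
    obtain ⟨m, rfl⟩ : ∃ m, n = m + 1 := ⟨n - 1, by omega⟩
    obtain ⟨a, rfl⟩ : ∃ m, α = m + 1 := ⟨α - 1, by omega⟩
    ring_nf
    omega
  refine (Reaches.seq (b := 2 + α * 4) (R := fun s' => (∀ j, j ≠ .rx → s' j = s j) ∧
    ∀ y < α, s' .rx y = n) ?_ fun s1 ⟨f1, h1⟩ => ?_).mono (fun _ h => h) hb
  · refine (Reaches.tabulate (m := α) (cN := 1) (ci := 1) (ca := 1) (f := id)
      (by simpa using hal) le_rfl rfl rfl (fun i _ => by simp)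
      (fun i _ j _ h => h) (fun i _ s => le_rfl) (fun i hi s' _ => le_rfl)).mono ?_ le_rfl
    rintro s' ⟨f, h2, -⟩
    exact ⟨f, fun y hy => by simpa [hn] using h2 y hy⟩
  let L : List Arr := [.mk, .qu, .ln, .s1, .s2, .fl, .gd, .cc, .cnt, .dg, .ca]
  let Fr : Store → Prop := fun s' => ∀ j, j ∉ L → s' j = s1 j
  have split_nonempty : ∀ C v D, Reg C → v ∈ C → IsComp h (C.erase v) D →
      D.card < C.card ∧ (bdry n h D).Nonempty := by
    intro C v D hC hv hD
    constructor
    · exact (Finset.card_le_card hD.subset).trans_lt (Finset.card_erase_lt_of_mem hv)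
    · obtain ⟨w, hw, hvw⟩ := exists_adj_of_isComp hI.hG (hR.connected C hC) hv hD
      exact ⟨v, mem_bdry.mpr ⟨hI.hG.lt hvw, fun hvD => by simpa using hD.subset hvD, w, hw, hvw⟩⟩
  refine (Reaches.loop (fun r s' => Fr s' ∧ SplitTable n α h (s' .gd) ∧
    ∀ C, Reg C → (bdry n h C).Nonempty → C.card ≤ r → s' .gd (code n C) ≠ 0) (m := n) (cN := 1)
    (by simpa using hn) le_rfl ⟨fun _ _ => rfl, ?_, ?_⟩ ?_).mono ?_ le_rfl
  · intro C _ hC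
    rw [f1 _ (by simp), h0] at hC
    exact absurd rfl hC
  · intro C hC _ hc
    have := (hR.nonempty C hC).card_pos
    omega
  · rintro r hr s2 ⟨f2, T2, C2⟩
    have rx2 : ∀ y < α, s2 .rx y = n := by rw [f2 _ (by decide)]; exact h1
    refine Reaches.seq (initBox_spec (m := α) (R := n) (r := fun _ => n) (by simpa using hal) rx2
      (fun _ _ => le_rfl)) fun s3 ⟨f3, c3, d3⟩ => ?_
    have g3 : s3 .gd = s2 .gd := f3 _ (by simp) (by simp)
    have c3' : s3 .cnt 0 = n ^ α := by simpa using c3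
    refine (Reaches.loop (fun e s' => Fr s' ∧ SplitTable n α h (s' .gd) ∧
      (∀ a, s2 .gd a ≠ 0 → s' .gd a ≠ 0) ∧ (∀ y < α, s' .dg y = dig (fun _ => n) e y) ∧
      ∀ e' < e, SplitProgress n h ((Finset.range α).image (dig (fun _ => n) e')) (s2 .gd) (s' .gd))
      (m := n ^ α) (cN := 2) (by simpa using c3') le_rfl
      ⟨fun j hj => ?_, by rwa [g3], by rw [g3]; exact fun _ h => h, d3, by simp⟩ ?_).mono ?_ le_rfl
    · rw [f3 j, f2 j hj] <;> (rintro rfl; revert hj; decide)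
    · rintro e he s4 ⟨f4, T4, m4, d4, p4⟩
      have k4 : ∀ j, j ∈ [Arr.row, .hd, .hn, .pw2] → s4 j = s j := by
        intro j hj
        rw [f4 j, f1 j]
        · rintro rfl; simp at hj
        · revert hj; cases j <;> decide
      refine Reaches.seq (tupleStep_spec (α := α) hI (by simpa using hn) (by simpa using hal) hα1 hn1
        (by simpa [k4] using hL) (by simpa [k4] using hp) T4
        (fun p _ => dig_lt (r := fun _ => n) (e := e) (y := p) (by omega)) d4)
        fun s5 ⟨f5, T5, m5, p5⟩ => ?_
      refine (next_spec (m := α) (e := e) (r := fun _ => n) (by simpa using hal) (fun _ _ => by omega)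
        (fun y hy => ?_) (fun y hy => ?_)).mono ?_ le_rfl
      · rw [f5 _ (by simp) (by simp) (by simp) (by simp) (by simp) (by simp) (by simp) (by simp),
          f4 _ (by decide), h1 y hy]
      · rw [f5 _ (by simp) (by simp) (by simp) (by simp) (by simp) (by simp) (by simp) (by simp),
          d4 y hy]
      rintro s6 ⟨f6, d6⟩
      have g6 : s6 .gd = s5 .gd := f6 _ (by simp) (by simp)
      rw [← g6] at T5 m5 p5
      refine ⟨fun j hj => ?_, T5, fun a ha => m5 a (m4 a ha), d6, fun e' he' => ?_⟩
      · rw [f6 j, f5 j, f4 j hj] <;> (rintro rfl; revert hj; decide)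
      · rcases Nat.lt_succ_iff_lt_or_eq.mp he' with h7 | rfl
        · exact fun u hu hx hs => m5 _ (p4 e' h7 u hu hx hs)
        · rintro u hu hx ⟨v, hv, hD⟩
          exact p5 u hu hx ⟨v, hv, fun D hD' => m4 _ (hD D hD')⟩
    · rintro s4 ⟨f4, T4, m4, -, p4⟩
      refine ⟨f4, T4, fun C hC hne hcard => ?_⟩
      obtain ⟨τ, hτ, hX⟩ := exists_tuple hne (hR.card_bdry C hC)
      obtain ⟨e, he, hde⟩ := exists_dig_eq (fun _ => n) τ α fun y _ => (mem_bdry.mp (hτ y)).1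
      have himg : (Finset.range α).image (dig (fun _ => n) e) = bdry n h C := by
        rw [← hX]
        exact Finset.image_congr fun y hy => hde y (by simpa using hy)
      have hp4 := p4 e (by simpa using he)
      rw [himg] at hp4
      obtain ⟨x, hx⟩ := hne
      obtain ⟨-, hxC, u, hu, hxu⟩ := mem_bdry.mp hx
      have hsub : C ⊆ Finset.range n \ bdry n h C := fun y hy => Finset.mem_sdiff.mpr
        ⟨hR.subset C hC hy, fun hb => (mem_bdry.mp hb).2.1 hy⟩
      -- C is connected, and all its outside neighbors are in the boundary, so it is a full
      -- component once the boundary is deleted.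
      have hcomp : comp h (Finset.range n \ bdry n h C) u = C := by
        refine comp_eq_of_closed hsub (hR.connected C hC u hu) hu fun a ha b hb hab => ?_
        by_contra hbC
        obtain ⟨h5, h6⟩ := Finset.mem_sdiff.mp hb
        exact h6 (mem_bdry.mpr ⟨by simpa using h5, hbC, a, ha, hI.hG.symm hab⟩)
      have := hp4 u (hsub hu) ⟨x, hx, hxu⟩
      rw [hcomp] at this
      obtain ⟨v, hv, hD⟩ := hR.split C hC
      refine this ⟨v, hv, fun D hD' => ?_⟩
      obtain ⟨h5, h6⟩ := split_nonempty C v D hC hv hD'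
      exact C2 D (hD D hD') h6 (by omega)
  · rintro s' ⟨f, T, hC⟩
    refine ⟨fun j j1 j2 j3 j4 j5 j6 j7 j8 j9 j10 j11 j12 => ?_, T, fun C h1 h2 => hC C h1 h2 ?_⟩
    · rw [f j (by simp [L, *]), f1 j j9]
    · simpa using Finset.card_le_card (hR.subset C h1)

/-! ## The order in which vertices are removed -/

/-- The vertices left after the removal of `vt 0, …, vt (i-1)`. -/
def rest (n : ℕ) (vt : ℕ → ℕ) (i : ℕ) : Finset ℕ := Finset.range n \ (Finset.range i).image vt

theorem rest_zero (n : ℕ) (vt : ℕ → ℕ) : rest n vt 0 = Finset.range n := by simp [rest]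

theorem rest_succ (n : ℕ) (vt : ℕ → ℕ) (i : ℕ) :
    rest n vt (i + 1) = (rest n vt i).erase (vt i) := by
  ext x
  simp only [rest, Finset.mem_sdiff, Finset.mem_erase, Finset.mem_image, Finset.mem_range]
  constructor
  · rintro ⟨h1, h2⟩
    exact ⟨fun h => h2 ⟨i, by omega, h.symm⟩, h1, fun ⟨j, hj, h⟩ => h2 ⟨j, by omega, h⟩⟩
  · rintro ⟨h1, h2, h3⟩
    refine ⟨h2, fun ⟨j, hj, h⟩ => ?_⟩
    rcases Nat.lt_succ_iff_lt_or_eq.mp hj with h4 | rfl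
    · exact h3 ⟨j, h4, h⟩
    · exact h1 h.symm

theorem rest_congr {n i : ℕ} {vt vt' : ℕ → ℕ} (h : ∀ j < i, vt j = vt' j) :
    rest n vt i = rest n vt' i := by
  rw [rest, rest, Finset.image_congr fun j hj => h j (by simpa using hj)]

theorem rest_subset {n i : ℕ} {vt : ℕ → ℕ} : rest n vt i ⊆ Finset.range n := Finset.sdiff_subset

/-- At step `i` vertex `vt i` is removed from the component `cs i` of what is left. -/
structure RemovalOrder (n α : ℕ) (h : ℕ → ℕ → Prop) (vt : ℕ → ℕ) (cs : ℕ → Finset ℕ)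
    (m : ℕ) : Prop where
  mem : ∀ i < m, vt i ∈ cs i
  isComp : ∀ i < m, IsComp h (rest n vt i) (cs i)
  card : ∀ i < m, (bdry n h (cs i)).card ≤ α

/-! ### How components change when a vertex is removed. -/

theorem isComp_of_erase {n : ℕ} {h : ℕ → ℕ → Prop} (H : IsGraphOn n h) {S C D : Finset ℕ} {v : ℕ}
    (hC : IsComp h S C) (hD : IsComp h (C.erase v) D) : IsComp h (S.erase v) D := by
  refine isComp_mono H (Finset.erase_subset_erase _ hC.subset) hD fun a ha b hb hab => ?_
  obtain ⟨h1, h2⟩ := Finset.mem_erase.mp hb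
  exact Finset.mem_erase.mpr
    ⟨h1, hC.closed (Finset.erase_subset _ _ (hD.subset ha)) hab h2⟩

theorem isComp_erase_of_notMem {n : ℕ} {h : ℕ → ℕ → Prop} (H : IsGraphOn n h) {S D : Finset ℕ}
    {v : ℕ} (hD : IsComp h S D) (hv : v ∉ D) : IsComp h (S.erase v) D := by
  obtain ⟨x, hx⟩ := hD.nonempty
  have hsub : D ⊆ S.erase v := fun y hy =>
    Finset.mem_erase.mpr ⟨fun h => hv (h ▸ hy), hD.subset hy⟩
  exact ⟨x, hsub hx, comp_eq_of_closed hsub (hD.connected H hx) hx fun a ha b hb hab =>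
    hD.closed ha hab (Finset.erase_subset _ _ hb)⟩

/-- Removing v breaks up only the component that contains v. A component of the rest that misses C
has no edge to v, so it was a component before. -/
theorem IsComp.of_erase {n : ℕ} {h : ℕ → ℕ → Prop} (H : IsGraphOn n h) {S C D : Finset ℕ} {v : ℕ}
    (hC : IsComp h S C) (hv : v ∈ C) (hD : IsComp h (S.erase v) D) :
    IsComp h (C.erase v) D ∨ IsComp h S D := by
  by_cases hDC : ∃ x ∈ D, x ∈ C
  · left
    obtain ⟨x, hx, hxC⟩ := hDC
    have hsub : D ⊆ C.erase v := by
      have hDS : comp h D x ⊆ C := comp_subset_of_closed hxC fun a ha b hb hab =>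
        hC.closed ha hab (Finset.erase_subset _ _ (hD.subset hb))
      rw [hD.connected H hx] at hDS
      exact fun y hy => Finset.mem_erase.mpr ⟨(Finset.mem_erase.mp (hD.subset hy)).1, hDS hy⟩
    exact ⟨x, hsub hx, comp_eq_of_closed hsub (hD.connected H hx) hx fun a ha b hb hab =>
      hD.closed ha hab (Finset.erase_subset_erase _ hC.subset hb)⟩
  · right
    push Not at hDC
    obtain ⟨x, hx⟩ := hD.nonempty
    have hDS := hD.subset.trans (Finset.erase_subset _ _)
    refine ⟨x, hDS hx, comp_eq_of_closed hDS (hD.connected H hx) hx fun a ha b hb hab => ?_⟩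
    refine hD.closed ha hab (Finset.mem_erase.mpr ⟨?_, hb⟩)
    rintro rfl
    exact hDC a ha (hC.closed hv (H.symm hab) (hDS ha))

/-- The removed vertex is still present at its step, so no vertex is removed twice and n steps use
up all vertices. -/
theorem RemovalOrder.card_rest {n α m : ℕ} {h : ℕ → ℕ → Prop} {vt : ℕ → ℕ} {cs : ℕ → Finset ℕ}
    (hO : RemovalOrder n α h vt cs m) : ∀ i ≤ m, (rest n vt i).card + i = n := by
  intro i
  induction i with
  | zero => simp [rest_zero]
  | succ i ih =>
    intro hi
    have hmem : vt i ∈ rest n vt i := (hO.isComp i hi).subset (hO.mem i hi)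
    rw [rest_succ, Finset.card_erase_of_mem hmem]
    have := Finset.card_pos.mpr ⟨_, hmem⟩
    have := ih (by omega)
    omega

/-- Every component that is left at step `i` is handled at some later step. -/
theorem RemovalOrder.exists_eq {n α : ℕ} {h : ℕ → ℕ → Prop} (H : IsGraphOn n h) {vt : ℕ → ℕ}
    {cs : ℕ → Finset ℕ} (hO : RemovalOrder n α h vt cs n) {i : ℕ} (hi : i ≤ n) {D : Finset ℕ}
    (hD : IsComp h (rest n vt i) D) : ∃ j, i ≤ j ∧ j < n ∧ cs j = D := by
  induction hi using Nat.decreasingInduction generalizing D with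
  | self =>
    have := hO.card_rest n le_rfl
    have h0 : rest n vt n = ∅ := Finset.card_eq_zero.mp (by omega)
    obtain ⟨x, hx, -⟩ := hD
    simp [h0] at hx
  | of_succ i hi ih =>
    -- Either D is the component that is handled now, or it survives this removal untouched and is
    -- found later by the backward induction.
    by_cases hv : vt i ∈ D
    · refine ⟨i, le_rfl, hi, ?_⟩
      rw [hD.eq_comp H hv, (hO.isComp i hi).eq_comp H (hO.mem i hi)]
    · have := isComp_erase_of_notMem H hD hv
      rw [← rest_succ] at this
      obtain ⟨j, h1, h2, h3⟩ := ih this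
      exact ⟨j, by omega, h2, h3⟩

/-- The pieces of a set appear strictly later in the order, so processing the order backwards has
the witnesses for all pieces at hand. -/
theorem RemovalOrder.exists_child {n α : ℕ} {h : ℕ → ℕ → Prop} (H : IsGraphOn n h) {vt : ℕ → ℕ}
    {cs : ℕ → Finset ℕ} (hO : RemovalOrder n α h vt cs n) {i : ℕ} (hi : i < n) {D : Finset ℕ}
    (hD : IsComp h ((cs i).erase (vt i)) D) : ∃ j, i < j ∧ j < n ∧ cs j = D := by
  have := isComp_of_erase H (hO.isComp i hi) hD
  rw [← rest_succ] at this
  obtain ⟨j, h1, h2, h3⟩ := hO.exists_eq H (by omega) this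
  exact ⟨j, by omega, h2, h3⟩

open Expr in
/-- Choose the order in which the vertices are removed, according to table `gd`. -/
def order : Cmd :=
  .seq (.loop .y (.var .n) (.set .s1 (.var .y) (.const 1))) <|
  .loop .i (.var .n) <|
    .letE .u (.sup .x (.var .n) (.ite (.get .s1 (.var .x)) (.var .x) (.const 0))) <|
    .seq (bfs .s1 .u) <|
    .letE .v (.sub (.get .gd (codeOf .mk)) (.const 1)) <|
    .seq (.set .vt (.var .i) (.var .v)) <|
    .seq (.loop .y (.var .n) (.set .cm (ix (.var .i) (.var .y)) (.get .mk (.var .y)))) <|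
    .set .s1 (.var .v) (.const 0)

/-- The invariant is that every component of what is left has a table entry. A removal replaces one
component by its pieces, which have entries by `SplitTable`, and leaves the others alone. -/
theorem order_spec {I : ℕ → ℕ} {n Δ α : ℕ} {g h : ℕ → ℕ → Prop} (hI : Ctx I n g h) {env : Env}
    {s : Store} (hn : env .n = n) (hL : AdjLists n Δ h (s .row) (s .hd) (s .hn))
    (hp : ∀ y ≤ n, s .pw2 y = 2 ^ y * (n + 1) ^ (n + 1)) (hT : SplitTable n α h (s .gd))
    (h0 : ∀ D, IsComp h (Finset.range n) D → s .gd (code n D) ≠ 0) :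
    Reaches I env order s (fun s' =>
      (∀ j, j ∉ [Arr.mk, .qu, .ln, .s1, .vt, .cm] → s' j = s j) ∧
      ∃ cs, RemovalOrder n α h (s' .vt) cs n ∧
        ∀ i < n, ∀ y < n, 0 < s' .cm (n * i + y) ↔ y ∈ cs i)
      (200 * (n ^ 2 * (Δ + 1)) + 4) := by
  let b := 50 * (n * (Δ + 1))
  have hb : (2 + n * 4) + (2 + n * (1 + ((3 + n * 6) + (b + ((6 + n * 7) + (3 + ((2 + n * 8) + 3))))))) ≤
      200 * (n ^ 2 * (Δ + 1)) + 4 := by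
    rcases Nat.eq_zero_or_pos n with rfl | hn0
    · simp
    obtain ⟨m, rfl⟩ : ∃ m, n = m + 1 := ⟨n - 1, by omega⟩
    simp only [b]
    ring_nf
    omega
  refine (Reaches.seq (b := 2 + n * 4) (R := fun s' => (∀ j, j ≠ .s1 → s' j = s j) ∧
    Ind n (s' .s1) (Finset.range n)) ?_ fun s1 ⟨f1, h1⟩ => ?_).mono (fun _ h => h) hb
  · refine (Reaches.fill (n := n) (ca := 1) (by simpa using hn) (by simp) rfl rfl
            le_rfl).mono ?_ le_rfl
    rintro s' ⟨f, hs⟩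
    refine ⟨f, fun x hx => ?_⟩
    rw [hs x hx]
    simpa using hx
  refine (Reaches.loop (fun i s' => (∀ j, j ∉ [Arr.mk, .qu, .ln, .s1, .vt, .cm] → s' j = s j) ∧
      Ind n (s' .s1) (rest n (s' .vt) i) ∧
      (∀ D, IsComp h (rest n (s' .vt) i) D → s .gd (code n D) ≠ 0) ∧
      ∃ cs, RemovalOrder n α h (s' .vt) cs i ∧
        ∀ j < i, ∀ y < n, 0 < s' .cm (n * j + y) ↔ y ∈ cs j) (m := n) (cN := 1)
    (by simpa using hn) le_rfl ⟨?_, ?_, ?_, ?_⟩ ?_).mono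
    (fun s' h => ⟨h.1, h.2.2.2⟩) le_rfl
  · intro j hj
    exact f1 j (by rintro rfl; simp at hj)
  · rwa [rest_zero]
  · rwa [rest_zero]
  · exact ⟨fun _ => ∅, ⟨by simp, by simp, by simp⟩, by simp⟩
  · rintro i hi s2 ⟨f2, h2, D2, cs, hO, hcm⟩
    have k2 : ∀ j, j ∈ [Arr.row, .hd, .hn, .pw2, .gd] → s2 j = s j := by
      intro j hj
      apply f2
      revert hj; cases j <;> decide
    set A := rest n (s2 .vt) i with hA
    have hAne : A.Nonempty := by
      rw [← Finset.card_pos]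
      have : A.card + i = n := hO.card_rest i le_rfl
      omega
    -- The supremum is the largest remaining vertex. Removed vertices contribute 0; if the supremum
    -- stems from one of them, every remaining vertex is at most 0, so vertex 0 itself remains.
    have hu : ∃ u ∈ A, (Finset.range n).sup (fun x => if 0 < s2 .s1 x then x else 0) = u := by
      have hne : (Finset.range n).Nonempty := ⟨i, by simpa using hi⟩
      obtain ⟨x, hx, he⟩ := Finset.exists_mem_eq_sup _ hne (fun x => if 0 < s2 .s1 x then x else 0)
      by_cases hxA : x ∈ A
      · rw [if_pos ((h2 x (by simpa using hx)).mpr hxA)] at he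
        exact ⟨x, hxA, he⟩
      · rw [if_neg fun h => hxA ((h2 x (by simpa using hx)).mp h)] at he
        obtain ⟨y, hy⟩ := hAne
        have hyn := rest_subset hy
        have h3 := Finset.le_sup (f := fun x => if 0 < s2 .s1 x then x else 0) hyn
        rw [he] at h3
        rw [if_pos ((h2 y (by simpa using hyn)).mpr hy)] at h3
        obtain rfl : y = 0 := by omega
        exact ⟨0, hy, he⟩
    obtain ⟨u, huA, hue⟩ := hu
    refine (Reaches.letE (v := u) (ca := 2 + n * 6)
      (b := b + ((6 + n * 7) + (3 + ((2 + n * 8) + 3)))) ?_ ?_ ?_).mono (fun _ h => h) (by omega)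
    · rw [← hue]
      simp [Expr.eval, hn]
    · exact Expr.cost_le (n := n) (by simpa using hn) rfl (by simp [Expr.bound])
    refine Reaches.seq (bfs_spec hI (by simpa using hn) (by simpa [k2] using hL)
            (by simp) (by simp) (by simp) rest_subset h2 (by simp) huA) fun s3 ⟨f3, h3⟩ => ?_
    set C := comp h A u with hC
    have hCn : C ⊆ Finset.range n := comp_subset.trans rest_subset
    have hCA : IsComp h A C := isComp_comp huA
    obtain ⟨v, hv, hgv, hcard, hDv⟩ := hT C hCn (D2 C hCA)
    have hvA : v ∈ A := comp_subset hv
    refine (Reaches.letE (v := v) (ca := 5 + n * 7)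
      (b := 3 + ((2 + n * 8) + 3)) ?_ ?_ ?_).mono (fun _ h => h) (by omega)
    · rw [Expr.eval_sub, Expr.eval_get, eval_codeOf (n := n) (by simpa using hn)
        (by rw [f3 _ (by simp) (by simp) (by simp)]; simpa [k2] using hp) hCn h3,
        f3 _ (by simp) (by simp) (by simp), k2 _ (by simp), hgv]
      simp
    · exact Expr.cost_le (n := n) (by simpa using hn) rfl (by
        simp [Expr.bound, Expr.codeOf]; omega)
    refine Reaches.seq (b := 3) (R := fun s' => s' = s3.set .vt i v)
      (Reaches.set (by simp) le_rfl le_rfl) ?_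
    rintro _ rfl
    refine Reaches.seq (Reaches.fillRow (n := n) (i := i) (ca := 2) (by simpa using hn) (by simp) hi
      (by simp) (by simp) (by simp) ?_ rfl rfl le_rfl) fun s4 ⟨f4, h4, h5⟩ => ?_
    · rw [Store.set_of_ne (by simp), f3 _ (by simp) (by simp) (by simp), k2 _ (by simp)]
      exact hL.row
    refine Reaches.set (ca := 1) (cb := 1) ?_ le_rfl le_rfl
    simp only [Expr.eval_var, Expr.eval_const, Function.update_self]
    have vt4 : s4 .vt = Function.update (s2 .vt) i v := by
      rw [f4 _ (by simp), ← f3 .vt (by simp) (by simp) (by simp)]; simp [Store.set]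
    have vt5 : (s4.set .s1 v 0) .vt = Function.update (s2 .vt) i v := by
      rw [Store.set_of_ne (by simp), vt4]
    have hrest : ∀ j ≤ i, rest n (Function.update (s2 .vt) i v) j = rest n (s2 .vt) j :=
      fun j hj => rest_congr fun j' hj' => Function.update_of_ne (by omega) _ _
    have hA' : rest n (Function.update (s2 .vt) i v) (i + 1) = A.erase v := by
      rw [rest_succ, hrest i le_rfl, Function.update_self]
    rw [vt5, hA']
    refine ⟨fun j hj => ?_, fun x hx => ?_, fun D hD => ?_, Function.update cs i C,
      ⟨fun j hj => ?_, fun j hj => ?_, fun j hj => ?_⟩, fun j hj y hy => ?_⟩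
    · have hj' : j ≠ .mk ∧ j ≠ .qu ∧ j ≠ .ln ∧ j ≠ .s1 ∧ j ≠ .vt ∧ j ≠ .cm := by simpa using hj
      obtain ⟨j1, j2, j3, j4, j5, j6⟩ := hj'
      rw [Store.set_of_ne j4, f4 j j6, Store.set_of_ne j5, f3 j j1 j2 j3, f2 j hj]
    · rw [Store.set_self, f4 _ (by simp), Store.set_of_ne (by simp),
        f3 _ (by simp) (by simp) (by simp), Finset.mem_erase]
      split_ifs with hxv
      · simp [hxv]
      · simp [hxv, h2 x hx]
    · rcases hCA.of_erase hI.hG hv hD with h6 | h6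
      · exact hDv D h6
      · exact D2 D h6
    · rcases Nat.lt_succ_iff_lt_or_eq.mp hj with h6 | rfl
      · rw [Function.update_of_ne h6.ne, Function.update_of_ne h6.ne]; exact hO.mem j h6
      · simpa using hv
    · rw [hrest j (by omega)]
      rcases Nat.lt_succ_iff_lt_or_eq.mp hj with h6 | rfl
      · rw [Function.update_of_ne h6.ne]; exact hO.isComp j h6
      · simpa using hCA
    · rcases Nat.lt_succ_iff_lt_or_eq.mp hj with h6 | rfl
      · rw [Function.update_of_ne h6.ne]; exact hO.card j h6
      · simpa using hcard
    · rw [Store.set_of_ne (by simp)]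
      rcases Nat.lt_succ_iff_lt_or_eq.mp hj with h6 | rfl
      · rw [h5 _ fun j' hj' h => h6.ne' (index_inj hj' hy h).1, Store.set_of_ne (by simp),
          f3 _ (by simp) (by simp) (by simp), Function.update_of_ne h6.ne]
        exact hcm j h6 y hy
      · rw [h4 y hy, Function.update_self, ← h3 y hy]
        simp [Store.set]

/-! ## Addresses of witnesses -/

open Expr in
/-- Entry `(y, c)` of `kt` is the contribution of the value `c` at `y` to an address. -/
def keyTable : Cmd :=
  .loop .x (.var .n) <| .loop .y (.var .n) <| .set .kt (ix (.var .x) (.var .y))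
    (.sum .t (.var .n) (.ite (lt (.var .t) (.add (.var .y) (.const 1))) (.get .pw (.var .x))
      (.const 0)))

theorem keyTable_spec {I : ℕ → ℕ} {n : ℕ} {env : Env} {s : Store} (hn : env .n = n) (hn1 : 1 ≤ n)
    (hrow : ∀ x ≤ n, s .row x = n * x) (hpw : ∀ y ≤ n, s .pw y = (n + 1) ^ (y + 1)) :
    Reaches I env keyTable s (fun s' => (∀ j, j ≠ .kt → s' j = s j) ∧
      ∀ x < n, ∀ c < n, s' .kt (n * x + c) = (c + 1) * (n + 1) ^ (x + 1)) (100 * n ^ 4) := by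
  refine (Reaches.fill2 (n := n) (ca := 2 + n * 10) hn (by simp) (by simp) (by simp)
        (by simp) hrow rfl rfl ?_).mono ?_ ?_
  · simp [Expr.bound, Expr.lt]
  · rintro s' ⟨f, h'⟩
    refine ⟨f, fun x hx c hc => ?_⟩
    rw [h' x hx c hc]
    have hcard : (Finset.range n).filter (fun i => i < c + 1) = Finset.range (c + 1) := by
      ext i; simp; omega
    simp only [Expr.eval, Function.update_self, ne_eq, reduceCtorEq, not_false_eq_true,
      Function.update_of_ne, hn, hpw x hx.le, Expr.lt_pos]
    rw [← Finset.sum_filter, hcard]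
    simp
  · have h1 : 1 ≤ n ^ 4 := Nat.one_le_pow _ _ hn1
    have h2 : n ≤ n ^ 4 := Nat.le_self_pow (by norm_num) n
    have h3 : n ^ 2 ≤ n ^ 4 := Nat.pow_le_pow_right hn1 (by norm_num)
    have h4 : n ^ 3 ≤ n ^ 4 := Nat.pow_le_pow_right hn1 (by norm_num)
    nlinarith

/-- The address of the row for the set with code `c` and the values `ph` on the set `ind`. -/
def Expr.key (c ind : Expr) : Expr :=
  .add c (.sum .y (.var .n) (.ite ind (.get .kt (ix (.var .y) (.get .ph (.var .y)))) (.const 0)))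

theorem eval_key {I : ℕ → ℕ} {n : ℕ} {env : Env} {s : Store} (hn : env .n = n)
    (hrow : ∀ x ≤ n, s .row x = n * x)
    (hkt : ∀ x < n, ∀ c < n, s .kt (n * x + c) = (c + 1) * (n + 1) ^ (x + 1))
    (hph : ∀ x < n, s .ph x < n) {c ind : Expr} {S B : Finset ℕ} (hB : B ⊆ Finset.range n)
    (hc : c.eval I env s = code n S)
    (hind : ∀ y < n, 0 < ind.eval I (Function.update env .y y) s ↔ y ∈ B) :
    (Expr.key c ind).eval I env s = witKey n S B (s .ph) := by
  simp only [Expr.key, Expr.eval, hc, hn, witKey, Expr.ix, Function.update_self]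
  rw [← Finset.sum_subset hB]
  · congr 1
    refine Finset.sum_congr rfl fun x hx => ?_
    have hxn := Finset.mem_range.mp (hB hx)
    rw [if_pos ((hind x hxn).mpr hx), hrow x hxn.le, hkt x hxn _ (hph x hxn)]
  · intro x hx hxS
    rw [if_neg fun h => hxS ((hind x (Finset.mem_range.mp hx)).mp h)]

/-- The tables that stay fixed while the witnesses are computed. -/
structure Tables (n d Δ Q : ℕ) (g h : ℕ → ℕ → Prop) (s : Store) : Prop where
  lists : AdjLists n Δ h (s .row) (s .hd) (s .hn)
  eh : NearMat n d h (s .eh)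
  gbl_lt : ∀ x < n, ∀ k < n, s .gbl (n * x + k) < n
  gbl_ex : ∀ x < n, ∀ y < n, Near g d x y → ∃ k < Q, s .gbl (n * x + k) = y
  kt : ∀ x < n, ∀ c < n, s .kt (n * x + c) = (c + 1) * (n + 1) ^ (x + 1)
  pw2 : ∀ y ≤ n, s .pw2 y = 2 ^ y * (n + 1) ^ (n + 1)

theorem Tables.congr {n d Δ Q : ℕ} {g h : ℕ → ℕ → Prop} {s s' : Store} (hT : Tables n d Δ Q g h s)
    (he : ∀ j, j ∈ [Arr.row, .hd, .hn, .eh, .gbl, .kt, .pw2] → s' j = s j) :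
    Tables n d Δ Q g h s' := by
  obtain ⟨h1, h2, h3, h4, h5, h6⟩ := hT
  constructor <;> simpa [he]

/-- The data for the set `C` from which `v` is removed: the code, the members, and the surroundings
of the boundary of the component of `C \ {v}` that contains the `k`-th neighbor of `v`. -/
structure NodeData (n d : ℕ) (h : ℕ → ℕ → Prop) (v : ℕ) (C : Finset ℕ) (s : Store) : Prop where
  cc : Ind n (s .cc) C
  bx : Ind n (s .bx) (ball n h d (bdry n h C))
  chf : ∀ k < s .hd v, 0 < s .chf k ↔ s .hn (n * v + k) ∈ C.erase v
  chc : ∀ k < s .hd v, s .hn (n * v + k) ∈ C.erase v →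
    s .chc k = code n (comp h (C.erase v) (s .hn (n * v + k)))
  chm : ∀ k < s .hd v, s .hn (n * v + k) ∈ C.erase v → ∀ y < n,
    0 < s .chm (n * k + y) ↔ y ∈ comp h (C.erase v) (s .hn (n * v + k))
  chb : ∀ k < s .hd v, s .hn (n * v + k) ∈ C.erase v → ∀ y < n,
    0 < s .chb (n * k + y) ↔ y ∈ ball n h d (bdry n h (comp h (C.erase v) (s .hn (n * v + k))))

theorem NodeData.congr {n d v : ℕ} {h : ℕ → ℕ → Prop} {C : Finset ℕ} {s s' : Store}
    (hN : NodeData n d h v C s)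
    (he : ∀ j, j ∈ [Arr.cc, .bx, .chf, .chc, .chm, .chb, .hd, .hn] → s' j = s j) :
    NodeData n d h v C s' := by
  obtain ⟨h1, h2, h3, h4, h5, h6⟩ := hN
  constructor <;> simpa only [he, List.mem_cons, true_or, or_true]

theorem ball_subset {n d : ℕ} {h : ℕ → ℕ → Prop} {X : Finset ℕ} :
    ball n h d X ⊆ Finset.range n := fun y hy => by simpa using (mem_ball.mp hy).1

/-- Components are indexed by neighbors of v, possibly with repetition; by `exists_adj_of_isComp`
none is missed. -/
theorem forall_isComp_iff {n Δ : ℕ} {h : ℕ → ℕ → Prop} (H : IsGraphOn n h) {row hd hn : ℕ → ℕ}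
    (hL : AdjLists n Δ h row hd hn) {C : Finset ℕ} {v : ℕ} (hv : v ∈ C) (hvn : v < n)
    (hconn : ∀ x ∈ C, comp h C x = C) {P : Finset ℕ → Prop} :
    (∀ k < hd v, hn (n * v + k) ∈ C.erase v → P (comp h (C.erase v) (hn (n * v + k)))) ↔
      ∀ D, IsComp h (C.erase v) D → P D := by
  constructor
  · intro h4 D hD
    obtain ⟨w, hw, hvw⟩ := exists_adj_of_isComp H hconn hv hD
    obtain ⟨k, hk, rfl⟩ := hL.ex v hvn w hvw
    rw [hD.eq_comp H hw]
    exact h4 k hk (hD.subset hw)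
  · exact fun h4 j hj h5 => h4 _ (isComp_comp h5)

/-! ## Testing an assignment -/

open Expr in
/-- Test the local condition for `ph` at `v`. -/
def localTest : Cmd :=
  .seq (.loop .y (.var .n) (.set .t2 (.var .y) (.const 0))) <|
  -- Array `t2` becomes the indicator of the image of the d-ball around v, against which the
  -- neighbors of the value at v are checked.
  .seq (.loop .y (.var .n) (.ite (.get .eh (ix (.var .v) (.var .y)))
    (.set .t2 (.get .ph (.var .y)) (.const 1)) .skip)) <|
  .set .fl (.const 0) (not (.add
    (.sum .y (.var .n) (and (hadj (.var .v) (.var .y))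
      (not (gadj (.get .ph (.var .v)) (.get .ph (.var .y))))))
    (.sum .y (.var .n) (and (gadj (.get .ph (.var .v)) (.var .y)) (not (.get .t2 (.var .y)))))))

theorem localTest_spec {I : ℕ → ℕ} {n d Δ Q : ℕ} {g h : ℕ → ℕ → Prop} (hI : Ctx I n g h)
    {env : Env} {s : Store} (hn : env .n = n) (hT : Tables n d Δ Q g h s) {v : ℕ}
    (hv : env .v = v) (hvn : v < n) (hph : ∀ x < n, s .ph x < n) :
    Reaches I env localTest s (fun s' => (∀ j, j ≠ .t2 → j ≠ .fl → s' j = s j) ∧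
      (0 < s' .fl 0 ↔ LocalOk n d g h (s .ph) v)) (200 * n) := by
  refine (Reaches.seq (b := 2 + n * 4) (b' := (2 + n * 12) + (12 + n * 70)) (R := fun s' =>
    (∀ j, j ≠ .t2 → s' j = s j) ∧ ∀ y < n, s' .t2 y = 0) ?_ fun s1 ⟨f1, h1⟩ => ?_).mono
    (fun _ h => h) (by omega)
  · refine (Reaches.fill (n := n) (ca := 1) (by simpa using hn) (by simp) rfl rfl
            le_rfl).mono ?_ le_rfl
    rintro s' ⟨f, hs⟩
    exact ⟨f, fun x hx => by rw [hs x hx]; rfl⟩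
  refine Reaches.seq (R := fun s' => (∀ j, j ≠ .t2 → s' j = s j) ∧
    ∀ u < n, 0 < s' .t2 u ↔ ∃ y < n, Near h d v y ∧ s .ph y = u) ?_ fun s2 ⟨f2, h2⟩ => ?_
  · refine (Reaches.loop (fun m s' => (∀ j, j ≠ .t2 → s' j = s j) ∧
      ∀ u < n, 0 < s' .t2 u ↔ ∃ y < m, Near h d v y ∧ s .ph y = u) (m := n) (cN := 1) (b := 11)
      (by simpa using hn) le_rfl ⟨f1, fun u hu => by simp [h1 u hu]⟩ ?_).mono (fun _ h => h) le_rfl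
    rintro y hy s2 ⟨f2, h2⟩
    have he : 0 < s2 .eh (s2 .row v + y) ↔ Near h d v y := by
      rw [f2 _ (by simp), f2 _ (by simp), hT.lists.row v hvn.le]
      exact hT.eh v hvn y hy
    refine (Reaches.ite (be := 5) (b := 4) le_rfl (fun hc => ?_) (fun hc => ?_)).mono
      (fun _ h => h) (by omega)
    · have hc' := he.mp (by simpa [hv] using hc)
      refine Reaches.set ⟨fun j hj => by rw [Store.set_of_ne hj, f2 j hj], fun u hu => ?_⟩
        le_rfl le_rfl
      simp only [Expr.eval_get, Expr.eval_var, Expr.eval_const, Function.update_self]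
      rw [Store.set_self, f2 .ph (by simp)]
      split_ifs with hu'
      · simp only [Nat.lt_one_iff, pos_of_gt, true_iff]
        exact ⟨y, by omega, hc', hu'.symm⟩
      · rw [h2 u hu]
        constructor
        · rintro ⟨z, h3, h4⟩; exact ⟨z, by omega, h4⟩
        · rintro ⟨z, h3, h4, h5⟩
          rcases Nat.lt_succ_iff_lt_or_eq.mp h3 with h6 | rfl
          · exact ⟨z, h6, h4, h5⟩
          · exact absurd h5.symm hu'
    · have hc' : ¬ Near h d v y := fun h3 => hc (by simpa [hv] using he.mpr h3)
      refine (Reaches.skip ⟨f2, fun u hu => ?_⟩).mono (fun _ h => h) (by omega)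
      rw [h2 u hu]
      constructor
      · rintro ⟨z, h3, h4⟩; exact ⟨z, by omega, h4⟩
      · rintro ⟨z, h3, h4, h5⟩
        rcases Nat.lt_succ_iff_lt_or_eq.mp h3 with h6 | rfl
        · exact ⟨z, h6, h4, h5⟩
        · exact absurd h4 hc'
  · have hrow : ∀ x ≤ n, s2 .row x = n * x := by rw [f2 _ (by simp)]; exact hT.lists.row
    have e1 : s2 .ph = s .ph := f2 _ (by simp)
    refine (Reaches.set (ca := 1) (cb := 10 + n * 70) ?_ le_rfl ?_).mono (fun _ h => h) (by omega)
    · refine ⟨fun j j1 j2 => ?_, ?_⟩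
      · rw [Store.set_of_ne j2, f2 j j1]
      · simp only [Expr.eval_const]
        rw [Store.set_self, if_pos rfl, Expr.not_pos, Expr.eval_add, Nat.add_pos_iff_pos_or_pos,
          Expr.sum_pos, Expr.sum_pos]
        simp only [Expr.and_pos, Expr.not_pos, Expr.eval_var, hn]
        have a1 : ∀ y < n, (0 < (Expr.hadj (.var .v) (.var .y)).eval I (Function.update env .y y) s2 ∧
            ¬ 0 < (Expr.gadj (.get .ph (.var .v)) (.get .ph (.var .y))).eval I
              (Function.update env .y y) s2) ↔ (h v y ∧ ¬ g (s .ph v) (s .ph y)) := by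
          intro y hy
          rw [hadj_pos hI (x := v) (y := y) (by simpa using hn) hrow (by simpa using hv) (by simp) hvn
            hy, gadj_pos hI (x := s .ph v) (y := s .ph y) hrow (by simp [e1, hv]) (by simp [e1])
            (hph v hvn) (hph y hy)]
        have a2 : ∀ y < n, (0 < (Expr.gadj (.get .ph (.var .v)) (.var .y)).eval I
            (Function.update env .y y) s2 ∧
            ¬ 0 < (Expr.get .t2 (.var .y)).eval I (Function.update env .y y) s2) ↔
            (g (s .ph v) y ∧ ¬ ∃ z < n, Near h d v z ∧ s .ph z = y) := by
          intro y hy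
          rw [gadj_pos hI (x := s .ph v) (y := y) hrow (by simp [e1, hv]) (by simp) (hph v hvn) hy]
          simp only [Expr.eval_get, Expr.eval_var, Function.update_self, h2 y hy]
        constructor
        · intro hc
          refine ⟨hph v hvn, fun y hy => ?_, fun w hw => ?_⟩
          · by_contra hg
            have hyn := hI.hG.lt_right hy
            exact hc (Or.inl ⟨y, hyn, (a1 y hyn).mpr ⟨hy, hg⟩⟩)
          · by_contra hg
            have hyn := hI.gG.lt_right hw
            exact hc (Or.inr ⟨w, hyn, (a2 w hyn).mpr ⟨hw, fun ⟨z, _, hz⟩ => hg ⟨z, hz⟩⟩⟩)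
        · rintro ⟨-, b1, b2⟩ (⟨y, hy, hc⟩ | ⟨y, hy, hc⟩)
          · obtain ⟨h3, h4⟩ := (a1 y hy).mp hc
            exact h4 (b1 y h3)
          · obtain ⟨h3, h4⟩ := (a2 y hy).mp hc
            obtain ⟨z, h5, h6⟩ := b2 y h3
            exact h4 ⟨z, h5.lt hI.hG hvn, h5, h6⟩
    · refine Expr.cost_le (n := n) (by simpa using hn) rfl ?_
      simp [Expr.bound, Expr.not, Expr.and, Expr.hadj, Expr.gadj, Expr.ix]
      omega

open Expr in
/-- Clear the flag if a component of the rest has no witness that fits to `ph`. -/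
def childTest : Cmd :=
  .loop .k (.get .hd (.var .v)) <| .ite (.get .chf (.var .k))
    (.letE .key2 (key (.get .chc (.var .k)) (.get .chb (ix (.var .k) (.var .y)))) <|
      .ite (.get .wt (.var .key2)) .skip (.set .fl (.const 0) (.const 0)))
    .skip

theorem eval_childKey {I : ℕ → ℕ} {n d Δ Q : ℕ} {g h : ℕ → ℕ → Prop}
    {env : Env} {s : Store} (hn : env .n = n) (hT : Tables n d Δ Q g h s) {v k : ℕ} {C : Finset ℕ}
    (hk : env .k = k) (hkv : k < s .hd v) (hkn : k < n) (hN : NodeData n d h v C s)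
    (hph : ∀ x < n, s .ph x < n) (hkC : s .hn (n * v + k) ∈ C.erase v) :
    (Expr.key (.get .chc (.var .k)) (.get .chb (.ix (.var .k) (.var .y)))).eval I env s =
      witKey n (comp h (C.erase v) (s .hn (n * v + k)))
        (ball n h d (bdry n h (comp h (C.erase v) (s .hn (n * v + k))))) (s .ph) := by
  refine eval_key hn hT.lists.row hT.kt hph ball_subset ?_ fun y hy => ?_
  · simp [hk, hN.chc k hkv hkC]
  · rw [← hN.chb k hkv hkC y hy]
    simp [hk, hT.lists.row k hkn.le]

theorem childTest_spec {I : ℕ → ℕ} {n d Δ Q : ℕ} {g h : ℕ → ℕ → Prop} (hI : Ctx I n g h)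
    {env : Env} {s : Store} (hn : env .n = n) (hT : Tables n d Δ Q g h s) {v : ℕ} {C : Finset ℕ}
    (hv : env .v = v) (hvn : v < n) (hvC : v ∈ C) (hconn : ∀ x ∈ C, comp h C x = C)
    (hN : NodeData n d h v C s) (hph : ∀ x < n, s .ph x < n) :
    Reaches I env childTest s (fun s' => (∀ j, j ≠ .fl → s' j = s j) ∧
      (0 < s' .fl 0 ↔ 0 < s .fl 0 ∧ ∀ D, IsComp h (C.erase v) D →
        s .wt (witKey n D (ball n h d (bdry n h D)) (s .ph)) ≠ 0)) (50 * (n * (Δ + 1))) := by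
  refine (Reaches.loop (fun k s' => (∀ j, j ≠ .fl → s' j = s j) ∧
      (0 < s' .fl 0 ↔ 0 < s .fl 0 ∧ ∀ j < k, s .hn (n * v + j) ∈ C.erase v →
        s .wt (witKey n (comp h (C.erase v) (s .hn (n * v + j)))
          (ball n h d (bdry n h (comp h (C.erase v) (s .hn (n * v + j))))) (s .ph)) ≠ 0))
      (m := s .hd v) (cN := 2) (b := 18 + n * 20) (by simp [hv]) le_rfl ⟨fun _ _ => rfl, by simp⟩
      ?_).mono ?_ ?_
  · rintro k hk s1 ⟨f1, h1⟩
    have hkn := hk.trans_le (hT.lists.le_n v hvn)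
    have T1 : Tables n d Δ Q g h s1 := hT.congr fun j hj => f1 j (by rintro rfl; simp at hj)
    have N1 : NodeData n d h v C s1 := hN.congr fun j hj => f1 j (by rintro rfl; simp at hj)
    have e1 : s1 .ph = s .ph := f1 _ (by simp)
    have e2 : s1 .wt = s .wt := f1 _ (by simp)
    have e3 : s1 .hn = s .hn := f1 _ (by simp)
    have e4 : s1 .hd = s .hd := f1 _ (by simp)
    have e5 : s1 .chf = s .chf := f1 _ (by simp)
    have step : ∀ P : ℕ → Prop, (∀ j < k + 1, P j) ↔ (∀ j < k, P j) ∧ P k := fun P =>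
      ⟨fun h => ⟨fun j hj => h j (by omega), h k (by omega)⟩, fun h j hj => by
        rcases Nat.lt_succ_iff_lt_or_eq.mp hj with h6 | rfl
        · exact h.1 j h6
        · exact h.2⟩
    refine (Reaches.ite (be := 2) (b := 15 + n * 20) le_rfl (fun hc => ?_) (fun hc => ?_)).mono
      (fun _ h => h) (by omega)
    · have hkC := (hN.chf k hk).mp (by simpa [e5] using hc)
      refine (Reaches.letE (ca := 8 + n * 20) (b := 6) (eval_childKey (by simpa using hn) T1
        (Function.update_self ..) (by rwa [e4]) hkn N1 (by rwa [e1]) (by rwa [e3])) ?_ ?_).mono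
        (fun _ h => h) (by omega)
      · refine Expr.cost_le (n := n) (by simpa using hn) rfl ?_
        simp [Expr.bound, Expr.key, Expr.ix]
        omega
      rw [e1, e3]
      set key := witKey n (comp h (C.erase v) (s .hn (n * v + k)))
          (ball n h d (bdry n h (comp h (C.erase v) (s .hn (n * v + k))))) (s .ph) with hkey
      refine (Reaches.ite (be := 2) (b := 3) le_rfl (fun hc2 => ?_) (fun hc2 => ?_))
      · have hc2' : 0 < s .wt key := by simpa [e2] using hc2
        refine (Reaches.skip ⟨f1, ?_⟩).mono (fun _ h => h) (by omega)
        rw [h1, step]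
        refine and_congr Iff.rfl ⟨fun h => ⟨h, fun _ => hc2'.ne'⟩, fun h => h.1⟩
      · have hc2' : ¬ 0 < s .wt key := by simpa [e2] using hc2
        refine Reaches.set ⟨fun j hj => by rw [Store.set_of_ne hj, f1 j hj], ?_⟩ le_rfl le_rfl
        simp only [Expr.eval_const]
        rw [Store.set_self, if_pos rfl, step]
        refine ⟨fun h => absurd h (by simp), fun h => absurd (h.2.2 hkC) ?_⟩
        rw [← hkey]; omega
    · have hkC : s .hn (n * v + k) ∉ C.erase v := fun h => hc (by
        simpa [e5] using (hN.chf k hk).mpr h)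
      refine (Reaches.skip ⟨f1, ?_⟩).mono (fun _ h => h) (by omega)
      rw [h1, step]
      exact and_congr Iff.rfl ⟨fun h => ⟨h, fun h' => absurd h' hkC⟩, fun h => h.1⟩
  · rintro s' ⟨f, h'⟩
    refine ⟨f, h'.trans (and_congr Iff.rfl ?_)⟩
    exact forall_isComp_iff (P := fun D => s .wt (witKey n D (ball n h d (bdry n h D)) (s .ph)) ≠ 0)
      hI.hG hT.lists hvC hvn hconn
  · have h1 := Nat.mul_le_mul_right (1 + (18 + n * 20)) (hT.lists.le v hvn)
    obtain ⟨m, rfl⟩ : ∃ m, n = m + 1 := ⟨n - 1, by omega⟩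
    nlinarith

/-! ## Recording witnesses -/

/-- The address of the witness for `D` that fits to `φ`. -/
noncomputable def fitKey (n d : ℕ) (h : ℕ → ℕ → Prop) (D : Finset ℕ) (φ : ℕ → ℕ) : ℕ :=
  witKey n D (ball n h d (bdry n h D)) φ

/-- The address sees φ only on the d-ball around the boundary of D. This is the interface through
which D communicates with the rest of the graph. -/
theorem fitKey_congr {n d : ℕ} {h : ℕ → ℕ → Prop} {D : Finset ℕ} {φ ψ : ℕ → ℕ}
    (he : ∀ y ∈ ball n h d (bdry n h D), φ y = ψ y) : fitKey n d h D φ = fitKey n d h D ψ := by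
  unfold fitKey witKey
  congr 1
  exact Finset.sum_congr rfl fun y hy => by rw [he y hy]

/-- Two rows that share a cell belong to the same set and the same interface values, so they
coincide: rows of witnesses are equal or disjoint. -/
theorem fitKey_inj {n d : ℕ} {h : ℕ → ℕ → Prop} {D D' : Finset ℕ} {φ ψ : ℕ → ℕ} {z z' : ℕ}
    (hφ : ∀ y < n, φ y < n) (hψ : ∀ y < n, ψ y < n) (hz : z < n) (hz' : z' < n)
    (he : fitKey n d h D φ + z = fitKey n d h D' ψ + z') :
    D = D' ∧ fitKey n d h D φ = fitKey n d h D' ψ ∧ z = z' ∧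
      ∀ y ∈ ball n h d (bdry n h D), φ y = ψ y := by
  obtain ⟨h1, h2, h3⟩ := witKey_inj ball_subset ball_subset
    (fun y hy => hφ y (by simpa using ball_subset hy))
    (fun y hy => hψ y (by simpa using ball_subset hy)) hz hz' he
  subst h1
  exact ⟨rfl, by omega, h3, h2 rfl⟩

/-- Every nonempty row of the table holds a solution for its set that fits to its values. -/
def Witnesses (n d : ℕ) (g h : ℕ → ℕ → Prop) (wt : ℕ → ℕ) : Prop :=
  ∀ D ⊆ Finset.range n, ∀ ψ : ℕ → ℕ, (∀ y < n, ψ y < n) → wt (fitKey n d h D ψ) ≠ 0 →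
    ∃ ω : ℕ → ℕ, (∀ z < n, wt (fitKey n d h D ψ + z) = ω z + 1) ∧
      (∀ y ∈ ball n h d (bdry n h D), ω y = ψ y) ∧ ∀ x ∈ D, LocalOk n d g h ω x

/-- A row that meets the rewritten one is that row, and it now holds the solution ψ. All other rows
are unchanged. Values are stored increased by one, so a written cell is never 0. -/
theorem Witnesses.update {n d : ℕ} {g h : ℕ → ℕ → Prop} {wt wt' : ℕ → ℕ}
    (hW : Witnesses n d g h wt) {C : Finset ℕ} {φ ψ : ℕ → ℕ} (hφ : ∀ y < n, φ y < n)
    (hrow : ∀ z < n, wt' (fitKey n d h C φ + z) = ψ z + 1)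
    (hne : ∀ b, (∀ z < n, fitKey n d h C φ + z ≠ b) → wt' b = wt b)
    (h1 : ∀ y ∈ ball n h d (bdry n h C), ψ y = φ y) (h2 : ∀ x ∈ C, LocalOk n d g h ψ x) :
    Witnesses n d g h wt' ∧ ∀ a, wt a ≠ 0 → wt' a ≠ 0 := by
  constructor
  · intro D hD χ hχ h0
    by_cases hc : ∃ z < n, ∃ z' < n, fitKey n d h C φ + z = fitKey n d h D χ + z'
    · obtain ⟨z, hz, z', hz', he⟩ := hc
      obtain ⟨rfl, h3, -, h4⟩ := fitKey_inj hφ hχ hz hz' he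
      rw [← h3]
      exact ⟨ψ, hrow, fun y hy => by rw [h1 y hy, h4 y hy], h2⟩
    · push Not at hc
      have h3 : ∀ z' < n, wt' (fitKey n d h D χ + z') = wt (fitKey n d h D χ + z') :=
        fun z' hz' => hne _ fun z hz => hc z hz z' hz'
      by_cases hn : n = 0
      · subst hn
        obtain rfl : D = ∅ := by simpa using hD
        exact ⟨χ, by simp, fun _ _ => rfl, by simp⟩
      · have h4 := h3 0 (by omega)
        rw [add_zero] at h4
        rw [h4] at h0
        obtain ⟨ω, h5, h6⟩ := hW D hD χ hχ h0
        exact ⟨ω, fun z hz => by rw [h3 z hz, h5 z hz], h6⟩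
  · intro a ha
    by_cases hc : ∃ z < n, fitKey n d h C φ + z = a
    · obtain ⟨z, hz, rfl⟩ := hc
      rw [hrow z hz]; simp
    · push Not at hc
      rwa [hne a hc]

open Expr in
/-- Combine `ph` with the witnesses for the components of the rest. -/
def record : Cmd :=
  .letE .key (key (codeOf .cc) (.get .bx (.var .y))) <|
  -- The row starts as a copy of `ph` and is then overwritten on each component by the solution
  -- stored for that component.
  .seq (.loop .z (.var .n)
    (.set .wt (.add (.var .key) (.var .z)) (.add (.get .ph (.var .z)) (.const 1)))) <|
  .loop .k (.get .hd (.var .v)) <| .ite (.get .chf (.var .k))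
    (.letE .key2 (key (.get .chc (.var .k)) (.get .chb (ix (.var .k) (.var .y)))) <|
      .loop .z (.var .n) <| .ite (.get .chm (ix (.var .k) (.var .z)))
        (.set .wt (.add (.var .key) (.var .z)) (.get .wt (.add (.var .key2) (.var .z)))) .skip)
    .skip

/-- The finished row is the map ψ of `localOk_glue`: on each component it is the stored solution
that fits to φ, elsewhere it is φ. -/
theorem record_spec {I : ℕ → ℕ} {n d Δ Q : ℕ} {g h : ℕ → ℕ → Prop} (hI : Ctx I n g h)
    {env : Env} {s : Store} (hn : env .n = n) (hd : 1 ≤ d) (hT : Tables n d Δ Q g h s) {v : ℕ}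
    {C : Finset ℕ} (hv : env .v = v) (hC : C ⊆ Finset.range n) (hvC : v ∈ C)
    (hconn : ∀ x ∈ C, comp h C x = C)
    (hN : NodeData n d h v C s) (hph : ∀ x < n, s .ph x < n) (hW : Witnesses n d g h (s .wt))
    (hok : LocalOk n d g h (s .ph) v)
    (hD : ∀ D, IsComp h (C.erase v) D → s .wt (fitKey n d h D (s .ph)) ≠ 0) :
    Reaches I env record s (fun s' => (∀ j, j ≠ .wt → s' j = s j) ∧ Witnesses n d g h (s' .wt) ∧
      (∀ a, s .wt a ≠ 0 → s' .wt a ≠ 0) ∧ s' .wt (fitKey n d h C (s .ph)) ≠ 0)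
      (200 * (n * (Δ + 1))) := by
  have hvn : v < n := by simpa using hC hvC
  set φ := s .ph with hφ
  set A := C.erase v with hA
  have hAn : A ⊆ Finset.range n := (Finset.erase_subset _ _).trans hC
  set K := fitKey n d h C φ with hK
  let w : ℕ → ℕ := fun k => s .hn (n * v + k)
  let cov : ℕ → ℕ → Prop := fun k z => ∃ j < k, w j ∈ A ∧ z ∈ comp h A (w j)
  classical
  -- The row being written never overlaps a row being read, because v belongs to C but to no
  -- component of C \ {v}.
  have hchild : ∀ D, IsComp h A D → ∀ z < n, ∀ z' < n, K + z ≠ fitKey n d h D φ + z' := by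
    intro D hD' z hz z' hz' he
    obtain ⟨h1, -⟩ := fitKey_inj hph hph hz hz' he
    have : v ∈ D := h1 ▸ hvC
    simpa [hA] using hD'.subset this
  have hb : 1 + (6 + n * 22) + ((2 + n * 9) + (3 + Δ * (1 + (4 + (9 + n * 20 + (2 + n * 15)))))) ≤
      200 * (n * (Δ + 1)) := by
    obtain ⟨m, rfl⟩ : ∃ m, n = m + 1 := ⟨n - 1, by omega⟩
    ring_nf
    omega
  refine (Reaches.letE (v := K) (ca := 6 + n * 22) ?_ ?_ (Reaches.seq (b := 2 + n * 9)
    (R := fun s' => (∀ j, j ≠ .wt → s' j = s j) ∧ (∀ z < n, s' .wt (K + z) = φ z + 1) ∧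
      ∀ b, (∀ z < n, K + z ≠ b) → s' .wt b = s .wt b) ?_ fun s1 ⟨f1, h1, g1⟩ => ?_)).mono
      (fun _ h => h) hb
  · refine eval_key hn hT.lists.row hT.kt hph ball_subset (eval_codeOf hn hT.pw2 hC hN.cc)
      fun y hy => ?_
    rw [← hN.bx y hy]
    simp
  · refine Expr.cost_le (n := n) (by simpa using hn) rfl ?_
    simp [Expr.bound, Expr.key, Expr.ix, Expr.codeOf]
    omega
  · refine (Reaches.tabulate (m := n) (cN := 1) (ci := 3) (ca := 4) (f := fun z => K + z)
      (by simpa using hn) le_rfl rfl rfl (fun i _ => by simp)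
      (fun i _ j _ h => by omega) (fun i _ s => le_rfl) (fun i hi s' _ => le_rfl)).mono ?_ (by omega)
    rintro s' ⟨f, h2, h3⟩
    exact ⟨f, fun z hz => by rw [h2 z hz]; simp [hφ], h3⟩
  refine (Reaches.loop (fun k s' => (∀ j, j ≠ .wt → s' j = s j) ∧
    (∀ z < n, s' .wt (K + z) = if cov k z then s .wt (fitKey n d h (comp h A z) φ + z) else φ z + 1) ∧
      ∀ b, (∀ z < n, K + z ≠ b) → s' .wt b = s .wt b) (m := s .hd v) (cN := 2)
    (b := 4 + (9 + n * 20 + (2 + n * 15))) (by simp [hv, f1]) le_rfl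
    ⟨f1, fun z hz => by rw [h1 z hz, if_neg]; rintro ⟨_, h, -⟩; omega, g1⟩ ?_).mono ?_ ?_
  · rintro k hk s2 ⟨f2, h2, g2⟩
    have hkn := hk.trans_le (hT.lists.le_n v hvn)
    have T2 : Tables n d Δ Q g h s2 := hT.congr fun j hj => f2 j (by rintro rfl; simp at hj)
    have N2 : NodeData n d h v C s2 := hN.congr fun j hj => f2 j (by rintro rfl; simp at hj)
    have e1 : s2 .ph = φ := f2 _ (by simp)
    have e3 : s2 .hn = s .hn := f2 _ (by simp)
    have e4 : s2 .hd = s .hd := f2 _ (by simp)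
    have e5 : s2 .chf = s .chf := f2 _ (by simp)
    have step : ∀ z, cov (k + 1) z ↔ cov k z ∨ w k ∈ A ∧ z ∈ comp h A (w k) := by
      intro z
      constructor
      · rintro ⟨j, hj, h3⟩
        rcases Nat.lt_succ_iff_lt_or_eq.mp hj with h6 | rfl
        · exact Or.inl ⟨j, h6, h3⟩
        · exact Or.inr h3
      · rintro (⟨j, hj, h3⟩ | h3)
        · exact ⟨j, by omega, h3⟩
        · exact ⟨k, by omega, h3⟩
    refine (Reaches.ite (be := 2) (b := 1 + (8 + n * 20) + (2 + n * 15)) le_rfl (fun hc => ?_)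
      (fun hc => ?_)).mono (fun _ h => h) (by omega)
    · have hkC : w k ∈ A := (hN.chf k hk).mp (by simpa [e5] using hc)
      refine (Reaches.letE (ca := 8 + n * 20) (b := 2 + n * 15) (eval_childKey (by simpa using hn) T2
        (Function.update_self ..) (by rwa [e4]) hkn N2
        (by rwa [e1]) (by rwa [e3])) ?_ ?_).mono
        (fun _ h => h) (by omega)
      · refine Expr.cost_le (n := n) (by simpa using hn) rfl ?_
        simp [Expr.bound, Expr.key, Expr.ix]
        omega
      rw [e1, e3]
      set K2 := fitKey n d h (comp h A (w k)) φ with hK2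
      refine (Reaches.loop (fun m s' => (∀ j, j ≠ .wt → s' j = s j) ∧
        (∀ z < n, s' .wt (K + z) = if cov k z ∨ z < m ∧ z ∈ comp h A (w k) then
          s .wt (fitKey n d h (comp h A z) φ + z) else φ z + 1) ∧
          ∀ b, (∀ z < n, K + z ≠ b) → s' .wt b = s .wt b) (m := n) (cN := 1)
        (b := 14) (by simpa using hn) le_rfl
        ⟨f2, fun z hz => by rw [h2 z hz]; simp, g2⟩ ?_).mono ?_ le_rfl
      · rintro z hz s3 ⟨f3, h3, g3⟩
        have hm : 0 < s3 .chm (s3 .row k + z) ↔ z ∈ comp h A (w k) := by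
          rw [f3 _ (by simp), f3 _ (by simp), hT.lists.row k hkn.le]
          exact hN.chm k hk hkC z hz
        have hstep : ∀ z', (z' < z + 1 ∧ z' ∈ comp h A (w k) ↔
            (z' < z ∧ z' ∈ comp h A (w k)) ∨ z' = z ∧ z ∈ comp h A (w k)) := by
          intro z'
          constructor
          · rintro ⟨h5, h6⟩
            rcases Nat.lt_succ_iff_lt_or_eq.mp h5 with h7 | rfl
            · exact Or.inl ⟨h7, h6⟩
            · exact Or.inr ⟨rfl, h6⟩
          · rintro (⟨h5, h6⟩ | ⟨rfl, h6⟩)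
            · exact ⟨by omega, h6⟩
            · exact ⟨by omega, h6⟩
        refine (Reaches.ite (be := 5) (b := 8) le_rfl (fun hc2 => ?_)
          (fun hc2 => ?_)).mono (fun _ h => h) le_rfl
        · have hzk : z ∈ comp h A (w k) := hm.mp (by simpa using hc2)
          refine Reaches.set (ca := 3) (cb := 4) ?_ le_rfl le_rfl
          have hread : s3 .wt (K2 + z) = s .wt (fitKey n d h (comp h A z) φ + z) := by
            rw [g3 _ fun z' hz' => hchild _ (isComp_comp hkC) z' hz' z hz,
              comp_eq_of_mem hI.hG hkC hzk]
          have ev1 : Expr.eval I (.add (.var .key) (.var .z)) (Function.update (Function.update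
            (Function.update (Function.update env .key K) .k k) .key2 K2) .z z) s3 = K + z := by simp
          have ev2 : Expr.eval I (.get .wt (.add (.var .key2) (.var .z))) (Function.update
            (Function.update (Function.update (Function.update env .key K) .k k) .key2 K2) .z z) s3 =
              s3 .wt (K2 + z) := by simp
          have : Function.update (Function.update
            (Function.update (Function.update env .key K) .k k) .key2 K2) .z z = Function.update (Function.update
            (Function.update (Function.update env .key K) .k k) .key2 (witKey n (comp h A (s .hn (n * v + k)))
              (ball n h d (bdry n h (comp h A (s .hn (n * v + k))))) φ)) .z z := rfl
          rw [← this, ev1, ev2, hread]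
          refine ⟨fun j hj => by rw [Store.set_of_ne hj, f3 j hj], fun z' hz' => ?_, fun b hb' => ?_⟩
          · rw [Store.set_self]
            by_cases hzz : z' = z
            · subst hzz
              rw [if_pos rfl, if_pos (Or.inr ⟨by omega, hzk⟩)]
            · rw [if_neg (by omega), h3 z' hz']
              simp only [hstep, hzz, false_and, or_false]
          · rw [Store.set_self, if_neg fun h => hb' z hz h.symm, g3 b hb']
        · have hzk : z ∉ comp h A (w k) := fun h5 => hc2 (by simpa using hm.mpr h5)
          refine (Reaches.skip ⟨f3, fun z' hz' => ?_, g3⟩).mono (fun _ h => h) (by omega)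
          rw [h3 z' hz']
          simp only [hstep, hzk, and_false, or_false]
      · rintro s3 ⟨f3, h3, g3⟩
        refine ⟨f3, fun z hz => ?_, g3⟩
        rw [h3 z hz]
        simp only [step, hz, hkC, true_and]
    · have hkC : w k ∉ A := fun h => hc (by simpa [e5] using (hN.chf k hk).mpr h)
      refine (Reaches.skip ⟨f2, fun z hz => ?_, g2⟩).mono (fun _ h => h) (by omega)
      rw [h2 z hz]
      simp only [step, hkC, false_and, or_false]
  · rintro s' ⟨f, h', g'⟩
    have hcov : ∀ z, cov (s .hd v) z ↔ z ∈ A := by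
      intro z
      constructor
      · rintro ⟨j, -, -, h3⟩; exact comp_subset h3
      · intro hz
        obtain ⟨u, hu, hvu⟩ := exists_adj_of_isComp hI.hG hconn hvC (isComp_comp (h := h) hz)
        obtain ⟨k, hk, rfl⟩ := hT.lists.ex v hvn u hvu
        exact ⟨k, hk, comp_subset hu, comp_mem_symm hI.hG hz hu⟩
    let ψ : ℕ → ℕ := fun z =>
      if z ∈ A then s .wt (fitKey n d h (comp h A z) φ + z) - 1 else φ z
    have hsol : ∀ D, IsComp h A D → ∃ ω : ℕ → ℕ, (∀ x ∈ D, ψ x = ω x) ∧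
        (∀ x ∈ D, s .wt (fitKey n d h D φ + x) = ω x + 1) ∧
        (∀ y ∈ ball n h d (bdry n h D), ω y = φ y) ∧ ∀ x ∈ D, LocalOk n d g h ω x := by
      intro D hD'
      obtain ⟨ω, h3, h4, h5⟩ := hW D (hD'.subset.trans hAn) φ hph (hD D hD')
      have h6 : ∀ x ∈ D, s .wt (fitKey n d h D φ + x) = ω x + 1 := fun x hx =>
        h3 x (by simpa using hAn (hD'.subset hx))
      refine ⟨ω, fun x hx => ?_, h6, h4, h5⟩
      simp only [ψ]
      rw [if_pos (hD'.subset hx), ← hD'.eq_comp hI.hG hx, h6 x hx]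
      simp
    have hrow : ∀ z < n, s' .wt (K + z) = ψ z + 1 := by
      intro z hz
      rw [h' z hz]
      by_cases hzA : z ∈ A
      · obtain ⟨ω, h3, h4, -⟩ := hsol _ (isComp_comp hzA)
        rw [if_pos ((hcov z).mpr hzA), h4 z (mem_comp_self hzA), h3 z (mem_comp_self hzA)]
      · rw [if_neg fun h => hzA ((hcov z).mp h)]
        simp [ψ, hzA]
    obtain ⟨h3, h4⟩ := localOk_glue hI.hG hd hvC hok (ψ := ψ) (fun x hx => by simp only [ψ]; rw [if_neg hx])
      fun D hD' => by
        obtain ⟨ω, h5, -, h6, h7⟩ := hsol D hD'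
        exact ⟨ω, h5, h6, h7⟩
    obtain ⟨h5, h6⟩ := hW.update hph hrow g' h3 h4
    refine ⟨f, h5, h6, ?_⟩
    have := hrow 0 (by omega)
    rw [add_zero] at this
    rw [this]; simp
  · have h1 := Nat.mul_le_mul_right (1 + (4 + (9 + n * 20 + (2 + n * 15)))) (hT.lists.le v hvn)
    omega

/-! ## Enumerating the assignments near a bag -/

/-- The assignment that is given by the values `τ` on `X` and by positions in lists of near vertices
elsewhere. -/
def assignOf (n : ℕ) (X : Finset ℕ) (an gbl τ : ℕ → ℕ) (y : ℕ) : ℕ :=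
  if y ∈ X then τ y else if 0 < an y then gbl (n * τ (an y - 1) + τ y) else 0

/-- The number of values for entry `y` of a vector that describes an assignment. -/
def radix (n Q : ℕ) (X : Finset ℕ) (an : ℕ → ℕ) (y : ℕ) : ℕ :=
  if y ∈ X then n else if 0 < an y then Q else 1

/-- Array `an` names for every vertex near `X` a vertex of `X` that it is near to (plus `1`). -/
structure BagData (n d Q : ℕ) (h : ℕ → ℕ → Prop) (X : Finset ℕ) (s : Store) : Prop where
  bg : Ind n (s .bg) X
  an_mem : ∀ y < n, 0 < s .an y → s .an y - 1 ∈ X ∧ Near h d (s .an y - 1) y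
  an_pos : ∀ y ∈ ball n h d X, 0 < s .an y
  rx : ∀ y < n, s .rx y = radix n Q X (s .an) y

open Expr in
/-- Compute the assignment `ph` that is described by the vector `dg`. -/
def assign : Cmd :=
  .loop .y (.var .n) <| .set .ph (.var .y) <| .ite (.get .bg (.var .y)) (.get .dg (.var .y))
    (.ite (.get .an (.var .y))
      (.get .gbl (ix (.get .dg (.sub (.get .an (.var .y)) (.const 1))) (.get .dg (.var .y))))
      (.const 0))

theorem assign_spec {I : ℕ → ℕ} {n d Δ Q : ℕ} {g h : ℕ → ℕ → Prop}
    {env : Env} {s : Store} (hn : env .n = n) (hT : Tables n d Δ Q g h s) (hQ : Q ≤ n)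
    {X : Finset ℕ} (hX : X ⊆ Finset.range n) (hB : BagData n d Q h X s) {τ : ℕ → ℕ}
    (hdg : ∀ y < n, s .dg y = τ y) (hτ : ∀ y < n, τ y < radix n Q X (s .an) y) :
    Reaches I env assign s (fun s' => (∀ j, j ≠ .ph → s' j = s j) ∧
      (∀ y < n, s' .ph y = assignOf n X (s .an) (s .gbl) τ y) ∧ ∀ y < n, s' .ph y < n)
      (2 + n * 25) := by
  refine (Reaches.fill (n := n) (ca := 20) hn (by simp) rfl rfl
    (by simp [Expr.bound, Expr.ix])).mono ?_ (by omega)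
  rintro s' ⟨f, h'⟩
  have key : ∀ y < n, s' .ph y = assignOf n X (s .an) (s .gbl) τ y := by
    intro y hy
    rw [h' y hy, assignOf]
    simp only [Expr.eval_ite, Expr.eval_get, Expr.eval_var, Function.update_self, hB.bg y hy,
      hdg y hy, Expr.eval_ix, Expr.eval_sub, Expr.eval_const]
    split_ifs with h1 h2
    · rfl
    · have ha := (hB.an_mem y hy h2).1
      have han := Finset.mem_range.mp (hX ha)
      have := hτ _ han
      rw [radix, if_pos ha] at this
      rw [hdg _ han, hT.lists.row _ this.le]
    · rfl
  refine ⟨f, key, fun y hy => ?_⟩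
  rw [key y hy, assignOf]
  have hy' := hτ y hy
  unfold radix at hy'
  split_ifs at hy' ⊢ with h1 h2
  · exact hy'
  · have ha := (hB.an_mem y hy h2).1
    have := hτ _ (Finset.mem_range.mp (hX ha))
    rw [radix, if_pos ha] at this
    exact hT.gbl_lt _ this _ (hy'.trans_le hQ)
  · omega

/-- Every map that is compatible with nearness is described by some vector. -/
theorem exists_assignOf_eq {n d Δ Q : ℕ} {g h : ℕ → ℕ → Prop} {s : Store}
    (hT : Tables n d Δ Q g h s) {X : Finset ℕ} (hX : X ⊆ Finset.range n)
    (hB : BagData n d Q h X s) {Φ : ℕ → ℕ} (hΦ : ∀ y < n, Φ y < n)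
    (hnear : ∀ x < n, ∀ y, Near h d x y → Near g d (Φ x) (Φ y)) :
    ∃ e < ∏ y ∈ Finset.range n, radix n Q X (s .an) y, ∀ y ∈ ball n h d X,
      assignOf n X (s .an) (s .gbl) (dig (radix n Q X (s .an)) e) y = Φ y := by
  have h1 : ∀ y, ∃ t, y < n → t < radix n Q X (s .an) y ∧ (y ∈ X → t = Φ y) ∧
      (y ∉ X → 0 < s .an y → s .gbl (n * Φ (s .an y - 1) + t) = Φ y) := by
    intro y
    by_cases hy : y < n
    swap
    · exact ⟨0, fun h => absurd h hy⟩
    unfold radix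
    by_cases hyX : y ∈ X
    · exact ⟨Φ y, fun _ => ⟨by rw [if_pos hyX]; exact hΦ y hy, fun _ => rfl, fun h => absurd hyX h⟩⟩
    by_cases ha : 0 < s .an y
    · obtain ⟨h2, h3⟩ := hB.an_mem y hy ha
      have han := Finset.mem_range.mp (hX h2)
      -- As Φ does not increase distances, its value at y is near its value at the bag vertex that
      -- is recorded for y, so it occurs at some position k of that list.
      obtain ⟨k, hk, he⟩ := hT.gbl_ex _ (hΦ _ han) _ (hΦ y hy) (hnear _ han y h3)
      exact ⟨k, fun _ => ⟨by rwa [if_neg hyX, if_pos ha], fun h => absurd h hyX, fun _ _ => he⟩⟩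
    · exact ⟨0, fun _ => ⟨by rw [if_neg hyX, if_neg ha]; omega, fun h => absurd h hyX,
        fun _ h => absurd h ha⟩⟩
  choose τ hτ using h1
  obtain ⟨e, he, hd⟩ := exists_dig_eq (radix n Q X (s .an)) τ n fun y hy => (hτ y hy).1
  refine ⟨e, he, fun y hy => ?_⟩
  have hyn := (mem_ball.mp hy).1
  obtain ⟨-, h2, h3⟩ := hτ y hyn
  rw [assignOf, hd y hyn]
  split_ifs with hyX ha
  · exact h2 hyX
  · have ha' := (hB.an_mem y hyn ha).1
    have han := Finset.mem_range.mp (hX ha')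
    rw [hd _ han, (hτ _ han).2.1 ha', h3 hyX ha]
  · exact absurd (hB.an_pos y hy) ha

/-- Find witnesses for the current set by trying all assignments. -/
def enumerate : Cmd :=
  .seq (initBox .n) <| .loop .e (.get .cnt (.const 0)) <|
    .seq assign <| .seq localTest <| .seq childTest <|
    .seq (.ite (.get .fl (.const 0)) record .skip) (next .n)

/-- Completeness is claimed only for maps Φ that respect nearness, which includes all global
solutions. The tests at v and at the pieces depend only on the d-ball around the bag, so the
enumerated assignment that agrees with Φ there passes, and its row has the address that belongs to
Φ. -/
theorem enumerate_spec {I : ℕ → ℕ} {n d Δ Q : ℕ} {g h : ℕ → ℕ → Prop} (hI : Ctx I n g h)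
    {env : Env} {s : Store} (hn : env .n = n) (hd : 1 ≤ d) (hT : Tables n d Δ Q g h s)
    (hQ1 : 1 ≤ Q) (hQ : Q ≤ n) {v : ℕ} {C X : Finset ℕ} (hv : env .v = v)
    (hC : C ⊆ Finset.range n) (hvC : v ∈ C) (hconn : ∀ x ∈ C, comp h C x = C)
    (hXe : X = insert v (bdry n h C)) (hN : NodeData n d h v C s) (hB : BagData n d Q h X s)
    (hW : Witnesses n d g h (s .wt)) :
    Reaches I env enumerate s (fun s' =>
      (∀ j, j ∉ [Arr.dg, .cnt, .ph, .t2, .fl, .wt, .ca] → s' j = s j) ∧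
      Witnesses n d g h (s' .wt) ∧ (∀ a, s .wt a ≠ 0 → s' .wt a ≠ 0) ∧
      ∀ Φ : ℕ → ℕ, (∀ y < n, Φ y < n) → (∀ x < n, ∀ y, Near h d x y → Near g d (Φ x) (Φ y)) →
        LocalOk n d g h Φ v → (∀ D, IsComp h (C.erase v) D → s .wt (fitKey n d h D Φ) ≠ 0) →
        s' .wt (fitKey n d h C Φ) ≠ 0)
      (30 * n ^ 2 + (∏ y ∈ Finset.range n, radix n Q X (s .an) y) * (700 * (n * (Δ + 1)))) := by
  have hvn : v < n := by simpa using hC hvC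
  have hX : X ⊆ Finset.range n := by
    rw [hXe]
    exact Finset.insert_subset (by simpa using hvn)
      fun x hx => by simpa using (mem_bdry.mp hx).1
  set r := radix n Q X (s .an) with hr
  set E := ∏ y ∈ Finset.range n, r y with hE
  have hr0 : ∀ y < n, 0 < r y := by
    intro y hy
    simp only [hr, radix]
    split_ifs <;> omega
  have hrn : ∀ y < n, r y ≤ n := by
    intro y hy
    simp only [hr, radix]
    split_ifs <;> omega
  have hb : (7 + n * (10 + 3 * n)) + (3 + E * (1 + ((2 + n * 25) + (200 * n + (50 * (n * (Δ + 1)) +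
      ((3 + 200 * (n * (Δ + 1))) + (5 + n * 25))))))) ≤ 30 * n ^ 2 + E * (700 * (n * (Δ + 1))) := by
    obtain ⟨m, rfl⟩ : ∃ m, n = m + 1 := ⟨n - 1, by omega⟩
    clear_value E
    ring_nf
    omega
  refine (Reaches.seq (initBox_spec (m := n) (R := n) (r := r) hn hB.rx hrn)
    fun s1 ⟨f1, c1, d1⟩ => ?_).mono (fun _ h => h) hb
  let L := [Arr.dg, .cnt, .ph, .t2, .fl, .wt, .ca]
  have w1 : s1 .wt = s .wt := f1 _ (by simp) (by simp)
  refine (Reaches.loop (fun e s' => (∀ j, j ∉ L → s' j = s j) ∧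
    Witnesses n d g h (s' .wt) ∧ (∀ a, s .wt a ≠ 0 → s' .wt a ≠ 0) ∧ (∀ y < n, s' .dg y = dig r e y) ∧
      ∀ e' < e, ∀ φ : ℕ → ℕ, (∀ y < n, φ y = assignOf n X (s .an) (s .gbl) (dig r e') y) →
        LocalOk n d g h φ v → (∀ D, IsComp h (C.erase v) D → s .wt (fitKey n d h D φ) ≠ 0) →
        s' .wt (fitKey n d h C φ) ≠ 0) (m := E) (cN := 2) (by simpa using c1) le_rfl
    ⟨fun j hj => ?_, by rwa [w1], by rw [w1]; exact fun _ h => h, d1, by simp⟩ ?_).mono ?_ le_rfl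
  · refine f1 j ?_ ?_ <;> (rintro rfl; revert hj; decide)
  · rintro e he s2 ⟨f2, W2, m2, d2, p2⟩
    have T2 : Tables n d Δ Q g h s2 := hT.congr fun j hj => f2 j (by
      revert hj; cases j <;> decide)
    have N2 : NodeData n d h v C s2 := hN.congr fun j hj => f2 j (by
      revert hj; cases j <;> decide)
    have e2 : s2 .an = s .an := f2 _ (by decide)
    have e3 : s2 .gbl = s .gbl := f2 _ (by decide)
    have e4 : s2 .rx = s .rx := f2 _ (by decide)
    have B2 : BagData n d Q h X s2 := by
      obtain ⟨b1, b2, b3, b4⟩ := hB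
      refine ⟨?_, ?_, ?_, ?_⟩ <;> simpa [e2, e4, f2 .bg (by decide)]
    refine Reaches.seq (assign_spec (by simpa using hn) T2 hQ hX B2 d2
      (by rw [e2]; exact fun y hy => dig_lt (hr0 y hy))) fun s3 ⟨f3, h3, l3⟩ => ?_
    rw [e2, e3] at h3
    have T3 : Tables n d Δ Q g h s3 := T2.congr fun j hj => f3 j (by rintro rfl; simp at hj)
    have N3 : NodeData n d h v C s3 := N2.congr fun j hj => f3 j (by rintro rfl; simp at hj)
    refine Reaches.seq (localTest_spec hI (by simpa using hn) T3 (by simpa using hv) hvn l3)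
      fun s4 ⟨f4, h4⟩ => ?_
    have T4 : Tables n d Δ Q g h s4 := T3.congr fun j hj => by
      apply f4 <;> (rintro rfl; simp at hj)
    have N4 : NodeData n d h v C s4 := N3.congr fun j hj => by
      apply f4 <;> (rintro rfl; simp at hj)
    have p4 : s4 .ph = s3 .ph := f4 _ (by simp) (by simp)
    refine Reaches.seq (childTest_spec hI (by simpa using hn) T4 (by simpa using hv) hvn hvC hconn N4
      (by rwa [p4])) fun s5 ⟨f5, h5⟩ => ?_
    have T5 : Tables n d Δ Q g h s5 := T4.congr fun j hj => f5 j (by rintro rfl; simp at hj)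
    have N5 : NodeData n d h v C s5 := N4.congr fun j hj => f5 j (by rintro rfl; simp at hj)
    have p5 : s5 .ph = s3 .ph := by rw [f5 _ (by simp), p4]
    have w4 : s4 .wt = s2 .wt := by rw [f4 _ (by simp) (by simp), f3 _ (by simp)]
    have w5 : s5 .wt = s2 .wt := by rw [f5 _ (by simp), w4]
    rw [h4, p4, w4] at h5
    refine Reaches.seq (R := fun s' => (∀ j, j ≠ .wt → s' j = s5 j) ∧
      Witnesses n d g h (s' .wt) ∧ (∀ a, s2 .wt a ≠ 0 → s' .wt a ≠ 0) ∧
      (0 < s5 .fl 0 → s' .wt (fitKey n d h C (s3 .ph)) ≠ 0)) (b := 3 + 200 * (n * (Δ + 1))) ?_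
      fun s6 ⟨f6, W6, m6, h6⟩ => ?_
    · have hpos : 1 ≤ 200 * (n * (Δ + 1)) := by
        have : 0 < n * (Δ + 1) := Nat.mul_pos (by omega) (by omega)
        omega
      refine (Reaches.ite (be := 2) (b := 200 * (n * (Δ + 1))) le_rfl (fun hc => ?_)
        (fun hc => ?_)).mono (fun _ h => h) le_rfl
      · obtain ⟨c1, c2⟩ := h5.mp (by simpa using hc)
        refine (record_spec hI (by simpa using hn) hd T5 (by simpa using hv) hC hvC hconn N5
          (by rwa [p5]) (by rwa [w5]) (by rwa [p5]) (by rwa [p5, w5])).mono ?_ le_rfl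
        rintro s' ⟨k1, k2, k3, k4⟩
        rw [w5] at k3
        rw [p5] at k4
        exact ⟨k1, k2, k3, fun _ => k4⟩
      · exact (Reaches.skip ⟨fun _ _ => rfl, by rwa [w5], by rw [w5]; exact fun _ h => h,
          fun h => absurd h (by simpa using hc)⟩).mono (fun _ h => h) hpos
    have rr : ∀ j, j ∉ [Arr.ph, .t2, .fl, .wt] → s6 j = s2 j := by
      intro j hj
      rw [f6 j, f5 j, f4 j, f3 j] <;> (rintro rfl; revert hj; decide)
    refine (next_spec (m := n) (e := e) (r := r) (by simpa using hn) hr0 (fun y hy => ?_)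
      (fun y hy => ?_)).mono ?_ le_rfl
    · rw [rr _ (by decide), e4]; exact hB.rx y hy
    · rw [rr _ (by decide)]; exact d2 y hy
    rintro s7 ⟨f7, d7⟩
    have w7 : s7 .wt = s6 .wt := f7 _ (by simp) (by simp)
    rw [w7]
    refine ⟨fun j hj => ?_, W6, fun a ha => m6 a (m2 a ha), d7, fun e' he' φ hφ hok hD => ?_⟩
    · rw [f7 j, rr j, f2 j hj] <;> (revert hj; cases j <;> decide)
    · rcases Nat.lt_succ_iff_lt_or_eq.mp he' with h7 | rfl
      · exact m6 _ (p2 e' h7 φ hφ hok hD)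
      · have heq : ∀ y < n, s3 .ph y = φ y := fun y hy => by rw [h3 y hy, hφ y hy]
        have hfk : ∀ D, fitKey n d h D (s3 .ph) = fitKey n d h D φ := fun D =>
          fitKey_congr fun y hy => heq y (mem_ball.mp hy).1
        rw [← hfk]
        refine h6 (h5.mpr ⟨hok.congr hd fun y hy => heq y (hy.lt hI.hG hvn), fun D hD' => ?_⟩)
        have := m2 _ (hD D hD')
        rw [← hfk] at this
        exact this
  · rintro s' ⟨f, W, m, -, p⟩
    refine ⟨f, W, m, fun Φ hΦ hnear hok hD => ?_⟩
    obtain ⟨e, he, hag⟩ := exists_assignOf_eq hT hX hB hΦ hnear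
    set φ := assignOf n X (s .an) (s .gbl) (dig (radix n Q X (s .an)) e) with hφ
    -- Used for the boundary of C and for the boundaries of the pieces, all of which lie in the bag
    -- X.
    have hball : ∀ Y ⊆ X, ∀ y ∈ ball n h d Y, φ y = Φ y := by
      intro Y hY y hy
      obtain ⟨h1, b, hb, h2⟩ := mem_ball.mp hy
      exact hag y (mem_ball.mpr ⟨h1, b, hY hb, h2⟩)
    rw [← fitKey_congr (hball _ (by rw [hXe]; exact Finset.subset_insert _ _))]
    refine p e he φ (fun _ _ => rfl) (hok.congr hd fun y hy => ?_) fun D hD' => ?_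
    · exact hag y (mem_ball.mpr ⟨hy.lt hI.hG hvn, v, by simp [hXe], hy⟩)
    · rw [fitKey_congr (hball _ (by rw [hXe]; exact bdry_comp_subset hI.hG hD'))]
      exact hD D hD'

/-! ## Setting up a node -/

namespace Expr

/-- Membership of `y` in the boundary of the set in array `S`. -/
def bdryOf (S : Arr) : Expr :=
  and (not (.get S (.var .y))) (.sum .z (.var .n) (and (.get S (.var .z)) (hadj (.var .y) (.var .z))))

/-- Membership of `y` in the ball around the set in array `S`. -/
def ballOf (S : Arr) : Expr :=
  .sum .x (.var .n) (and (.get S (.var .x)) (.get .eh (ix (.var .x) (.var .y))))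

variable {I : ℕ → ℕ} {n d Δ Q : ℕ} {g h : ℕ → ℕ → Prop} {env : Env} {s : Store}

theorem bdryOf_pos (hI : Ctx I n g h) (hn : env .n = n) (hT : Tables n d Δ Q g h s) {S : Arr}
    {C : Finset ℕ} (hC : C ⊆ Finset.range n) (hS : Ind n (s S) C) {y : ℕ} (hy : env .y = y)
    (hyn : y < n) : 0 < (bdryOf S).eval I env s ↔ y ∈ bdry n h C := by
  simp only [bdryOf, and_pos, not_pos, sum_pos, eval_get, eval_var, hy, hS y hyn, hn, mem_bdry, hyn,
    true_and, Function.update_self]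
  refine and_congr Iff.rfl ⟨?_, ?_⟩
  · rintro ⟨z, hz, h1, h2⟩
    rw [hadj_pos hI (x := y) (y := z) (by simpa using hn) hT.lists.row (by simpa using hy) (by simp)
      hyn hz] at h2
    exact ⟨z, (hS z hz).mp h1, h2⟩
  · rintro ⟨z, h1, h2⟩
    have hz : z < n := by simpa using hC h1
    refine ⟨z, hz, (hS z hz).mpr h1, ?_⟩
    rwa [hadj_pos hI (x := y) (y := z) (by simpa using hn) hT.lists.row (by simpa using hy) (by simp)
      hyn hz]

theorem ballOf_pos (hn : env .n = n) (hT : Tables n d Δ Q g h s) {S : Arr}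
    {X : Finset ℕ} (hX : X ⊆ Finset.range n) (hS : Ind n (s S) X) {y : ℕ} (hy : env .y = y)
    (hyn : y < n) : 0 < (ballOf S).eval I env s ↔ y ∈ ball n h d X := by
  simp only [ballOf, and_pos, sum_pos, eval_get, eval_var, hn, mem_ball, hyn,
    true_and, Function.update_self, eval_ix]
  constructor
  · rintro ⟨x, hx, h1, h2⟩
    refine ⟨x, (hS x hx).mp h1, ?_⟩
    rw [hT.lists.row x hx.le] at h2
    simpa [hy, hT.eh x hx y hyn] using h2
  · rintro ⟨x, h1, h2⟩
    have hx : x < n := by simpa using hX h1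
    refine ⟨x, hx, (hS x hx).mpr h1, ?_⟩
    rw [hT.lists.row x hx.le]
    simpa [hy, hT.eh x hx y hyn] using h2

end Expr

theorem bdry_subset {n : ℕ} {h : ℕ → ℕ → Prop} {C : Finset ℕ} : bdry n h C ⊆ Finset.range n :=
  fun x hx => by simpa using (mem_bdry.mp hx).1

/-- Filling an array with the indicator of a set. -/
theorem Reaches.fillInd {I : ℕ → ℕ} {env : Env} {s : Store} {a : Expr} {k : Arr} {n ca : ℕ}
    {S : Finset ℕ} (hn : env .n = n)
    (ha : a.reads k = false) (hp : a.isPlain = true) (hb : a.bound n ≤ ca)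
    (h : ∀ y < n, 0 < a.eval I (Function.update env .y y) s ↔ y ∈ S) :
    Reaches I env (.loop .y (.var .n) (.set k (.var .y) a)) s
      (fun s' => (∀ j, j ≠ k → s' j = s j) ∧ Ind n (s' k) S) (2 + n * (3 + ca)) :=
  (Reaches.fill hn (by simp) ha hp hb).mono
    (fun s' h' => ⟨h'.1, fun y hy => by rw [h'.2 y hy]; exact h y hy⟩) le_rfl

open Expr in
/-- Tabulate the components of the rest and the surroundings of their boundaries. -/
def childSetup : Cmd :=
  .loop .k (.get .hd (.var .v)) <| .letE .w (.get .hn (ix (.var .v) (.var .k))) <|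
    .ite (.get .s2 (.var .w))
      (.seq (bfs .s2 .w) <|
      .seq (.set .chf (.var .k) (.const 1)) <|
      .seq (.set .chc (.var .k) (codeOf .mk)) <|
      .seq (.loop .y (.var .n) (.set .chm (ix (.var .k) (.var .y)) (.get .mk (.var .y)))) <|
      .seq (.loop .y (.var .n) (.set .xd (.var .y) (bdryOf .mk))) <|
      .loop .y (.var .n) (.set .chb (ix (.var .k) (.var .y)) (ballOf .xd)))
      (.set .chf (.var .k) (.const 0))

theorem childSetup_spec {I : ℕ → ℕ} {n d Δ Q : ℕ} {g h : ℕ → ℕ → Prop} (hI : Ctx I n g h)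
    {env : Env} {s : Store} (hn : env .n = n) (hT : Tables n d Δ Q g h s) {v : ℕ} {A : Finset ℕ}
    (hv : env .v = v) (hvn : v < n) (hA : A ⊆ Finset.range n) (hs2 : Ind n (s .s2) A) :
    Reaches I env childSetup s (fun s' =>
      (∀ j, j ∉ [Arr.mk, .qu, .ln, .chf, .chc, .chm, .xd, .chb] → s' j = s j) ∧
      (∀ k < s .hd v, 0 < s' .chf k ↔ s .hn (n * v + k) ∈ A) ∧
      ∀ k < s .hd v, s .hn (n * v + k) ∈ A →
        s' .chc k = code n (comp h A (s .hn (n * v + k))) ∧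
        (∀ y < n, 0 < s' .chm (n * k + y) ↔ y ∈ comp h A (s .hn (n * v + k))) ∧
        ∀ y < n, 0 < s' .chb (n * k + y) ↔ y ∈ ball n h d (bdry n h (comp h A (s .hn (n * v + k)))))
      (200 * (n ^ 2 * (Δ + 1) ^ 2)) := by
  obtain ⟨b2, hb2⟩ : ∃ b2, b2 = 50 * (n * (Δ + 1)) + (3 + ((4 + n * 7) + ((2 + n * 8) +
    ((2 + n * (8 + (2 + n * 20))) + (2 + n * (6 + (2 + n * 20))))))) := ⟨_, rfl⟩
  have hb : 3 + Δ * (1 + (6 + (3 + b2))) ≤ 200 * (n ^ 2 * (Δ + 1) ^ 2) := by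
    obtain ⟨m, rfl⟩ : ∃ m, n = m + 1 := ⟨n - 1, by omega⟩
    rw [hb2]
    ring_nf
    omega
  refine (Reaches.loop (fun k s' => (∀ j, j ∉ [Arr.mk, .qu, .ln, .chf, .chc, .chm, .xd, .chb] →
        s' j = s j) ∧ (∀ j < k, 0 < s' .chf j ↔ s .hn (n * v + j) ∈ A) ∧
      ∀ j < k, s .hn (n * v + j) ∈ A →
        s' .chc j = code n (comp h A (s .hn (n * v + j))) ∧
        (∀ y < n, 0 < s' .chm (n * j + y) ↔ y ∈ comp h A (s .hn (n * v + j))) ∧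
        ∀ y < n, 0 < s' .chb (n * j + y) ↔ y ∈ ball n h d (bdry n h (comp h A (s .hn (n * v + j)))))
    (m := s .hd v) (cN := 2) (by simp [hv]) le_rfl ⟨fun _ _ => rfl, by simp, by simp⟩ ?_
    (b := 6 + (3 + b2))).mono (fun _ h => h) ?_
  swap
  · have := Nat.mul_le_mul_right (1 + (6 + (3 + b2))) (hT.lists.le v hvn)
    omega
  rintro k hk s1 ⟨f1, c1, d1⟩
  have hkn := hk.trans_le (hT.lists.le_n v hvn)
  have T1 : Tables n d Δ Q g h s1 := hT.congr fun j hj => f1 j (by revert hj; cases j <;> decide)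
  have hvw := hT.lists.adj v hvn k hk
  set w := s .hn (n * v + k) with hw
  have hwn := hI.hG.lt_right hvw
  have e2 : s1 .s2 = s .s2 := f1 _ (by decide)
  refine (Reaches.letE (v := w) (ca := 5) (b := 3 + b2) ?_ le_rfl ?_).mono
    (fun _ h => h) (by omega)
  · simp [hv, f1 .row (by decide), f1 .hn (by decide), hT.lists.row v hvn.le, hw]
  refine (Reaches.ite (be := 2) (b := b2) le_rfl (fun hc2 => ?_)
    (fun hc2 => ?_)).mono (fun _ h => h) le_rfl
  swap
  · have hwA : w ∉ A := fun h3 => hc2 (by simpa [e2] using (hs2 w hwn).mpr h3)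
    refine (Reaches.set (ca := 1) (cb := 1) ?_ le_rfl le_rfl).mono (fun _ h => h) (by omega)
    simp only [Expr.eval_const, Expr.eval_var, ne_eq, reduceCtorEq, not_false_eq_true,
      Function.update_of_ne, Function.update_self]
    refine ⟨fun j hj => ?_, fun j hj => ?_, fun j hj hjA => ?_⟩
    · rw [Store.set_of_ne (by rintro rfl; revert hj; decide), f1 j hj]
    · rw [Store.set_self]
      rcases Nat.lt_succ_iff_lt_or_eq.mp hj with h6 | rfl
      · rw [if_neg h6.ne]; exact c1 j h6
      · simp only [if_pos, lt_self_iff_false, false_iff]; exact hwA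
    · rw [Store.set_of_ne (by simp), Store.set_of_ne (by simp), Store.set_of_ne (by simp)]
      rcases Nat.lt_succ_iff_lt_or_eq.mp hj with h6 | rfl
      · exact d1 j h6 hjA
      · exact absurd hjA hwA
  · have hwA : w ∈ A := (hs2 w hwn).mp (by simpa [e2] using hc2)
    set D := comp h A w with hD
    have hDn : D ⊆ Finset.range n := comp_subset.trans hA
    refine Reaches.mono (b := 50 * (n * (Δ + 1)) + (3 + ((4 + n * 7) + ((2 + n * 8) +
    ((2 + n * (8 + (2 + n * 20))) + (2 + n * (6 + (2 + n * 20))))))))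
      ?_ (fun _ h => h) hb2.ge
    refine Reaches.seq (bfs_spec hI (by simpa using hn) T1.lists
      (by simp) (by simp) (by simp) hA (by rw [e2]; exact hs2)
      (by simp) hwA) fun s3 ⟨f3, h3⟩ => ?_
    have T3 : Tables n d Δ Q g h s3 := T1.congr fun j hj => by
      apply f3 <;> (rintro rfl; simp at hj)
    refine Reaches.seq (R := fun s' => s' = s3.set .chf k 1) (b := 3)
      (Reaches.set (by simp) le_rfl le_rfl) ?_
    rintro _ rfl
    refine Reaches.seq (R := fun s' => s' = (s3.set .chf k 1).set .chc k (code n D))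
      (b := 4 + n * 7) ?_ ?_
    · refine (Reaches.set (ca := 1) (cb := 2 + n * 7) ?_ le_rfl ?_).mono (fun _ h => h) (by omega)
      · rw [eval_codeOf (n := n) (by simpa using hn) (by rw [Store.set_of_ne (by simp)]; exact T3.pw2)
          hDn (by rw [Store.set_of_ne (by simp)]; exact h3)]
        simp
      · exact Expr.cost_le (n := n) (by simpa using hn) rfl (by simp [Expr.bound, Expr.codeOf])
    rintro _ rfl
    set s4 := (s3.set .chf k 1).set .chc k (code n D) with hs4
    have f4 : ∀ j, j ≠ .chf → j ≠ .chc → s4 j = s3 j := fun j j1 j2 => by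
      rw [hs4, Store.set_of_ne j2, Store.set_of_ne j1]
    have T4 : Tables n d Δ Q g h s4 := T3.congr fun j hj => by
      apply f4 <;> (rintro rfl; simp at hj)
    refine Reaches.seq (Reaches.fillRow (n := n) (i := k) (ca := 2) (by simpa using hn) (by simp) hkn
      (by simp) (by simp) (by simp) T4.lists.row rfl rfl le_rfl) fun s5 ⟨f5, h5, g5⟩ => ?_
    have T5 : Tables n d Δ Q g h s5 := T4.congr fun j hj => f5 j (by rintro rfl; simp at hj)
    have m5 : s5 .mk = s3 .mk := by rw [f5 _ (by simp), f4 _ (by simp) (by simp)]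
    refine Reaches.seq ((Reaches.fillInd (n := n) (ca := 5 + (2 + n * 20)) (S := bdry n h D)
      (by simpa using hn) rfl rfl ?_ fun y hy => ?_).mono (fun _ h => h) (by
        apply le_of_eq; ring)) fun s6 ⟨f6, h6⟩ => ?_
    · simp [Expr.bound, Expr.bdryOf, Expr.and, Expr.not, Expr.hadj, Expr.ix]
      omega
    · exact Expr.bdryOf_pos hI (by simpa using hn) T5 hDn (by rw [m5]; exact h3) (by simp) hy
    have T6 : Tables n d Δ Q g h s6 := T5.congr fun j hj => f6 j (by rintro rfl; simp at hj)
    refine (Reaches.fillRow (n := n) (i := k) (ca := 2 + n * 20) (by simpa using hn) (by simp) hkn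
      (by simp) (by simp) (by simp) T6.lists.row rfl rfl ?_).mono ?_ le_rfl
    · simp [Expr.bound, Expr.ballOf, Expr.and, Expr.ix]
      omega
    rintro s7 ⟨f7, h7, g7⟩
    refine ⟨fun j hj => ?_, fun j hj => ?_, fun j hj hjA => ?_⟩
    · rw [f7 j, f6 j, f5 j, f4 j, f3 j, f1 j hj] <;> (rintro rfl; revert hj; decide)
    · rw [f7 _ (by simp), f6 _ (by simp), f5 _ (by simp), hs4, Store.set_of_ne (by simp),
        Store.set_self, f3 _ (by simp) (by simp) (by simp)]
      rcases Nat.lt_succ_iff_lt_or_eq.mp hj with h8 | rfl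
      · rw [if_neg h8.ne]; exact c1 j h8
      · simp only [if_pos, Nat.lt_one_iff, pos_of_gt, true_iff]; exact hwA
    · rcases Nat.lt_succ_iff_lt_or_eq.mp hj with h8 | rfl
      · obtain ⟨i1, i2, i3⟩ := d1 j h8 hjA
        have hne : ∀ y < n, ∀ y' < n, n * k + y' ≠ n * j + y := fun y hy y' hy' h =>
          h8.ne' (index_inj hy' hy h).1
        refine ⟨?_, fun y hy => ?_, fun y hy => ?_⟩
        · rw [f7 _ (by simp), f6 _ (by simp), f5 _ (by simp), hs4, Store.set_self, if_neg h8.ne,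
            Store.set_of_ne (by simp), f3 _ (by simp) (by simp) (by simp), i1]
        · rw [f7 _ (by simp), f6 _ (by simp), g5 _ (hne y hy), f4 _ (by simp) (by simp),
            f3 _ (by simp) (by simp) (by simp)]
          exact i2 y hy
        · rw [g7 _ (hne y hy), f6 _ (by simp), f5 _ (by simp), f4 _ (by simp) (by simp),
            f3 _ (by simp) (by simp) (by simp)]
          exact i3 y hy
      · refine ⟨?_, fun y hy => ?_, fun y hy => ?_⟩
        · rw [f7 _ (by simp), f6 _ (by simp), f5 _ (by simp), hs4, Store.set_self, if_pos rfl]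
        · rw [f7 _ (by simp), f6 _ (by simp), h5 y hy, ← h3 y hy, Expr.eval_get,
            f4 _ (by simp) (by simp)]
          simp
        · rw [h7 y hy]
          exact Expr.ballOf_pos (by simpa using hn) T6 bdry_subset h6 (by simp) hy

open Expr in
/-- Prepare the enumeration for the `i`-th set of the removal order. -/
def nodeSetup : Cmd :=
  .seq (.loop .y (.var .n) (.set .cc (.var .y) (.get .cm (ix (.var .i) (.var .y))))) <|
  .seq (.loop .y (.var .n) (.set .xx (.var .y) (bdryOf .cc))) <|
  .seq (.loop .y (.var .n) (.set .bx (.var .y) (ballOf .xx))) <|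
  .seq (.loop .y (.var .n) (.set .bg (.var .y) (or (.get .xx (.var .y)) (eq (.var .y) (.var .v))))) <|
  .seq (.loop .y (.var .n) (.set .an (.var .y) (.sup .x (.var .n)
    (.ite (and (.get .bg (.var .x)) (.get .eh (ix (.var .x) (.var .y))))
      (.add (.var .x) (.const 1)) (.const 0))))) <|
  .seq (.loop .y (.var .n) (.set .s2 (.var .y)
    (and (.get .cc (.var .y)) (not (eq (.var .y) (.var .v)))))) <|
  .seq (.loop .y (.var .n) (.set .rx (.var .y)
    (.ite (.get .bg (.var .y)) (.var .n) (.ite (.get .an (.var .y)) (.var .q) (.const 1))))) <|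
  childSetup

theorem nodeSetup_spec {I : ℕ → ℕ} {n d Δ Q : ℕ} {g h : ℕ → ℕ → Prop} (hI : Ctx I n g h)
    {env : Env} {s : Store} (hn : env .n = n) (hq : env .q = Q) (hT : Tables n d Δ Q g h s)
    {v i : ℕ} {C : Finset ℕ} (hv : env .v = v) (hi : env .i = i) (hin : i < n) (hvC : v ∈ C)
    (hC : C ⊆ Finset.range n) (hcm : ∀ y < n, 0 < s .cm (n * i + y) ↔ y ∈ C) :
    Reaches I env nodeSetup s (fun s' =>
      (∀ j, j ∉ [Arr.cc, .xx, .bx, .bg, .an, .s2, .rx, .mk, .qu, .ln, .chf, .chc, .chm, .xd, .chb] →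
        s' j = s j) ∧ NodeData n d h v C s' ∧ BagData n d Q h (insert v (bdry n h C)) s')
      (400 * (n ^ 2 * (Δ + 1) ^ 2)) := by
  have hvn : v < n := by simpa using hC hvC
  set X := insert v (bdry n h C) with hX
  have hXn : X ⊆ Finset.range n := Finset.insert_subset (by simpa using hvn) bdry_subset
  have hb : (2 + n * 8) + ((2 + n * (3 + (5 + (2 + n * 20)))) + ((2 + n * (3 + (2 + n * 20))) +
      ((2 + n * 18) + ((2 + n * (3 + (2 + n * 20))) + ((2 + n * 18) + ((2 + n * 12) +
      200 * (n ^ 2 * (Δ + 1) ^ 2))))))) ≤ 400 * (n ^ 2 * (Δ + 1) ^ 2) := by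
    obtain ⟨m, rfl⟩ : ∃ m, n = m + 1 := ⟨n - 1, by omega⟩
    ring_nf
    omega
  refine (Reaches.seq (Reaches.fillInd (n := n) (ca := 5) (S := C) hn rfl rfl le_rfl fun y hy => ?_)
    fun s1 ⟨f1, h1⟩ => ?_).mono (fun _ h => h) hb
  · simp [hi, hT.lists.row i hin.le, hcm y hy]
  have T1 : Tables n d Δ Q g h s1 := hT.congr fun j hj => f1 j (by rintro rfl; simp at hj)
  refine Reaches.seq (Reaches.fillInd (n := n) (ca := 5 + (2 + n * 20)) (S := bdry n h C)
      hn rfl rfl ?_ fun y hy => ?_) fun s2 ⟨f2, h2⟩ => ?_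
  · simp [Expr.bound, Expr.bdryOf, Expr.and, Expr.not, Expr.hadj, Expr.ix]
    omega
  · exact Expr.bdryOf_pos hI (by simpa using hn) T1 hC h1 (by simp) hy
  have T2 : Tables n d Δ Q g h s2 := T1.congr fun j hj => f2 j (by rintro rfl; simp at hj)
  refine Reaches.seq (Reaches.fillInd (n := n) (ca := 2 + n * 20) (S := ball n h d (bdry n h C))
      hn rfl rfl ?_ fun y hy => ?_) fun s3 ⟨f3, h3⟩ => ?_
  · simp [Expr.bound, Expr.ballOf, Expr.and, Expr.ix]
    omega
  · exact Expr.ballOf_pos (by simpa using hn) T2 bdry_subset h2 (by simp) hy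
  have T3 : Tables n d Δ Q g h s3 := T2.congr fun j hj => f3 j (by rintro rfl; simp at hj)
  refine Reaches.seq (Reaches.fillInd (n := n) (ca := 15) (S := X)
      hn rfl rfl ?_ fun y hy => ?_) fun s4 ⟨f4, h4⟩ => ?_
  · simp [Expr.bound, Expr.or, Expr.eq, Expr.not]
  · rw [hX, Finset.mem_insert, ← h2 y hy]
    simp [hv, f3 .xx (by simp), or_comm]
  have T4 : Tables n d Δ Q g h s4 := T3.congr fun j hj => f4 j (by rintro rfl; simp at hj)
  refine Reaches.seq (R := fun s' => (∀ j, j ≠ .an → s' j = s4 j) ∧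
      (∀ y < n, 0 < s' .an y → s' .an y - 1 ∈ X ∧ Near h d (s' .an y - 1) y) ∧
      ∀ y ∈ ball n h d X, 0 < s' .an y) (b := 2 + n * (3 + (2 + n * 20))) ?_
      fun s5 ⟨f5, h5, h5'⟩ => ?_
  · refine (Reaches.fill (n := n) (ca := 2 + n * 20) hn (by simp) rfl rfl ?_).mono ?_ le_rfl
    · simp [Expr.bound, Expr.and, Expr.ix]
      omega
    · rintro s' ⟨f, hv'⟩
      classical
      -- The supremum selects the largest bag vertex near y. The shift by one distinguishes vertex 0
      -- from the absence of such a vertex.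
      have hval : ∀ y < n, s' .an y = (Finset.range n).sup fun x =>
          if x ∈ X ∧ Near h d x y then x + 1 else 0 := by
        intro y hy
        rw [hv' y hy]
        simp only [Expr.eval, ne_eq, reduceCtorEq, not_false_eq_true, Function.update_of_ne, hn]
        refine Finset.sup_congr rfl fun x hx => ?_
        have hx' := Finset.mem_range.mp hx
        simp only [Expr.and_pos, Expr.eval_get, Expr.eval_var, Function.update_self, h4 x hx',
          Expr.eval_ix, ne_eq, reduceCtorEq, not_false_eq_true, Function.update_of_ne,
          T4.lists.row x hx'.le, T4.eh x hx' y hy]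
      refine ⟨f, fun y hy h0 => ?_, fun y hy => ?_⟩
      · obtain ⟨x, hx, he⟩ := Finset.exists_mem_eq_sup (Finset.range n) ⟨y, by simpa using hy⟩
          (fun x => if x ∈ X ∧ Near h d x y then x + 1 else 0)
        rw [← hval y hy] at he
        split_ifs at he with hc
        · rw [he]; simpa using hc
        · omega
      · obtain ⟨hyn, x, hx, hxy⟩ := mem_ball.mp hy
        rw [hval y hyn]
        have := Finset.le_sup (f := fun x => if x ∈ X ∧ Near h d x y then x + 1 else 0) (hXn hx)
        simp only [hx, hxy, and_self, if_true] at this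
        omega
  refine Reaches.seq (Reaches.fillInd (n := n) (ca := 15) (S := C.erase v)
      hn rfl rfl ?_ fun y hy => ?_) fun s6 ⟨f6, h6⟩ => ?_
  · simp [Expr.bound, Expr.and, Expr.eq, Expr.not]
  · have e5 : s5 .cc = s1 .cc := by
      rw [f5 _ (by simp), f4 _ (by simp), f3 _ (by simp), f2 _ (by simp)]
    rw [Finset.mem_erase, ← h1 y hy]
    simp [hv, e5, and_comm]
  refine Reaches.seq (R := fun s' => (∀ j, j ≠ .rx → s' j = s6 j) ∧
      ∀ y < n, s' .rx y = radix n Q X (s5 .an) y) (b := 2 + n * 12) ?_ fun s7 ⟨f7, h7⟩ => ?_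
  · refine (Reaches.fill (n := n) (ca := 9) hn (by simp) rfl rfl
      (by simp [Expr.bound])).mono ?_ (by omega)
    rintro s' ⟨f, hv'⟩
    refine ⟨f, fun y hy => ?_⟩
    rw [hv' y hy, radix]
    have e6 : s6 .bg = s4 .bg := by rw [f6 _ (by simp), f5 _ (by simp)]
    have e6' : s6 .an = s5 .an := f6 _ (by simp)
    simp [hn, hq, e6, e6', h4 y hy]
  have T7 : Tables n d Δ Q g h s7 := T4.congr fun j hj => by
    rw [f7 j, f6 j, f5 j] <;> (rintro rfl; simp at hj)
  refine (childSetup_spec hI hn T7 hv hvn ((Finset.erase_subset v C).trans hC)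
    (by rw [f7 _ (by simp)]; exact h6)).mono ?_ le_rfl
  rintro s8 ⟨f8, c8, d8⟩
  have e : ∀ j, j ∉ [Arr.mk, .qu, .ln, .chf, .chc, .chm, .xd, .chb, .rx, .s2, .an] →
      s8 j = s4 j := by
    intro j hj
    rw [f8 j, f7 j, f6 j, f5 j] <;> (revert hj; cases j <;> decide)
  have hd8 : s8 .hd = s7 .hd := f8 _ (by decide)
  have hn8 : s8 .hn = s7 .hn := f8 _ (by decide)
  have an8 : s8 .an = s5 .an := by rw [f8 _ (by decide), f7 _ (by simp), f6 _ (by simp)]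
  refine ⟨fun j hj => ?_, ⟨?_, ?_, ?_, ?_, ?_, ?_⟩, ⟨?_, ?_, ?_, ?_⟩⟩
  · rw [e j, f4 j, f3 j, f2 j, f1 j] <;> (revert hj; cases j <;> decide)
  · rw [e _ (by decide), f4 _ (by simp), f3 _ (by simp), f2 _ (by simp)]; exact h1
  · rw [e _ (by decide), f4 _ (by simp)]; exact h3
  · rw [hd8, hn8]; exact c8
  · rw [hd8, hn8]; exact fun k hk hkA => (d8 k hk hkA).1
  · rw [hd8, hn8]; exact fun k hk hkA => (d8 k hk hkA).2.1
  · rw [hd8, hn8]; exact fun k hk hkA => (d8 k hk hkA).2.2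
  · rw [e _ (by decide)]; exact h4
  · rw [an8]; exact h5
  · rw [an8]; exact h5'
  · rw [an8, f8 _ (by decide)]; exact h7

/-! ### The dynamic program over the removal order. -/

/-- Edges of h are mapped to edges of g, so walks are mapped to walks. This is why it suffices to
try values from d-balls of g. -/
theorem near_map {n d : ℕ} {g h : ℕ → ℕ → Prop} (H : IsGraphOn n h) {Φ : ℕ → ℕ}
    (hΦ : ∀ x < n, LocalOk n d g h Φ x) {r x y : ℕ} (hxy : Near h r x y) :
    Near g r (Φ x) (Φ y) := by
  induction r generalizing y with
  | zero => exact congrArg Φ hxy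
  | succ r ih =>
    rcases hxy with h1 | ⟨z, h1, h2⟩
    · exact Or.inl (ih h1)
    · exact Or.inr ⟨Φ z, ih h1, (hΦ z (H.lt h2)).2.1 y h2⟩

open Expr in
/-- Compute the witnesses for all sets of the removal order, the last one first. -/
def witnesses : Cmd :=
  .loop .j (.var .n) <| .letE .i (.sub (.sub (.var .n) (.const 1)) (.var .j)) <|
    .letE .v (.get .vt (.var .i)) <| .seq nodeSetup enumerate

/-- A global solution Φ leaves a trace in every set: when set i is processed, the rows of its pieces
for Φ are already filled, because the pieces come later in the order, and so the row of set i for Φ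
gets filled too. -/
theorem witnesses_spec {I : ℕ → ℕ} {n d Δ Q α E : ℕ} {g h : ℕ → ℕ → Prop} (hI : Ctx I n g h)
    {env : Env} {s : Store} (hn : env .n = n) (hq : env .q = Q) (hd : 1 ≤ d) (hQ1 : 1 ≤ Q)
    (hQ : Q ≤ n) (hn1 : 1 ≤ n) (hT : Tables n d Δ Q g h s) {cs : ℕ → Finset ℕ}
    (hO : RemovalOrder n α h (s .vt) cs n)
    (hcm : ∀ i < n, ∀ y < n, 0 < s .cm (n * i + y) ↔ y ∈ cs i) (hwt : ∀ a, s .wt a = 0)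
    (hE1 : 1 ≤ E) (hE : ∀ X ⊆ Finset.range n, X.card ≤ α + 1 → ∀ s, BagData n d Q h X s →
      ∏ y ∈ Finset.range n, radix n Q X (s .an) y ≤ E) :
    Reaches I env witnesses s (fun s' =>
      Witnesses n d g h (s' .wt) ∧ s' .pw2 = s .pw2 ∧ s' .res = s .res ∧
      ∀ Φ : ℕ → ℕ, (∀ x < n, LocalOk n d g h Φ x) → ∀ i < n, s' .wt (fitKey n d h (cs i) Φ) ≠ 0)
      (500 * (n ^ 3 * (Δ + 1) ^ 2) + 1000 * (n ^ 2 * (Δ + 1) * E)) := by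
  let L : List Arr := [.cc, .xx, .bx, .bg, .an, .s2, .rx, .mk, .qu, .ln, .chf, .chc, .chm, .xd,
    .chb, .dg, .cnt, .ph, .t2, .fl, .wt, .ca]
  have hb : 2 + n * (1 + (6 + (3 + (400 * (n ^ 2 * (Δ + 1) ^ 2) + (30 * n ^ 2 + E *
      (700 * (n * (Δ + 1)))))))) ≤
      500 * (n ^ 3 * (Δ + 1) ^ 2) + 1000 * (n ^ 2 * (Δ + 1) * E) := by
    obtain ⟨m, rfl⟩ : ∃ m, n = m + 1 := ⟨n - 1, by omega⟩
    obtain ⟨e, rfl⟩ : ∃ m, E = m + 1 := ⟨E - 1, by omega⟩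
    clear hE
    ring_nf
    omega
  -- The condition n ≤ i + j singles out the last j sets of the order, those handled in the first j
  -- rounds.
  refine (Reaches.loop (fun j s' => (∀ j, j ∉ L → s' j = s j) ∧ Witnesses n d g h (s' .wt) ∧
    ∀ Φ : ℕ → ℕ, (∀ x < n, LocalOk n d g h Φ x) → ∀ i < n, n ≤ i + j →
      s' .wt (fitKey n d h (cs i) Φ) ≠ 0) (m := n) (cN := 1) (by simpa using hn) le_rfl
    ⟨fun _ _ => rfl, fun D _ ψ _ h0 => absurd (hwt _) h0, fun _ _ i hi hi' => by omega⟩ ?_).mono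
    ?_ hb
  · rintro j hj s1 ⟨f1, W1, c1⟩
    obtain ⟨i, hi⟩ : ∃ i, i + j + 1 = n := ⟨n - 1 - j, by omega⟩
    have hin : i < n := by omega
    have T1 : Tables n d Δ Q g h s1 := hT.congr fun j hj => f1 j (by revert hj; cases j <;> decide)
    set v := s .vt i with hv
    have hvC := hO.mem i hin
    have hCs := hO.isComp i hin
    have hC : cs i ⊆ Finset.range n := hCs.subset.trans rest_subset
    have hconn : ∀ x ∈ cs i, comp h (cs i) x = cs i := fun x hx => hCs.connected hI.hG hx
    refine (Reaches.letE (v := i) (ca := 5) (b := 3 + (400 * (n ^ 2 * (Δ + 1) ^ 2) +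
      (30 * n ^ 2 + E * (700 * (n * (Δ + 1)))))) ?_ le_rfl ?_).mono (fun _ h => h) (by omega)
    · simp [hn]; omega
    refine (Reaches.letE (v := v) (ca := 2) (b := 400 * (n ^ 2 * (Δ + 1) ^ 2) +
      (30 * n ^ 2 + E * (700 * (n * (Δ + 1))))) ?_ le_rfl ?_).mono (fun _ h => h) (by omega)
    · simp [hv, f1 .vt (by decide)]
    refine Reaches.seq (nodeSetup_spec (C := cs i) hI (by simpa using hn) (by simpa using hq) T1
      (Function.update_self ..) (by simp) hin hvC hC
      (by rw [f1 .cm (by decide)]; exact hcm i hin)) fun s2 ⟨f2, N2, B2⟩ => ?_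
    have T2 : Tables n d Δ Q g h s2 := T1.congr fun j hj => f2 j (by revert hj; cases j <;> decide)
    have w2 : s2 .wt = s1 .wt := f2 _ (by decide)
    have hvn : v < n := by simpa using hC hvC
    have hcard : (insert v (bdry n h (cs i))).card ≤ α + 1 :=
      (Finset.card_insert_le _ _).trans (Nat.add_le_add_right (hO.card i hin) 1)
    have hEs := hE _ (Finset.insert_subset (by simpa using hvn) bdry_subset) hcard s2 B2
    refine (enumerate_spec (C := cs i) hI (by simpa using hn) hd T2 hQ1 hQ (Function.update_self ..)
      hC hvC hconn rfl N2 B2 (by rwa [w2])).mono ?_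
      (Nat.add_le_add_left (Nat.mul_le_mul_right _ hEs) _)
    rintro s3 ⟨f3, W3, m3, p3⟩
    rw [w2] at m3 p3
    refine ⟨fun j hj => ?_, W3, fun Φ hΦ i' hi' hij => ?_⟩
    · rw [f3 j, f2 j, f1 j hj] <;> (revert hj; cases j <;> decide)
    · by_cases hii : n ≤ i' + j
      · exact m3 _ (c1 Φ hΦ i' hi' hii)
      · obtain rfl : i' = i := by omega
        refine p3 Φ (fun y hy => (hΦ y hy).1) (fun x _ y hxy => near_map hI.hG hΦ hxy)
          (hΦ v hvn) fun D hD => ?_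
        obtain ⟨j', h1, h2, rfl⟩ := hO.exists_child hI.hG hin hD
        exact c1 Φ hΦ j' h2 (by omega)
  · rintro s' ⟨f, W, c⟩
    exact ⟨W, f _ (by decide), f _ (by decide), fun Φ hΦ i hi => c Φ hΦ i hi (by omega)⟩

/-! ## Sizes of balls -/

open Classical in
theorem count_eq_card {n : ℕ} {P : ℕ → Prop} :
    Nat.count P n = ((Finset.range n).filter P).card := by
  rw [Nat.count_eq_card_filter_range]

open Classical in
-- One more step replaces each vertex by its closed neighborhood, which has at most D + 1 elements.
theorem count_near_le {n D : ℕ} {g : ℕ → ℕ → Prop} (H : IsGraphOn n g)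
    (hD : ∀ x < n, Nat.count (g x) n ≤ D) (r x : ℕ) :
    Nat.count (Near g r x) n ≤ (D + 1) ^ r := by
  induction r with
  | zero =>
    rw [count_eq_card, pow_zero, Finset.card_le_one]
    intro a ha b hb
    have h1 : x = a := (Finset.mem_filter.mp ha).2
    have h2 : x = b := (Finset.mem_filter.mp hb).2
    exact h1.symm.trans h2
  | succ r ih =>
    rw [count_eq_card] at ih ⊢
    set S := (Finset.range n).filter (Near g r x) with hS
    have hsub : (Finset.range n).filter (Near g (r + 1) x) ⊆
        S.biUnion fun z => insert z ((Finset.range n).filter (g z)) := by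
      intro y hy
      obtain ⟨h1, h2⟩ := Finset.mem_filter.mp hy
      rw [Finset.mem_biUnion]
      rcases h2 with h2 | ⟨z, h2, h3⟩
      · exact ⟨y, Finset.mem_filter.mpr ⟨h1, h2⟩, Finset.mem_insert_self _ _⟩
      · exact ⟨z, Finset.mem_filter.mpr ⟨Finset.mem_range.mpr (H.lt h3), h2⟩,
          Finset.mem_insert_of_mem (Finset.mem_filter.mpr ⟨h1, h3⟩)⟩
    refine (Finset.card_le_card hsub).trans ?_
    refine (Finset.card_biUnion_le_card_mul _ _ (D + 1) fun z hz => ?_).trans ?_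
    · refine (Finset.card_insert_le _ _).trans ?_
      have := hD z (Finset.mem_range.mp (Finset.mem_filter.mp hz).1)
      rw [count_eq_card] at this
      omega
    · rw [pow_succ]
      exact Nat.mul_le_mul_right _ ih

open Classical in
-- A bag vertex contributes a factor of at most n, a further vertex near the bag at most Q, and all
-- others 1. The ball around the bag has at most kM vertices.
theorem prod_radix_le {n d Q M k : ℕ} {h : ℕ → ℕ → Prop} (hn : 1 ≤ n) (hQ : 1 ≤ Q)
    (hM : ∀ x < n, Nat.count (Near h d x) n ≤ M) {X : Finset ℕ} (hX : X ⊆ Finset.range n)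
    (hk : X.card ≤ k) {s : Store} (hB : BagData n d Q h X s) :
    ∏ y ∈ Finset.range n, radix n Q X (s .an) y ≤ n ^ k * Q ^ (k * M) := by
  have h1 : ∀ y ∈ Finset.range n, radix n Q X (s .an) y ≤
      (if y ∈ X then n else 1) * (if y ∈ ball n h d X then Q else 1) := by
    intro y hy
    have hyn := Finset.mem_range.mp hy
    unfold radix
    by_cases hyX : y ∈ X
    · rw [if_pos hyX, if_pos hyX]
      split_ifs
      · exact Nat.le_mul_of_pos_right _ hQ
      · simp
    · rw [if_neg hyX, if_neg hyX, one_mul]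
      by_cases ha : 0 < s .an y
      · obtain ⟨h2, h3⟩ := hB.an_mem y hyn ha
        rw [if_pos ha, if_pos (mem_ball.mpr ⟨hyn, _, h2, h3⟩)]
      · rw [if_neg ha]; split_ifs <;> omega
  refine (Finset.prod_le_prod' h1).trans ?_
  rw [Finset.prod_mul_distrib, Finset.prod_ite, Finset.prod_ite]
  simp only [Finset.prod_const, one_pow, mul_one, Finset.filter_mem_eq_inter]
  refine Nat.mul_le_mul (Nat.pow_le_pow_right hn ((Finset.card_le_card
    Finset.inter_subset_right).trans hk)) (Nat.pow_le_pow_right hQ ?_)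
  have hsub : Finset.range n ∩ ball n h d X ⊆ X.biUnion fun x =>
      (Finset.range n).filter (Near h d x) := by
    intro y hy
    obtain ⟨hyn, x, hx, hxy⟩ := mem_ball.mp (Finset.mem_inter.mp hy).2
    exact Finset.mem_biUnion.mpr ⟨x, hx, Finset.mem_filter.mpr ⟨by simpa using hyn, hxy⟩⟩
  refine (Finset.card_le_card hsub).trans ?_
  refine (Finset.card_biUnion_le_card_mul _ _ M fun x hx => ?_).trans (Nat.mul_le_mul_right _ hk)
  rw [← count_eq_card]
  exact hM x (Finset.mem_range.mp (hX hx))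

/-! ### Small graphs, and a degree bound for the source graph. -/

open Classical in
theorem eq_of_count_le_one {n y z : ℕ} {P : ℕ → Prop} (hP : Nat.count P n ≤ 1) (hy : y < n)
    (hz : z < n) (h1 : P y) (h2 : P z) : y = z := by
  rw [count_eq_card, Finset.card_le_one] at hP
  exact hP y (by simp [hy, h1]) z (by simp [hz, h2])

open Classical in
/-- A connected graph with at least three vertices has a vertex of degree at least two. -/
theorem two_le_of_connected {n Δ : ℕ} {h : ℕ → ℕ → Prop} (H : IsGraphOn n h) (hn : 3 ≤ n)
    (hc : comp h (Finset.range n) 0 = Finset.range n) (hΔ : ∀ x < n, Nat.count (h x) n ≤ Δ) :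
    2 ≤ Δ := by
  by_contra! hlt
  have hΔ1 : ∀ x < n, Nat.count (h x) n ≤ 1 := fun x hx => (hΔ x hx).trans (by omega)
  -- A closed set with at most two vertices would be the whole graph. With all degrees at most 1,
  -- vertex 0 and its neighbor form such a set.
  have key : ∀ T : Finset ℕ, 0 ∈ T → T.card ≤ 2 →
      (∀ a ∈ T, ∀ b ∈ Finset.range n, h a b → b ∈ T) → False := by
    intro T h0 hT hcl
    have := Finset.card_le_card (comp_subset_of_closed (h := h) h0 hcl)
    rw [hc, Finset.card_range] at this
    omega
  by_cases hw : ∃ w, h 0 w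
  · obtain ⟨w, hw⟩ := hw
    have hwn := H.lt_right hw
    refine key {0, w} (by simp) Finset.card_le_two ?_
    intro a ha b hb hab
    have hbn := Finset.mem_range.mp hb
    rcases Finset.mem_insert.mp ha with rfl | ha
    · rw [eq_of_count_le_one (hΔ1 _ (by omega)) hbn hwn hab hw]; simp
    · rw [Finset.mem_singleton.mp ha] at hab
      rw [eq_of_count_le_one (hΔ1 _ hwn) hbn (by omega) hab (H.symm hw)]; simp
  · push Not at hw
    refine key {0} (by simp) (by simp) ?_
    intro a ha b _ hab
    rw [Finset.mem_singleton.mp ha] at hab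
    exact absurd hab (hw b)

theorem reflTransGen_of_comp {n : ℕ} {h : ℕ → ℕ → Prop} (H : IsGraphOn n h)
    (hc : comp h (Finset.range n) 0 = Finset.range n) {x y : ℕ} (hx : x < n) (hy : y < n) :
    Relation.ReflTransGen h x y := by
  have h0 : 0 ∈ Finset.range n := by simp; omega
  have hx' : x ∈ comp h (Finset.range n) 0 := by rw [hc]; simpa using hx
  have hy' : y ∈ comp h (Finset.range n) x := by
    rw [comp_eq_of_mem H h0 hx', hc]; simpa using hy
  exact Relation.ReflTransGen.mono (fun a b hab => hab.1) _ _ (mem_comp.mp hy').2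

/-- In a connected graph with at most two vertices all distinct vertices are adjacent. -/
theorem adj_of_connected {n : ℕ} {h : ℕ → ℕ → Prop} (H : IsGraphOn n h) (hirr : ∀ x, ¬ h x x)
    (hn : n < 3) {x y : ℕ} (hx : x < n) (hy : y < n) (hxy : x ≠ y)
    (hc : Relation.ReflTransGen h x y) : h x y := by
  rcases Relation.ReflTransGen.cases_head hc with h1 | ⟨z, h1, -⟩
  · exact absurd h1 hxy
  · have hz := H.lt_right h1
    have hzx : z ≠ x := fun h2 => hirr x (h2 ▸ h1)
    obtain rfl : z = y := by omega
    exact h1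

/-- Connected graphs with at most two vertices are complete, hence equal. Treating them apart leaves
only connected H with Δ ≥ 2 to the main part. -/
theorem localOk_id {n d : ℕ} {g h : ℕ → ℕ → Prop} (hG : IsGraphOn n g) (hH : IsGraphOn n h)
    (hgi : ∀ x, ¬ g x x) (hhi : ∀ x, ¬ h x x) (hn : n < 3) (hd : 1 ≤ d)
    (hg : ∀ x < n, ∀ y < n, Relation.ReflTransGen g x y)
    (hc : comp h (Finset.range n) 0 = Finset.range n) :
    ∀ x < n, LocalOk n d g h id x := by
  intro x hx
  refine ⟨hx, fun y hxy => ?_, fun w hw => ⟨w, ?_, rfl⟩⟩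
  · have hy := hH.lt_right hxy
    exact adj_of_connected hG hgi hn hx hy (fun h1 : x = y => hhi x (h1 ▸ hxy)) (hg x hx y hy)
  · have hy := hG.lt_right hw
    exact Near.of_adj hd (adj_of_connected hH hhi hn hx hy (fun h1 => hgi x (h1 ▸ hw))
      (reflTransGen_of_comp hH hc hx hy))

open Classical in
/-- If there is an embedding, the degrees in `g` are smaller than the sizes of balls in `h`. -/
theorem count_lt_of_localOk {n d : ℕ} {g h : ℕ → ℕ → Prop}
    (hH : IsGraphOn n h) (hgi : ∀ x, ¬ g x x) {Φ : ℕ → ℕ} {x : ℕ} (hx : x < n)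
    (hΦ : LocalOk n d g h Φ x) :
    Nat.count (g (Φ x)) n < Nat.count (Near h d x) n := by
  rw [count_eq_card, count_eq_card]
  -- The closed neighborhood of Φ x is contained in the image of the d-ball around x; counting the
  -- center makes the inequality strict.
  have hsub : insert (Φ x) ((Finset.range n).filter (g (Φ x))) ⊆
      ((Finset.range n).filter (Near h d x)).image Φ := by
    intro w hw
    rw [Finset.mem_image]
    rcases Finset.mem_insert.mp hw with rfl | hw
    · exact ⟨x, by simp [hx, Near.refl], rfl⟩
    · obtain ⟨y, hy, rfl⟩ := hΦ.2.2 w (Finset.mem_filter.mp hw).2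
      exact ⟨y, by simp [hy, hy.lt hH hx], rfl⟩
  have h1 := (Finset.card_le_card hsub).trans Finset.card_image_le
  rw [Finset.card_insert_of_notMem (by simp [hgi])] at h1
  omega

/-! ## The bound for the running time -/

/-- The cost of the main part of the program. -/
def mainCost (n d Δ α : ℕ) : ℕ :=
  1000 * n ^ (α + 3) * (d + 1) + 500 * (α * n ^ (α + 3) * (Δ + 1) ^ 3) +
    1000 * (n ^ (α + 3) * (Δ + 1) ^ 2) +
    1000 * (n ^ (α + 3) * (Δ + 1) * ((Δ + 1) ^ (d * d)) ^ ((α + 1) * (Δ + 1) ^ d))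

/-- With t = α d², the coefficient 2d²(α+1) is at most 4t and Δ^(2d) is at most Δ^(2t). Since Δ ≥ 2
gives t ≤ Δ^t and 4 ≤ Δ^(2t), the product is at most Δ^(5t). The factor 10 in the exponent is
generous. -/
theorem exponent_le {d Δ α : ℕ} (hd : 1 ≤ d) (hΔ : 2 ≤ Δ) (hα : 1 ≤ α) :
    6 + 2 * (d * d) * ((α + 1) * Δ ^ (2 * d)) ≤ (d + 1) * Δ ^ (10 * (α * d ^ 2)) := by
  set t := α * d ^ 2 with ht
  have ht1 : 1 ≤ t := Nat.mul_pos hα (pow_pos hd 2)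
  have hdt : d ≤ t := by
    calc d ≤ d ^ 2 := Nat.le_self_pow (by norm_num) d
      _ ≤ t := Nat.le_mul_of_pos_left _ hα
  have h1 : t ≤ Δ ^ t := (Nat.lt_pow_self hΔ).le
  have h2 : Δ ^ (2 * d) ≤ Δ ^ (2 * t) := Nat.pow_le_pow_right (by omega) (by omega)
  have h4 : 4 ≤ Δ ^ (2 * t) := by
    calc 4 = 2 ^ 2 := rfl
      _ ≤ Δ ^ 2 := Nat.pow_le_pow_left hΔ 2
      _ ≤ Δ ^ (2 * t) := Nat.pow_le_pow_right (by omega) (by omega)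
  have h5 : 2 * (d * d) * ((α + 1) * Δ ^ (2 * d)) ≤ Δ ^ (5 * t) := by
    calc 2 * (d * d) * ((α + 1) * Δ ^ (2 * d)) ≤ 2 * (d * d) * ((2 * α) * Δ ^ (2 * t)) := by
          gcongr; omega
      _ = 4 * t * Δ ^ (2 * t) := by rw [ht]; ring
      _ ≤ Δ ^ (2 * t) * Δ ^ t * Δ ^ (2 * t) := by gcongr
      _ = Δ ^ (5 * t) := by rw [← pow_add, ← pow_add]; congr 1; ring
  have h6 : 6 ≤ Δ ^ (5 * t) := by
    calc 6 ≤ 2 ^ 5 := by norm_num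
      _ ≤ Δ ^ 5 := Nat.pow_le_pow_left hΔ 5
      _ ≤ Δ ^ (5 * t) := Nat.pow_le_pow_right (by omega) (by omega)
  have h7 : Δ ^ (5 * t) ≤ Δ ^ (10 * t) := Nat.pow_le_pow_right (by omega) (by omega)
  nlinarith

/-- P joins the number of assignments, without its power of n, to a factor Δ^6 that swallows all
polynomial terms in Δ + 1 ≤ Δ². Each summand is at most its coefficient times α² n^(α+3) Δ^(d+1) P,
the coefficients add up to 3500, and P ≤ W by `exponent_le`. -/
theorem mainCost_le {n d Δ α : ℕ} (hd : 1 ≤ d) (hΔ : 2 ≤ Δ) (hα : 1 ≤ α) :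
    mainCost n d Δ α ≤ 3500 * (α ^ 2 * n ^ (α + 3)) * Δ ^ (d + 1) *
      (α * Δ ^ (d + 1)) ^ (Δ ^ (10 * (α * d ^ 2))) := by
  set N := n ^ (α + 3) with hN
  set W := (α * Δ ^ (d + 1)) ^ (Δ ^ (10 * (α * d ^ 2))) with hW
  set P := Δ ^ 6 * ((Δ + 1) ^ (d * d)) ^ ((α + 1) * (Δ + 1) ^ d) with hP
  have hsq : Δ + 1 ≤ Δ ^ 2 := by nlinarith
  have hPW : P ≤ W := by
    calc P ≤ Δ ^ 6 * ((Δ ^ 2) ^ (d * d)) ^ ((α + 1) * (Δ ^ 2) ^ d) := by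
          rw [hP]
          gcongr
          exact Nat.one_le_pow _ _ (by positivity)
      _ = Δ ^ (6 + 2 * (d * d) * ((α + 1) * Δ ^ (2 * d))) := by
          rw [← pow_mul, ← pow_mul, ← pow_mul, ← pow_add, mul_assoc 2 (d * d)]
      _ ≤ Δ ^ ((d + 1) * Δ ^ (10 * (α * d ^ 2))) :=
          Nat.pow_le_pow_right (by omega) (exponent_le hd hΔ hα)
      _ = (Δ ^ (d + 1)) ^ (Δ ^ (10 * (α * d ^ 2))) := by rw [pow_mul]
      _ ≤ W := Nat.pow_le_pow_left (Nat.le_mul_of_pos_left _ hα) _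
  have hR1 : 1 ≤ ((Δ + 1) ^ (d * d)) ^ ((α + 1) * (Δ + 1) ^ d) :=
    Nat.one_le_pow _ _ (by positivity)
  have hP6 : Δ ^ 6 ≤ P := Nat.le_mul_of_pos_right _ hR1
  have h3 : (Δ + 1) ^ 3 ≤ P := by
    calc (Δ + 1) ^ 3 ≤ (Δ ^ 2) ^ 3 := Nat.pow_le_pow_left hsq 3
      _ = Δ ^ 6 := by ring
      _ ≤ P := hP6
  have h2 : (Δ + 1) ^ 2 ≤ P := (Nat.pow_le_pow_right (by omega) (by norm_num)).trans h3
  have h1 : (Δ + 1) * ((Δ + 1) ^ (d * d)) ^ ((α + 1) * (Δ + 1) ^ d) ≤ P := by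
    rw [hP]
    gcongr
    exact hsq.trans (Nat.pow_le_pow_right (by omega) (by norm_num))
  have hP1 : 1 ≤ P := le_trans (Nat.one_le_pow _ _ (by omega)) hP6
  have hdΔ : d + 1 ≤ Δ ^ (d + 1) := (Nat.lt_pow_self hΔ).le
  have hα2 : α ≤ α ^ 2 := Nat.le_self_pow (by norm_num) α
  have hα1 : 1 ≤ α ^ 2 := Nat.one_le_pow _ _ hα
  set Z := Δ ^ (d + 1) with hZ
  have hZ1 : 1 ≤ Z := by omega
  have e1 : N * (d + 1) ≤ α ^ 2 * N * Z * P := by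
    calc N * (d + 1) ≤ N * Z := Nat.mul_le_mul_left _ hdΔ
      _ = 1 * N * Z * 1 := by ring
      _ ≤ α ^ 2 * N * Z * P := by gcongr
  have e2 : α * N * (Δ + 1) ^ 3 ≤ α ^ 2 * N * Z * P := by
    calc α * N * (Δ + 1) ^ 3 = α * N * 1 * (Δ + 1) ^ 3 := by ring
      _ ≤ α ^ 2 * N * Z * P := by gcongr
  have e3 : N * (Δ + 1) ^ 2 ≤ α ^ 2 * N * Z * P := by
    calc N * (Δ + 1) ^ 2 = 1 * N * 1 * (Δ + 1) ^ 2 := by ring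
      _ ≤ α ^ 2 * N * Z * P := by gcongr
  have e4 : N * (Δ + 1) * ((Δ + 1) ^ (d * d)) ^ ((α + 1) * (Δ + 1) ^ d) ≤ α ^ 2 * N * Z * P := by
    calc N * (Δ + 1) * ((Δ + 1) ^ (d * d)) ^ ((α + 1) * (Δ + 1) ^ d) =
          1 * N * 1 * ((Δ + 1) * ((Δ + 1) ^ (d * d)) ^ ((α + 1) * (Δ + 1) ^ d)) := by ring
      _ ≤ α ^ 2 * N * Z * P := by gcongr
  have e5 : α ^ 2 * N * Z * P ≤ α ^ 2 * N * Z * W := Nat.mul_le_mul_left _ hPW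
  unfold mainCost
  calc _ = 1000 * (N * (d + 1)) + 500 * (α * N * (Δ + 1) ^ 3) + 1000 * (N * (Δ + 1) ^ 2) +
        1000 * (N * (Δ + 1) * ((Δ + 1) ^ (d * d)) ^ ((α + 1) * (Δ + 1) ^ d)) := by ring
    _ ≤ 3500 * (α ^ 2 * N * Z * W) := by omega
    _ = _ := by ring

/-! ## The program -/

/-- The store answers the instance: either `res` holds `1` and `out` holds an embedding, or `res`
holds `0` and there is none. -/
def Answers (n d : ℕ) (g h : ℕ → ℕ → Prop) (s : Store) : Prop :=
  (s .res 0 = 1 ∧ ∃ ω : ℕ → ℕ, (∀ x < n, LocalOk n d g h ω x) ∧ ∀ x < n, s .out (ω x) = x) ∨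
  (s .res 0 = 0 ∧ ¬ ∃ ω : ℕ → ℕ, ∀ x < n, LocalOk n d g h ω x)

/-- Solutions of the local conditions are bijections. -/
def SolutionsBijective (n d : ℕ) (g h : ℕ → ℕ → Prop) : Prop :=
  ∀ ω : ℕ → ℕ, (∀ x < n, LocalOk n d g h ω x) →
    (∀ x < n, ∀ y < n, ω x = ω y → x = y) ∧ ∀ a < n, ∃ x < n, ω x = a

open Expr in
/-- Read off an embedding from the witness for the whole graph. -/
def output : Cmd :=
  .letE .key (.sum .t (.var .n) (.get .pw2 (.var .t))) <| .ite (.get .wt (.var .key))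
    (.seq (.set .res (.const 0) (.const 1)) <| .loop .z (.var .n)
      -- A witness is a map from H to G, while an embedding from G to H is asked for. Hence z is
      -- stored at position ω z.
      (.set .out (.sub (.get .wt (.add (.var .key) (.var .z))) (.const 1)) (.var .z)))
    .skip

theorem bdry_range {n : ℕ} {h : ℕ → ℕ → Prop} : bdry n h (Finset.range n) = ∅ := by
  ext x
  simp only [mem_bdry, Finset.notMem_empty, iff_false, not_and]
  intro h1 h2
  exact absurd (Finset.mem_range.mpr h1) h2

/-- The whole vertex set has empty boundary, so it has a single row, which is filled exactly if an
embedding exists. -/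
theorem fitKey_range {n d : ℕ} {h : ℕ → ℕ → Prop} (φ : ℕ → ℕ) :
    fitKey n d h (Finset.range n) φ = code n (Finset.range n) := by
  have : ball n h d (bdry n h (Finset.range n)) = ∅ := by
    ext y
    simp [mem_ball, bdry_range]
  simp [fitKey, witKey, this]

theorem output_spec {I : ℕ → ℕ} {n d : ℕ} {g h : ℕ → ℕ → Prop}
    {env : Env} {s : Store} (hn : env .n = n) (hn1 : 1 ≤ n)
    (hp : ∀ y ≤ n, s .pw2 y = 2 ^ y * (n + 1) ^ (n + 1)) (hW : Witnesses n d g h (s .wt))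
    (hres : s .res 0 = 0) (hbij : SolutionsBijective n d g h)
    (hc : ∀ ω : ℕ → ℕ, (∀ x < n, LocalOk n d g h ω x) →
      s .wt (fitKey n d h (Finset.range n) ω) ≠ 0) :
    Reaches I env output s (Answers n d g h) (30 * n) := by
  set K := code n (Finset.range n) with hK
  refine (Reaches.letE (v := K) (ca := 2 + n * 3) (b := 3 + (3 + (2 + n * 9))) ?_ ?_ ?_).mono
    (fun _ h => h) (by omega)
  · simp only [Expr.eval, hn, Function.update_self, hK, code]
    exact Finset.sum_congr rfl fun y hy => hp y (Finset.mem_range.mp hy).le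
  · exact Expr.cost_le (n := n) (by simpa using hn) rfl (by simp [Expr.bound])
  refine (Reaches.ite (be := 2) (b := 3 + (2 + n * 9)) le_rfl (fun h0 => ?_)
    (fun h0 => ?_)).mono (fun _ h => h) le_rfl
  · have h0' : s .wt (fitKey n d h (Finset.range n) (fun _ => 0)) ≠ 0 := by
      rw [fitKey_range, ← hK]
      have : 0 < s .wt K := by simpa using h0
      omega
    obtain ⟨ω, h1, -, h2⟩ := hW _ (Finset.Subset.refl _) (fun _ => 0) (fun _ _ => by omega) h0'
    rw [fitKey_range, ← hK] at h1
    have hok : ∀ x < n, LocalOk n d g h ω x := fun x hx => h2 x (by simpa using hx)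
    refine Reaches.seq (b := 3) (R := fun s' => s' = s.set .res 0 1)
      (Reaches.set (by simp) le_rfl le_rfl) ?_
    rintro _ rfl
    refine (Reaches.tabulate (m := n) (cN := 1) (ci := 6) (ca := 1) (f := ω)
      (by simpa using hn) le_rfl rfl rfl (fun i hi => ?_)
      (fun i hi j hj => (hbij ω hok).1 i hi j hj) (fun i _ s => le_rfl)
      (fun i hi s' _ => le_rfl)).mono ?_ (by omega)
    · simp [Store.set, h1 i hi]
    · rintro s' ⟨f, h3, -⟩
      refine Or.inl ⟨?_, ω, hok, fun x hx => by simpa using h3 x hx⟩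
      rw [f _ (by simp), Store.set_self, if_pos rfl]
  · refine (Reaches.skip (Or.inr ⟨hres, ?_⟩)).mono (fun _ h => h) (by omega)
    rintro ⟨ω, hω⟩
    have := hc ω hω
    rw [fitKey_range, ← hK] at this
    apply h0
    simp
    omega

/-- The maximal number of `y` with property `p`, over all `x`. -/
def Expr.supCount (p : Expr) : Expr := .sup .x (.var .n) (count .y p)

open Classical in
theorem eval_supCount {I : ℕ → ℕ} {n : ℕ} {env : Env} {s : Store} (hn : env .n = n) {p : Expr}
    {P : ℕ → ℕ → Prop} (h : ∀ x < n, ∀ y < n,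
      0 < p.eval I (Function.update (Function.update env .x x) .y y) s ↔ P x y) :
    (Expr.supCount p).eval I env s = (Finset.range n).sup fun x => Nat.count (P x) n := by
  simp only [Expr.supCount, Expr.eval, hn]
  exact Finset.sup_congr rfl fun x hx => Expr.eval_count (by simpa using hn)
    fun y hy => h x (Finset.mem_range.mp hx) y hy

open Expr in
/-- The main part, after the number `m` of vertices in a largest ball has been compared with the
degrees. -/
def bigCore : Cmd :=
  .letE .q (supCount (.get .eg (ix (.var .x) (.var .y)))) <|
  .seq nearLists <| .seq weights <| .seq keyTable <| .seq splits <|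
  -- The whole vertex set has empty boundary and is not reached by `splits`. Its entry 1 names
  -- vertex 0 as splitting vertex.
  .seq (.set .gd (.sum .t (.var .n) (.get .pw2 (.var .t))) (.const 1)) <|
  .seq order <| .seq witnesses output

open Expr in
/-- The main part of the program, for connected graphs with at least three vertices. -/
def big : Cmd :=
  .seq (dists .eh (hadj (.var .z) (.var .y))) <| .seq (dists .eg (gadj (.var .z) (.var .y))) <|
  .letE .m (supCount (.get .eh (ix (.var .x) (.var .y)))) <|
  .letE .gm (supCount (gadj (.var .x) (.var .y))) <|
  -- If some degree of g is not below the largest d-ball of h, no embedding exists, and the result 0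
  -- stands. Otherwise the balls of g are bounded in terms of those of h.
  .ite (lt (.var .gm) (.var .m)) bigCore .skip

open Classical in
theorem bigCore_spec {I : ℕ → ℕ} {n d Δ α M : ℕ} {g h : ℕ → ℕ → Prop} (hI : Ctx I n g h)
    {env : Env} {s : Store} (hn : env .n = n) (hal : env .al = α) (hn1 : 1 ≤ n)
    (hd1 : 1 ≤ d) (hα : 1 ≤ α) (hL : AdjLists n Δ h (s .row) (s .hd) (s .hn))
    (heh : NearMat n d h (s .eh)) (heg : NearMat n d g (s .eg)) (hgd : ∀ a, s .gd a = 0)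
    (hwt : ∀ a, s .wt a = 0) (hres : s .res 0 = 0)
    (hconn : comp h (Finset.range n) 0 = Finset.range n) {Reg : Finset ℕ → Prop}
    (hR : SplitFamily n α h Reg) (hR0 : ∀ D, IsComp h ((Finset.range n).erase 0) D → Reg D)
    (hbij : SolutionsBijective n d g h) (hM : ∀ x < n, Nat.count (Near h d x) n ≤ M)
    (hg : ∀ x < n, Nat.count (g x) n < M) :
    Reaches I env bigCore s (Answers n d g h) (600 * n ^ (α + 3) +
      500 * (α * n ^ (α + 3) * (Δ + 1) ^ 3) + 1000 * (n ^ (α + 3) * (Δ + 1) ^ 2) +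
      1000 * (n ^ (α + 3) * (Δ + 1) * (M ^ d) ^ ((α + 1) * M))) := by
  set Q := (Finset.range n).sup fun x => Nat.count (Near g d x) n with hQ
  set E := n ^ (α + 1) * (M ^ d) ^ ((α + 1) * M) with hE
  have hM1 : 1 ≤ M := by have := hg 0 (by omega); omega
  have hE1 : 1 ≤ E := Nat.mul_pos (pow_pos hn1 _) (pow_pos (pow_pos hM1 _) _)
  have hQle : ∀ x < n, Nat.count (Near g d x) n ≤ Q := fun x hx =>
    Finset.le_sup (f := fun x => Nat.count (Near g d x) n) (by simpa using hx)
  have hQn : Q ≤ n := Finset.sup_le fun x _ => Nat.count_le _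
  have hQ1 : 1 ≤ Q := by
    refine le_trans ?_ (hQle 0 (by omega))
    rw [count_eq_card]
    exact Finset.card_pos.mpr ⟨0, by simp; exact ⟨by omega, Near.refl _ _ _⟩⟩
  -- Degrees in g are at most M - 1 by the preceding test, so `count_near_le` gives exactly M^d.
  have hQM : Q ≤ M ^ d := Finset.sup_le fun x hx => by
    refine (count_near_le hI.gG (D := M - 1) (fun x hx => by have := hg x hx; omega) d
      x).trans (le_of_eq ?_)
    rw [Nat.sub_add_cancel hM1]
  have hb : 1 + (2 + n * 20 + n * n * 20) + (100 * n ^ 4 + (100 * n ^ 4 + (100 * n ^ 4 +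
      (500 * (α * n ^ (α + 3) * (Δ + 1) ^ 3) + ((4 + n * 3) + ((200 * (n ^ 2 * (Δ + 1)) + 4) +
      ((500 * (n ^ 3 * (Δ + 1) ^ 2) + 1000 * (n ^ 2 * (Δ + 1) * E)) + 30 * n))))))) ≤
      600 * n ^ (α + 3) + 500 * (α * n ^ (α + 3) * (Δ + 1) ^ 3) +
      1000 * (n ^ (α + 3) * (Δ + 1) ^ 2) +
      1000 * (n ^ (α + 3) * (Δ + 1) * (M ^ d) ^ ((α + 1) * M)) := by
    have p4 : n ^ 4 ≤ n ^ (α + 3) := Nat.pow_le_pow_right hn1 (by omega)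
    have p3 : n ^ 3 ≤ n ^ (α + 3) := Nat.pow_le_pow_right hn1 (by omega)
    have p2 : n ^ 2 ≤ n ^ (α + 3) := Nat.pow_le_pow_right hn1 (by omega)
    have p1 : n ≤ n ^ (α + 3) := Nat.le_self_pow (by omega) n
    have p0 : 1 ≤ n ^ (α + 3) := Nat.one_le_pow _ _ hn1
    have q1 : n ^ 2 * (Δ + 1) ≤ n ^ (α + 3) * (Δ + 1) ^ 2 :=
      Nat.mul_le_mul p2 (Nat.le_self_pow (by norm_num) _)
    have q2 : n ^ 3 * (Δ + 1) ^ 2 ≤ n ^ (α + 3) * (Δ + 1) ^ 2 := Nat.mul_le_mul_right _ p3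
    -- The n values for each of α + 1 bag vertices, the n sets, and the factor n in the time per
    -- assignment make up the exponent α + 3.
    have q3 : n ^ 2 * (Δ + 1) * E = n ^ (α + 3) * (Δ + 1) * (M ^ d) ^ ((α + 1) * M) := by
      rw [hE]; ring
    rw [q3]
    have p2' : n * n ≤ n ^ (α + 3) := by rw [← sq]; exact p2
    omega
  refine (Reaches.letE (v := Q) (ca := 2 + n * 20 + n * n * 20) ?_ ?_
    (Reaches.seq (nearLists_spec (n := n) (d := d) (g := g) (by simpa using hn) hn1 hL.row heg)
      fun s1 ⟨f1, l1, x1⟩ => ?_)).mono (fun _ h => h) hb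
  · exact eval_supCount hn fun x hx y hy => by simp [hL.row x hx.le, heg x hx y hy]
  · refine Expr.cost_le (n := n) hn rfl ?_
    simp [Expr.bound, Expr.supCount, Expr.count, Expr.ix]
    nlinarith
  have x1' : ∀ x < n, ∀ y < n, Near g d x y → ∃ k < Q, s1 .gbl (n * x + k) = y := by
    intro x hx y hy hxy
    obtain ⟨k, hk, he⟩ := x1 x hx y hy hxy
    exact ⟨k, hk.trans_le (hQle x hx), he⟩
  refine Reaches.seq (weights_spec (n := n) (by simpa using hn) hn1) fun s2 ⟨f2, w2, w2'⟩ => ?_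
  have k2 : ∀ j, j ≠ .gbl → j ≠ .pw → j ≠ .pw2 → s2 j = s j := fun j j1 j2 j3 => by
    rw [f2 j j2 j3, f1 j j1]
  refine Reaches.seq (keyTable_spec (n := n) (by simpa using hn) hn1
    (by rw [k2 _ (by simp) (by simp) (by simp)]; exact hL.row) w2) fun s3 ⟨f3, t3⟩ => ?_
  have k3 : ∀ j, j ∉ [Arr.gbl, .pw, .pw2, .kt] → s3 j = s j := fun j hj => by
    rw [f3 j, k2 j] <;> (rintro rfl; simp at hj)
  have T3 : Tables n d Δ Q g h s3 := by
    refine ⟨?_, ?_, ?_, ?_, t3, ?_⟩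
    · rw [k3 .row (by decide), k3 .hd (by decide), k3 .hn (by decide)]; exact hL
    · rw [k3 _ (by decide)]; exact heh
    · rw [f3 _ (by simp), f2 _ (by simp) (by simp)]; exact l1
    · rw [f3 _ (by simp), f2 _ (by simp) (by simp)]; exact x1'
    · rw [f3 _ (by simp)]; exact w2'
  refine Reaches.seq (splits_spec hI (by simpa using hn) (by simpa using hal) hα hn1 T3.lists T3.pw2
    (by rw [k3 _ (by decide)]; exact hgd) hR) fun s4 ⟨f4, S4, R4⟩ => ?_
  have k4 : ∀ j, j ∉ [Arr.mk, .qu, .ln, .s1, .s2, .fl, .gd, .cc, .rx, .cnt, .dg, .ca] →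
      s4 j = s3 j := fun j hj => by
    apply f4 <;> (rintro rfl; simp at hj)
  have T4 : Tables n d Δ Q g h s4 := T3.congr fun j hj => k4 j (by revert hj; cases j <;> decide)
  refine Reaches.seq (R := fun s' => s' = s4.set .gd (code n (Finset.range n)) 1)
    (b := 4 + n * 3) ?_ ?_
  · refine (Reaches.set (ca := 2 + n * 3) (cb := 1) ?_ ?_ le_rfl).mono (fun _ h => h) (by omega)
    · congr 1
      simp only [Expr.eval, ne_eq, reduceCtorEq, not_false_eq_true, Function.update_of_ne, hn,
        Function.update_self, code]
      exact Finset.sum_congr rfl fun y hy => T4.pw2 y (Finset.mem_range.mp hy).le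
    · exact Expr.cost_le (n := n) (by simpa using hn) rfl (by simp [Expr.bound])
  rintro _ rfl
  set s5 := s4.set .gd (code n (Finset.range n)) 1 with hs5
  have k5 : ∀ j, j ≠ .gd → s5 j = s4 j := fun j hj => Store.set_of_ne hj _ _
  have T5 : Tables n d Δ Q g h s5 := T4.congr fun j hj => k5 j (by rintro rfl; simp at hj)
  have h0 : 0 ∈ Finset.range n := by simp; omega
  have hconn' : ∀ x ∈ Finset.range n, comp h (Finset.range n) x = Finset.range n := by
    intro x hx
    rw [comp_eq_of_mem hI.hG h0 (by rwa [hconn]), hconn]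
  have g5 : s5 .gd = Function.update (s4 .gd) (code n (Finset.range n)) (0 + 1) := by
    simp [hs5, Store.set]
  -- Any vertex splits the whole set: each component left by the removal of 0 has 0 in its boundary
  -- and is a member of the family, so `splits` has filled its entry.
  have S5 : SplitTable n α h (s5 .gd) := by
    rw [g5]
    refine S4.update h0 (by simp [bdry_range]) fun D hD => R4 D (hR0 D hD) ?_
    obtain ⟨w, hw, h0w⟩ := exists_adj_of_isComp hI.hG hconn' h0 hD
    exact ⟨0, mem_bdry.mpr ⟨by omega, fun h1 => by simpa using hD.subset h1, w, hw, h0w⟩⟩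
  refine Reaches.seq (order_spec (α := α) hI (by simpa using hn) T5.lists T5.pw2 S5
    fun D hD => ?_) fun s6 ⟨f6, cs, hO, hcm⟩ => ?_
  · obtain ⟨x, hx, rfl⟩ := hD
    rw [hconn' x hx, g5, Function.update_self]
    simp
  have T6 : Tables n d Δ Q g h s6 := T5.congr fun j hj => f6 j (by revert hj; cases j <;> decide)
  have r6 : ∀ j, j ∈ [Arr.wt, .res] → s6 j = s j := fun j hj => by
    rw [f6 j, k5 j, k4 j, k3 j] <;> (revert hj; cases j <;> decide)
  refine Reaches.seq (witnesses_spec (α := α) (E := E) hI (by simpa using hn)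
    (Function.update_self ..) hd1 hQ1 hQn hn1 T6 hO hcm (by rw [r6 _ (by simp)]; exact hwt) hE1
    fun X hX hXc s' hB => ?_) fun s7 ⟨W7, p7, e7, c7⟩ => ?_
  · refine (prod_radix_le hn1 hQ1 hM hX hXc hB).trans ?_
    rw [hE]
    exact Nat.mul_le_mul_left _ (Nat.pow_le_pow_left hQM _)
  refine output_spec (by simpa using hn) hn1 (by rw [p7]; exact T6.pw2) W7
    (by rw [e7, r6 _ (by simp)]; exact hres) hbij fun ω hω => ?_
  have hc0 : cs 0 = Finset.range n := by
    have := hO.isComp 0 (by omega)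
    rw [rest_zero] at this
    obtain ⟨x, hx, he⟩ := this
    rw [← he, hconn' x hx]
  have := c7 ω hω 0 (by omega)
  rwa [hc0] at this

open Classical in
theorem big_spec {I : ℕ → ℕ} {n d Δ α : ℕ} {g h : ℕ → ℕ → Prop} (hI : Ctx I n g h)
    (hgi : ∀ x, ¬ g x x) {env : Env} {s : Store} (hn : env .n = n) (hd : env .d = d)
    (hal : env .al = α) (hn1 : 1 ≤ n) (hd1 : 1 ≤ d) (hα : 1 ≤ α)
    (hΔ : ∀ x < n, Nat.count (h x) n ≤ Δ) (hL : AdjLists n Δ h (s .row) (s .hd) (s .hn))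
    (hgd : ∀ a, s .gd a = 0) (hwt : ∀ a, s .wt a = 0) (hres : s .res 0 = 0)
    (hconn : comp h (Finset.range n) 0 = Finset.range n) {Reg : Finset ℕ → Prop}
    (hR : SplitFamily n α h Reg) (hR0 : ∀ D, IsComp h ((Finset.range n).erase 0) D → Reg D)
    (hbij : SolutionsBijective n d g h) :
    Reaches I env big s (Answers n d g h) (mainCost n d Δ α) := by
  set M := (Finset.range n).sup fun x => Nat.count (Near h d x) n with hM
  set D := (Finset.range n).sup fun x => Nat.count (g x) n with hD
  have hMle : ∀ x < n, Nat.count (Near h d x) n ≤ M := fun x hx =>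
    Finset.le_sup (f := fun x => Nat.count (Near h d x) n) (by simpa using hx)
  have hDle : ∀ x < n, Nat.count (g x) n ≤ D := fun x hx =>
    Finset.le_sup (f := fun x => Nat.count (g x) n) (by simpa using hx)
  have hMΔ : M ≤ (Δ + 1) ^ d := Finset.sup_le fun x _ =>
    count_near_le hI.hG hΔ d x
  have hM1 : 1 ≤ M := by
    refine le_trans ?_ (hMle 0 (by omega))
    rw [count_eq_card]
    exact Finset.card_pos.mpr ⟨0, by simp; exact ⟨by omega, Near.refl _ _ _⟩⟩
  obtain ⟨B, hB⟩ : ∃ B, B = 600 * n ^ (α + 3) +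
      500 * (α * n ^ (α + 3) * (Δ + 1) ^ 3) + 1000 * (n ^ (α + 3) * (Δ + 1) ^ 2) +
      1000 * (n ^ (α + 3) * (Δ + 1) * (M ^ d) ^ ((α + 1) * M)) := ⟨_, rfl⟩
  have p0 : 1 ≤ n ^ (α + 3) := Nat.one_le_pow _ _ hn1
  have hb : 100 * (n ^ 3 * (d + 1)) + (100 * (n ^ 3 * (d + 1)) + (1 + (2 + n * 20 + n * n * 20) +
      (1 + (2 + n * 20 + n * n * 20) + (4 + B)))) ≤ mainCost n d Δ α := by
    have p3 : n ^ 3 * (d + 1) ≤ n ^ (α + 3) * (d + 1) :=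
      Nat.mul_le_mul_right _ (Nat.pow_le_pow_right hn1 (by omega))
    have p2 : n * n ≤ n ^ (α + 3) := by
      rw [← sq]; exact Nat.pow_le_pow_right hn1 (by omega)
    have p1 : n ≤ n ^ (α + 3) := Nat.le_self_pow (by omega) n
    have p5 : n ^ (α + 3) * 2 ≤ n ^ (α + 3) * (d + 1) := Nat.mul_le_mul_left _ (by omega)
    have q : (M ^ d) ^ ((α + 1) * M) ≤ ((Δ + 1) ^ (d * d)) ^ ((α + 1) * (Δ + 1) ^ d) := by
      rw [pow_mul (Δ + 1) d d]
      exact (Nat.pow_le_pow_left (Nat.pow_le_pow_left hMΔ d) _).trans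
        (Nat.pow_le_pow_right (by positivity) (Nat.mul_le_mul_left _ hMΔ))
    have q' := Nat.mul_le_mul_left (n ^ (α + 3) * (Δ + 1)) q
    rw [hB, mainCost, mul_assoc 1000]
    omega
  refine (Reaches.seq (dists_spec (n := n) (d := d) (h := h) hI.hG hn hd hn1 hL.row (by simp)
    (by simp) (by simp) rfl (by simp [Expr.bound, Expr.hadj, Expr.ix]) rfl
    fun env' s' e1 e2 e3 e4 => ?_) fun s1 ⟨f1, h1⟩ => ?_).mono (fun _ h => h) hb
  · exact hadj_pos hI e1 e2 rfl rfl e4 e3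
  have r1 : s1 .row = s .row := f1 _ (by simp) (by simp) (by simp)
  refine Reaches.seq (dists_spec (n := n) (d := d) (h := g) hI.gG hn hd hn1 (by rw [r1]; exact hL.row)
    (by simp) (by simp) (by simp) rfl (by simp [Expr.bound, Expr.gadj, Expr.ix]) rfl
    fun env' s' e1 e2 e3 e4 => ?_) fun s2 ⟨f2, h2⟩ => ?_
  · exact gadj_pos hI e2 rfl rfl e4 e3
  have k2 : ∀ j, j ∉ [Arr.t1, .t2, .eh, .eg] → s2 j = s j := fun j hj => by
    rw [f2 j, f1 j] <;> (rintro rfl; simp at hj)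
  have L2 : AdjLists n Δ h (s2 .row) (s2 .hd) (s2 .hn) := by
    rw [k2 .row (by decide), k2 .hd (by decide), k2 .hn (by decide)]; exact hL
  have eh2 : NearMat n d h (s2 .eh) := by rw [f2 _ (by simp) (by simp) (by simp)]; exact h1
  refine (Reaches.letE (v := M) (ca := 2 + n * 20 + n * n * 20) ?_ ?_ ?_)
  · exact eval_supCount hn fun x hx y hy => by simp [L2.row x hx.le, eh2 x hx y hy]
  · refine Expr.cost_le (n := n) hn rfl ?_
    simp [Expr.bound, Expr.supCount, Expr.count, Expr.ix]
    nlinarith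
  refine (Reaches.letE (v := D) (ca := 2 + n * 20 + n * n * 20) ?_ ?_ ?_)
  · exact eval_supCount (by simpa using hn) fun x hx y hy =>
      gadj_pos hI L2.row (by simp) (by simp) hx hy
  · refine Expr.cost_le (n := n) (by simpa using hn) rfl ?_
    simp [Expr.bound, Expr.supCount, Expr.count, Expr.gadj, Expr.ix]
    nlinarith
  refine Reaches.ite (be := 3) (b := B) (by simp [Expr.cost, Expr.lt]) (fun hc => ?_)
    (fun hc => ?_)
  · have hDM : D < M := by simpa using hc
    rw [hB]
    exact bigCore_spec hI (by simpa using hn) (by simpa using hal) hn1 hd1 hα L2 eh2 h2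
      (by rw [k2 _ (by decide)]; exact hgd) (by rw [k2 _ (by decide)]; exact hwt)
      (by rw [k2 _ (by decide)]; exact hres) hconn hR hR0 hbij hMle
      fun x hx => (hDle x hx).trans_lt hDM
  · have hDM : ¬ D < M := by simpa using hc
    refine (Reaches.skip (Or.inr ⟨by rw [k2 _ (by decide)]; exact hres, ?_⟩)).mono
      (fun _ h => h) (by rw [hB]; omega)
    rintro ⟨ω, hω⟩
    apply hDM
    rw [hD, Finset.sup_lt_iff (by simp; omega)]
    intro a ha
    obtain ⟨x, hx, rfl⟩ := (hbij ω hω).2 a (Finset.mem_range.mp ha)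
    exact (count_lt_of_localOk hI.hG hgi hx (hω x hx)).trans_le (hMle x hx)

open Expr in
/-- The whole algorithm. If `h` is not connected, there is no embedding; if it is and has at most
two vertices, the identity is one. -/
def mainCmd : Cmd :=
  .seq buildLists <| .seq (.loop .y (.var .n) (.set .s1 (.var .y) (.const 1))) <|
  .letE .u (.const 0) <| .seq (bfs .s1 .u) <|
  .ite (not (.sum .y (.var .n) (not (.get .mk (.var .y)))))
    (.ite (lt (.var .n) (.const 3))
      (.seq (.set .res (.const 0) (.const 1)) <|
        .loop .z (.var .n) (.set .out (.var .z) (.var .z)))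
      big)
    .skip

open Classical in
-- The bound K on the main part and α ≥ 1 are required only when the main part is reached, because
-- they are not available for edgeless or tiny graphs, on which correctness must hold as well.
theorem mainCmd_spec {I : ℕ → ℕ} {n d Δ α K : ℕ} {g h : ℕ → ℕ → Prop} (hI : Ctx I n g h)
    (hgi : ∀ x, ¬ g x x) (hhi : ∀ x, ¬ h x x) (hn1 : 1 ≤ n) (hd1 : 1 ≤ d)
    (hΔ : ∀ x < n, Nat.count (h x) n ≤ Δ)
    (hg : ∀ x < n, ∀ y < n, Relation.ReflTransGen g x y)
    (hconn : ∀ ω : ℕ → ℕ, (∀ x < n, LocalOk n d g h ω x) →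
      comp h (Finset.range n) 0 = Finset.range n)
    {Reg : Finset ℕ → Prop} (hR : SplitFamily n α h Reg)
    (hR0 : comp h (Finset.range n) 0 = Finset.range n →
      ∀ D, IsComp h ((Finset.range n).erase 0) D → Reg D)
    (hbij : SolutionsBijective n d g h)
    (hα : 3 ≤ n → comp h (Finset.range n) 0 = Finset.range n → 1 ≤ α)
    (hK : 3 ≤ n → comp h (Finset.range n) 0 = Finset.range n → mainCost n d Δ α ≤ K) :
    Reaches I (initEnv n d α) mainCmd (fun _ _ => 0) (Answers n d g h)
      (400 * n ^ 4 + 50 * (n * (Δ + 1)) + K) := by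
  have hn : initEnv n d α .n = n := rfl
  have hb : 300 * n ^ 4 + ((2 + n * 4) + (1 + 1 + (50 * (n * (Δ + 1)) +
      (1 + (4 + n * 10) + (1 + 3 + (3 + (2 + n * 4) + K)))))) ≤
      400 * n ^ 4 + 50 * (n * (Δ + 1)) + K := by
    have h1 : n ≤ n ^ 4 := Nat.le_self_pow (by norm_num) n
    omega
  refine (Reaches.seq (buildLists_spec hI hn hn1 hΔ) fun s1 ⟨f1, L1⟩ => ?_).mono
    (fun _ h => h) hb
  refine Reaches.seq (Reaches.fill (ca := 1) hn (by simp) rfl rfl le_rfl) fun s2 ⟨f2, i2⟩ => ?_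
  have L2 : AdjLists n Δ h (s2 .row) (s2 .hd) (s2 .hn) := by
    rw [f2 .row (by simp), f2 .hd (by simp), f2 .hn (by simp)]; exact L1
  have h0 : 0 ∈ Finset.range n := Finset.mem_range.mpr hn1
  refine Reaches.letE (v := 0) (ca := 1) rfl le_rfl ?_
  refine Reaches.seq (bfs_spec hI (by simpa using hn) L2 (S := .s1) (by simp) (by simp) (by simp)
    (Finset.Subset.refl _) (fun x hx => by simp [i2 x hx, hx]) (Function.update_self ..) h0)
    fun s3 ⟨f3, i3⟩ => ?_
  have e3 : ∀ j, j ∈ [Arr.gd, .wt, .res] → ∀ a, s3 j a = 0 := fun j hj a => by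
    rw [f3 j, f2 j, f1 j] <;> (revert hj; cases j <;> decide)
  have hiff : 0 < (Expr.not (.sum .y (.var .n) (Expr.not (.get .mk (.var .y))))).eval I
      (Function.update (initEnv n d α) .u 0) s3 ↔
      comp h (Finset.range n) 0 = Finset.range n := by
    simp only [Expr.not_pos, Expr.sum_pos, Expr.eval_var, Expr.eval_get, ne_eq, reduceCtorEq,
      not_false_eq_true, Function.update_of_ne, Function.update_self, hn]
    constructor
    · intro hc
      refine Finset.Subset.antisymm comp_subset fun x hx => ?_
      by_contra hxc
      exact hc ⟨x, Finset.mem_range.mp hx, by rwa [i3 x (Finset.mem_range.mp hx)]⟩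
    · rintro hc ⟨x, hx, hxc⟩
      rw [i3 x hx, hc] at hxc
      exact hxc (Finset.mem_range.mpr hx)
  refine Reaches.ite (be := 4 + n * 10) ?_ (fun hc => ?_) fun hc => ?_
  · refine Expr.cost_le (n := n) (by simpa using hn) rfl ?_
    simp [Expr.bound, Expr.not]
    omega
  · rw [hiff] at hc
    refine Reaches.ite (be := 3) (by simp [Expr.cost, Expr.lt]) (fun h3 => ?_) fun h3 => ?_
    · have h3' : n < 3 := by simpa [hn] using h3
      refine (Reaches.seq (b := 3) (R := fun s' => s' .res 0 = 1)
        (Reaches.set (by simp [Store.set_self]) le_rfl le_rfl) fun s4 h4 => ?_).mono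
        (b := 3 + (2 + n * 4)) (fun _ h => h) (by omega)
      refine (Reaches.fill (ca := 1) (by simpa using hn) (by simp) rfl rfl le_rfl).mono
        (fun s5 ⟨f5, i5⟩ => Or.inl ⟨by rw [f5 _ (by simp), h4], id,
          localOk_id hI.gG hI.hG hgi hhi h3' hd1 hg hc, fun x hx => ?_⟩) le_rfl
      simpa using i5 x hx
    · have h3' : 3 ≤ n := by simpa [hn] using h3
      refine (big_spec hI hgi (by simpa using hn) rfl rfl hn1 hd1 (hα h3' hc) hΔ ?_
        (e3 _ (by simp)) (e3 _ (by simp)) (e3 _ (by simp) 0) hc hR (hR0 hc) hbij).mono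
        (fun _ h => h) ((hK h3' hc).trans (by omega))
      rw [f3 .row (by simp) (by simp) (by simp), f3 .hd (by simp) (by simp) (by simp),
        f3 .hn (by simp) (by simp) (by simp)]
      exact L2
  · rw [hiff] at hc
    refine (Reaches.skip (Or.inr ⟨e3 _ (by simp) 0, ?_⟩)).mono (fun _ h => h) (by omega)
    rintro ⟨ω, hω⟩
    exact hc (hconn ω hω)

/-! ## The theorem -/

section Graphs

variable {n : ℕ} {G H : SimpleGraph (Fin n)}

theorem natAdj_irrefl (x : ℕ) : ¬ natAdj G x x := fun ⟨_, _, h⟩ => h.ne rfl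

theorem reflTransGen_natAdj {x y : Fin n} (h : G.Reachable x y) :
    Relation.ReflTransGen (fun a b => natAdj G a b ∧ b ∈ Finset.range n) (x : ℕ) y := by
  rw [SimpleGraph.reachable_iff_reflTransGen] at h
  exact Relation.ReflTransGen.lift Fin.val
    (fun a b hab => ⟨(natAdj_val G a b).mpr hab, by simp⟩) _ _ h

theorem comp_natAdj_eq_range (hG : G.Connected) (hn : 0 < n) :
    comp (natAdj G) (Finset.range n) 0 = Finset.range n := by
  refine Finset.Subset.antisymm comp_subset fun y hy => mem_comp.mpr ⟨hy, ?_⟩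
  exact reflTransGen_natAdj (hG.preconnected ⟨0, hn⟩ ⟨y, Finset.mem_range.mp hy⟩)

/-- Distances in G are finite, so the upper bound keeps all distances between images finite. -/
theorem connected_of_embedding {d : ℕ} (hG : G.Connected) {F : Fin n → Fin n}
    (hF : Function.Surjective F) (hd : IsNonContractingEmbedding G H d F) : H.Connected := by
  have := hG.nonempty
  refine ⟨fun a b => ?_⟩
  obtain ⟨u, rfl⟩ := hF a
  obtain ⟨v, rfl⟩ := hF b
  apply SimpleGraph.reachable_of_edist_ne_top
  refine ne_top_of_le_ne_top (WithTop.mul_ne_top (ENat.natCast_ne_top d) ?_) (hd u v).2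
  exact SimpleGraph.edist_ne_top_iff_reachable.mpr (hG.preconnected u v)

open Classical in
theorem count_natAdj_le [DecidableRel H.Adj] {x : ℕ} (hx : x < n) :
    Nat.count (natAdj H x) n ≤ H.maxDegree := by
  refine le_trans ?_ (H.degree_le_maxDegree ⟨x, hx⟩)
  rw [count_eq_card, ← SimpleGraph.card_neighborFinset_eq_degree,
    ← Finset.card_map Fin.valEmbedding]
  refine Finset.card_le_card fun y hy => ?_
  obtain ⟨-, _, hy, hxy⟩ := Finset.mem_filter.mp hy
  exact Finset.mem_map.mpr ⟨⟨y, hy⟩, by simpa using hxy, rfl⟩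

theorem solutionsBijective {d : ℕ} (hG : G.Connected) :
    SolutionsBijective n d (natAdj G) (natAdj H) := by
  intro ω hω
  obtain ⟨F, hF, -, hFω⟩ := embedding_of_localOk hG hω
  constructor
  · intro x hx y hy hxy
    have h1 := hFω x hx
    have h2 := hFω y hy
    simp only [hxy] at h1
    exact Fin.mk.inj_iff.mp (h1.symm.trans h2)
  · intro a ha
    refine ⟨F ⟨a, ha⟩, (F ⟨a, ha⟩).2, ?_⟩
    exact Fin.mk.inj_iff.mp (hF.injective (hFω _ (F ⟨a, ha⟩).2) : (⟨_, _⟩ : Fin n) = ⟨a, ha⟩)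

theorem isCorrectAnswer_of_answers {d : ℕ} (hG : G.Connected) {s : Store} {rs : RAMState}
    (hs : Answers n d (natAdj G) (natAdj H) s) (h0 : rs.reg 0 = s .res 0)
    (hout : ∀ i < n, rs.mem i = s .out i) : IsCorrectAnswer G H d rs := by
  rcases hs with ⟨h1, ω, hω, ho⟩ | ⟨h1, h2⟩
  · obtain ⟨F, hF, hd, hFω⟩ := embedding_of_localOk hG hω
    refine Or.inl ⟨h0.trans h1, F, hF, hd, fun i => ?_⟩
    obtain ⟨x, hx, hxi⟩ := (solutionsBijective hG ω hω).2 i i.2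
    have h3 := hFω x hx
    have h4 : (⟨ω x, (hω x hx).1⟩ : Fin n) = i := Fin.ext hxi
    rw [h4] at h3
    rw [hout i i.2, ← hxi, ho x hx, h3]
  · refine Or.inr ⟨h0.trans h1, ?_⟩
    rintro ⟨F, hF, hd⟩
    exact h2 (localOk_of_embedding hF hd)

theorem adjEntry_pos [DecidableRel G.Adj] {x y : ℕ} : 0 < adjEntry G x y ↔ natAdj G x y := by
  unfold adjEntry natAdj
  split_ifs with h1 h2 <;> simp_all

theorem ctx_embeddingInput [DecidableRel G.Adj] [DecidableRel H.Adj] (d α : ℕ) :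
    Ctx (embeddingInput G H d α).mem n (natAdj G) (natAdj H) where
  gG := natAdj_isGraphOn G
  hG := natAdj_isGraphOn H
  inpG x hx y hy := by
    have h1 : n * x + y < n * n := by nlinarith
    have h2 : (n * x + y) / n = x := by
      rw [Nat.mul_add_div (by omega), Nat.div_eq_of_lt hy, add_zero]
    simp [embeddingInput, h1, h2, Nat.mod_eq_of_lt hy, adjEntry_pos]
  inpH x hx y hy := by
    have h2 : (n * x + y) / n = x := by
      rw [Nat.mul_add_div (by omega), Nat.div_eq_of_lt hy, add_zero]
    simp [embeddingInput, h2, Nat.mod_eq_of_lt hy, adjEntry_pos]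

theorem embeddingInput_mem_eq_zero [DecidableRel G.Adj] [DecidableRel H.Adj] (d α : ℕ) {a : ℕ}
    (hn : 1 ≤ n) (ha : 2 * n * n ≤ a) : (embeddingInput G H d α).mem a = 0 := by
  have h1 : ¬ a < n * n := by nlinarith
  have h2 : ¬ (a - n * n) / n < n := by
    rw [not_lt, Nat.le_div_iff_mul_le hn]
    have : 2 * n * n = n * n + n * n := by ring
    omega
  simp [embeddingInput, h1, adjEntry, h2]

/-- The regions of a tree decomposition of width at most `α` form a split family. -/
theorem exists_splitFamily {α : ℕ} (hα : treewidth H ≤ α) :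
    ∃ Reg, SplitFamily n α (natAdj H) Reg ∧
      (comp (natAdj H) (Finset.range n) 0 = Finset.range n →
        ∀ D, IsComp (natAdj H) ((Finset.range n).erase 0) D → Reg D) ∧
      ∀ x y, H.Adj x y → 1 ≤ α := by
  obtain ⟨T, hT⟩ : ∃ T : TreeDecomposition H, T.width = treewidth H :=
    Nat.sInf_mem (s := {k | ∃ T : TreeDecomposition H, T.width = k})
      ((treeDecomposition_nonempty H).elim fun T => ⟨_, T, rfl⟩)
  have hcard : ∀ u, (T.bag u).card ≤ α + 1 := by
    intro u
    have h1 := @Finset.le_sup _ _ _ _ (@Finset.univ T.node T.nodeFintype)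
      (fun u => (T.bag u).card) u (@Finset.mem_univ _ T.nodeFintype u)
    have h2 : T.width ≤ α := hT.trans_le hα
    unfold TreeDecomposition.width at h2
    exact h1.trans (by omega)
  let bag : T.node → Finset ℕ := fun u => (T.bag u).map Fin.valEmbedding
  have hmem : ∀ (x : Fin n) u, (x : ℕ) ∈ bag u ↔ x ∈ T.bag u := fun x u => by
    simp [bag, Fin.val_inj]
  have hlt : ∀ x u, x ∈ bag u → x < n := by
    intro x u hx
    obtain ⟨y, -, rfl⟩ := Finset.mem_map.mp hx
    exact y.2
  have Hn := natAdj_isGraphOn H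
  have hcover : ∀ x < n, ∃ u, x ∈ bag u := fun x hx =>
    (T.cover ⟨x, hx⟩).imp fun u hu => (hmem ⟨x, hx⟩ u).mpr hu
  have hsplit := fun C (hC : IsRegion n (natAdj H) bag C) =>
    IsRegion.split Hn T.isTree hcover
    (fun x y ⟨hx, hy, hxy⟩ => (T.edge_cover _ _ hxy).imp fun u hu =>
      ⟨(hmem ⟨x, hx⟩ u).mpr hu.1, (hmem ⟨y, hy⟩ u).mpr hu.2⟩)
    (fun u v w p hp hw x hxu hxv => by
      have hx := hlt x u hxu
      exact (hmem ⟨x, hx⟩ w).mpr (T.path_closed u v w p hp hw ⟨x, hx⟩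
        ((hmem ⟨x, hx⟩ u).mp hxu) ((hmem ⟨x, hx⟩ v).mp hxv)))
    (α := α) (fun u => by simpa [bag] using hcard u) hC
  refine ⟨IsRegion n (natAdj H) bag, ⟨fun C hC => hC.subset, fun C hC => hC.nonempty,
    fun C hC => hC.connected, fun C hC => (hsplit C hC).1, fun C hC => (hsplit C hC).2⟩, ?_, ?_⟩
  · intro _ D hD
    have hDn : D ⊆ Finset.range n := hD.subset.trans (Finset.erase_subset _ _)
    obtain ⟨x, hx⟩ := hD.nonempty
    have h0 : 0 < n := (Nat.zero_le x).trans_lt (Finset.mem_range.mp (hDn hx))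
    -- A component of the graph without vertex 0 has boundary contained in {0}, so any bag that
    -- covers 0 will do.
    obtain ⟨u, hu⟩ := hcover 0 h0
    refine ⟨hD.nonempty, hDn, fun x hx => hD.connected Hn hx, u, ?_⟩
    refine (bdry_comp_subset Hn hD).trans ?_
    simpa [bdry_range] using hu
  · intro x y hxy
    -- The bag that covers an edge has two elements, which forces width at least 1.
    obtain ⟨u, hx, hy⟩ := T.edge_cover x y hxy
    have h1 := (Finset.card_le_card (Finset.insert_subset hx
      (Finset.singleton_subset_iff.mpr hy))).trans (hcard u)
    rw [Finset.card_pair hxy.ne] at h1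
    omega

theorem exists_adj_of_one_le_maxDegree [DecidableRel H.Adj] (h : 1 ≤ H.maxDegree) :
    ∃ x y, H.Adj x y := by
  by_contra! hc
  have : H.maxDegree ≤ 0 := H.maxDegree_le_of_forall_degree_le 0 fun v => by
    rw [← SimpleGraph.card_neighborFinset_eq_degree, Nat.le_zero, Finset.card_eq_zero]
    ext w
    simp [hc v w]
  omega

theorem maxDegree_le_card [DecidableRel H.Adj] : H.maxDegree ≤ n :=
  H.maxDegree_le_of_forall_degree_le n fun v => by
    simpa using (H.degree_lt_card_verts v).le

end Graphs

theorem mainTheorem4 :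
    ∃ (P : RAMProg) (C c : ℕ),
      ∀ (n d α : ℕ) (G H : SimpleGraph (Fin n)) [DecidableRel G.Adj] [DecidableRel H.Adj],
        G.Connected → 1 ≤ d → treewidth H ≤ α →
          ∃ (s : RAMState) (t : ℕ),
            RAMExec P (embeddingInput G H d α) s t ∧
            IsCorrectAnswer G H d s ∧
            (1 ≤ H.maxDegree →
              t ≤ C * (α ^ 2 * n ^ (α + 3)) * H.maxDegree ^ (d + 1) *
                (α * H.maxDegree ^ (d + 1)) ^ (H.maxDegree ^ (c * (α * d ^ 2)))) := by
  -- The constant covers 60 · (400 + 100 + 3500) for the compiled command and 65 + 64 for input and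
  -- output; 10 is the exponent constant of `mainCost_le`.
  refine ⟨compProg mainCmd, 300000, 10, fun n d α G H _ _ hG hd hα => ?_⟩
  obtain ⟨x0⟩ := hG.nonempty
  have hn1 : 1 ≤ n := (Nat.zero_le _).trans_lt x0.2
  have hI := ctx_embeddingInput (G := G) (H := H) d α
  obtain ⟨Reg, hR, hR0, hadj⟩ := exists_splitFamily hα
  set Δ := H.maxDegree with hΔ
  have hcount := fun x (hx : x < n) => count_natAdj_le (H := H) hx
  have hα1 : 1 ≤ Δ → 1 ≤ α := fun h1 => by
    obtain ⟨x, y, hxy⟩ := exists_adj_of_one_le_maxDegree h1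
    exact hadj x y hxy
  have hΔ2 : 3 ≤ n → comp (natAdj H) (Finset.range n) 0 = Finset.range n → 2 ≤ Δ :=
    fun h3 hc => two_le_of_connected hI.hG h3 hc hcount
  have hspec := mainCmd_spec (K := 3500 * (α ^ 2 * n ^ (α + 3)) * Δ ^ (d + 1) *
      (α * Δ ^ (d + 1)) ^ (Δ ^ (10 * (α * d ^ 2)))) hI natAdj_irrefl natAdj_irrefl hn1 hd hcount
    (fun x hx y hy => Relation.ReflTransGen.mono (fun _ _ h => h.1) _ _
      (reflTransGen_natAdj (hG.preconnected ⟨x, hx⟩ ⟨y, hy⟩)))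
    (fun ω hω => by
      obtain ⟨F, hF, hFd, -⟩ := embedding_of_localOk hG hω
      exact comp_natAdj_eq_range (connected_of_embedding hG hF.surjective hFd) hn1)
    hR hR0 (solutionsBijective hG) (fun h3 hc => hα1 ((hΔ2 h3 hc).trans' (by norm_num)))
    fun h3 hc => mainCost_le hd (hΔ2 h3 hc) (hα1 ((hΔ2 h3 hc).trans' (by norm_num)))
  obtain ⟨rs, t, hex, h0, hout, ht⟩ := compProg_spec mainCmd (d := d) (α := α)
    (rs := embeddingInput G H d α) hn1 rfl fun a ha => embeddingInput_mem_eq_zero d α hn1 ha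
  refine ⟨rs, t, hex, isCorrectAnswer_of_answers hG hspec.1 h0 hout, fun h1 => ?_⟩
  set W := (α * Δ ^ (d + 1)) ^ (Δ ^ (10 * (α * d ^ 2))) with hW
  have hα' := hα1 h1
  have hΔn : Δ ≤ n := maxDegree_le_card
  -- An edge of H gives α ≥ 1, so the preprocessing of order n^4 is within the bound even when the
  -- main part is skipped.
  have hn4 : n ^ 4 ≤ α ^ 2 * n ^ (α + 3) * Δ ^ (d + 1) * W := by
    calc n ^ 4 ≤ n ^ (α + 3) := Nat.pow_le_pow_right hn1 (by omega)
      _ ≤ α ^ 2 * n ^ (α + 3) := Nat.le_mul_of_pos_left _ (pow_pos hα' 2)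
      _ ≤ α ^ 2 * n ^ (α + 3) * Δ ^ (d + 1) := Nat.le_mul_of_pos_right _ (pow_pos h1 _)
      _ ≤ _ := Nat.le_mul_of_pos_right _ (pow_pos (Nat.mul_pos hα' (pow_pos h1 _)) _)
  have hnn : n * (Δ + 1) ≤ 2 * n ^ 4 := by
    calc n * (Δ + 1) ≤ n * (n + n) := Nat.mul_le_mul_left _ (by omega)
      _ = 2 * n ^ 2 := by ring
      _ ≤ 2 * n ^ 4 := Nat.mul_le_mul_left _ (Nat.pow_le_pow_right hn1 (by norm_num))
  have hn0 : n ≤ n ^ 4 := Nat.le_self_pow (by norm_num) n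
  have hcost := hspec.2.trans (Nat.add_le_add_right (Nat.add_le_add_left
    (Nat.mul_le_mul_left 50 hnn) _) _)
  rw [mul_assoc 3500, mul_assoc 3500] at hcost
  rw [mul_assoc 300000, mul_assoc 300000]
  omega
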